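/- **Setting.** Let $\ell,\lambda_1,\lambda_2>0$, $q,\rho\neq 0$ with $|\rho q|\le \tfrac12$, and $c_1,c_2\in C^0([0,\ell];\mathbb R)$. The plant is $$u_t=-\lambda_1u_x+c_1v,\quad v_t=\lambda_2v_x+c_2u,\quad u(0,t)=qv(0,t),\quad v(\ell,t)=\rho u(\ell,t)+U_k,$$ and the observer, with $\tilde u=u-\hat u$, $\tilde v=v-\hat v$, is $$\hat u_t=-\lambda_1\hat u_x+c_1\hat v+p_1\tilde v(0,t),\quad \hat v_t=\lambda_2\hat v_x+c_2\hat u+p_2\tilde v(0,t),\quad \hat u(0,t)=qv(0,t),\quad \hat v(\ell,t)=\rho\hat u(\ell,t)+U_k,$$ for $x\in(0,\ell)$ and $t\in[t_k,t_{k+1})$, where $U_k=U(t_k)$ is the held value of $$U(t)=\int_0^\ell N^u(\xi)\hat u(\xi,t)\,d\xi+\int_0^\ell N^v(\xi)\hat v(\xi,t)\,d\xi .$$ **Kernels.** Put $\Lambda=\mathrm{diag}(-\lambda_1,\lambda_2)$ and $\mathcal C(x)=\begin{pmatrix}0&c_1(x)\\c_2(x)&0\end{pmatrix}$. Let $P,R,K,L$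 be $2\times2$ matrix functions, continuously differentiable on $\{0\le\xi\le x\le\ell\}$, that solve $$\Lambda P_x+P_\xi\Lambda=-\mathcal C(x)P,\quad \Lambda R_x+R_\xi\Lambda=R\,\mathcal C(\xi),\quad \Lambda K_x+K_\xi\Lambda=K\mathcal C(\xi),\quad \Lambda L_x+L_\xi\Lambda=-\mathcal C(x)L,$$ with, on the diagonal, $\Lambda P-P\Lambda=\Lambda R-R\Lambda=\mathcal C$ and $K\Lambda-\Lambda K=L\Lambda-\Lambda L=\mathcal C$, and, for $X\in\{P,R\}$, $Y\in\{K,L\}$ and $i=1,2$, $$X_{2i}(\ell,\xi)=\rho X_{1i}(\ell,\xi),\qquad \lambda_2Y_{i2}(x,0)=q\lambda_1Y_{i1}(x,0).$$ The gains are $p_i(x)=-\lambda_2P_{i2}(x,0)$; $N^u=K_{21}(\ell,\cdot)-\rho K_{11}(\ell,\cdot)$, $N^v=K_{22}(\ell,\cdot)-\rho K_{12}(\ell,\cdot)$; $N^\alpha=L_{21}(\ell,\cdot)-\rho L_{11}(\ell,\cdot)$, $N^\beta=L_{22}(\ell,\cdot)-\rho L_{12}(\ell,\cdot)$. Put $$\begin{pmatrix}\hat\alpha\\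 \hat\beta\end{pmatrix}(x)=\begin{pmatrix}\hat u\\ \hat v\end{pmatrix}(x)-\int_0^xK(x,\xi)\begin{pmatrix}\hat u\\ \hat v\end{pmatrix}(\xi)\,d\xi,\qquad \tilde\beta(0,t)=\tilde v(0,t),$$ $$\bar p_i(x)=p_i(x)-q\lambda_1K_{i1}(x,0)-\int_0^x\big(K_{i1}(x,\xi)p_1(\xi)+K_{i2}(x,\xi)p_2(\xi)\big)d\xi .$$ **Design constants.** Put $\varepsilon_0=5\max\{\lambda_1^2\int_0^\ell((N^{\alpha})')^2,\ \lambda_2^2\int_0^\ell((N^{\beta})')^2\}$, $\varepsilon_1=5(\lambda_1N^\alpha(\ell)-\rho\lambda_2N^\beta(\ell))^2$, $\varepsilon_2=5\big(\int_0^\ell(N^\alpha\bar p_1+N^\beta\bar p_2)+q\lambda_1N^\alpha(0)\big)^2$, $\varepsilon_3=5(\lambda_2N^\beta(\ell))^2$. Let $\eta,\theta>0$, $\sigma\in(0,1)$, $\kappa_i=\theta\varepsilon_i/(1-\sigma)$ $(i=0,1,2)$, and $$\bar\mu=\tfrac{2\lambda_1\lambda_2}{\ell(\lambda_1+\lambda_2)}\ln\tfrac1{2|q\rho|},\quad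 \mu\in(0,\bar\mu),\quad \delta\in(0,\mu),\quad r=\min\Big\{\tfrac{e^{-\mu\ell/\lambda_1}}{\lambda_1},\tfrac{2q^2}{\lambda_2}\Big\},$$ $$C>\max\Big\{\tfrac{\kappa_0}{(\mu-\delta)r},\ \tfrac{\kappa_1e^{\mu\ell/\lambda_1}}{1-4\rho^2q^2e^{\mu(\ell/\lambda_1+\ell/\lambda_2)}}\Big\},\qquad \theta_m=4Cq^2e^{\mu\ell/\lambda_2},\qquad a=1+\varepsilon_3+\eta,$$ $$\tau=\tfrac1a\ln\Big(1+\tfrac{a\theta\sigma}{(a\theta+\theta_m)(1-\sigma)}\Big).$$ (If $|\rho q|=\frac12$ there is no admissible $\mu$.) Put $\bar D=2q^2$, $$r_d=\frac{4\max\{\int_0^\ell (N^\alpha)^2,\int_0^\ell (N^\beta)^2\}}{\min\{e^{-\bar\mu\ell/\lambda_1}/\lambda_1,\ \bar D/\lambda_2\}},\qquad \varrho=\bar\delta-\bar\mu+2r_d\bar De^{\bar\mu\ell/\lambda_2},$$ with $\bar\delta>0$ chosen such that $\varrho>0$. **Self-triggering rule.** Let $\phi_u,\phi_v>0$ and $m^0<0$.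 The variable $m$ is continuous, $m(0)=m^0$, and, with $d(t)=U(t_k)-U(t)$ for $t\in[t_k,t_{k+1})$, $$\dot m=-\eta m+\theta_md^2-\kappa_0\|(\hat\alpha,\hat\beta)\|_{L^2}^2-\kappa_1\hat\alpha(\ell,t)^2-\kappa_2\tilde\beta(0,t)^2\quad\text{on }(t_k,t_{k+1})$$ in the integrated sense. Put $$\bar V_2=\int_0^\ell\Big(\tfrac1{\lambda_1}\hat\alpha^2e^{-\bar\mu x/\lambda_1}+\tfrac{\bar D}{\lambda_2}\hat\beta^2e^{\bar\mu x/\lambda_2}\Big)dx,\quad \bar P=\tfrac1{\bar\delta}\int_0^\ell\Big(\tfrac1{\lambda_1}\bar p_1^2e^{-\bar\mu x/\lambda_1}+\tfrac{\bar D}{\lambda_2}\bar p_2^2e^{\bar\mu x/\lambda_2}\Big)dx,$$ $$\phi_\alpha=3\max_{x\in[0,\ell]}\Big\{\phi_u+\phi_ux\!\int_0^x\!R_{11}(x,\xi)^2d\xi+\phi_vx\!\int_0^x\!R_{12}(x,\xi)^2d\xi\Big\},$$ $$\phi_\beta=3\max_{x\in[0,\ell]}\Big\{\phi_v+\phi_ux\!\int_0^x\!R_{21}(x,\xi)^2d\xi+\phi_vx\!\int_0^x\!R_{22}(x,\xi)^2d\xi\Big\},$$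 $\phi_0(t)=\max\{\rho^2\phi_\alpha,\phi_\beta\}$ for $t\le\ell/\lambda_1+\ell/\lambda_2$, $\phi_0(t)=0$ for later $t$, $\phi=(2q^2+\bar P)\phi_0$, and $$\mathcal F=r_d\Big(2\bar V_2+\tfrac{2r_d\bar De^{\bar\mu\ell/\lambda_2}\bar V_2+\phi}{\varrho}\Big),\qquad \bar G=\tfrac1{\varrho+\eta}\ln\Big(\tfrac{\theta_m\mathcal F-m(\varrho+\eta)}{\mathcal F(\theta(\varrho+\eta)+\theta_m)}\Big).$$ The event times are $t_0=0$ and $t_{k+1}=t_k+\max\{\tau,\bar G(t_k)\}$ (and $t_{k+1}=t_k+\tau$ if $\mathcal F(t_k)=0$). **Theorem.** There are constants $\nu,M>0$ such that for all $\phi_u,\phi_v>0$, all $m^0<0$ and all $(u^0,v^0,\hat u^0,\hat v^0)\in L^2((0,\ell);\mathbb R)^4$ with $(u^0-\hat u^0)^2\le\phi_u$ and $(v^0-\hat v^0)^2\le\phi_v$ almost everywhere on $(0,\ell)$, the closed loop (plant, observer, held control, $m$ and the event times above) with these initial data has a unique solution $(u,v,\hat u,\hat v)\in C^0([0,\infty);L^2((0,\ell);\mathbb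 R^4))$, understood in the weak sense with boundary traces in $L^2_{\rm loc}([0,\infty))$; its event times and $m$ are unique too. It satisfies, for all $t\ge0$, $$\|(u,v,\hat u,\hat v)(\cdot,t)\|_{L^2}^2\le M\big(\|(u^0,v^0,\hat u^0,\hat v^0)\|_{L^2}^2+|m^0|\big)e^{-\nu t},$$ so the closed-loop states converge exponentially to $0$ in $L^2$. -/

import Mathlib

open Set MeasureTheory

namespace STC

noncomputable section

/-- The Hilbert space `L²((0,ℓ);ℝ)`. -/
abbrev L2 (ℓ : ℝ) := Lp ℝ 2 (volume.restrict (Ioo (0 : ℝ) ℓ))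

/-- Data of the plant
`∂ₜu = -λ₁ ∂ₓu + c₁ v`, `∂ₜv = λ₂ ∂ₓv + c₂ u` on `(0,ℓ)`, `u(0,t) = q v(0,t)`,
`v(ℓ,t) = ρ u(ℓ,t) + U(t)`. -/
structure Plant where
  ℓ : ℝ
  lam₁ : ℝ
  lam₂ : ℝ
  q : ℝ
  ρ : ℝ
  c₁ : ℝ → ℝ
  c₂ : ℝ → ℝ
  ℓ_pos : 0 < ℓ
  lam₁_pos : 0 < lam₁
  lam₂_pos : 0 < lam₂
  q_ne : q ≠ 0
  ρ_ne : ρ ≠ 0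
  c₁_cont : ContinuousOn c₁ (Icc 0 ℓ)
  c₂_cont : ContinuousOn c₂ (Icc 0 ℓ)

/-! ### Backstepping kernels -/

/-- A `2 × 2` matrix of kernels; `k₁₂ x ξ` is the entry in row 1 and column 2 at `(x, ξ)`.
Rows and columns are ordered as (`α`, `β`) or (`u`, `v`). -/
structure Kernel where
  k₁₁ : ℝ → ℝ → ℝ
  k₁₂ : ℝ → ℝ → ℝ
  k₂₁ : ℝ → ℝ → ℝ
  k₂₂ : ℝ → ℝ → ℝ

/-- The closed triangle `0 ≤ ξ ≤ x ≤ ℓ`. -/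
def triangle (ℓ : ℝ) : Set (ℝ × ℝ) := {z | 0 ≤ z.2 ∧ z.2 ≤ z.1 ∧ z.1 ≤ ℓ}

/-- Continuous differentiability of all entries on the closed triangle. -/
def Kernel.IsC1 (k : Kernel) (ℓ : ℝ) : Prop :=
  ContDiffOn ℝ 1 (fun z : ℝ × ℝ => k.k₁₁ z.1 z.2) (triangle ℓ) ∧
  ContDiffOn ℝ 1 (fun z : ℝ × ℝ => k.k₁₂ z.1 z.2) (triangle ℓ) ∧
  ContDiffOn ℝ 1 (fun z : ℝ × ℝ => k.k₂₁ z.1 z.2) (triangle ℓ) ∧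
  ContDiffOn ℝ 1 (fun z : ℝ × ℝ => k.k₂₂ z.1 z.2) (triangle ℓ)

/-- `a ∂ₓk(x,ξ) + b ∂_ξ k(x,ξ)`. -/
def dirDeriv (a b : ℝ) (k : ℝ → ℝ → ℝ) (x ξ : ℝ) : ℝ :=
  a * deriv (fun y => k y ξ) x + b * deriv (fun y => k x y) ξ

/-- Kernel equations of the transformation `(α̃, β̃) ↦ (ũ, ṽ)` of the observer error. -/
structure IsKernelP (pl : Plant) (P : Kernel) : Prop where
  c1 : P.IsC1 pl.ℓ
  pde₁₁ : ∀ x ξ, 0 < ξ → ξ < x → x < pl.ℓ →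
    dirDeriv pl.lam₁ pl.lam₁ P.k₁₁ x ξ = pl.c₁ x * P.k₂₁ x ξ
  pde₁₂ : ∀ x ξ, 0 < ξ → ξ < x → x < pl.ℓ →
    dirDeriv pl.lam₁ (-pl.lam₂) P.k₁₂ x ξ = pl.c₁ x * P.k₂₂ x ξ
  pde₂₁ : ∀ x ξ, 0 < ξ → ξ < x → x < pl.ℓ →
    dirDeriv pl.lam₂ (-pl.lam₁) P.k₂₁ x ξ = -pl.c₂ x * P.k₁₁ x ξ
  pde₂₂ : ∀ x ξ, 0 < ξ → ξ < x → x < pl.ℓ →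
    dirDeriv pl.lam₂ pl.lam₂ P.k₂₂ x ξ = -pl.c₂ x * P.k₁₂ x ξ
  bc₁₁ : ∀ ξ ∈ Icc 0 pl.ℓ, P.k₁₁ pl.ℓ ξ = 1 / pl.ρ * P.k₂₁ pl.ℓ ξ
  bc₁₂ : ∀ x ∈ Icc 0 pl.ℓ, P.k₁₂ x x = -(pl.c₁ x / (pl.lam₁ + pl.lam₂))
  bc₂₂ : ∀ ξ ∈ Icc 0 pl.ℓ, P.k₂₂ pl.ℓ ξ = pl.ρ * P.k₁₂ pl.ℓ ξ
  bc₂₁ : ∀ x ∈ Icc 0 pl.ℓ, P.k₂₁ x x = pl.c₂ x / (pl.lam₁ + pl.lam₂)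

/-- Kernel equations of the inverse transformation `(ũ, ṽ) ↦ (α̃, β̃)`. -/
structure IsKernelR (pl : Plant) (R : Kernel) : Prop where
  c1 : R.IsC1 pl.ℓ
  pde₁₁ : ∀ x ξ, 0 < ξ → ξ < x → x < pl.ℓ →
    dirDeriv pl.lam₁ pl.lam₁ R.k₁₁ x ξ = -pl.c₂ ξ * R.k₁₂ x ξ
  pde₁₂ : ∀ x ξ, 0 < ξ → ξ < x → x < pl.ℓ →
    dirDeriv pl.lam₁ (-pl.lam₂) R.k₁₂ x ξ = -pl.c₁ ξ * R.k₁₁ x ξ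
  pde₂₁ : ∀ x ξ, 0 < ξ → ξ < x → x < pl.ℓ →
    dirDeriv pl.lam₂ (-pl.lam₁) R.k₂₁ x ξ = pl.c₂ ξ * R.k₂₂ x ξ
  pde₂₂ : ∀ x ξ, 0 < ξ → ξ < x → x < pl.ℓ →
    dirDeriv pl.lam₂ pl.lam₂ R.k₂₂ x ξ = pl.c₁ ξ * R.k₂₁ x ξ
  bc₁₁ : ∀ ξ ∈ Icc 0 pl.ℓ, R.k₁₁ pl.ℓ ξ = 1 / pl.ρ * R.k₂₁ pl.ℓ ξ
  bc₁₂ : ∀ x ∈ Icc 0 pl.ℓ, R.k₁₂ x x = -(pl.c₁ x / (pl.lam₁ + pl.lam₂))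
  bc₂₂ : ∀ ξ ∈ Icc 0 pl.ℓ, R.k₂₂ pl.ℓ ξ = pl.ρ * R.k₁₂ pl.ℓ ξ
  bc₂₁ : ∀ x ∈ Icc 0 pl.ℓ, R.k₂₁ x x = pl.c₂ x / (pl.lam₁ + pl.lam₂)

/-- Kernel equations of the transformation `(û, v̂) ↦ (α̂, β̂)` of the observer. -/
structure IsKernelK (pl : Plant) (K : Kernel) : Prop where
  c1 : K.IsC1 pl.ℓ
  pde₁₁ : ∀ x ξ, 0 < ξ → ξ < x → x < pl.ℓ →
    dirDeriv pl.lam₁ pl.lam₁ K.k₁₁ x ξ = -pl.c₂ ξ * K.k₁₂ x ξ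
  pde₁₂ : ∀ x ξ, 0 < ξ → ξ < x → x < pl.ℓ →
    dirDeriv pl.lam₁ (-pl.lam₂) K.k₁₂ x ξ = -pl.c₁ ξ * K.k₁₁ x ξ
  pde₂₁ : ∀ x ξ, 0 < ξ → ξ < x → x < pl.ℓ →
    dirDeriv pl.lam₂ (-pl.lam₁) K.k₂₁ x ξ = pl.c₂ ξ * K.k₂₂ x ξ
  pde₂₂ : ∀ x ξ, 0 < ξ → ξ < x → x < pl.ℓ →
    dirDeriv pl.lam₂ pl.lam₂ K.k₂₂ x ξ = pl.c₁ ξ * K.k₂₁ x ξ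
  bc₁₁ : ∀ x ∈ Icc 0 pl.ℓ, K.k₁₁ x 0 = pl.lam₂ / (pl.q * pl.lam₁) * K.k₁₂ x 0
  bc₁₂ : ∀ x ∈ Icc 0 pl.ℓ, K.k₁₂ x x = pl.c₁ x / (pl.lam₁ + pl.lam₂)
  bc₂₂ : ∀ x ∈ Icc 0 pl.ℓ, K.k₂₂ x 0 = pl.q * pl.lam₁ / pl.lam₂ * K.k₂₁ x 0
  bc₂₁ : ∀ x ∈ Icc 0 pl.ℓ, K.k₂₁ x x = -(pl.c₂ x / (pl.lam₁ + pl.lam₂))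

/-- Kernel equations of the inverse transformation `(α̂, β̂) ↦ (û, v̂)`. -/
structure IsKernelL (pl : Plant) (L : Kernel) : Prop where
  c1 : L.IsC1 pl.ℓ
  pde₁₁ : ∀ x ξ, 0 < ξ → ξ < x → x < pl.ℓ →
    dirDeriv pl.lam₁ pl.lam₁ L.k₁₁ x ξ = pl.c₁ x * L.k₂₁ x ξ
  pde₁₂ : ∀ x ξ, 0 < ξ → ξ < x → x < pl.ℓ →
    dirDeriv pl.lam₁ (-pl.lam₂) L.k₁₂ x ξ = pl.c₁ x * L.k₂₂ x ξ
  pde₂₁ : ∀ x ξ, 0 < ξ → ξ < x → x < pl.ℓ →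
    dirDeriv pl.lam₂ (-pl.lam₁) L.k₂₁ x ξ = -pl.c₂ x * L.k₁₁ x ξ
  pde₂₂ : ∀ x ξ, 0 < ξ → ξ < x → x < pl.ℓ →
    dirDeriv pl.lam₂ pl.lam₂ L.k₂₂ x ξ = -pl.c₂ x * L.k₁₂ x ξ
  bc₁₁ : ∀ x ∈ Icc 0 pl.ℓ, L.k₁₁ x 0 = pl.lam₂ / (pl.q * pl.lam₁) * L.k₁₂ x 0
  bc₁₂ : ∀ x ∈ Icc 0 pl.ℓ, L.k₁₂ x x = pl.c₁ x / (pl.lam₁ + pl.lam₂)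
  bc₂₂ : ∀ x ∈ Icc 0 pl.ℓ, L.k₂₂ x 0 = pl.q * pl.lam₁ / pl.lam₂ * L.k₂₁ x 0
  bc₂₁ : ∀ x ∈ Icc 0 pl.ℓ, L.k₂₁ x x = -(pl.c₂ x / (pl.lam₁ + pl.lam₂))

/-- The four kernel matrices. -/
structure Kernels where
  P : Kernel
  R : Kernel
  K : Kernel
  L : Kernel

/-- `P`, `R`, `K`, `L` are classical solutions of their kernel equations. -/
structure Kernels.Solve (ker : Kernels) (pl : Plant) : Prop where
  P : IsKernelP pl ker.P
  R : IsKernelR pl ker.R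
  K : IsKernelK pl ker.K
  L : IsKernelL pl ker.L

/-! ### Gains -/

/-- Observer gain `p₁`. -/
def p₁ (pl : Plant) (ker : Kernels) (x : ℝ) : ℝ := -pl.lam₂ * ker.P.k₁₂ x 0

/-- Observer gain `p₂`. -/
def p₂ (pl : Plant) (ker : Kernels) (x : ℝ) : ℝ := -pl.lam₂ * ker.P.k₂₂ x 0

/-- Coefficient of `β̃(0,t)` in the `α̂`-equation of the observer target system
`∂ₜα̂ = -λ₁ ∂ₓα̂ + p̄₁ β̃(0,t)`. The term `q λ₁ K^{uu}(x,0)` comes from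
`û(0,t) = q v̂(0,t) + q ṽ(0,t)`. -/
def pbar₁ (pl : Plant) (ker : Kernels) (x : ℝ) : ℝ :=
  p₁ pl ker x - pl.q * pl.lam₁ * ker.K.k₁₁ x 0
    - (∫ ξ in (0 : ℝ)..x, ker.K.k₁₁ x ξ * p₁ pl ker ξ)
    - ∫ ξ in (0 : ℝ)..x, ker.K.k₁₂ x ξ * p₂ pl ker ξ

/-- Coefficient of `β̃(0,t)` in the `β̂`-equation of the observer target system
`∂ₜβ̂ = λ₂ ∂ₓβ̂ + p̄₂ β̃(0,t)`. -/
def pbar₂ (pl : Plant) (ker : Kernels) (x : ℝ) : ℝ :=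
  p₂ pl ker x - pl.q * pl.lam₁ * ker.K.k₂₁ x 0
    - (∫ ξ in (0 : ℝ)..x, ker.K.k₂₁ x ξ * p₁ pl ker ξ)
    - ∫ ξ in (0 : ℝ)..x, ker.K.k₂₂ x ξ * p₂ pl ker ξ

/-- Control gain `N^u`. -/
def Nu (pl : Plant) (ker : Kernels) (ξ : ℝ) : ℝ :=
  ker.K.k₂₁ pl.ℓ ξ - pl.ρ * ker.K.k₁₁ pl.ℓ ξ

/-- Control gain `N^v`. -/
def Nv (pl : Plant) (ker : Kernels) (ξ : ℝ) : ℝ :=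
  ker.K.k₂₂ pl.ℓ ξ - pl.ρ * ker.K.k₁₂ pl.ℓ ξ

/-- Control gain `N^α`. -/
def Nα (pl : Plant) (ker : Kernels) (ξ : ℝ) : ℝ :=
  ker.L.k₂₁ pl.ℓ ξ - pl.ρ * ker.L.k₁₁ pl.ℓ ξ

/-- Control gain `N^β`. -/
def Nβ (pl : Plant) (ker : Kernels) (ξ : ℝ) : ℝ :=
  ker.L.k₂₂ pl.ℓ ξ - pl.ρ * ker.L.k₁₂ pl.ℓ ξ

/-- The continuous-time control law `U = ∫ N^u û + ∫ N^v v̂` at an observer state `(û, v̂)`. -/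
def control (pl : Plant) (ker : Kernels) (uh vh : L2 pl.ℓ) : ℝ :=
  (∫ ξ in (0 : ℝ)..pl.ℓ, Nu pl ker ξ * uh ξ) + ∫ ξ in (0 : ℝ)..pl.ℓ, Nv pl ker ξ * vh ξ

/-- The backstepping variable `α̂(x)` of an observer state `(û, v̂)`. -/
def αh (pl : Plant) (ker : Kernels) (uh vh : L2 pl.ℓ) (x : ℝ) : ℝ :=
  uh x - (∫ ξ in (0 : ℝ)..x, ker.K.k₁₁ x ξ * uh ξ) - ∫ ξ in (0 : ℝ)..x, ker.K.k₁₂ x ξ * vh ξ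

/-- The backstepping variable `β̂(x)` of an observer state `(û, v̂)`. -/
def βh (pl : Plant) (ker : Kernels) (uh vh : L2 pl.ℓ) (x : ℝ) : ℝ :=
  vh x - (∫ ξ in (0 : ℝ)..x, ker.K.k₂₁ x ξ * uh ξ) - ∫ ξ in (0 : ℝ)..x, ker.K.k₂₂ x ξ * vh ξ

/-- The boundary value `α̂(ℓ)`, where `y` is the boundary value `û(ℓ)`. -/
def αhEnd (pl : Plant) (ker : Kernels) (uh vh : L2 pl.ℓ) (y : ℝ) : ℝ :=
  y - (∫ ξ in (0 : ℝ)..pl.ℓ, ker.K.k₁₁ pl.ℓ ξ * uh ξ)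
    - ∫ ξ in (0 : ℝ)..pl.ℓ, ker.K.k₁₂ pl.ℓ ξ * vh ξ

/-- `‖(α̂, β̂)‖²`. -/
def targetNormSq (pl : Plant) (ker : Kernels) (uh vh : L2 pl.ℓ) : ℝ :=
  (∫ x in (0 : ℝ)..pl.ℓ, αh pl ker uh vh x ^ 2) + ∫ x in (0 : ℝ)..pl.ℓ, βh pl ker uh vh x ^ 2

/-! ### Constants of the triggering mechanism -/

def ε₀ (pl : Plant) (ker : Kernels) : ℝ :=
  5 * max (pl.lam₁ ^ 2 * ∫ ξ in (0 : ℝ)..pl.ℓ, deriv (Nα pl ker) ξ ^ 2)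
    (pl.lam₂ ^ 2 * ∫ ξ in (0 : ℝ)..pl.ℓ, deriv (Nβ pl ker) ξ ^ 2)

def ε₁ (pl : Plant) (ker : Kernels) : ℝ :=
  5 * (pl.lam₁ * Nα pl ker pl.ℓ - pl.ρ * pl.lam₂ * Nβ pl ker pl.ℓ) ^ 2

def ε₂ (pl : Plant) (ker : Kernels) : ℝ :=
  5 * ((∫ ξ in (0 : ℝ)..pl.ℓ, (Nα pl ker ξ * pbar₁ pl ker ξ + Nβ pl ker ξ * pbar₂ pl ker ξ))
    + pl.q * pl.lam₁ * Nα pl ker 0) ^ 2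

def ε₃ (pl : Plant) (ker : Kernels) : ℝ := 5 * (pl.lam₂ * Nβ pl ker pl.ℓ) ^ 2

/-- Free design parameters; `δb` stands for `δ̄`. -/
structure Design where
  η : ℝ
  θ : ℝ
  σ : ℝ
  μ : ℝ
  δ : ℝ
  C : ℝ
  δb : ℝ

def κ₀ (pl : Plant) (ker : Kernels) (ds : Design) : ℝ := ds.θ * ε₀ pl ker / (1 - ds.σ)

def κ₁ (pl : Plant) (ker : Kernels) (ds : Design) : ℝ := ds.θ * ε₁ pl ker / (1 - ds.σ)

def κ₂ (pl : Plant) (ker : Kernels) (ds : Design) : ℝ := ds.θ * ε₂ pl ker / (1 - ds.σ)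

/-- `a = 1 + ε₃ + η`. -/
def aConst (pl : Plant) (ker : Kernels) (ds : Design) : ℝ := 1 + ε₃ pl ker + ds.η

/-- `θ_m = 2 D e^{μℓ/λ₂}` with `D = 2 C q²`. -/
def θm (pl : Plant) (ds : Design) : ℝ :=
  2 * (2 * ds.C * pl.q ^ 2) * Real.exp (ds.μ * pl.ℓ / pl.lam₂)

/-- The minimum dwell-time `τ`. -/
def τ (pl : Plant) (ker : Kernels) (ds : Design) : ℝ :=
  1 / aConst pl ker ds * Real.log (1 + aConst pl ker ds * ds.θ * ds.σ /
    ((aConst pl ker ds * ds.θ + θm pl ds) * (1 - ds.σ)))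

/-- `μ̄`, the upper end of the range of `μ`. -/
def μbar (pl : Plant) : ℝ :=
  2 * pl.lam₁ * pl.lam₂ / (pl.ℓ * (pl.lam₁ + pl.lam₂)) * Real.log (1 / (2 * |pl.q * pl.ρ|))

/-- `r = min {e^{-μℓ/λ₁}/λ₁, 2q²/λ₂}`. -/
def rConst (pl : Plant) (ds : Design) : ℝ :=
  min (1 / pl.lam₁ * Real.exp (-(ds.μ * pl.ℓ / pl.lam₁))) (2 * pl.q ^ 2 / pl.lam₂)

/-- `D̄ = 2q²` (and `C̄ = 1`). -/
def Dbar (pl : Plant) : ℝ := 2 * pl.q ^ 2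

def rd (pl : Plant) (ker : Kernels) : ℝ :=
  4 * max (∫ ξ in (0 : ℝ)..pl.ℓ, Nα pl ker ξ ^ 2) (∫ ξ in (0 : ℝ)..pl.ℓ, Nβ pl ker ξ ^ 2) /
    min (Real.exp (-(μbar pl * pl.ℓ / pl.lam₁)) / pl.lam₁) (Dbar pl / pl.lam₂)

/-- The growth rate `ϱ = δ̄ - μ̄ + 2 r_d D̄ e^{μ̄ℓ/λ₂}`. -/
def growth (pl : Plant) (ker : Kernels) (ds : Design) : ℝ :=
  ds.δb - μbar pl + 2 * rd pl ker * Dbar pl * Real.exp (μbar pl * pl.ℓ / pl.lam₂)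

/-- Conditions on the design parameters. -/
structure Design.Admissible (ds : Design) (pl : Plant) (ker : Kernels) : Prop where
  η_pos : 0 < ds.η
  θ_pos : 0 < ds.θ
  σ_pos : 0 < ds.σ
  σ_lt : ds.σ < 1
  μ_pos : 0 < ds.μ
  μ_lt : ds.μ < μbar pl
  δ_pos : 0 < ds.δ
  δ_lt : ds.δ < ds.μ
  C_gt₀ : κ₀ pl ker ds / ((ds.μ - ds.δ) * rConst pl ds) < ds.C
  C_gt₁ : κ₁ pl ker ds * Real.exp (ds.μ * pl.ℓ / pl.lam₁) /
    (1 - 4 * pl.ρ ^ 2 * pl.q ^ 2 * Real.exp (ds.μ * (pl.ℓ / pl.lam₁ + pl.ℓ / pl.lam₂))) < ds.C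
  δb_pos : 0 < ds.δb
  growth_pos : 0 < growth pl ker ds

/-! ### The self-triggering rule -/

/-- The bound `φ_α` of `α̃²(·,0)`, from the bounds `φ_u` of `ũ²(·,0)` and `φ_v` of `ṽ²(·,0)`. -/
def φα (pl : Plant) (ker : Kernels) (φu φv : ℝ) : ℝ :=
  3 * sSup ((fun x : ℝ => φu + φu * x * (∫ ξ in (0 : ℝ)..x, ker.R.k₁₁ x ξ ^ 2)
    + φv * x * ∫ ξ in (0 : ℝ)..x, ker.R.k₁₂ x ξ ^ 2) '' Icc 0 pl.ℓ)

/-- The bound `φ_β` of `β̃²(·,0)`. -/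
def φβ (pl : Plant) (ker : Kernels) (φu φv : ℝ) : ℝ :=
  3 * sSup ((fun x : ℝ => φv + φu * x * (∫ ξ in (0 : ℝ)..x, ker.R.k₂₁ x ξ ^ 2)
    + φv * x * ∫ ξ in (0 : ℝ)..x, ker.R.k₂₂ x ξ ^ 2) '' Icc 0 pl.ℓ)

/-- `φ₀(t)`. -/
def φ₀ (pl : Plant) (ker : Kernels) (φu φv t : ℝ) : ℝ :=
  if t ≤ pl.ℓ / pl.lam₁ + pl.ℓ / pl.lam₂ then
    max (pl.ρ ^ 2 * φα pl ker φu φv) (φβ pl ker φu φv)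
  else 0

/-- `P̄_{V₂}`. -/
def PV₂ (pl : Plant) (ker : Kernels) (ds : Design) : ℝ :=
  1 / ds.δb * ∫ x in (0 : ℝ)..pl.ℓ,
    (1 / pl.lam₁ * Real.exp (-(μbar pl * x / pl.lam₁)) * pbar₁ pl ker x ^ 2
      + Dbar pl / pl.lam₂ * Real.exp (μbar pl * x / pl.lam₂) * pbar₂ pl ker x ^ 2)

/-- `φ(t) = (2 C̄ q² + P̄_{V₂}) φ₀(t)`. -/
def φTot (pl : Plant) (ker : Kernels) (ds : Design) (φu φv t : ℝ) : ℝ :=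
  (2 * pl.q ^ 2 + PV₂ pl ker ds) * φ₀ pl ker φu φv t

/-- `V̄₂` at an observer state `(û, v̂)`. -/
def V₂ (pl : Plant) (ker : Kernels) (uh vh : L2 pl.ℓ) : ℝ :=
  ∫ x in (0 : ℝ)..pl.ℓ,
    (1 / pl.lam₁ * αh pl ker uh vh x ^ 2 * Real.exp (-(μbar pl * x / pl.lam₁))
      + Dbar pl / pl.lam₂ * Real.exp (μbar pl * x / pl.lam₂) * βh pl ker uh vh x ^ 2)

/-- `𝓕` at time `t` and observer state `(û, v̂)`. -/
def Fpred (pl : Plant) (ker : Kernels) (ds : Design) (φu φv t : ℝ) (uh vh : L2 pl.ℓ) : ℝ :=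
  rd pl ker * (2 * V₂ pl ker uh vh +
    (2 * rd pl ker * Dbar pl * Real.exp (μbar pl * pl.ℓ / pl.lam₂) * V₂ pl ker uh vh
      + φTot pl ker ds φu φv t) / growth pl ker ds)

/-- `Ḡ`, for a value `F` of `𝓕` and a value `m` of the dynamic variable. -/
def Gbar (pl : Plant) (ker : Kernels) (ds : Design) (F m : ℝ) : ℝ :=
  1 / (growth pl ker ds + ds.η) *
    Real.log ((θm pl ds * F - m * (growth pl ker ds + ds.η)) /
      (F * (ds.θ * (growth pl ker ds + ds.η) + θm pl ds)))

/-- The waiting time `G = max {τ, Ḡ}`. If `𝓕 = 0`, where `Ḡ` is not defined, it is `τ`. -/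
def waiting (pl : Plant) (ker : Kernels) (ds : Design) (φu φv t : ℝ) (uh vh : L2 pl.ℓ)
    (m : ℝ) : ℝ :=
  if Fpred pl ker ds φu φv t uh vh = 0 then τ pl ker ds
  else max (τ pl ker ds) (Gbar pl ker ds (Fpred pl ker ds φu φv t uh vh) m)

/-! ### The closed loop -/

/-- `w` is a weak solution of `∂ₜw + a ∂ₓw = f` on `(0,ℓ) × (0,∞)` with boundary traces
`w(0,·) = w0` and `w(ℓ,·) = wL`. -/
def IsWeakTransport (ℓ a : ℝ) (w : ℝ → L2 ℓ) (w0 wL : ℝ → ℝ) (f : ℝ → ℝ → ℝ) : Prop :=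
  ∀ φ : ℝ → ℝ, ContDiff ℝ 1 φ → ∀ t : ℝ, 0 ≤ t →
    ∫ x in (0 : ℝ)..ℓ, w t x * φ x =
      (∫ x in (0 : ℝ)..ℓ, w 0 x * φ x) +
      ∫ s in (0 : ℝ)..t,
        (a * (∫ x in (0 : ℝ)..ℓ, w s x * deriv φ x) + a * (w0 s * φ 0 - wL s * φ ℓ)
          + ∫ x in (0 : ℝ)..ℓ, f s x * φ x)

/-- A boundary trace: locally square integrable on `[0,∞)`. -/
def IsTrace (y : ℝ → ℝ) : Prop := ∀ T : ℝ, MemLp y 2 (volume.restrict (Ioc 0 T))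

/-- The signals of the closed loop: plant state `(u, v)`, observer state `(û, v̂)`, their traces
at `x = 0` and `x = ℓ`, the dynamic variable `m` and the event times `t`. -/
structure Signals (ℓ : ℝ) where
  u : ℝ → L2 ℓ
  v : ℝ → L2 ℓ
  uh : ℝ → L2 ℓ
  vh : ℝ → L2 ℓ
  uAt0 : ℝ → ℝ
  uAtL : ℝ → ℝ
  vAt0 : ℝ → ℝ
  vAtL : ℝ → ℝ
  uhAt0 : ℝ → ℝ
  uhAtL : ℝ → ℝ
  vhAt0 : ℝ → ℝ
  vhAtL : ℝ → ℝ
  m : ℝ → ℝ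
  t : ℕ → ℝ

/-- Initial data `(u⁰, v⁰, û⁰, v̂⁰)` and `m⁰`. -/
structure InitialData (ℓ : ℝ) where
  u : L2 ℓ
  v : L2 ℓ
  uh : L2 ℓ
  vh : L2 ℓ
  m : ℝ

/-- `S` is a solution, with states continuous from `[0,∞)` to `L²`, of the observer-based closed
loop under self-triggered control. -/
structure IsClosedLoop (pl : Plant) (ker : Kernels) (ds : Design) (φu φv : ℝ)
    (ini : InitialData pl.ℓ) (S : Signals pl.ℓ) : Prop where
  u_cont : ContinuousOn S.u (Ici 0)
  v_cont : ContinuousOn S.v (Ici 0)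
  uh_cont : ContinuousOn S.uh (Ici 0)
  vh_cont : ContinuousOn S.vh (Ici 0)
  m_cont : ContinuousOn S.m (Ici 0)
  u_init : S.u 0 = ini.u
  v_init : S.v 0 = ini.v
  uh_init : S.uh 0 = ini.uh
  vh_init : S.vh 0 = ini.vh
  m_init : S.m 0 = ini.m
  uAt0_trace : IsTrace S.uAt0
  uAtL_trace : IsTrace S.uAtL
  vAt0_trace : IsTrace S.vAt0
  vAtL_trace : IsTrace S.vAtL
  uhAt0_trace : IsTrace S.uhAt0
  uhAtL_trace : IsTrace S.uhAtL
  vhAt0_trace : IsTrace S.vhAt0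
  vhAtL_trace : IsTrace S.vhAtL
  -- the plant and the observer
  u_eq : IsWeakTransport pl.ℓ pl.lam₁ S.u S.uAt0 S.uAtL (fun s x => pl.c₁ x * S.v s x)
  v_eq : IsWeakTransport pl.ℓ (-pl.lam₂) S.v S.vAt0 S.vAtL (fun s x => pl.c₂ x * S.u s x)
  uh_eq : IsWeakTransport pl.ℓ pl.lam₁ S.uh S.uhAt0 S.uhAtL
    (fun s x => pl.c₁ x * S.vh s x + p₁ pl ker x * (S.vAt0 s - S.vhAt0 s))
  vh_eq : IsWeakTransport pl.ℓ (-pl.lam₂) S.vh S.vhAt0 S.vhAtL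
    (fun s x => pl.c₂ x * S.uh s x + p₂ pl ker x * (S.vAt0 s - S.vhAt0 s))
  -- boundary conditions; the input is held at its value at the last event
  bc_u : ∀ᵐ s ∂volume.restrict (Ioi (0 : ℝ)), S.uAt0 s = pl.q * S.vAt0 s
  bc_uh : ∀ᵐ s ∂volume.restrict (Ioi (0 : ℝ)), S.uhAt0 s = pl.q * S.vAt0 s
  bc_v : ∀ k : ℕ, ∀ᵐ s ∂volume.restrict (Ico (S.t k) (S.t (k + 1))),
    S.vAtL s = pl.ρ * S.uAtL s + control pl ker (S.uh (S.t k)) (S.vh (S.t k))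
  bc_vh : ∀ k : ℕ, ∀ᵐ s ∂volume.restrict (Ico (S.t k) (S.t (k + 1))),
    S.vhAtL s = pl.ρ * S.uhAtL s + control pl ker (S.uh (S.t k)) (S.vh (S.t k))
  -- the dynamic variable between events
  m_eq : ∀ k : ℕ, ∀ t ∈ Icc (S.t k) (S.t (k + 1)),
    S.m t = S.m (S.t k) + ∫ s in (S.t k)..t,
      (-ds.η * S.m s
        + θm pl ds * (control pl ker (S.uh (S.t k)) (S.vh (S.t k))
            - control pl ker (S.uh s) (S.vh s)) ^ 2
        - κ₀ pl ker ds * targetNormSq pl ker (S.uh s) (S.vh s)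
        - κ₁ pl ker ds * αhEnd pl ker (S.uh s) (S.vh s) (S.uhAtL s) ^ 2
        - κ₂ pl ker ds * (S.vAt0 s - S.vhAt0 s) ^ 2)
  -- the event times
  t_zero : S.t 0 = 0
  t_succ : ∀ k : ℕ, S.t (k + 1) = S.t k +
    waiting pl ker ds φu φv (S.t k) (S.uh (S.t k)) (S.vh (S.t k)) (S.m (S.t k))

end

end STC

open Filter Topology
open scoped ENNReal

namespace STC

noncomputable section

/-! ### The Hilbert space `L²(0,ℓ)` -/

section Basic

variable {ℓ : ℝ}

lemma memLp_of_continuous (ℓ : ℝ) {φ : ℝ → ℝ} (hφ : Continuous φ) :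
    MemLp φ 2 (volume.restrict (Ioo (0 : ℝ) ℓ)) := by
  obtain ⟨C, hC⟩ := (isCompact_Icc (a := (0 : ℝ)) (b := ℓ)).exists_bound_of_continuousOn
    hφ.continuousOn
  refine MemLp.of_bound hφ.aestronglyMeasurable C ?_
  filter_upwards [ae_restrict_mem measurableSet_Ioo] with x hx
  exact hC x (Ioo_subset_Icc_self hx)

/-- The class of a continuous function. -/
def emb (ℓ : ℝ) (φ : C(ℝ, ℝ)) : L2 ℓ := (memLp_of_continuous ℓ φ.continuous).toLp φ

lemma coeFn_emb (φ : C(ℝ, ℝ)) : emb ℓ φ =ᵐ[volume.restrict (Ioo (0 : ℝ) ℓ)] φ :=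
  MemLp.coeFn_toLp _

lemma emb_add (φ ψ : C(ℝ, ℝ)) : emb ℓ (φ + ψ) = emb ℓ φ + emb ℓ ψ := rfl

lemma emb_smul (c : ℝ) (φ : C(ℝ, ℝ)) : emb ℓ (c • φ) = c • emb ℓ φ := rfl

lemma setIntegral_Ioo_eq (hℓ : 0 ≤ ℓ) (f : ℝ → ℝ) :
    ∫ x in Ioo (0 : ℝ) ℓ, f x = ∫ x in (0 : ℝ)..ℓ, f x := by
  rw [intervalIntegral.integral_of_le hℓ, integral_Ioc_eq_integral_Ioo]

lemma inner_eq_integral (hℓ : 0 ≤ ℓ) (f g : L2 ℓ) :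
    inner ℝ f g = ∫ x in (0 : ℝ)..ℓ, f x * g x := by
  rw [L2.inner_def, ← setIntegral_Ioo_eq hℓ]
  simp [mul_comm]

lemma intervalIntegral_congr_ae (hℓ : 0 ≤ ℓ) {f g : ℝ → ℝ}
    (h : f =ᵐ[volume.restrict (Ioo (0 : ℝ) ℓ)] g) :
    ∫ x in (0 : ℝ)..ℓ, f x = ∫ x in (0 : ℝ)..ℓ, g x := by
  rw [← setIntegral_Ioo_eq hℓ, ← setIntegral_Ioo_eq hℓ]
  exact integral_congr_ae h

lemma inner_emb (hℓ : 0 ≤ ℓ) (w : L2 ℓ) (φ : C(ℝ, ℝ)) :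
    inner ℝ w (emb ℓ φ) = ∫ x in (0 : ℝ)..ℓ, w x * φ x := by
  rw [inner_eq_integral hℓ]
  refine intervalIntegral_congr_ae hℓ ?_
  filter_upwards [coeFn_emb φ] with x hx
  rw [hx]

lemma norm_sq_eq_integral (hℓ : 0 ≤ ℓ) (w : L2 ℓ) :
    ‖w‖ ^ 2 = ∫ x in (0 : ℝ)..ℓ, w x ^ 2 := by
  rw [← real_inner_self_eq_norm_sq, inner_eq_integral hℓ]
  simp [sq]

lemma integrableOn_Ioo_coeFn (w : L2 ℓ) : IntegrableOn w (Ioo 0 ℓ) :=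
  (Lp.memLp w).integrable (by norm_num)

lemma integrableOn_Ioc_coeFn (w : L2 ℓ) : IntegrableOn w (Ioc 0 ℓ) :=
  (integrableOn_Ioc_iff_integrableOn_Ioo (by simp)).2 (integrableOn_Ioo_coeFn w)

lemma intervalIntegrable_coeFn (w : L2 ℓ) {x y : ℝ} (hx : x ∈ Icc 0 ℓ) (hy : y ∈ Icc 0 ℓ) :
    IntervalIntegrable w volume x y := by
  rw [intervalIntegrable_iff]
  refine (integrableOn_Ioc_coeFn w).mono_set ?_
  rw [uIoc]
  exact Ioc_subset_Ioc (le_min hx.1 hy.1) (max_le hx.2 hy.2)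

lemma integral_abs_le (hℓ : 0 ≤ ℓ) (w : L2 ℓ) :
    ∫ x in (0 : ℝ)..ℓ, |w x| ≤ √ℓ * ‖w‖ := by
  have h1 : inner ℝ (emb ℓ 1) |w| ≤ ‖emb ℓ 1‖ * ‖|w|‖ := real_inner_le_norm _ _
  rw [norm_abs_eq_norm] at h1
  have h2 : ‖emb ℓ (1 : C(ℝ, ℝ))‖ = √ℓ := by
    rw [← Real.sqrt_sq (norm_nonneg _), ← real_inner_self_eq_norm_sq, inner_emb hℓ]
    congr 1
    rw [intervalIntegral_congr_ae hℓ (g := fun _ => 1)]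
    · simp
    · filter_upwards [coeFn_emb (1 : C(ℝ, ℝ))] with x hx
      rw [hx]; simp
  rw [h2, real_inner_comm, inner_emb hℓ] at h1
  refine le_trans (le_of_eq ?_) h1
  refine intervalIntegral_congr_ae hℓ ?_
  filter_upwards [Lp.coeFn_abs w] with x hx
  simp [hx]

lemma exists_bound_Icc (ℓ : ℝ) (φ : C(ℝ, ℝ)) : ∃ C, 0 ≤ C ∧ ∀ x ∈ Icc (0 : ℝ) ℓ, |φ x| ≤ C := by
  obtain ⟨C, hC⟩ := (isCompact_Icc (a := (0 : ℝ)) (b := ℓ)).exists_bound_of_continuousOn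
    φ.continuous.continuousOn
  exact ⟨max C 0, le_max_right _ _, fun x hx => (hC x hx).trans (le_max_left _ _)⟩

lemma ae_abs_mul_le {φ : C(ℝ, ℝ)} {C : ℝ} (hC : ∀ x ∈ Icc (0 : ℝ) ℓ, |φ x| ≤ C) (w : ℝ → ℝ) :
    ∀ᵐ x ∂volume.restrict (Ioo (0 : ℝ) ℓ), ‖φ x * w x‖ ≤ C * ‖w x‖ := by
  filter_upwards [ae_restrict_mem measurableSet_Ioo] with x hx
  rw [norm_mul]
  exact mul_le_mul_of_nonneg_right (hC x (Ioo_subset_Icc_self hx)) (norm_nonneg _)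

lemma memLp_mul_coeFn (φ : C(ℝ, ℝ)) (w : L2 ℓ) :
    MemLp (fun x => φ x * w x) 2 (volume.restrict (Ioo (0 : ℝ) ℓ)) := by
  obtain ⟨C, -, hC⟩ := exists_bound_Icc ℓ φ
  exact MemLp.of_le_mul (Lp.memLp w)
    (φ.continuous.aestronglyMeasurable.mul (Lp.aestronglyMeasurable w)) (ae_abs_mul_le hC w)

/-- Multiplication by a continuous function. -/
def mulH (ℓ : ℝ) (φ : C(ℝ, ℝ)) : L2 ℓ →L[ℝ] L2 ℓ :=
  LinearMap.mkContinuous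
    { toFun := fun w => (memLp_mul_coeFn φ w).toLp _
      map_add' := fun v w => by
        ext1
        filter_upwards [(memLp_mul_coeFn φ (v + w)).coeFn_toLp, (memLp_mul_coeFn φ v).coeFn_toLp,
          (memLp_mul_coeFn φ w).coeFn_toLp, Lp.coeFn_add v w,
          Lp.coeFn_add ((memLp_mul_coeFn φ v).toLp _) ((memLp_mul_coeFn φ w).toLp _)]
          with x h1 h2 h3 h4 h5
        rw [h1, h5, Pi.add_apply, h2, h3, h4, Pi.add_apply, mul_add]
      map_smul' := fun c w => by
        ext1
        filter_upwards [(memLp_mul_coeFn φ (c • w)).coeFn_toLp, (memLp_mul_coeFn φ w).coeFn_toLp,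
          Lp.coeFn_smul c w, Lp.coeFn_smul c ((memLp_mul_coeFn φ w).toLp _)] with x h1 h2 h4 h5
        simp only [RingHom.id_apply]
        rw [h1, h5, Pi.smul_apply, h2, h4, Pi.smul_apply, smul_eq_mul, smul_eq_mul]
        ring }
    (exists_bound_Icc ℓ φ).choose (fun w => by
      refine Lp.norm_le_mul_norm_of_ae_le_mul ?_
      filter_upwards [(memLp_mul_coeFn φ w).coeFn_toLp,
        ae_abs_mul_le (exists_bound_Icc ℓ φ).choose_spec.2 w] with x h1 h2
      simp only [LinearMap.coe_mk, AddHom.coe_mk]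
      rw [h1]
      exact h2)

lemma coeFn_mulH (φ : C(ℝ, ℝ)) (w : L2 ℓ) :
    mulH ℓ φ w =ᵐ[volume.restrict (Ioo (0 : ℝ) ℓ)] fun x => φ x * w x :=
  (memLp_mul_coeFn φ w).coeFn_toLp

lemma inner_mulH_comm (hℓ : 0 ≤ ℓ) (φ : C(ℝ, ℝ)) (v w : L2 ℓ) :
    inner ℝ (mulH ℓ φ v) w = inner ℝ v (mulH ℓ φ w) := by
  rw [inner_eq_integral hℓ, inner_eq_integral hℓ]
  refine intervalIntegral_congr_ae hℓ ?_
  filter_upwards [coeFn_mulH φ v, coeFn_mulH φ w] with x h1 h2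
  rw [h1, h2]; ring

lemma mulH_emb (φ ψ : C(ℝ, ℝ)) : mulH ℓ φ (emb ℓ ψ) = emb ℓ (φ * ψ) := by
  ext1
  filter_upwards [coeFn_mulH φ (emb ℓ ψ), coeFn_emb (ℓ := ℓ) ψ, coeFn_emb (ℓ := ℓ) (φ * ψ)]
    with x h1 h2 h3
  rw [h1, h2, h3]; rfl

/-- Interchange of the order of integration over a triangle. -/
lemma integral_triangle_swap {a b : ℝ} (hab : a ≤ b) {F : ℝ → ℝ → ℝ}
    (hF : IntegrableOn F.uncurry (Ioc a b ×ˢ Ioc a b)) :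
    ∫ x in a..b, ∫ ξ in a..x, F x ξ = ∫ ξ in a..b, ∫ x in ξ..b, F x ξ := by
  have h1 : ∀ x ∈ uIoc a b, ∫ ξ in a..x, F x ξ
      = ∫ ξ in a..b, {z : ℝ × ℝ | z.2 ≤ z.1}.indicator F.uncurry (x, ξ) := by
    intro x hx
    rw [uIoc_of_le hab] at hx
    have : (fun ξ => {z : ℝ × ℝ | z.2 ≤ z.1}.indicator F.uncurry (x, ξ))
        = (Iic x).indicator (F x) := by
      ext ξ
      simp only [indicator, mem_ofPred_eq, mem_Iic, Function.uncurry]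
    rw [this, intervalIntegral.integral_of_le hab, intervalIntegral.integral_of_le hx.1.le,
      setIntegral_indicator measurableSet_Iic, Ioc_inter_Iic, min_eq_right hx.2]
  have h2 : ∀ ξ ∈ uIoc a b, ∫ x in ξ..b, F x ξ
      = ∫ x in a..b, {z : ℝ × ℝ | z.2 ≤ z.1}.indicator F.uncurry (x, ξ) := by
    intro ξ hx
    rw [uIoc_of_le hab] at hx
    have : (fun x => {z : ℝ × ℝ | z.2 ≤ z.1}.indicator F.uncurry (x, ξ))
        = (Ici ξ).indicator (fun x => F x ξ) := by
      ext x
      simp only [indicator, mem_ofPred_eq, mem_Ici, Function.uncurry]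
    rw [this, intervalIntegral.integral_of_le hab, intervalIntegral.integral_of_le hx.2,
      setIntegral_indicator measurableSet_Ici]
    have : Ioc a b ∩ Ici ξ = Icc ξ b := by
      ext y; simp only [mem_inter_iff, mem_Ioc, mem_Ici, mem_Icc]
      exact ⟨fun h => ⟨h.2, h.1.2⟩, fun h => ⟨⟨hx.1.trans_le h.1, h.2⟩, h.1⟩⟩
    rw [this, integral_Icc_eq_integral_Ioc]
  rw [intervalIntegral.integral_congr_ae (Eventually.of_forall h1),
    intervalIntegral.integral_congr_ae (Eventually.of_forall h2)]
  refine intervalIntegral_intervalIntegral_swap (F := fun x ξ =>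
    {z : ℝ × ℝ | z.2 ≤ z.1}.indicator F.uncurry (x, ξ)) ?_
  rw [uIoc_of_le hab]
  exact hF.indicator (measurableSet_le measurable_snd measurable_fst)

/-! ### Volterra operators -/

/-- The Volterra integral `∫₀ˣ k(x,ξ) w(ξ) dξ`. -/
def volterra (k : C(ℝ × ℝ, ℝ)) (w : ℝ → ℝ) (x : ℝ) : ℝ := ∫ ξ in (0 : ℝ)..x, k (x, ξ) * w ξ

lemma exists_bound_square (ℓ : ℝ) (k : C(ℝ × ℝ, ℝ)) :
    ∃ C, 0 ≤ C ∧ ∀ x ∈ Icc (0 : ℝ) ℓ, ∀ ξ ∈ Icc (0 : ℝ) ℓ, |k (x, ξ)| ≤ C := by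
  obtain ⟨C, hC⟩ := ((isCompact_Icc (a := (0 : ℝ)) (b := ℓ)).prod
    (isCompact_Icc (a := (0 : ℝ)) (b := ℓ))).exists_bound_of_continuousOn
    k.continuous.continuousOn
  exact ⟨max C 0, le_max_right _ _, fun x hx ξ hξ => (hC (x, ξ) ⟨hx, hξ⟩).trans (le_max_left _ _)⟩

lemma intervalIntegrable_mul_coeFn {φ : ℝ → ℝ} (hφ : Continuous φ) (w : L2 ℓ) {x y : ℝ}
    (hx : x ∈ Icc 0 ℓ) (hy : y ∈ Icc 0 ℓ) :
    IntervalIntegrable (fun ξ => φ ξ * w ξ) volume x y :=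
  (intervalIntegrable_coeFn w hx hy).continuousOn_mul hφ.continuousOn

lemma abs_volterra_le {k : C(ℝ × ℝ, ℝ)} {C : ℝ}
    (hC : ∀ x ∈ Icc (0 : ℝ) ℓ, ∀ ξ ∈ Icc (0 : ℝ) ℓ, |k (x, ξ)| ≤ C) (w : L2 ℓ) {x : ℝ}
    (hx : x ∈ Icc 0 ℓ) : |volterra k w x| ≤ C * ∫ ξ in (0 : ℝ)..x, |w ξ| := by
  have h0 : (0 : ℝ) ∈ Icc 0 ℓ := ⟨le_rfl, hx.1.trans hx.2⟩
  refine (intervalIntegral.abs_integral_le_integral_abs hx.1).trans ?_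
  rw [← intervalIntegral.integral_const_mul]
  refine intervalIntegral.integral_mono_on hx.1 ?_ ?_ fun ξ hξ => ?_
  · exact (intervalIntegrable_mul_coeFn (by fun_prop) w h0 hx).abs
  · exact (intervalIntegrable_coeFn w h0 hx).abs.const_mul C
  · rw [abs_mul]
    exact mul_le_mul_of_nonneg_right (hC x hx ξ ⟨hξ.1, hξ.2.trans hx.2⟩) (abs_nonneg _)

lemma abs_volterra_le_norm {k : C(ℝ × ℝ, ℝ)} {C : ℝ} (hC0 : 0 ≤ C)
    (hC : ∀ x ∈ Icc (0 : ℝ) ℓ, ∀ ξ ∈ Icc (0 : ℝ) ℓ, |k (x, ξ)| ≤ C) (w : L2 ℓ) {x : ℝ}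
    (hx : x ∈ Icc 0 ℓ) : |volterra k w x| ≤ C * √ℓ * ‖w‖ := by
  refine (abs_volterra_le hC w hx).trans ?_
  rw [mul_assoc]
  refine mul_le_mul_of_nonneg_left (le_trans ?_ (integral_abs_le (hx.1.trans hx.2) w)) hC0
  exact intervalIntegral.integral_mono_interval le_rfl hx.1 hx.2
    (Eventually.of_forall fun _ => abs_nonneg _)
    (intervalIntegrable_coeFn w ⟨le_rfl, hx.1.trans hx.2⟩ ⟨hx.1.trans hx.2, le_rfl⟩).abs

lemma integrableOn_kernel_mul (k : C(ℝ × ℝ, ℝ)) (w : L2 ℓ) (φ : C(ℝ, ℝ)) :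
    IntegrableOn (fun z : ℝ × ℝ => k z * w z.2 * φ z.1) (Ioc 0 ℓ ×ˢ Ioc 0 ℓ) := by
  obtain ⟨C, hC0, hC⟩ := exists_bound_square ℓ k
  obtain ⟨D, hD0, hD⟩ := exists_bound_Icc ℓ φ
  have h1 : Integrable (fun z : ℝ × ℝ => (1 : ℝ) * w z.2)
      ((volume.restrict (Ioc 0 ℓ)).prod (volume.restrict (Ioc 0 ℓ))) :=
    Integrable.mul_prod (integrable_const 1) (integrableOn_Ioc_coeFn w)
  rw [IntegrableOn, Measure.volume_eq_prod, ← Measure.prod_restrict]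
  refine (h1.norm.const_mul (C * D)).mono' ?_ ?_
  · have h2 := h1.aestronglyMeasurable
    simp only [one_mul] at h2
    exact (k.continuous.aestronglyMeasurable.mul h2).mul
      (φ.continuous.comp continuous_fst).aestronglyMeasurable
  · rw [Measure.prod_restrict]
    filter_upwards [ae_restrict_mem (measurableSet_Ioc.prod measurableSet_Ioc)] with z hz
    have hz1 := Ioc_subset_Icc_self hz.1
    have hz2 := Ioc_subset_Icc_self hz.2
    simp only [norm_mul, Real.norm_eq_abs, one_mul]
    calc |k z| * |w z.2| * |φ z.1| ≤ C * |w z.2| * D := by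
          gcongr
          · exact hC _ hz1 _ hz2
          · exact hD _ hz1
      _ = _ := by ring

lemma memLp_volterra (k : C(ℝ × ℝ, ℝ)) (w : L2 ℓ) :
    MemLp (volterra k w) 2 (volume.restrict (Ioo (0 : ℝ) ℓ)) := by
  obtain ⟨C, hC0, hC⟩ := exists_bound_square ℓ k
  refine MemLp.of_bound ?_ (C * √ℓ * ‖w‖) ?_
  · have h1 := (integrableOn_kernel_mul k w 1).indicator
      (measurableSet_le measurable_snd measurable_fst)
    rw [IntegrableOn, Measure.volume_eq_prod, ← Measure.prod_restrict] at h1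
    have h2 := h1.aestronglyMeasurable.integral_prod_right'
    refine (h2.mono_measure (Measure.restrict_mono Ioo_subset_Ioc_self le_rfl)).congr ?_
    filter_upwards [ae_restrict_mem measurableSet_Ioo] with x hx
    have : (fun ξ => {z : ℝ × ℝ | z.2 ≤ z.1}.indicator
        (fun z : ℝ × ℝ => k z * w z.2 * (1 : C(ℝ, ℝ)) z.1) (x, ξ))
        = (Iic x).indicator (fun ξ => k (x, ξ) * w ξ) := by
      ext ξ
      simp only [indicator, mem_ofPred_eq, mem_Iic, ContinuousMap.one_apply, mul_one]
    rw [this, setIntegral_indicator measurableSet_Iic, Ioc_inter_Iic, min_eq_right hx.2.le,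
      volterra, intervalIntegral.integral_of_le hx.1.le]
  · filter_upwards [ae_restrict_mem measurableSet_Ioo] with x hx
    exact abs_volterra_le_norm hC0 hC w (Ioo_subset_Icc_self hx)

lemma volterra_add (k : C(ℝ × ℝ, ℝ)) (v w : L2 ℓ) {x : ℝ} (hx : x ∈ Icc 0 ℓ) :
    volterra k (v + w : L2 ℓ) x = volterra k v x + volterra k w x := by
  have h0 : (0 : ℝ) ∈ Icc 0 ℓ := ⟨le_rfl, hx.1.trans hx.2⟩
  rw [volterra, volterra, volterra, ← intervalIntegral.integral_add
    (intervalIntegrable_mul_coeFn (by fun_prop) v h0 hx)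
    (intervalIntegrable_mul_coeFn (by fun_prop) w h0 hx)]
  rw [intervalIntegral.integral_of_le hx.1, intervalIntegral.integral_of_le hx.1,
    integral_Ioc_eq_integral_Ioo, integral_Ioc_eq_integral_Ioo]
  refine integral_congr_ae (ae_restrict_of_ae_restrict_of_subset (Ioo_subset_Ioo_right hx.2) ?_)
  filter_upwards [Lp.coeFn_add v w] with ξ h
  rw [h, Pi.add_apply, mul_add]

lemma volterra_smul (k : C(ℝ × ℝ, ℝ)) (c : ℝ) (w : L2 ℓ) {x : ℝ} (hx : x ∈ Icc 0 ℓ) :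
    volterra k (c • w : L2 ℓ) x = c * volterra k w x := by
  rw [volterra, volterra, ← intervalIntegral.integral_const_mul]
  rw [intervalIntegral.integral_of_le hx.1, intervalIntegral.integral_of_le hx.1,
    integral_Ioc_eq_integral_Ioo, integral_Ioc_eq_integral_Ioo]
  refine integral_congr_ae (ae_restrict_of_ae_restrict_of_subset (Ioo_subset_Ioo_right hx.2) ?_)
  filter_upwards [Lp.coeFn_smul c w] with ξ h
  rw [h, Pi.smul_apply, smul_eq_mul]; ring

/-- The Volterra operator with kernel `k` on `L²(0,ℓ)`. -/
def volH (ℓ : ℝ) (k : C(ℝ × ℝ, ℝ)) : L2 ℓ →L[ℝ] L2 ℓ :=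
  LinearMap.mkContinuous
    { toFun := fun w => (memLp_volterra k w).toLp _
      map_add' := fun v w => by
        ext1
        filter_upwards [(memLp_volterra k (v + w)).coeFn_toLp, (memLp_volterra k v).coeFn_toLp,
          (memLp_volterra k w).coeFn_toLp, ae_restrict_mem measurableSet_Ioo,
          Lp.coeFn_add ((memLp_volterra k v).toLp _) ((memLp_volterra k w).toLp _)]
          with x h1 h2 h3 h4 h5
        rw [h1, h5, Pi.add_apply, h2, h3, volterra_add k v w (Ioo_subset_Icc_self h4)]
      map_smul' := fun c w => by
        ext1
        filter_upwards [(memLp_volterra k (c • w)).coeFn_toLp, (memLp_volterra k w).coeFn_toLp,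
          ae_restrict_mem measurableSet_Ioo,
          Lp.coeFn_smul c ((memLp_volterra k w).toLp _)] with x h1 h2 h4 h5
        simp only [RingHom.id_apply]
        rw [h1, h5, Pi.smul_apply, h2, volterra_smul k c w (Ioo_subset_Icc_self h4), smul_eq_mul] }
    (((volume.restrict (Ioo (0 : ℝ) ℓ)) univ).toNNReal ^ ((2 : ℝ≥0∞).toReal)⁻¹ *
      ((exists_bound_square ℓ k).choose * √ℓ))
    (fun w => by
      have hC := (exists_bound_square ℓ k).choose_spec
      rw [mul_assoc]
      refine (Lp.norm_le_of_ae_bound (C := (exists_bound_square ℓ k).choose * √ℓ * ‖w‖) ?_ ?_).trans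
        (le_of_eq ?_)
      · have := hC.1; positivity
      · filter_upwards [(memLp_volterra k w).coeFn_toLp, ae_restrict_mem measurableSet_Ioo]
          with x h1 h2
        simp only [LinearMap.coe_mk, AddHom.coe_mk]
        rw [h1]
        exact abs_volterra_le_norm hC.1 hC.2 w (Ioo_subset_Icc_self h2)
      · simp [measureUnivNNReal])

lemma coeFn_volH (k : C(ℝ × ℝ, ℝ)) (w : L2 ℓ) :
    volH ℓ k w =ᵐ[volume.restrict (Ioo (0 : ℝ) ℓ)] volterra k w :=
  (memLp_volterra k w).coeFn_toLp

/-- The adjoint Volterra integral `∫_ξ^ℓ k(x,ξ) φ(x) dx` of a continuous function. -/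
def adjVolterra (ℓ : ℝ) (k : C(ℝ × ℝ, ℝ)) (φ : C(ℝ, ℝ)) : C(ℝ, ℝ) where
  toFun ξ := ∫ x in ξ..ℓ, k (x, ξ) * φ x
  continuous_toFun := by
    have h : Continuous fun ξ : ℝ => ∫ x in ℓ..ξ, k (x, ξ) * φ x :=
      intervalIntegral.continuous_parametric_intervalIntegral_of_continuous
        (f := fun ξ x => k (x, ξ) * φ x) (by fun_prop) continuous_id
    simp_rw [intervalIntegral.integral_symm ℓ]
    exact h.neg

lemma inner_volH_emb (hℓ : 0 ≤ ℓ) (k : C(ℝ × ℝ, ℝ)) (w : L2 ℓ) (φ : C(ℝ, ℝ)) :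
    inner ℝ (volH ℓ k w) (emb ℓ φ) = inner ℝ w (emb ℓ (adjVolterra ℓ k φ)) := by
  rw [inner_emb hℓ, inner_emb hℓ]
  rw [intervalIntegral_congr_ae hℓ (g := fun x => ∫ ξ in (0 : ℝ)..x, k (x, ξ) * w ξ * φ x)]
  · rw [integral_triangle_swap hℓ (F := fun x ξ => k (x, ξ) * w ξ * φ x)
      (integrableOn_kernel_mul k w φ)]
    refine intervalIntegral.integral_congr fun ξ _ => ?_
    simp only [adjVolterra, ContinuousMap.coe_mk]
    rw [← intervalIntegral.integral_const_mul]
    exact intervalIntegral.integral_congr fun x _ => by ring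
  · filter_upwards [coeFn_volH k w] with x hx
    rw [hx, volterra, ← intervalIntegral.integral_mul_const]

end Basic

/-! ### Continuously differentiable kernels -/

/-- `k` has the continuous partial derivatives `kx` and `kξ` on the triangle `0 ≤ ξ ≤ x ≤ ℓ`. -/
structure IsC1Kernel (ℓ : ℝ) (k kx kξ : C(ℝ × ℝ, ℝ)) : Prop where
  fst : ∀ ξ x y, 0 ≤ ξ → ξ ≤ x → x ≤ y → y ≤ ℓ → k (y, ξ) - k (x, ξ) = ∫ s in x..y, kx (s, ξ)
  snd : ∀ x ξ ζ, 0 ≤ ξ → ξ ≤ ζ → ζ ≤ x → x ≤ ℓ → k (x, ζ) - k (x, ξ) = ∫ s in ξ..ζ, kξ (x, s)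

section Kernels

variable {ℓ : ℝ} {k kx kξ : C(ℝ × ℝ, ℝ)}

lemma emb_congr {φ ψ : C(ℝ, ℝ)} (h : ∀ x ∈ Icc 0 ℓ, φ x = ψ x) : emb ℓ φ = emb ℓ ψ := by
  ext1
  filter_upwards [coeFn_emb (ℓ := ℓ) φ, coeFn_emb (ℓ := ℓ) ψ, ae_restrict_mem measurableSet_Ioo]
    with x h1 h2 h3
  rw [h1, h2, h x (Ioo_subset_Icc_self h3)]

lemma integral_triangle_swap_continuous {a b : ℝ} (hab : a ≤ b) (F : C(ℝ × ℝ, ℝ)) :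
    ∫ x in a..b, ∫ ξ in a..x, F (x, ξ) = ∫ ξ in a..b, ∫ x in ξ..b, F (x, ξ) := by
  refine integral_triangle_swap hab (F := fun x ξ => F (x, ξ)) ?_
  refine (F.continuous.continuousOn.integrableOn_compact
    (isCompact_Icc.prod isCompact_Icc)).mono_set
    (prod_mono (Ioc_subset_Icc_self (a := a) (b := b)) (Ioc_subset_Icc_self (a := a) (b := b)))

lemma IsC1Kernel.adjVolterra_eq (hk : IsC1Kernel ℓ k kx kξ) (φ : C(ℝ, ℝ)) {ξ : ℝ}
    (hξ : ξ ∈ Icc 0 ℓ) :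
    adjVolterra ℓ k φ ξ = ∫ s in ξ..ℓ, (k (s, s) * φ s - adjVolterra ℓ kξ φ s) := by
  have h1 : adjVolterra ℓ k φ ξ
      = ∫ x in ξ..ℓ, (k (x, x) * φ x - ∫ s in ξ..x, kξ (x, s) * φ x) := by
    simp only [adjVolterra, ContinuousMap.coe_mk]
    refine intervalIntegral.integral_congr fun x hx => ?_
    rw [uIcc_of_le hξ.2] at hx
    rw [intervalIntegral.integral_mul_const, ← hk.snd x ξ x hξ.1 hx.1 le_rfl hx.2]
    ring
  have hc : Continuous fun x : ℝ => ∫ s in ξ..x, kξ (x, s) * φ x :=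
    intervalIntegral.continuous_parametric_intervalIntegral_of_continuous
      (f := fun x s => kξ (x, s) * φ x) (by fun_prop) continuous_id
  rw [h1, intervalIntegral.integral_sub, intervalIntegral.integral_sub]
  · congr 1
    exact integral_triangle_swap_continuous hξ.2 ⟨fun z => kξ z * φ z.1, by fun_prop⟩
  · exact Continuous.intervalIntegrable (by fun_prop) _ _
  · exact Continuous.intervalIntegrable (by fun_prop) _ _
  · exact Continuous.intervalIntegrable (by fun_prop) _ _
  · exact hc.intervalIntegrable _ _

/-- The derivative of `adjVolterra ℓ k φ`. -/
def adjVolterraDeriv (ℓ : ℝ) (k kξ : C(ℝ × ℝ, ℝ)) (φ : C(ℝ, ℝ)) : C(ℝ, ℝ) :=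
  ⟨fun s => adjVolterra ℓ kξ φ s - k (s, s) * φ s, by fun_prop⟩

/-- A continuously differentiable function on `ℝ` that agrees with `adjVolterra ℓ k φ` on
`[0,ℓ]`. -/
def adjVolterraExt (ℓ : ℝ) (k kξ : C(ℝ × ℝ, ℝ)) (φ : C(ℝ, ℝ)) : C(ℝ, ℝ) :=
  ⟨fun ξ => ∫ s in ℓ..ξ, adjVolterraDeriv ℓ k kξ φ s,
    intervalIntegral.continuous_primitive
      (fun _ _ => (map_continuous _).intervalIntegrable _ _) _⟩

lemma hasDerivAt_adjVolterraExt (φ : C(ℝ, ℝ)) (x : ℝ) :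
    HasDerivAt (adjVolterraExt ℓ k kξ φ) (adjVolterraDeriv ℓ k kξ φ x) x :=
  intervalIntegral.integral_hasDerivAt_right ((map_continuous _).intervalIntegrable _ _)
    (map_continuous (adjVolterraDeriv ℓ k kξ φ)).stronglyMeasurable.stronglyMeasurableAtFilter
    (map_continuous (adjVolterraDeriv ℓ k kξ φ)).continuousAt

lemma IsC1Kernel.adjVolterraExt_eq (hk : IsC1Kernel ℓ k kx kξ) (φ : C(ℝ, ℝ)) {ξ : ℝ}
    (hξ : ξ ∈ Icc 0 ℓ) : adjVolterraExt ℓ k kξ φ ξ = adjVolterra ℓ k φ ξ := by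
  rw [hk.adjVolterra_eq φ hξ]
  simp only [adjVolterraExt, adjVolterraDeriv, ContinuousMap.coe_mk]
  rw [intervalIntegral.integral_symm, ← intervalIntegral.integral_neg]
  exact intervalIntegral.integral_congr fun s _ => by ring

lemma IsC1Kernel.adjVolterra_deriv_eq (hk : IsC1Kernel ℓ k kx kξ) {φ φ' : C(ℝ, ℝ)}
    (hφ : ∀ x, HasDerivAt φ (φ' x) x) {ξ : ℝ} (hξ : ξ ∈ Icc 0 ℓ) :
    adjVolterra ℓ k φ' ξ = k (ℓ, ξ) * φ ℓ - k (ξ, ξ) * φ ξ - adjVolterra ℓ kx φ ξ := by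
  have hd : ∀ x, HasDerivAt (fun x => k (ξ, ξ) + ∫ s in ξ..x, kx (s, ξ)) (kx (x, ξ)) x :=
    fun x => (intervalIntegral.integral_hasDerivAt_right
      (Continuous.intervalIntegrable (by fun_prop) _ _)
      (Continuous.stronglyMeasurable (by fun_prop)).stronglyMeasurableAtFilter
      (Continuous.continuousAt (by fun_prop))).const_add _
  have he : ∀ x ∈ Icc ξ ℓ, k (x, ξ) = k (ξ, ξ) + ∫ s in ξ..x, kx (s, ξ) := fun x hx => by
    rw [← hk.fst ξ ξ x hξ.1 le_rfl hx.1 hx.2]; ring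
  have := intervalIntegral.integral_mul_deriv_eq_deriv_mul (a := ξ) (b := ℓ)
    (fun x _ => hd x) (fun x _ => hφ x) (Continuous.intervalIntegrable (by fun_prop) _ _)
    (Continuous.intervalIntegrable (by fun_prop) _ _)
  simp only [adjVolterra, ContinuousMap.coe_mk]
  rw [intervalIntegral.integral_congr (g := fun x => (k (ξ, ξ) + ∫ s in ξ..x, kx (s, ξ)) * φ' x),
    this, ← he ℓ ⟨hξ.2, le_rfl⟩]
  · simp
  · intro x hx
    rw [uIcc_of_le hξ.2] at hx
    simp only
    rw [he x hx]

end Kernels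

/-! ### Weak solutions of transport equations -/

/-- `w` is a weak solution of `∂ₜw + a ∂ₓw = F` with boundary traces `w0` and `wL`. -/
def WeakTransport (ℓ a : ℝ) (w : ℝ → L2 ℓ) (w0 wL : ℝ → ℝ) (F : ℝ → L2 ℓ) : Prop :=
  ∀ φ φ' : C(ℝ, ℝ), (∀ x, HasDerivAt φ (φ' x) x) → ∀ t, 0 ≤ t →
    inner ℝ (w t) (emb ℓ φ) = inner ℝ (w 0) (emb ℓ φ) +
      ∫ s in (0 : ℝ)..t, (a * inner ℝ (w s) (emb ℓ φ') + a * (w0 s * φ 0 - wL s * φ ℓ)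
        + inner ℝ (F s) (emb ℓ φ))

lemma IsTrace.intervalIntegrable {y : ℝ → ℝ} (hy : IsTrace y) {s t : ℝ} (hs : 0 ≤ s) (ht : 0 ≤ t) :
    IntervalIntegrable y volume s t := by
  rw [intervalIntegrable_iff]
  have : IntegrableOn y (Ioc 0 (max s t)) := (hy (max s t)).integrable (by norm_num)
  refine this.mono_set ?_
  rw [uIoc]
  exact Ioc_subset_Ioc_left (le_min hs ht)

lemma IsTrace.sq_intervalIntegrable {y : ℝ → ℝ} (hy : IsTrace y) {s t : ℝ} (hs : 0 ≤ s)
    (ht : 0 ≤ t) : IntervalIntegrable (fun r => y r ^ 2) volume s t := by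
  rw [intervalIntegrable_iff]
  have : IntegrableOn (fun r => y r ^ 2) (Ioc 0 (max s t)) := (hy (max s t)).integrable_sq
  refine this.mono_set ?_
  rw [uIoc]
  exact Ioc_subset_Ioc_left (le_min hs ht)

lemma ContinuousOn.intervalIntegrable_Ici {f : ℝ → ℝ} (hf : ContinuousOn f (Ici 0)) {s t : ℝ}
    (hs : 0 ≤ s) (ht : 0 ≤ t) : IntervalIntegrable f volume s t :=
  (hf.mono fun _ hx => (le_min hs ht).trans hx.1).intervalIntegrable

/-- Locally integrable in the weak sense on `[0,∞)`. -/
def WeakIntegrable {ℓ : ℝ} (F : ℝ → L2 ℓ) : Prop :=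
  ∀ (h : L2 ℓ) (t : ℝ), 0 ≤ t → IntervalIntegrable (fun s => inner ℝ (F s) h) volume 0 t

section WeakIntegrable

variable {ℓ : ℝ}

lemma WeakIntegrable.add {F G : ℝ → L2 ℓ} (hF : WeakIntegrable F) (hG : WeakIntegrable G) :
    WeakIntegrable fun s => F s + G s := fun h t ht => by
  simp only [inner_add_left]
  exact (hF h t ht).add (hG h t ht)

lemma WeakIntegrable.clm {F : ℝ → L2 ℓ} (hF : WeakIntegrable F) (T : L2 ℓ →L[ℝ] L2 ℓ) :
    WeakIntegrable fun s => T (F s) := fun h t ht => by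
  have := hF (ContinuousLinearMap.adjoint T h) t ht
  simpa only [ContinuousLinearMap.adjoint_inner_right] using this

lemma WeakIntegrable.of_continuousOn {F : ℝ → L2 ℓ} (hF : ContinuousOn F (Ici 0)) :
    WeakIntegrable F := fun _ _ ht =>
  ContinuousOn.intervalIntegrable_Ici (hF.inner continuousOn_const) le_rfl ht

lemma IsTrace.weakIntegrable_smul {y : ℝ → ℝ} (hy : IsTrace y) (p : L2 ℓ) :
    WeakIntegrable fun s => y s • p := fun h t ht => by
  simp only [inner_smul_left]
  exact (hy.intervalIntegrable le_rfl ht).mul_const _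

end WeakIntegrable

lemma WeakTransport.intervalIntegrable {ℓ a : ℝ} {w F : ℝ → L2 ℓ} {w0 wL : ℝ → ℝ}
    (hw : ContinuousOn w (Ici 0)) (h0 : IsTrace w0) (hL : IsTrace wL) (hF : WeakIntegrable F)
    (φ φ' : C(ℝ, ℝ)) {t : ℝ} (ht : 0 ≤ t) :
    IntervalIntegrable (fun s => a * inner ℝ (w s) (emb ℓ φ') + a * (w0 s * φ 0 - wL s * φ ℓ)
        + inner ℝ (F s) (emb ℓ φ)) volume 0 t :=
  (((WeakIntegrable.of_continuousOn hw _ t ht).const_mul a).add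
    ((((h0.intervalIntegrable le_rfl ht).mul_const _).sub
      ((hL.intervalIntegrable le_rfl ht).mul_const _)).const_mul a)).add (hF _ t ht)

/-! ### Volterra transformations of hyperbolic systems -/

/-- `y = w + ∫ M w` transforms the system `∂ₜw + s ∂ₓw = Cin w` into `∂ₜy + s ∂ₓy = Cout y`, up to
boundary terms. -/
structure IsTransformKernel (ℓ : ℝ) (s : Fin 2 → ℝ) (M Mx Mξ : Fin 2 → Fin 2 → C(ℝ × ℝ, ℝ))
    (Cin Cout : Fin 2 → Fin 2 → C(ℝ, ℝ)) : Prop where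
  c1 : ∀ i j, IsC1Kernel ℓ (M i j) (Mx i j) (Mξ i j)
  pde : ∀ i j x ξ, 0 ≤ ξ → ξ ≤ x → x ≤ ℓ →
    s i * Mx i j (x, ξ) + s j * Mξ i j (x, ξ)
      = ∑ n, Cout i n x * M n j (x, ξ) - ∑ n, M i n (x, ξ) * Cin n j ξ
  diag : ∀ i j x, x ∈ Icc 0 ℓ → (s i - s j) * M i j (x, x) = Cout i j x - Cin i j x

section Transform

variable {ℓ : ℝ} {s : Fin 2 → ℝ} {M Mx Mξ : Fin 2 → Fin 2 → C(ℝ × ℝ, ℝ)}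
  {Cin Cout : Fin 2 → Fin 2 → C(ℝ, ℝ)}

/-- The trace `M(ℓ,·)`. -/
def rowEnd (ℓ : ℝ) (k : C(ℝ × ℝ, ℝ)) : C(ℝ, ℝ) := ⟨fun ξ => k (ℓ, ξ), by fun_prop⟩

/-- The trace `M(·,0)`. -/
def colZero (k : C(ℝ × ℝ, ℝ)) : C(ℝ, ℝ) := ⟨fun x => k (x, 0), by fun_prop⟩

/-- The transformation `w ↦ w + ∫ M w`. -/
def transform (ℓ : ℝ) (M : Fin 2 → Fin 2 → C(ℝ × ℝ, ℝ)) (w : Fin 2 → L2 ℓ) (i : Fin 2) : L2 ℓ :=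
  w i + ∑ j, volH ℓ (M i j) (w j)

lemma IsTransformKernel.test_identity (h : IsTransformKernel ℓ s M Mx Mξ Cin Cout)
    {φ φ' : C(ℝ, ℝ)} (hφ : ∀ x, HasDerivAt φ (φ' x) x) (i j : Fin 2) {ξ : ℝ} (hξ : ξ ∈ Icc 0 ℓ) :
    Cin i j ξ * φ ξ + s j * adjVolterraDeriv ℓ (M i j) (Mξ i j) φ ξ
        + ∑ n, Cin n j ξ * adjVolterra ℓ (M i n) φ ξ
      = s i * adjVolterra ℓ (M i j) φ' ξ - s i * φ ℓ * rowEnd ℓ (M i j) ξ + Cout i j ξ * φ ξ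
        + ∑ n, adjVolterra ℓ (M n j) (Cout i n * φ) ξ := by
  rw [(h.c1 i j).adjVolterra_deriv_eq hφ hξ]
  have h1 : s i * adjVolterra ℓ (Mx i j) φ ξ + s j * adjVolterra ℓ (Mξ i j) φ ξ
      + ∑ n, Cin n j ξ * adjVolterra ℓ (M i n) φ ξ
      - ∑ n, adjVolterra ℓ (M n j) (Cout i n * φ) ξ = 0 := by
    simp only [adjVolterra, ContinuousMap.coe_mk, Fin.sum_univ_two, ContinuousMap.mul_apply]
    simp only [← intervalIntegral.integral_const_mul]
    have hi : ∀ f : ℝ → ℝ, Continuous f → IntervalIntegrable f volume ξ ℓ :=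
      fun f hf => hf.intervalIntegrable _ _
    rw [← intervalIntegral.integral_add (hi _ (by fun_prop)) (hi _ (by fun_prop)),
      ← intervalIntegral.integral_add (hi _ (by fun_prop)) (hi _ (by fun_prop)),
      ← intervalIntegral.integral_add (hi _ (by fun_prop)) (hi _ (by fun_prop)),
      ← intervalIntegral.integral_add (hi _ (by fun_prop)) (hi _ (by fun_prop)),
      ← intervalIntegral.integral_sub (hi _ (by fun_prop)) (hi _ (by fun_prop))]
    rw [intervalIntegral.integral_congr (g := fun _ => 0)]
    · simp
    · intro x hx
      rw [uIcc_of_le hξ.2] at hx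
      have := h.pde i j x ξ hξ.1 hx.1 hx.2
      simp only [Fin.sum_univ_two] at this
      linear_combination φ x * this
  have h2 := h.diag i j ξ hξ
  simp only [adjVolterraDeriv, rowEnd, ContinuousMap.coe_mk]
  linear_combination h1 + φ ξ * h2

lemma IsTransformKernel.weakTransport (hℓ : 0 ≤ ℓ)
    (h : IsTransformKernel ℓ s M Mx Mξ Cin Cout)
    {w f : Fin 2 → ℝ → L2 ℓ} {w0 wL : Fin 2 → ℝ → ℝ}
    (hw : ∀ i, ContinuousOn (w i) (Ici 0)) (h0 : ∀ i, IsTrace (w0 i)) (hL : ∀ i, IsTrace (wL i))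
    (hf : ∀ i, WeakIntegrable (f i))
    (hT : ∀ i, WeakTransport ℓ (s i) (w i) (w0 i) (wL i)
      fun t => ∑ j, mulH ℓ (Cin i j) (w j t) + f i t) (i : Fin 2) :
    WeakTransport ℓ (s i) (fun t => transform ℓ M (fun j => w j t) i) (w0 i)
      (fun t => wL i t + ∑ j, inner ℝ (w j t) (emb ℓ (rowEnd ℓ (M i j))))
      (fun t => ∑ j, mulH ℓ (Cout i j) (transform ℓ M (fun j => w j t) j)
        + transform ℓ M (fun j => f j t) i
        + ∑ j, (s j * w0 j t) • emb ℓ (colZero (M i j))) := by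
  intro φ φ' hφ t ht
  set ψ : Fin 2 → C(ℝ, ℝ) := fun j => adjVolterraExt ℓ (M i j) (Mξ i j) φ
  set ψ' : Fin 2 → C(ℝ, ℝ) := fun j => adjVolterraDeriv ℓ (M i j) (Mξ i j) φ
  have hψ : ∀ j, emb ℓ (ψ j) = emb ℓ (adjVolterra ℓ (M i j) φ) := fun j =>
    emb_congr fun x hx => (h.c1 i j).adjVolterraExt_eq φ hx
  have hψ0 : ∀ j, ψ j 0 = ∫ x in (0 : ℝ)..ℓ, M i j (x, 0) * φ x := fun j => by
    rw [(h.c1 i j).adjVolterraExt_eq φ ⟨le_rfl, hℓ⟩]; rfl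
  have hψL : ∀ j, ψ j ℓ = 0 := fun j => by
    rw [(h.c1 i j).adjVolterraExt_eq φ ⟨hℓ, le_rfl⟩]; simp [adjVolterra]
  have hcol : ∀ j, inner ℝ (emb ℓ (colZero (M i j))) (emb ℓ φ) = ψ j 0 := fun j => by
    rw [hψ0, inner_emb hℓ]
    refine intervalIntegral_congr_ae hℓ ?_
    filter_upwards [coeFn_emb (ℓ := ℓ) (colZero (M i j))] with x hx
    rw [hx]; rfl
  have hF : ∀ i, WeakIntegrable fun t => ∑ j, mulH ℓ (Cin i j) (w j t) + f i t := fun i => by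
    simp only [Fin.sum_univ_two]
    exact (((WeakIntegrable.of_continuousOn (hw 0)).clm _).add
      ((WeakIntegrable.of_continuousOn (hw 1)).clm _)).add (hf i)
  have e0 := hT i φ φ' hφ t ht
  have e1 := fun j => hT j (ψ j) (ψ' j) (fun x => hasDerivAt_adjVolterraExt φ x) t ht
  have i0 := WeakTransport.intervalIntegrable (a := s i) (hw i) (h0 i) (hL i) (hF i) φ φ' ht
  have i1 := fun j =>
    WeakTransport.intervalIntegrable (a := s j) (hw j) (h0 j) (hL j) (hF j) (ψ j) (ψ' j) ht
  have hy : ∀ t, inner ℝ (transform ℓ M (fun j => w j t) i) (emb ℓ φ)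
      = inner ℝ (w i t) (emb ℓ φ) + inner ℝ (w 0 t) (emb ℓ (ψ 0))
        + inner ℝ (w 1 t) (emb ℓ (ψ 1)) := fun t => by
    simp only [transform, Fin.sum_univ_two, inner_add_left, inner_volH_emb hℓ, hψ]
    ring
  rw [hy, hy, e0, e1 0, e1 1]
  have key : ∀ r, (s i * inner ℝ (transform ℓ M (fun j => w j r) i) (emb ℓ φ')
      + s i * (w0 i r * φ 0
        - (wL i r + ∑ j, inner ℝ (w j r) (emb ℓ (rowEnd ℓ (M i j)))) * φ ℓ)
      + inner ℝ (∑ j, mulH ℓ (Cout i j) (transform ℓ M (fun j => w j r) j)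
        + transform ℓ M (fun j => f j r) i
        + ∑ j, (s j * w0 j r) • emb ℓ (colZero (M i j))) (emb ℓ φ))
      = (s i * inner ℝ (w i r) (emb ℓ φ') + s i * (w0 i r * φ 0 - wL i r * φ ℓ)
          + inner ℝ (∑ j, mulH ℓ (Cin i j) (w j r) + f i r) (emb ℓ φ))
        + (s 0 * inner ℝ (w 0 r) (emb ℓ (ψ' 0)) + s 0 * (w0 0 r * ψ 0 0 - wL 0 r * ψ 0 ℓ)
          + inner ℝ (∑ j, mulH ℓ (Cin 0 j) (w j r) + f 0 r) (emb ℓ (ψ 0)))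
        + (s 1 * inner ℝ (w 1 r) (emb ℓ (ψ' 1)) + s 1 * (w0 1 r * ψ 1 0 - wL 1 r * ψ 1 ℓ)
          + inner ℝ (∑ j, mulH ℓ (Cin 1 j) (w j r) + f 1 r) (emb ℓ (ψ 1))) := by
    intro r
    have hk : ∀ j, inner ℝ (w j r) (emb ℓ (Cin i j * φ)) + s j * inner ℝ (w j r) (emb ℓ (ψ' j))
        + ∑ n, inner ℝ (w j r) (emb ℓ (Cin n j * adjVolterra ℓ (M i n) φ))
        = s i * inner ℝ (w j r) (emb ℓ (adjVolterra ℓ (M i j) φ'))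
          - s i * φ ℓ * inner ℝ (w j r) (emb ℓ (rowEnd ℓ (M i j)))
          + inner ℝ (w j r) (emb ℓ (Cout i j * φ))
          + ∑ n, inner ℝ (w j r) (emb ℓ (adjVolterra ℓ (M n j) (Cout i n * φ))) := by
      intro j
      have := congrArg (inner ℝ (w j r)) (emb_congr (ℓ := ℓ)
        (φ := Cin i j * φ + s j • ψ' j + ∑ n, Cin n j * adjVolterra ℓ (M i n) φ)
        (ψ := s i • adjVolterra ℓ (M i j) φ' + (-(s i * φ ℓ)) • rowEnd ℓ (M i j) + Cout i j * φ
          + ∑ n, adjVolterra ℓ (M n j) (Cout i n * φ)) fun ξ hξ => by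
        have := h.test_identity hφ i j hξ
        simp only [Fin.sum_univ_two, ContinuousMap.add_apply, ContinuousMap.mul_apply,
          ContinuousMap.smul_apply, smul_eq_mul] at this ⊢
        linear_combination this)
      simp only [Fin.sum_univ_two, emb_add, emb_smul, inner_add_right, inner_smul_right] at this ⊢
      linear_combination this
    have k0 := hk 0
    have k1 := hk 1
    simp only [transform, Fin.sum_univ_two, inner_add_left, map_add, inner_smul_left,
      inner_mulH_comm hℓ, mulH_emb, inner_volH_emb hℓ, hψ, hψL, hcol, RCLike.conj_to_real]
      at k0 k1 ⊢
    linear_combination -k0 - k1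
  rw [intervalIntegral.integral_congr fun r _ => key r,
    intervalIntegral.integral_add (i0.add (i1 0)) (i1 1), intervalIntegral.integral_add i0 (i1 0)]
  ring

end Transform

/-! ### Kernels on the closed triangle -/

section Triangle

variable {ℓ : ℝ}

/-- Retraction of the plane onto the triangle. -/
def triangleRetract (ℓ : ℝ) (z : ℝ × ℝ) : ℝ × ℝ :=
  (max 0 (min z.1 ℓ), max 0 (min z.2 (max 0 (min z.1 ℓ))))

lemma continuous_triangleRetract : Continuous (triangleRetract ℓ) := by
  unfold triangleRetract; fun_prop

lemma triangleRetract_mem (hℓ : 0 ≤ ℓ) (z : ℝ × ℝ) : triangleRetract ℓ z ∈ triangle ℓ :=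
  ⟨le_max_left _ _, max_le (le_max_left _ _) (min_le_right _ _), max_le hℓ (min_le_right _ _)⟩

lemma triangleRetract_of_mem {z : ℝ × ℝ} (hz : z ∈ triangle ℓ) : triangleRetract ℓ z = z := by
  obtain ⟨h1, h2, h3⟩ := hz
  simp only [triangleRetract, min_eq_left h3, max_eq_right (h1.trans h2), min_eq_left h2,
    max_eq_right h1]

lemma convex_triangle : Convex ℝ (triangle ℓ) := by
  rintro ⟨x, ξ⟩ ⟨h1, h2, h3⟩ ⟨y, ζ⟩ ⟨g1, g2, g3⟩ a b ha hb hab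
  simp only [triangle, mem_ofPred_eq, Prod.fst_add, Prod.snd_add, Prod.smul_fst, Prod.smul_snd,
    smul_eq_mul] at *
  refine ⟨by positivity, by gcongr, ?_⟩
  calc a * x + b * y ≤ a * ℓ + b * ℓ := by gcongr
    _ = ℓ := by rw [← add_mul, hab, one_mul]

lemma triangle_mem_nhds {x ξ : ℝ} (h1 : 0 < ξ) (h2 : ξ < x) (h3 : x < ℓ) :
    triangle ℓ ∈ 𝓝 (x, ξ) := by
  have ho : IsOpen {z : ℝ × ℝ | 0 < z.2 ∧ z.2 < z.1 ∧ z.1 < ℓ} :=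
    (isOpen_lt continuous_const continuous_snd).inter
      ((isOpen_lt continuous_snd continuous_fst).inter (isOpen_lt continuous_fst continuous_const))
  exact mem_of_superset (ho.mem_nhds ⟨h1, h2, h3⟩) fun z hz => ⟨hz.1.le, hz.2.1.le, hz.2.2.le⟩

lemma uniqueDiffOn_triangle (hℓ : 0 < ℓ) : UniqueDiffOn ℝ (triangle ℓ) :=
  uniqueDiffOn_convex convex_triangle
    ⟨(2 * ℓ / 3, ℓ / 3), mem_interior_iff_mem_nhds.2
      (triangle_mem_nhds (by linarith) (by linarith) (by linarith))⟩

lemma exists_isC1Kernel (hℓ : 0 < ℓ) {f : ℝ → ℝ → ℝ}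
    (hf : ContDiffOn ℝ 1 (fun z : ℝ × ℝ => f z.1 z.2) (triangle ℓ)) :
    ∃ k kx kξ : C(ℝ × ℝ, ℝ), IsC1Kernel ℓ k kx kξ ∧
      (∀ x ξ, 0 ≤ ξ → ξ ≤ x → x ≤ ℓ → k (x, ξ) = f x ξ) ∧
      ∀ a b x ξ, 0 < ξ → ξ < x → x < ℓ →
        dirDeriv a b f x ξ = a * kx (x, ξ) + b * kξ (x, ξ) := by
  set g : ℝ × ℝ → ℝ := fun z => f z.1 z.2
  have hu := uniqueDiffOn_triangle hℓ
  have hr : ContinuousOn (triangleRetract ℓ) univ := continuous_triangleRetract.continuousOn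
  have hm : MapsTo (triangleRetract ℓ) univ (triangle ℓ) := fun z _ => triangleRetract_mem hℓ.le z
  have hg : Continuous (g ∘ triangleRetract ℓ) := by
    rw [← continuousOn_univ]; exact hf.continuousOn.comp hr hm
  have hg' : Continuous (fderivWithin ℝ g (triangle ℓ) ∘ triangleRetract ℓ) := by
    rw [← continuousOn_univ]; exact (hf.continuousOn_fderivWithin hu le_rfl).comp hr hm
  have hd : ∀ z ∈ triangle ℓ, HasFDerivWithinAt g (fderivWithin ℝ g (triangle ℓ) z)
      (triangle ℓ) z := fun z hz => (hf.differentiableOn one_ne_zero z hz).hasFDerivWithinAt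
  refine ⟨⟨_, hg⟩, ⟨fun z => fderivWithin ℝ g (triangle ℓ) (triangleRetract ℓ z) (1, 0), ?_⟩,
    ⟨fun z => fderivWithin ℝ g (triangle ℓ) (triangleRetract ℓ z) (0, 1), ?_⟩, ⟨?_, ?_⟩, ?_, ?_⟩
  · exact hg'.clm_apply continuous_const
  · exact hg'.clm_apply continuous_const
  · intro ξ x y h0 h1 h2 h3
    refine (intervalIntegral.integral_eq_sub_of_hasDerivAt_of_le h2
      (f := fun s => g (triangleRetract ℓ (s, ξ))) ?_ ?_ ?_).symm
    · exact (hg.comp (by fun_prop : Continuous fun s : ℝ => (s, ξ))).continuousOn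
    · intro s hs
      have hmem : (s, ξ) ∈ triangle ℓ := ⟨h0, h1.trans hs.1.le, hs.2.le.trans h3⟩
      have hl : HasDerivWithinAt (fun s : ℝ => (s, ξ)) ((1 : ℝ), (0 : ℝ)) (Icc ξ ℓ) s :=
        ((hasDerivAt_id s).prodMk (hasDerivAt_const s ξ)).hasDerivWithinAt
      have := (hd _ hmem).comp_hasDerivWithinAt s hl
        (fun r hr => (⟨h0, hr.1, hr.2⟩ : (r, ξ) ∈ triangle ℓ))
      have hn : Icc ξ ℓ ∈ 𝓝 s := Icc_mem_nhds (h1.trans_lt hs.1) (hs.2.trans_le h3)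
      have h := this.hasDerivAt hn
      simp only [ContinuousMap.coe_mk, triangleRetract_of_mem hmem]
      refine h.congr_of_eventuallyEq ?_
      filter_upwards [hn] with r hr
      simp only [Function.comp_apply]
      rw [triangleRetract_of_mem (⟨h0, hr.1, hr.2⟩ : (r, ξ) ∈ triangle ℓ)]
    · refine Continuous.intervalIntegrable ?_ _ _
      exact (hg'.comp (by fun_prop : Continuous fun s : ℝ => (s, ξ))).clm_apply continuous_const
  · intro x ξ ζ h0 h1 h2 h3
    refine (intervalIntegral.integral_eq_sub_of_hasDerivAt_of_le h1
      (f := fun s => g (triangleRetract ℓ (x, s))) ?_ ?_ ?_).symm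
    · exact (hg.comp (by fun_prop : Continuous fun s : ℝ => (x, s))).continuousOn
    · intro s hs
      have hmem : (x, s) ∈ triangle ℓ := ⟨h0.trans hs.1.le, hs.2.le.trans h2, h3⟩
      have hl : HasDerivWithinAt (fun s : ℝ => (x, s)) ((0 : ℝ), (1 : ℝ)) (Icc 0 x) s :=
        ((hasDerivAt_const s x).prodMk (hasDerivAt_id s)).hasDerivWithinAt
      have := (hd _ hmem).comp_hasDerivWithinAt s hl
        (fun r hr => (⟨hr.1, hr.2, h3⟩ : (x, r) ∈ triangle ℓ))
      have hn : Icc 0 x ∈ 𝓝 s := Icc_mem_nhds (h0.trans_lt hs.1) (hs.2.trans_le h2)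
      have h := this.hasDerivAt hn
      simp only [ContinuousMap.coe_mk, triangleRetract_of_mem hmem]
      refine h.congr_of_eventuallyEq ?_
      filter_upwards [hn] with r hr
      simp only [Function.comp_apply]
      rw [triangleRetract_of_mem (⟨hr.1, hr.2, h3⟩ : (x, r) ∈ triangle ℓ)]
    · refine Continuous.intervalIntegrable ?_ _ _
      exact (hg'.comp (by fun_prop : Continuous fun s : ℝ => (x, s))).clm_apply continuous_const
  · intro x ξ h1 h2 h3
    simp only [ContinuousMap.coe_mk, Function.comp_apply]
    rw [triangleRetract_of_mem (⟨h1, h2, h3⟩ : (x, ξ) ∈ triangle ℓ)]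
  · intro a b x ξ h1 h2 h3
    have hmem : (x, ξ) ∈ triangle ℓ := ⟨h1.le, h2.le, h3.le⟩
    have h := (hd _ hmem).hasFDerivAt (triangle_mem_nhds h1 h2 h3)
    have e1 := h.comp_hasDerivAt x ((hasDerivAt_id x).prodMk (hasDerivAt_const x ξ))
    have e2 := h.comp_hasDerivAt ξ ((hasDerivAt_const ξ x).prodMk (hasDerivAt_id ξ))
    simp only [ContinuousMap.coe_mk, triangleRetract_of_mem hmem, dirDeriv]
    rw [← e1.deriv, ← e2.deriv]
    rfl

end Triangle

/-! ### Composition of kernels -/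

section Composition

variable {ℓ : ℝ}

lemma continuous_intervalIntegral_param {X : Type*} [TopologicalSpace X]
    [FirstCountableTopology X] {F : X → ℝ → ℝ} (hF : Continuous F.uncurry) {a b : X → ℝ}
    (ha : Continuous a) (hb : Continuous b) : Continuous fun z => ∫ s in a z..b z, F z s := by
  have h : ∀ z, ∫ s in a z..b z, F z s = (∫ s in (0 : ℝ)..b z, F z s) - ∫ s in (0 : ℝ)..a z, F z s :=
    fun z => by
      rw [intervalIntegral.integral_interval_sub_left] <;>
      exact Continuous.intervalIntegrable (hF.comp (by fun_prop : Continuous fun s => (z, s))) _ _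
  simp_rw [h]
  exact (intervalIntegral.continuous_parametric_intervalIntegral_of_continuous hF hb).sub
    (intervalIntegral.continuous_parametric_intervalIntegral_of_continuous hF ha)

/-- The composition `∫_ξ^x k(x,s) l(s,ξ) ds` of Volterra kernels. -/
def kconv (k l : C(ℝ × ℝ, ℝ)) : C(ℝ × ℝ, ℝ) :=
  ⟨fun z => ∫ s in z.2..z.1, k (z.1, s) * l (s, z.2),
    continuous_intervalIntegral_param (F := fun z s => k (z.1, s) * l (s, z.2)) (by fun_prop)
      continuous_snd continuous_fst⟩

lemma kconv_apply (k l : C(ℝ × ℝ, ℝ)) (x ξ : ℝ) :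
    kconv k l (x, ξ) = ∫ s in ξ..x, k (x, s) * l (s, ξ) := rfl

/-- The derivative of `kconv k l` with respect to the first variable. -/
def kconvFst (k kx l : C(ℝ × ℝ, ℝ)) : C(ℝ × ℝ, ℝ) :=
  ⟨fun z => k (z.1, z.1) * l z + kconv kx l z, by fun_prop⟩

/-- The derivative of `kconv k l` with respect to the second variable. -/
def kconvSnd (k l lξ : C(ℝ × ℝ, ℝ)) : C(ℝ × ℝ, ℝ) :=
  ⟨fun z => kconv k lξ z - k z * l (z.2, z.2), by fun_prop⟩

lemma IsC1Kernel.kconv {k kx kξ l lx lξ : C(ℝ × ℝ, ℝ)} (hk : IsC1Kernel ℓ k kx kξ)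
    (hl : IsC1Kernel ℓ l lx lξ) :
    IsC1Kernel ℓ (kconv k l) (kconvFst k kx l) (kconvSnd k l lξ) := by
  have hi : ∀ (f : ℝ → ℝ) (a b : ℝ), Continuous f → IntervalIntegrable f volume a b :=
    fun f a b hf => hf.intervalIntegrable _ _
  have h1 : ∀ ξ y, 0 ≤ ξ → ξ ≤ y → y ≤ ℓ →
      STC.kconv k l (y, ξ) = ∫ s in ξ..y, kconvFst k kx l (s, ξ) := by
    intro ξ y h0 h1 h2
    have hc : Continuous fun r => ∫ s in ξ..r, kx (r, s) * l (s, ξ) :=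
      continuous_intervalIntegral_param (F := fun r s => kx (r, s) * l (s, ξ)) (by fun_prop)
        continuous_const continuous_id
    have hc' : Continuous fun s => ∫ r in s..y, kx (r, s) * l (s, ξ) :=
      continuous_intervalIntegral_param (F := fun s r => kx (r, s) * l (s, ξ)) (by fun_prop)
        continuous_id continuous_const
    have e1 : STC.kconv k l (y, ξ)
        = ∫ s in ξ..y, (k (s, s) * l (s, ξ) + ∫ r in s..y, kx (r, s) * l (s, ξ)) := by
      rw [kconv_apply]
      refine intervalIntegral.integral_congr fun s hs => ?_
      rw [uIcc_of_le h1] at hs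
      rw [intervalIntegral.integral_mul_const,
        ← hk.fst s s y (h0.trans hs.1) le_rfl hs.2 h2]
      ring
    have sw := integral_triangle_swap_continuous h1 ⟨fun z => kx z * l (z.2, ξ), by fun_prop⟩
    simp only [ContinuousMap.coe_mk] at sw
    rw [e1, intervalIntegral.integral_add (hi _ _ _ (by fun_prop)) (hi _ _ _ hc'), ← sw]
    simp only [ContinuousMap.coe_mk, kconvFst, kconv_apply]
    rw [intervalIntegral.integral_add (hi _ _ _ (by fun_prop)) (hi _ _ _ hc)]
  have h2 : ∀ x ξ, 0 ≤ ξ → ξ ≤ x → x ≤ ℓ →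
      STC.kconv k l (x, ξ) = - ∫ s in ξ..x, kconvSnd k l lξ (x, s) := by
    intro x ξ h0 h1 h2
    have hc : Continuous fun r => ∫ s in ξ..r, k (x, r) * lξ (r, s) :=
      continuous_intervalIntegral_param (F := fun r s => k (x, r) * lξ (r, s)) (by fun_prop)
        continuous_const continuous_id
    have hc' : Continuous fun s => ∫ r in s..x, k (x, r) * lξ (r, s) :=
      continuous_intervalIntegral_param (F := fun s r => k (x, r) * lξ (r, s)) (by fun_prop)
        continuous_id continuous_const
    have e1 : STC.kconv k l (x, ξ)
        = ∫ r in ξ..x, (k (x, r) * l (r, r) - ∫ s in ξ..r, k (x, r) * lξ (r, s)) := by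
      rw [kconv_apply]
      refine intervalIntegral.integral_congr fun r hr => ?_
      rw [uIcc_of_le h1] at hr
      rw [intervalIntegral.integral_const_mul,
        ← hl.snd r ξ r h0 hr.1 le_rfl (hr.2.trans h2)]
      ring
    have sw := integral_triangle_swap_continuous h1 ⟨fun z => k (x, z.1) * lξ z, by fun_prop⟩
    simp only [ContinuousMap.coe_mk] at sw
    rw [e1, intervalIntegral.integral_sub (hi _ _ _ (by fun_prop)) (hi _ _ _ hc), sw]
    simp only [ContinuousMap.coe_mk, kconvSnd, kconv_apply]
    rw [intervalIntegral.integral_sub (hi _ _ _ hc') (hi _ _ _ (by fun_prop))]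
    ring
  constructor
  · intro ξ x y h0 hx hy hℓ
    rw [h1 ξ y h0 (hx.trans hy) hℓ, h1 ξ x h0 hx (hy.trans hℓ),
      intervalIntegral.integral_interval_sub_left] <;>
    exact hi _ _ _ (by fun_prop)
  · intro x ξ ζ h0 hx hy hℓ
    rw [h2 x ξ h0 (hx.trans hy) hℓ, h2 x ζ (h0.trans hx) hy hℓ,
      ← intervalIntegral.integral_add_adjacent_intervals (hi _ ξ ζ (by fun_prop))
        (hi _ ζ x (by fun_prop))]
    ring

lemma IsC1Kernel.add {k kx kξ l lx lξ : C(ℝ × ℝ, ℝ)} (hk : IsC1Kernel ℓ k kx kξ)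
    (hl : IsC1Kernel ℓ l lx lξ) : IsC1Kernel ℓ (k + l) (kx + lx) (kξ + lξ) := by
  have hi : ∀ (f : ℝ → ℝ) (a b : ℝ), Continuous f → IntervalIntegrable f volume a b :=
    fun f a b hf => hf.intervalIntegrable _ _
  constructor
  · intro ξ x y h0 h1 h2 h3
    simp only [ContinuousMap.add_apply]
    rw [intervalIntegral.integral_add (hi _ _ _ (by fun_prop)) (hi _ _ _ (by fun_prop)),
      ← hk.fst ξ x y h0 h1 h2 h3, ← hl.fst ξ x y h0 h1 h2 h3]
    ring
  · intro x ξ ζ h0 h1 h2 h3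
    simp only [ContinuousMap.add_apply]
    rw [intervalIntegral.integral_add (hi _ _ _ (by fun_prop)) (hi _ _ _ (by fun_prop)),
      ← hk.snd x ξ ζ h0 h1 h2 h3, ← hl.snd x ξ ζ h0 h1 h2 h3]
    ring

lemma IsC1Kernel.neg {k kx kξ : C(ℝ × ℝ, ℝ)} (hk : IsC1Kernel ℓ k kx kξ) :
    IsC1Kernel ℓ (-k) (-kx) (-kξ) := by
  constructor
  · intro ξ x y h0 h1 h2 h3
    simp only [ContinuousMap.neg_apply]
    rw [intervalIntegral.integral_neg, ← hk.fst ξ x y h0 h1 h2 h3]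
    ring
  · intro x ξ ζ h0 h1 h2 h3
    simp only [ContinuousMap.neg_apply]
    rw [intervalIntegral.integral_neg, ← hk.snd x ξ ζ h0 h1 h2 h3]
    ring

lemma IsC1Kernel.hasStrictFDerivAt {k kx kξ : C(ℝ × ℝ, ℝ)} (hk : IsC1Kernel ℓ k kx kξ) {x ξ : ℝ}
    (h1 : 0 < ξ) (h2 : ξ < x) (h3 : x < ℓ) :
    HasStrictFDerivAt k
      (((1 : ℝ →L[ℝ] ℝ).smulRight (kx (x, ξ))).coprod ((1 : ℝ →L[ℝ] ℝ).smulRight (kξ (x, ξ))))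
      (x, ξ) := by
  have ho : IsOpen {z : ℝ × ℝ | 0 < z.2 ∧ z.2 < z.1 ∧ z.1 < ℓ} :=
    (isOpen_lt continuous_const continuous_snd).inter
      ((isOpen_lt continuous_snd continuous_fst).inter (isOpen_lt continuous_fst continuous_const))
  have hn := ho.mem_nhds (⟨h1, h2, h3⟩ : (x, ξ) ∈ {z : ℝ × ℝ | 0 < z.2 ∧ z.2 < z.1 ∧ z.1 < ℓ})
  refine hasStrictFDerivAt_uncurry_coprod (𝕜 := ℝ) (u := (x, ξ)) (f := fun x ξ => k (x, ξ))
    (f₁ := fun x ξ => (1 : ℝ →L[ℝ] ℝ).smulRight (kx (x, ξ)))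
    (f₂ := fun x ξ => (1 : ℝ →L[ℝ] ℝ).smulRight (kξ (x, ξ))) ?_ ?_ ?_ ?_
  · filter_upwards [hn] with z hz
    have hd : HasDerivAt (fun y => k (z.1, z.2) + ∫ s in z.1..y, kx (s, z.2)) (kx (z.1, z.2)) z.1 :=
      (intervalIntegral.integral_hasDerivAt_right
        (Continuous.intervalIntegrable (by fun_prop) _ _)
        (Continuous.stronglyMeasurable (by fun_prop)).stronglyMeasurableAtFilter
        (Continuous.continuousAt (by fun_prop))).const_add _
    refine (hd.congr_of_eventuallyEq ?_).hasFDerivAt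
    filter_upwards [Ioo_mem_nhds hz.2.1 hz.2.2] with y hy
    rcases le_total z.1 y with h | h
    · rw [← hk.fst z.2 z.1 y hz.1.le hz.2.1.le h hy.2.le]; ring
    · rw [intervalIntegral.integral_symm, ← hk.fst z.2 y z.1 hz.1.le hy.1.le h hz.2.2.le]; ring
  · filter_upwards [hn] with z hz
    have hd : HasDerivAt (fun y => k (z.1, z.2) + ∫ s in z.2..y, kξ (z.1, s)) (kξ (z.1, z.2)) z.2 :=
      (intervalIntegral.integral_hasDerivAt_right
        (Continuous.intervalIntegrable (by fun_prop) _ _)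
        (Continuous.stronglyMeasurable (by fun_prop)).stronglyMeasurableAtFilter
        (Continuous.continuousAt (by fun_prop))).const_add _
    refine (hd.congr_of_eventuallyEq ?_).hasFDerivAt
    filter_upwards [Ioo_mem_nhds hz.1 hz.2.1] with y hy
    rcases le_total z.2 y with h | h
    · rw [← hk.snd z.1 z.2 y hz.1.le h hy.2.le hz.2.2.le]; ring
    · rw [intervalIntegral.integral_symm, ← hk.snd z.1 y z.2 hy.1.le h hz.2.1.le hz.2.2.le]; ring
  · refine Continuous.continuousAt ?_
    exact ((ContinuousLinearMap.smulRightL ℝ ℝ ℝ 1).continuous.comp kx.continuous)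
  · refine Continuous.continuousAt ?_
    exact ((ContinuousLinearMap.smulRightL ℝ ℝ ℝ 1).continuous.comp kξ.continuous)

/-- A kernel is constant along its characteristics. -/
lemma IsC1Kernel.eq_of_characteristic {k kx kξ : C(ℝ × ℝ, ℝ)} (hk : IsC1Kernel ℓ k kx kξ)
    {a b x ξ R : ℝ} (hR : 0 ≤ R)
    (hpath : ∀ r ∈ Ioo 0 R, 0 < ξ + b * r ∧ ξ + b * r < x + a * r ∧ x + a * r < ℓ)
    (hpde : ∀ x ξ, 0 < ξ → ξ < x → x < ℓ → a * kx (x, ξ) + b * kξ (x, ξ) = 0) :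
    k (x + a * R, ξ + b * R) = k (x, ξ) := by
  have hd : ∀ r ∈ Ioo 0 R, HasDerivAt (fun r => k (x + a * r, ξ + b * r)) 0 r := by
    intro r hr
    obtain ⟨h1, h2, h3⟩ := hpath r hr
    have e1 : HasDerivAt (fun r => (x + a * r, ξ + b * r)) (a, b) r := by
      have e2 : HasDerivAt (fun r => x + a * r) a r := by
        simpa using ((hasDerivAt_id r).const_mul a).const_add x
      have e3 : HasDerivAt (fun r => ξ + b * r) b r := by
        simpa using ((hasDerivAt_id r).const_mul b).const_add ξ
      exact e2.prodMk e3
    have := (hk.hasStrictFDerivAt h1 h2 h3).hasFDerivAt.comp_hasDerivAt r e1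
    convert! this using 1
    simp [hpde _ _ h1 h2 h3]
  have := intervalIntegral.integral_eq_sub_of_hasDerivAt_of_le hR
    (f := fun r => k (x + a * r, ξ + b * r)) (f' := fun _ => 0)
    (Continuous.continuousOn (by fun_prop)) hd (by simp)
  simp at this
  linarith

end Composition

/-! ### Inverse transformations -/

section Inverse

variable {ℓ : ℝ} {s : Fin 2 → ℝ} {N Nx Nξ L Lx Lξ : Fin 2 → Fin 2 → C(ℝ × ℝ, ℝ)}
  {C : Fin 2 → Fin 2 → C(ℝ, ℝ)}

/-- The kernel of `(1 + N)(1 + L) - 1`. -/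
def compKernel (N L : Fin 2 → Fin 2 → C(ℝ × ℝ, ℝ)) (i j : Fin 2) : C(ℝ × ℝ, ℝ) :=
  N i j + L i j + (kconv (N i 0) (L 0 j) + kconv (N i 1) (L 1 j))

/-- The derivative of `compKernel` with respect to the first variable. -/
def compKernelFst (N Nx L Lx : Fin 2 → Fin 2 → C(ℝ × ℝ, ℝ)) (i j : Fin 2) : C(ℝ × ℝ, ℝ) :=
  Nx i j + Lx i j + (kconvFst (N i 0) (Nx i 0) (L 0 j) + kconvFst (N i 1) (Nx i 1) (L 1 j))

/-- The derivative of `compKernel` with respect to the second variable. -/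
def compKernelSnd (N Nξ L Lξ : Fin 2 → Fin 2 → C(ℝ × ℝ, ℝ)) (i j : Fin 2) : C(ℝ × ℝ, ℝ) :=
  Nξ i j + Lξ i j + (kconvSnd (N i 0) (L 0 j) (Lξ 0 j) + kconvSnd (N i 1) (L 1 j) (Lξ 1 j))

lemma isC1Kernel_compKernel (hN : IsTransformKernel ℓ s N Nx Nξ C 0)
    (hL : IsTransformKernel ℓ s L Lx Lξ 0 C) (i j : Fin 2) :
    IsC1Kernel ℓ (compKernel N L i j) (compKernelFst N Nx L Lx i j)
      (compKernelSnd N Nξ L Lξ i j) :=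
  ((hN.c1 i j).add (hL.c1 i j)).add
    (((hN.c1 i 0).kconv (hL.c1 0 j)).add ((hN.c1 i 1).kconv (hL.c1 1 j)))

lemma integral_deriv_kconv {k kξ l lx : C(ℝ × ℝ, ℝ)} {kx lξ : C(ℝ × ℝ, ℝ)}
    (hk : IsC1Kernel ℓ k kx kξ) (hl : IsC1Kernel ℓ l lx lξ) {x ξ : ℝ} (h0 : 0 ≤ ξ) (h1 : ξ ≤ x)
    (h2 : x ≤ ℓ) :
    (∫ r in ξ..x, kξ (x, r) * l (r, ξ)) + ∫ r in ξ..x, k (x, r) * lx (r, ξ)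
      = k (x, x) * l (x, ξ) - k (x, ξ) * l (ξ, ξ) := by
  have e1 : ∀ r ∈ Icc ξ x, k (x, r) = k (x, ξ) + ∫ s in ξ..r, kξ (x, s) := fun r hr => by
    rw [← hk.snd x ξ r h0 hr.1 hr.2 h2]; ring
  have e2 : ∀ r ∈ Icc ξ x, l (r, ξ) = l (ξ, ξ) + ∫ s in ξ..r, lx (s, ξ) := fun r hr => by
    rw [← hl.fst ξ ξ r h0 le_rfl hr.1 (hr.2.trans h2)]; ring
  have d1 : ∀ r, HasDerivAt (fun r => k (x, ξ) + ∫ s in ξ..r, kξ (x, s)) (kξ (x, r)) r :=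
    fun r => (intervalIntegral.integral_hasDerivAt_right
      (Continuous.intervalIntegrable (by fun_prop) _ _)
      (Continuous.stronglyMeasurable (by fun_prop)).stronglyMeasurableAtFilter
      (Continuous.continuousAt (by fun_prop))).const_add _
  have d2 : ∀ r, HasDerivAt (fun r => l (ξ, ξ) + ∫ s in ξ..r, lx (s, ξ)) (lx (r, ξ)) r :=
    fun r => (intervalIntegral.integral_hasDerivAt_right
      (Continuous.intervalIntegrable (by fun_prop) _ _)
      (Continuous.stronglyMeasurable (by fun_prop)).stronglyMeasurableAtFilter
      (Continuous.continuousAt (by fun_prop))).const_add _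
  have := intervalIntegral.integral_mul_deriv_eq_deriv_mul (a := ξ) (b := x)
    (fun r _ => d1 r) (fun r _ => d2 r) (Continuous.intervalIntegrable (by fun_prop) _ _)
    (Continuous.intervalIntegrable (by fun_prop) _ _)
  have g1 : ∫ r in ξ..x, k (x, r) * lx (r, ξ)
      = ∫ r in ξ..x, (k (x, ξ) + ∫ s in ξ..r, kξ (x, s)) * lx (r, ξ) := by
    refine intervalIntegral.integral_congr fun r hr => ?_
    rw [uIcc_of_le h1] at hr
    simp only [e1 r hr]
  have g2 : ∫ r in ξ..x, kξ (x, r) * l (r, ξ)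
      = ∫ r in ξ..x, kξ (x, r) * (l (ξ, ξ) + ∫ s in ξ..r, lx (s, ξ)) := by
    refine intervalIntegral.integral_congr fun r hr => ?_
    rw [uIcc_of_le h1] at hr
    simp only [e2 r hr]
  rw [g1, g2, this, ← e1 x ⟨h1, le_rfl⟩, ← e2 x ⟨h1, le_rfl⟩]
  simp

lemma compKernel_pde (hN : IsTransformKernel ℓ s N Nx Nξ C 0)
    (hL : IsTransformKernel ℓ s L Lx Lξ 0 C) (i j : Fin 2) {x ξ : ℝ} (h0 : 0 ≤ ξ) (h1 : ξ ≤ x)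
    (h2 : x ≤ ℓ) :
    s i * compKernelFst N Nx L Lx i j (x, ξ) + s j * compKernelSnd N Nξ L Lξ i j (x, ξ) = 0 := by
  have p1 := hN.pde i j x ξ h0 h1 h2
  have p2 := hL.pde i j x ξ h0 h1 h2
  have hi : ∀ (f : ℝ → ℝ), Continuous f → IntervalIntegrable f volume ξ x :=
    fun f hf => hf.intervalIntegrable _ _
  have key : s i * (kconv (Nx i 0) (L 0 j) (x, ξ) + kconv (Nx i 1) (L 1 j) (x, ξ))
      + s j * (kconv (N i 0) (Lξ 0 j) (x, ξ) + kconv (N i 1) (Lξ 1 j) (x, ξ))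
      + (s 0 * ((∫ r in ξ..x, Nξ i 0 (x, r) * L 0 j (r, ξ))
          + ∫ r in ξ..x, N i 0 (x, r) * Lx 0 j (r, ξ))
      + s 1 * ((∫ r in ξ..x, Nξ i 1 (x, r) * L 1 j (r, ξ))
          + ∫ r in ξ..x, N i 1 (x, r) * Lx 1 j (r, ξ))) = 0 := by
    simp only [kconv_apply]
    rw [← intervalIntegral.integral_add (hi _ (by fun_prop)) (hi _ (by fun_prop)),
      ← intervalIntegral.integral_add (hi _ (by fun_prop)) (hi _ (by fun_prop)),
      ← intervalIntegral.integral_add (hi _ (by fun_prop)) (hi _ (by fun_prop)),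
      ← intervalIntegral.integral_add (hi _ (by fun_prop)) (hi _ (by fun_prop)),
      ← intervalIntegral.integral_const_mul, ← intervalIntegral.integral_const_mul,
      ← intervalIntegral.integral_const_mul, ← intervalIntegral.integral_const_mul,
      ← intervalIntegral.integral_add (hi _ (by fun_prop)) (hi _ (by fun_prop)),
      ← intervalIntegral.integral_add (hi _ (by fun_prop)) (hi _ (by fun_prop)),
      ← intervalIntegral.integral_add (hi _ (by fun_prop)) (hi _ (by fun_prop))]
    rw [intervalIntegral.integral_congr (g := fun _ => 0)]
    · simp
    · intro r hr
      rw [uIcc_of_le h1] at hr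
      have a0 := hN.pde i 0 x r (h0.trans hr.1) hr.2 h2
      have a1 := hN.pde i 1 x r (h0.trans hr.1) hr.2 h2
      have b0 := hL.pde 0 j r ξ h0 hr.1 (hr.2.trans h2)
      have b1 := hL.pde 1 j r ξ h0 hr.1 (hr.2.trans h2)
      simp only [Fin.sum_univ_two, Pi.zero_apply, ContinuousMap.zero_apply, zero_mul, mul_zero,
        add_zero, zero_sub, sub_zero] at a0 a1 b0 b1
      linear_combination L 0 j (r, ξ) * a0 + L 1 j (r, ξ) * a1 + N i 0 (x, r) * b0
        + N i 1 (x, r) * b1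
  have q0 := integral_deriv_kconv (hN.c1 i 0) (hL.c1 0 j) h0 h1 h2
  have q1 := integral_deriv_kconv (hN.c1 i 1) (hL.c1 1 j) h0 h1 h2
  have d0 := hN.diag i 0 x ⟨h0.trans h1, h2⟩
  have d1 := hN.diag i 1 x ⟨h0.trans h1, h2⟩
  have g0 := hL.diag 0 j ξ ⟨h0, h1.trans h2⟩
  have g1 := hL.diag 1 j ξ ⟨h0, h1.trans h2⟩
  simp only [Fin.sum_univ_two, Pi.zero_apply, ContinuousMap.zero_apply, zero_mul, mul_zero,
    add_zero, zero_sub, sub_zero] at p1 p2 d0 d1 g0 g1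
  simp only [compKernelFst, compKernelSnd, kconvFst, kconvSnd, ContinuousMap.add_apply,
    ContinuousMap.coe_mk]
  linear_combination p1 + p2 + key - s 0 * q0 - s 1 * q1 + L 0 j (x, ξ) * d0
    + L 1 j (x, ξ) * d1 + N i 0 (x, ξ) * g0 + N i 1 (x, ξ) * g1

lemma compKernel_diag (hN : IsTransformKernel ℓ s N Nx Nξ C 0)
    (hL : IsTransformKernel ℓ s L Lx Lξ 0 C) {i j : Fin 2} (hs : s i ≠ s j) {x : ℝ}
    (hx : x ∈ Icc 0 ℓ) : compKernel N L i j (x, x) = 0 := by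
  have d0 := hN.diag i j x hx
  have g0 := hL.diag i j x hx
  have : (s i - s j) * compKernel N L i j (x, x) = 0 := by
    simp only [compKernel, ContinuousMap.add_apply, kconv_apply, intervalIntegral.integral_same]
    simp only [Pi.zero_apply, ContinuousMap.zero_apply] at d0 g0
    linear_combination d0 + g0
  exact (mul_eq_zero.1 this).resolve_left (sub_ne_zero.2 hs)

lemma compKernel_offDiag_eq_zero (hN : IsTransformKernel ℓ s N Nx Nξ C 0)
    (hL : IsTransformKernel ℓ s L Lx Lξ 0 C) (h0 : 0 < s 0) (h1 : s 1 < 0) {i j : Fin 2}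
    (hij : i ≠ j) {x ξ : ℝ} (hξ : 0 ≤ ξ) (hx : ξ ≤ x) (hℓ : x ≤ ℓ) :
    compKernel N L i j (x, ξ) = 0 := by
  obtain ⟨a, b, ha, hb, hab, hs⟩ : ∃ a b : ℝ, 0 < a ∧ b < 0 ∧ s i ≠ s j ∧
      ((a = s i ∧ b = s j) ∨ (a = -s i ∧ b = -s j)) := by
    fin_cases i <;> fin_cases j <;> simp at hij
    · exact ⟨s 0, s 1, h0, h1, (h1.trans h0).ne', .inl ⟨rfl, rfl⟩⟩
    · exact ⟨-s 1, -s 0, by linarith, by linarith, (h1.trans h0).ne, .inr ⟨rfl, rfl⟩⟩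
  have hc : 0 < a - b := by linarith
  set R := (x - ξ) / (a - b) with hR
  have hRm : R * (a - b) = x - ξ := by rw [hR]; field_simp
  have hR0 : 0 ≤ R := div_nonneg (by linarith) hc.le
  set z := x - a * R with hz
  have hz' : z = ξ - b * R := by rw [hz]; linarith
  have hzm : z ∈ Icc 0 ℓ := ⟨by rw [hz']; nlinarith, by rw [hz]; nlinarith⟩
  have := (isC1Kernel_compKernel hN hL i j).eq_of_characteristic (a := a) (b := b) (x := z) (ξ := z)
    (R := R) hR0 (fun r hr => ⟨?_, ?_, ?_⟩) (fun x ξ g0 g1 g2 => ?_)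
  · rw [compKernel_diag hN hL hab hzm] at this
    rw [← this]
    congr 2 <;> linarith
  · have : b * R < b * r := mul_lt_mul_of_neg_left hr.2 hb
    linarith
  · nlinarith [hr.1]
  · have : a * r < a * R := mul_lt_mul_of_pos_left hr.2 ha
    linarith
  · have := compKernel_pde hN hL i j g0.le g1.le g2.le
    rcases hs with ⟨rfl, rfl⟩ | ⟨rfl, rfl⟩
    · exact this
    · linarith

lemma compKernel_diag_eq_zero (hN : IsTransformKernel ℓ s N Nx Nξ C 0)
    (hL : IsTransformKernel ℓ s L Lx Lξ 0 C) {i : Fin 2} (hi : s i ≠ 0)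
    (hb : (∀ x ∈ Icc 0 ℓ, compKernel N L i i (x, 0) = 0) ∨
      ∀ ξ ∈ Icc 0 ℓ, compKernel N L i i (ℓ, ξ) = 0) {x ξ : ℝ} (hξ : 0 ≤ ξ) (hx : ξ < x)
    (hℓ : x ≤ ℓ) : compKernel N L i i (x, ξ) = 0 := by
  have hp : ∀ x ξ, 0 < ξ → ξ < x → x < ℓ → 1 * compKernelFst N Nx L Lx i i (x, ξ)
      + 1 * compKernelSnd N Nξ L Lξ i i (x, ξ) = 0 := fun x ξ g0 g1 g2 => by
    have := compKernel_pde hN hL i i g0.le g1.le g2.le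
    rw [← mul_add] at this
    rw [one_mul, one_mul]
    exact (mul_eq_zero.1 this).resolve_left hi
  rcases hb with hb | hb
  · have := (isC1Kernel_compKernel hN hL i i).eq_of_characteristic (a := 1) (b := 1) (x := x - ξ)
      (ξ := 0) (R := ξ) hξ (fun r hr => ⟨by linarith [hr.1], by linarith, by linarith [hr.2]⟩) hp
    rw [hb _ ⟨by linarith, by linarith⟩] at this
    rw [← this]
    congr 2 <;> ring
  · have := (isC1Kernel_compKernel hN hL i i).eq_of_characteristic (a := 1) (b := 1) (x := x)
      (ξ := ξ) (R := ℓ - x) (by linarith)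
      (fun r hr => ⟨by linarith [hr.1], by linarith, by linarith [hr.2]⟩) hp
    rw [← this]
    have e := hb (ξ + 1 * (ℓ - x)) ⟨by linarith, by linarith⟩
    rw [← e]
    congr 2; ring

/-- Two transformations whose kernels satisfy the same boundary relation at `ξ = 0` or at `x = ℓ`
are inverse to each other. -/
lemma compKernel_eq_zero (hN : IsTransformKernel ℓ s N Nx Nξ C 0)
    (hL : IsTransformKernel ℓ s L Lx Lξ 0 C) (h0 : 0 < s 0) (h1 : s 1 < 0) {ρ : ℝ} (hρ : ρ ≠ 0)
    (hb : (∀ K ∈ ({N, L} : Set (Fin 2 → Fin 2 → C(ℝ × ℝ, ℝ))), ∀ i, ∀ x ∈ Icc 0 ℓ,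
        K i 1 (x, 0) = ρ * K i 0 (x, 0)) ∨
      ∀ K ∈ ({N, L} : Set (Fin 2 → Fin 2 → C(ℝ × ℝ, ℝ))), ∀ j, ∀ ξ ∈ Icc 0 ℓ,
        K 1 j (ℓ, ξ) = ρ * K 0 j (ℓ, ξ)) (i j : Fin 2) {x ξ : ℝ} (hξ : 0 ≤ ξ) (hx : ξ < x)
    (hℓ : x ≤ ℓ) : compKernel N L i j (x, ξ) = 0 := by
  by_cases hij : i = j
  · subst hij
    have hs : s i ≠ 0 := by fin_cases i; exacts [h0.ne', h1.ne]
    refine compKernel_diag_eq_zero hN hL hs ?_ hξ hx hℓ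
    rcases hb with hb | hb
    · left
      intro x hx
      have e : compKernel N L i 1 (x, 0) = ρ * compKernel N L i 0 (x, 0) := by
        have : ∀ n, kconv (N i n) (L n 1) (x, 0) = ρ * kconv (N i n) (L n 0) (x, 0) := fun n => by
          simp only [kconv_apply]
          rw [← intervalIntegral.integral_const_mul]
          refine intervalIntegral.integral_congr fun r hr => ?_
          rw [uIcc_of_le hx.1] at hr
          simp only [hb L (by simp) n r ⟨hr.1, hr.2.trans hx.2⟩]
          ring
        simp only [compKernel, ContinuousMap.add_apply, this, hb N (by simp) i x hx,
          hb L (by simp) i x hx]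
        ring
      fin_cases i
      · have := compKernel_offDiag_eq_zero hN hL h0 h1 (i := 0) (j := 1) (by simp) le_rfl hx.1 hx.2
        simp only [Fin.zero_eta] at e ⊢
        rw [this] at e
        exact (mul_eq_zero.1 e.symm).resolve_left hρ
      · have := compKernel_offDiag_eq_zero hN hL h0 h1 (i := 1) (j := 0) (by simp) le_rfl hx.1 hx.2
        simp only [Fin.mk_one] at e ⊢
        rw [e, this, mul_zero]
    · right
      intro ξ hξ
      have e : compKernel N L 1 i (ℓ, ξ) = ρ * compKernel N L 0 i (ℓ, ξ) := by
        have : ∀ n, kconv (N 1 n) (L n i) (ℓ, ξ) = ρ * kconv (N 0 n) (L n i) (ℓ, ξ) := fun n => by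
          simp only [kconv_apply]
          rw [← intervalIntegral.integral_const_mul]
          refine intervalIntegral.integral_congr fun r hr => ?_
          rw [uIcc_of_le hξ.2] at hr
          simp only [hb N (by simp) n r ⟨hξ.1.trans hr.1, hr.2⟩]
          ring
        simp only [compKernel, ContinuousMap.add_apply, this, hb N (by simp) i ξ hξ,
          hb L (by simp) i ξ hξ]
        ring
      fin_cases i
      · have := compKernel_offDiag_eq_zero hN hL h0 h1 (i := 1) (j := 0) (by simp) hξ.1 hξ.2 le_rfl
        simp only [Fin.zero_eta] at e ⊢
        rw [this] at e
        exact (mul_eq_zero.1 e.symm).resolve_left hρ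
      · have := compKernel_offDiag_eq_zero hN hL h0 h1 (i := 0) (j := 1) (by simp) hξ.1 hξ.2 le_rfl
        simp only [Fin.mk_one] at e ⊢
        rw [e, this, mul_zero]
  · exact compKernel_offDiag_eq_zero hN hL h0 h1 hij hξ hx.le hℓ

lemma volH_congr {k l : C(ℝ × ℝ, ℝ)} (h : ∀ x ξ, 0 ≤ ξ → ξ < x → x ≤ ℓ → k (x, ξ) = l (x, ξ)) :
    volH ℓ k = volH ℓ l := by
  ext w : 2
  filter_upwards [coeFn_volH k w, coeFn_volH l w, ae_restrict_mem measurableSet_Ioo] with x h1 h2 h3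
  rw [h1, h2, volterra, volterra, intervalIntegral.integral_of_le h3.1.le,
    intervalIntegral.integral_of_le h3.1.le, integral_Ioc_eq_integral_Ioo,
    integral_Ioc_eq_integral_Ioo]
  refine setIntegral_congr_fun measurableSet_Ioo fun ξ hξ => ?_
  simp only [h x ξ hξ.1.le hξ.2 h3.2.le]

lemma volH_zero : volH ℓ 0 = 0 := by
  ext w : 1
  refine (Lp.eq_zero_iff_ae_eq_zero).2 ?_
  filter_upwards [coeFn_volH 0 w] with x h1
  rw [h1]
  simp [volterra]

lemma volH_add (k l : C(ℝ × ℝ, ℝ)) (w : L2 ℓ) : volH ℓ (k + l) w = volH ℓ k w + volH ℓ l w := by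
  ext1
  filter_upwards [coeFn_volH (k + l) w, coeFn_volH k w, coeFn_volH l w,
    Lp.coeFn_add (volH ℓ k w) (volH ℓ l w), ae_restrict_mem measurableSet_Ioo] with x h1 h2 h3 h4 h5
  have h0 : (0 : ℝ) ∈ Icc 0 ℓ := ⟨le_rfl, h5.1.le.trans h5.2.le⟩
  rw [h1, h4, Pi.add_apply, h2, h3, volterra, volterra, volterra, ← intervalIntegral.integral_add
    (intervalIntegrable_mul_coeFn (by fun_prop) w h0 (Ioo_subset_Icc_self h5))
    (intervalIntegrable_mul_coeFn (by fun_prop) w h0 (Ioo_subset_Icc_self h5))]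
  simp only [ContinuousMap.add_apply, add_mul]

lemma volH_volH (k l : C(ℝ × ℝ, ℝ)) (w : L2 ℓ) :
    volH ℓ k (volH ℓ l w) = volH ℓ (kconv k l) w := by
  ext1
  filter_upwards [coeFn_volH k (volH ℓ l w), coeFn_volH (kconv k l) w,
    ae_restrict_mem measurableSet_Ioo] with x h1 h2 h3
  rw [h1, h2]
  have e1 : volterra k (volH ℓ l w) x
      = ∫ s in (0 : ℝ)..x, ∫ ξ in (0 : ℝ)..s, l (s, ξ) * w ξ * k (x, s) := by
    rw [volterra, intervalIntegral.integral_of_le h3.1.le, intervalIntegral.integral_of_le h3.1.le,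
      integral_Ioc_eq_integral_Ioo, integral_Ioc_eq_integral_Ioo]
    refine integral_congr_ae
      (ae_restrict_of_ae_restrict_of_subset (Ioo_subset_Ioo_right h3.2.le) ?_)
    filter_upwards [coeFn_volH l w] with s hs
    rw [hs, volterra, intervalIntegral.integral_mul_const]
    ring
  rw [e1, integral_triangle_swap h3.1.le (F := fun s ξ => l (s, ξ) * w ξ * k (x, s))]
  · rw [volterra]
    refine intervalIntegral.integral_congr fun ξ _ => ?_
    simp only [kconv_apply]
    rw [← intervalIntegral.integral_mul_const]
    exact intervalIntegral.integral_congr fun s _ => by ring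
  · exact (integrableOn_kernel_mul l w ⟨fun s => k (x, s), by fun_prop⟩).mono_set
      (prod_mono (Ioc_subset_Ioc_right h3.2.le) (Ioc_subset_Ioc_right h3.2.le))

lemma transform_transform (h : ∀ i j x ξ, 0 ≤ ξ → ξ < x → x ≤ ℓ → compKernel N L i j (x, ξ) = 0)
    (w : Fin 2 → L2 ℓ) : transform ℓ N (transform ℓ L w) = w := by
  have hz : ∀ i j, volH ℓ (compKernel N L i j) (w j) = 0 := fun i j => by
    rw [volH_congr (l := 0) fun x ξ h0 h1 h2 => by simpa using h i j x ξ h0 h1 h2, volH_zero]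
    rfl
  funext i
  have h0 := hz i 0
  have h1 := hz i 1
  simp only [compKernel, volH_add, ← volH_volH] at h0 h1
  simp only [transform, Fin.sum_univ_two, map_add]
  have := congrArg₂ (· + ·) h0 h1
  simp only [add_zero] at this
  rw [← sub_eq_zero, ← this]
  abel

lemma eq_zero_of_le_integral {h : ℝ → ℝ} {B c : ℝ} (hc : 0 ≤ c)
    (hB : ∀ x ∈ Icc 0 ℓ, h x ≤ B) (hcont : ContinuousOn h (Icc 0 ℓ))
    (hle : ∀ x ∈ Icc 0 ℓ, h x ≤ c * ∫ s in (0 : ℝ)..x, h s) {x : ℝ} (hx : x ∈ Icc 0 ℓ) :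
    h x ≤ 0 := by
  have key : ∀ n : ℕ, ∀ x ∈ Icc 0 ℓ, h x ≤ B * (c * x) ^ n / n.factorial := by
    intro n
    induction n with
    | zero => simpa using hB
    | succ n ih =>
      intro x hx
      refine (hle x hx).trans ?_
      have h1 : ∫ s in (0 : ℝ)..x, h s ≤ ∫ s in (0 : ℝ)..x, B * (c * s) ^ n / n.factorial := by
        refine intervalIntegral.integral_mono_on hx.1 ?_ ?_
          fun s hs => ih s ⟨hs.1, hs.2.trans hx.2⟩
        · refine ContinuousOn.intervalIntegrable (hcont.mono ?_)
          rw [uIcc_of_le hx.1]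
          exact Icc_subset_Icc_right hx.2
        · exact Continuous.intervalIntegrable (by fun_prop) _ _
      refine (mul_le_mul_of_nonneg_left h1 hc).trans (le_of_eq ?_)
      have : (fun s : ℝ => B * (c * s) ^ n / n.factorial)
          = fun s => B * c ^ n / n.factorial * s ^ n := by ext s; ring
      rw [this, intervalIntegral.integral_const_mul, integral_pow, Nat.factorial_succ]
      push_cast
      have : (n.factorial : ℝ) ≠ 0 := by positivity
      field_simp
      ring
  have hlim : Tendsto (fun n : ℕ => B * (c * x) ^ n / n.factorial) atTop (𝓝 0) := by
    have := (FloorSemiring.tendsto_pow_div_factorial_atTop (c * x)).const_mul B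
    simpa [mul_div_assoc] using this
  exact ge_of_tendsto' hlim fun n => key n x hx

lemma transform_injective (hℓ : 0 < ℓ) {M : Fin 2 → Fin 2 → C(ℝ × ℝ, ℝ)} {w : Fin 2 → L2 ℓ}
    (h : transform ℓ M w = 0) : w = 0 := by
  choose c hc0 hc using fun i j => exists_bound_square ℓ (M i j)
  have habs : ∀ i, ∀ᵐ x ∂volume.restrict (Ioo (0 : ℝ) ℓ),
      |w i x| ≤ (c i 0 + c i 1) * ∫ ξ in (0 : ℝ)..x, (|w 0 ξ| + |w 1 ξ|) := by
    intro i
    have hi : w i + (volH ℓ (M i 0) (w 0) + volH ℓ (M i 1) (w 1)) = 0 := by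
      have := congrFun h i
      simpa [transform, Fin.sum_univ_two] using this
    have hi' : w i = -(volH ℓ (M i 0) (w 0) + volH ℓ (M i 1) (w 1)) := eq_neg_of_add_eq_zero_left hi
    filter_upwards [coeFn_volH (M i 0) (w 0), coeFn_volH (M i 1) (w 1),
      Lp.coeFn_add (volH ℓ (M i 0) (w 0)) (volH ℓ (M i 1) (w 1)),
      Lp.coeFn_neg (volH ℓ (M i 0) (w 0) + volH ℓ (M i 1) (w 1)),
      ae_restrict_mem measurableSet_Ioo] with x h1 h2 h3 h4 h5
    have hx := Ioo_subset_Icc_self h5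
    have z0 : (0 : ℝ) ∈ Icc 0 ℓ := ⟨le_rfl, hℓ.le⟩
    have g0 := abs_volterra_le (hc i 0) (w 0) hx
    have g1 := abs_volterra_le (hc i 1) (w 1) hx
    have n0 : 0 ≤ ∫ ξ in (0 : ℝ)..x, |w 0 ξ| :=
      intervalIntegral.integral_nonneg hx.1 fun _ _ => abs_nonneg _
    have n1 : 0 ≤ ∫ ξ in (0 : ℝ)..x, |w 1 ξ| :=
      intervalIntegral.integral_nonneg hx.1 fun _ _ => abs_nonneg _
    rw [hi', h4, Pi.neg_apply, h3, Pi.add_apply, h1, h2, abs_neg,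
      intervalIntegral.integral_add (intervalIntegrable_coeFn _ z0 hx).abs
        (intervalIntegrable_coeFn _ z0 hx).abs]
    refine (abs_add_le _ _).trans ?_
    nlinarith [hc0 i 0, hc0 i 1]
  set f : ℝ → ℝ := fun x => |w 0 x| + |w 1 x|
  set c' := c 0 0 + c 0 1 + (c 1 0 + c 1 1)
  have hc' : 0 ≤ c' := by
    have := hc0 0 0; have := hc0 0 1; have := hc0 1 0; have := hc0 1 1; positivity
  have z0 : (0 : ℝ) ∈ Icc 0 ℓ := ⟨le_rfl, hℓ.le⟩
  have hfi : ∀ x ∈ Icc 0 ℓ, IntervalIntegrable f volume 0 x := fun x hx =>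
    (intervalIntegrable_coeFn _ z0 hx).abs.add (intervalIntegrable_coeFn _ z0 hx).abs
  have hcont : ContinuousOn (fun x => ∫ ξ in (0 : ℝ)..x, f ξ) (Icc 0 ℓ) := by
    have := intervalIntegral.continuousOn_primitive_interval'
      (hfi ℓ ⟨hℓ.le, le_rfl⟩) (left_mem_uIcc)
    rwa [uIcc_of_le hℓ.le] at this
  have hf : ∀ᵐ x ∂volume.restrict (Ioo (0 : ℝ) ℓ), f x ≤ c' * ∫ ξ in (0 : ℝ)..x, f ξ := by
    filter_upwards [habs 0, habs 1] with x h1 h2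
    simp only [f, c']
    linarith
  have hle : ∀ x ∈ Icc 0 ℓ, (∫ ξ in (0 : ℝ)..x, f ξ)
      ≤ c' * ∫ s in (0 : ℝ)..x, ∫ ξ in (0 : ℝ)..s, f ξ := by
    intro x hx
    rw [← intervalIntegral.integral_const_mul]
    refine intervalIntegral.integral_mono_ae_restrict hx.1 (hfi x hx) ?_ ?_
    · refine ContinuousOn.intervalIntegrable ((hcont.const_smul c').mono ?_)
      rw [uIcc_of_le hx.1]
      exact Icc_subset_Icc_right hx.2
    · rw [Measure.restrict_congr_set Ioo_ae_eq_Icc.symm]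
      exact ae_restrict_of_ae_restrict_of_subset (Ioo_subset_Ioo_right hx.2) hf
  have hnn : ∀ x ∈ Icc 0 ℓ, 0 ≤ ∫ ξ in (0 : ℝ)..x, f ξ := fun x hx =>
    intervalIntegral.integral_nonneg hx.1 fun _ _ => by positivity
  have hzero : ∀ x ∈ Icc 0 ℓ, ∫ ξ in (0 : ℝ)..x, f ξ = 0 := fun x hx =>
    le_antisymm (eq_zero_of_le_integral hc' (B := ∫ ξ in (0 : ℝ)..ℓ, f ξ)
      (fun y hy => intervalIntegral.integral_mono_interval le_rfl hy.1 hy.2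
        (Eventually.of_forall fun _ => by positivity) (hfi ℓ ⟨hℓ.le, le_rfl⟩))
      hcont hle hx) (hnn x hx)
  funext i
  ext1
  filter_upwards [habs i, ae_restrict_mem measurableSet_Ioo,
    Lp.coeFn_zero ℝ 2 (volume.restrict (Ioo (0 : ℝ) ℓ))] with x h1 h2 h3
  rw [hzero x (Ioo_subset_Icc_self h2), mul_zero] at h1
  rw [Pi.zero_apply, h3]
  exact abs_nonpos_iff.1 h1

lemma transform_sub (M : Fin 2 → Fin 2 → C(ℝ × ℝ, ℝ)) (v w : Fin 2 → L2 ℓ) :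
    transform ℓ M (v - w) = transform ℓ M v - transform ℓ M w := by
  funext i
  simp only [transform, Pi.sub_apply, map_sub, Fin.sum_univ_two]
  abel

/-- A right inverse of a Volterra transformation is a left inverse. -/
lemma transform_transform' (hℓ : 0 < ℓ)
    (h : ∀ i j x ξ, 0 ≤ ξ → ξ < x → x ≤ ℓ → compKernel N L i j (x, ξ) = 0)
    (w : Fin 2 → L2 ℓ) : transform ℓ L (transform ℓ N w) = w := by
  have : transform ℓ N (transform ℓ L (transform ℓ N w) - w) = 0 := by
    rw [transform_sub, transform_transform h, sub_self]
  exact sub_eq_zero.1 (transform_injective hℓ this)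

lemma inner_transform_rowEnd (hℓ : 0 ≤ ℓ)
    (h : ∀ i j x ξ, 0 ≤ ξ → ξ < x → x ≤ ℓ → compKernel N L i j (x, ξ) = 0)
    (w : Fin 2 → L2 ℓ) (i : Fin 2) :
    ∑ j, inner ℝ (transform ℓ L w j) (emb ℓ (rowEnd ℓ (N i j)))
      = -∑ j, inner ℝ (w j) (emb ℓ (rowEnd ℓ (L i j))) := by
  have e : ∀ j, inner ℝ (w j) (emb ℓ (rowEnd ℓ (N i j) + rowEnd ℓ (L i j)
      + (adjVolterra ℓ (L 0 j) (rowEnd ℓ (N i 0)) + adjVolterra ℓ (L 1 j) (rowEnd ℓ (N i 1)))))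
      = 0 := by
    intro j
    have hz : emb ℓ (rowEnd ℓ (N i j) + rowEnd ℓ (L i j)
        + (adjVolterra ℓ (L 0 j) (rowEnd ℓ (N i 0)) + adjVolterra ℓ (L 1 j) (rowEnd ℓ (N i 1))))
        = emb ℓ 0 := by
      ext1
      filter_upwards [coeFn_emb (ℓ := ℓ) (rowEnd ℓ (N i j) + rowEnd ℓ (L i j)
        + (adjVolterra ℓ (L 0 j) (rowEnd ℓ (N i 0)) + adjVolterra ℓ (L 1 j) (rowEnd ℓ (N i 1)))),
        coeFn_emb (ℓ := ℓ) 0, ae_restrict_mem measurableSet_Ioo] with ξ h1 h2 h3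
      rw [h1, h2]
      have := h i j ℓ ξ h3.1.le h3.2 le_rfl
      simp only [compKernel, ContinuousMap.add_apply, kconv_apply] at this
      simp only [ContinuousMap.add_apply, rowEnd, adjVolterra, ContinuousMap.coe_mk,
        ContinuousMap.zero_apply]
      simp only [mul_comm (N i _ _)] at this
      exact this
    rw [hz]
    have : emb ℓ (0 : C(ℝ, ℝ)) = 0 := by simpa using emb_smul (ℓ := ℓ) 0 0
    rw [this, inner_zero_right]
  have e0 := e 0
  have e1 := e 1
  simp only [emb_add, inner_add_right] at e0 e1
  simp only [transform, Fin.sum_univ_two, inner_add_left, inner_volH_emb hℓ]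
  linear_combination e0 + e1

end Inverse

/-! ### Primitives of integrable functions -/

/-- `f` is a primitive on `[a,b]` of the integrable function `f'`. -/
structure IsPrimitive (f f' : ℝ → ℝ) (a b : ℝ) : Prop where
  integrable : IntervalIntegrable f' volume a b
  eq : ∀ x ∈ Icc a b, f x = f a + ∫ s in a..x, f' s

section Primitive

variable {f f' g g' : ℝ → ℝ} {a b : ℝ}

lemma IsPrimitive.sub_eq (hf : IsPrimitive f f' a b) {x y : ℝ} (hx : x ∈ Icc a b)
    (hy : y ∈ Icc a b) : f y - f x = ∫ s in x..y, f' s := by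
  have hab : a ≤ b := hx.1.trans hx.2
  have hi : ∀ z ∈ Icc a b, IntervalIntegrable f' volume a z := fun z hz =>
    hf.integrable.mono_set (by
      rw [uIcc_of_le hab, uIcc_of_le hz.1]; exact Icc_subset_Icc_right hz.2)
  rw [hf.eq x hx, hf.eq y hy, ← intervalIntegral.integral_interval_sub_left (hi y hy) (hi x hx)]
  ring

lemma IsPrimitive.continuousOn (hf : IsPrimitive f f' a b) (hab : a ≤ b) :
    ContinuousOn f (Icc a b) := by
  have := intervalIntegral.continuousOn_primitive_interval' hf.integrable left_mem_uIcc
  rw [uIcc_of_le hab] at this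
  exact (continuousOn_const.add this).congr hf.eq

lemma IsPrimitive.mul (hab : a ≤ b) (hf : IsPrimitive f f' a b) (hg : IsPrimitive g g' a b) :
    IsPrimitive (fun x => f x * g x) (fun x => f' x * g x + f x * g' x) a b := by
  have cf := hf.continuousOn hab
  have cg := hg.continuousOn hab
  rw [← uIcc_of_le hab] at cf cg
  refine ⟨(hf.integrable.mul_continuousOn cg).add (hg.integrable.continuousOn_mul cf), ?_⟩
  intro x hx
  have hxx : uIcc a x ⊆ uIcc a b := by
    rw [uIcc_of_le hab, uIcc_of_le hx.1]; exact Icc_subset_Icc_right hx.2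
  have hf1 := hf.integrable.mono_set hxx
  have hg1 := hg.integrable.mono_set hxx
  have af : AbsolutelyContinuousOnInterval (fun y => f a + ∫ s in a..y, f' s) a x :=
    (LipschitzOnWith.absolutelyContinuousOnInterval
      ((LipschitzWith.const (f a)).lipschitzOnWith)).add
      (hf1.absolutelyContinuousOnInterval_intervalIntegral left_mem_uIcc)
  have ag : AbsolutelyContinuousOnInterval (fun y => g a + ∫ s in a..y, g' s) a x :=
    (LipschitzOnWith.absolutelyContinuousOnInterval
      ((LipschitzWith.const (g a)).lipschitzOnWith)).add
      (hg1.absolutelyContinuousOnInterval_intervalIntegral left_mem_uIcc)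
  have h := AbsolutelyContinuousOnInterval.integral_deriv_mul_eq_sub af ag
  simp only [← hf.eq x hx, ← hg.eq x hx, intervalIntegral.integral_same, add_zero] at h
  refine (sub_eq_iff_eq_add'.1 h.symm).trans (congrArg _ ?_)
  refine intervalIntegral.integral_congr_ae ?_
  filter_upwards [hf1.ae_hasDerivAt_integral, hg1.ae_hasDerivAt_integral] with y h1 h2 hy
  have hy' := uIoc_subset_uIcc hy
  rw [((h1 hy' a left_mem_uIcc).const_add (f a)).deriv,
    ((h2 hy' a left_mem_uIcc).const_add (g a)).deriv]
  have hyy : y ∈ Icc a b := by have := hxx hy'; rwa [uIcc_of_le hab] at this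
  rw [← hf.eq y hyy, ← hg.eq y hyy]

lemma IsPrimitive.of_hasDerivAt {φ φ' : C(ℝ, ℝ)} (hφ : ∀ x, HasDerivAt φ (φ' x) x) :
    IsPrimitive φ φ' a b :=
  ⟨φ'.continuous.intervalIntegrable _ _, fun x _ => by
    rw [intervalIntegral.integral_eq_sub_of_hasDerivAt (fun y _ => hφ y)
      (φ'.continuous.intervalIntegrable _ _)]
    ring⟩

lemma IsPrimitive.of_hasDerivAt' {φ φ' : ℝ → ℝ} (hφ : ∀ x, HasDerivAt φ (φ' x) x)
    (hc : Continuous φ') : IsPrimitive φ φ' a b :=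
  ⟨hc.intervalIntegrable _ _, fun x _ => by
    rw [intervalIntegral.integral_eq_sub_of_hasDerivAt (fun y _ => hφ y)
      (hc.intervalIntegrable _ _)]
    ring⟩

lemma IsPrimitive.const_add_integral (hf : IntervalIntegrable f' volume a b) (c : ℝ) :
    IsPrimitive (fun x => c + ∫ s in a..x, f' s) f' a b :=
  ⟨hf, fun x _ => by simp⟩

lemma IsPrimitive.add (hab : a ≤ b) (hf : IsPrimitive f f' a b) (hg : IsPrimitive g g' a b) :
    IsPrimitive (fun x => f x + g x) (fun x => f' x + g' x) a b := by
  refine ⟨hf.integrable.add hg.integrable, fun x hx => ?_⟩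
  have hxx : uIcc a x ⊆ uIcc a b := by
    rw [uIcc_of_le hab, uIcc_of_le hx.1]; exact Icc_subset_Icc_right hx.2
  rw [intervalIntegral.integral_add (hf.integrable.mono_set hxx) (hg.integrable.mono_set hxx),
    hf.eq x hx, hg.eq x hx]
  ring

end Primitive

/-! ### Square integrable functions -/

section SquareIntegrable

lemma abs_integral_mul_le {α : Type*} {mα : MeasurableSpace α} {μ : Measure α} {f g : α → ℝ}
    (hf : MemLp f 2 μ) (hg : MemLp g 2 μ) :
    |∫ x, f x * g x ∂μ| ≤ √(∫ x, f x ^ 2 ∂μ) * √(∫ x, g x ^ 2 ∂μ) := by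
  have hn : ∀ {f : α → ℝ} (hf : MemLp f 2 μ), ‖hf.toLp f‖ = √(∫ x, f x ^ 2 ∂μ) := fun {f} hf => by
    rw [← Real.sqrt_sq (norm_nonneg (hf.toLp f)), ← real_inner_self_eq_norm_sq, L2.inner_def]
    congr 1
    refine integral_congr_ae ?_
    filter_upwards [hf.coeFn_toLp] with x hx
    rw [hx]; simp [sq]
  have h := abs_real_inner_le_norm (hf.toLp f) (hg.toLp g)
  rw [hn, hn, L2.inner_def] at h
  refine le_trans (le_of_eq ?_) h
  congr 1
  refine integral_congr_ae ?_
  filter_upwards [hf.coeFn_toLp, hg.coeFn_toLp] with x h1 h2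
  rw [h1, h2]; simp [mul_comm]

lemma sq_integral_le {β : Type*} {mβ : MeasurableSpace β} {ν : Measure β} [IsFiniteMeasure ν]
    {f : β → ℝ} (hf : MemLp f 2 ν) : (∫ y, f y ∂ν) ^ 2 ≤ ν.real univ * ∫ y, f y ^ 2 ∂ν := by
  have h := abs_integral_mul_le (memLp_const (1 : ℝ)) hf
  simp only [one_mul, one_pow, integral_const, smul_eq_mul, mul_one] at h
  have h2 := pow_le_pow_left₀ (abs_nonneg _) h 2
  rwa [sq_abs, mul_pow, Real.sq_sqrt measureReal_nonneg,
    Real.sq_sqrt (integral_nonneg fun _ => sq_nonneg _)] at h2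

/-- Averages of square integrable functions are square integrable. -/
lemma memLp_integral_prod {α β : Type*} {mα : MeasurableSpace α} {mβ : MeasurableSpace β}
    {μ : Measure α} {ν : Measure β} [SFinite μ] [IsFiniteMeasure ν] {f : α × β → ℝ}
    (hf : MemLp f 2 (μ.prod ν)) :
    MemLp (fun x => ∫ y, f (x, y) ∂ν) 2 μ ∧
      ∫ x, (∫ y, f (x, y) ∂ν) ^ 2 ∂μ ≤ ν.real univ * ∫ z, f z ^ 2 ∂(μ.prod ν) := by
  have hm : AEStronglyMeasurable (fun x => ∫ y, f (x, y) ∂ν) μ :=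
    hf.aestronglyMeasurable.integral_prod_right'
  have hsq := hf.integrable_sq
  have hae : ∀ᵐ x ∂μ, (∫ y, f (x, y) ∂ν) ^ 2 ≤ ν.real univ * ∫ y, f (x, y) ^ 2 ∂ν := by
    filter_upwards [hf.aestronglyMeasurable.prodMk_left, hsq.prod_right_ae] with x h1 h2
    exact sq_integral_le ((memLp_two_iff_integrable_sq h1).2 h2)
  have hint := hsq.integral_prod_left.const_mul (ν.real univ)
  have hi : Integrable (fun x => (∫ y, f (x, y) ∂ν) ^ 2) μ := by
    refine hint.mono' (hm.pow 2) ?_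
    filter_upwards [hae] with x hx
    rwa [Real.norm_of_nonneg (sq_nonneg _)]
  refine ⟨(memLp_two_iff_integrable_sq hm).2 hi, ?_⟩
  rw [integral_prod _ hsq, ← integral_const_mul]
  exact integral_mono_ae hi hint hae

/-- The translate `t ↦ f (t + s)` of a square integrable function. -/
def translate (s : ℝ) (f : Lp ℝ 2 (volume : Measure ℝ)) : Lp ℝ 2 (volume : Measure ℝ) :=
  Lp.compMeasurePreserving (fun t => t + s) (measurePreserving_add_right volume s) f

lemma coeFn_translate (s : ℝ) (f : Lp ℝ 2 (volume : Measure ℝ)) :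
    translate s f =ᵐ[volume] fun t => f (t + s) :=
  Lp.coeFn_compMeasurePreserving _ _

lemma continuous_translate (f : Lp ℝ 2 (volume : Measure ℝ)) :
    Continuous fun s => translate s f := by
  have hg : Continuous fun s : ℝ => (⟨fun t => t + s, by fun_prop⟩ : C(ℝ, ℝ)) :=
    ContinuousMap.continuous_of_continuous_uncurry _ (by
      simp only [ContinuousMap.coe_mk, Function.uncurry_def]; fun_prop)
  exact Continuous.compMeasurePreservingLp (f := fun _ : ℝ => f) continuous_const hg
    (fun s => measurePreserving_add_right volume s) (by norm_num)

lemma norm_sq_Lp {α : Type*} {mα : MeasurableSpace α} {μ : Measure α} (f : Lp ℝ 2 μ) :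
    ‖f‖ ^ 2 = ∫ x, f x ^ 2 ∂μ := by
  rw [← real_inner_self_eq_norm_sq, L2.inner_def]
  simp [sq]

lemma memLp_prod_of_slices {α β : Type*} {mα : MeasurableSpace α} {mβ : MeasurableSpace β}
    {μ : Measure α} {ν : Measure β} [SFinite μ] [SFinite ν] {f : α × β → ℝ}
    (hm : AEStronglyMeasurable f (μ.prod ν))
    (h1 : ∀ y, Integrable (fun x => f (x, y) ^ 2) μ)
    (h2 : Integrable (fun y => ∫ x, f (x, y) ^ 2 ∂μ) ν) : MemLp f 2 (μ.prod ν) := by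
  refine (memLp_two_iff_integrable_sq hm).2 ?_
  rw [integrable_prod_iff' (f := fun z => f z ^ 2) (hm.pow 2)]
  refine ⟨Eventually.of_forall h1, ?_⟩
  simpa only [Real.norm_of_nonneg (sq_nonneg _)] using h2

/-- The Steklov average of `y` over `[t,t+h]`. -/
def steklov (h : ℝ) (y : ℝ → ℝ) (t : ℝ) : ℝ := h⁻¹ * ∫ s in t..t + h, y s

lemma memLp_indicator_of_isTrace {y : ℝ → ℝ} (hy : IsTrace y) (T : ℝ) :
    MemLp ((Ioc 0 T).indicator y) 2 volume :=
  (memLp_indicator_iff_restrict measurableSet_Ioc).2 (hy T)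

lemma integral_steklov_sub_sq_le (Y : Lp ℝ 2 (volume : Measure ℝ)) {h : ℝ} (hh : 0 < h) :
    Integrable (fun t => (steklov h Y t - Y t) ^ 2) ∧
    ∫ t, (steklov h Y t - Y t) ^ 2 ≤ h⁻¹ * ∫ s in (0 : ℝ)..h, ‖translate s Y - Y‖ ^ 2 := by
  have hn : ∀ s, ∫ t, (Y (t + s) - Y t) ^ 2 = ‖translate s Y - Y‖ ^ 2 := fun s => by
    rw [norm_sq_Lp]
    refine integral_congr_ae ?_
    filter_upwards [coeFn_translate s Y, Lp.coeFn_sub (translate s Y) Y] with t h1 h2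
    rw [h2, Pi.sub_apply, h1]
  have hc : Continuous fun s => ‖translate s Y - Y‖ ^ 2 :=
    ((continuous_translate Y).sub continuous_const).norm.pow 2
  have hsm := Lp.stronglyMeasurable Y
  have hF : MemLp (fun z : ℝ × ℝ => Y (z.1 + z.2) - Y z.1) 2
      ((volume : Measure ℝ).prod (volume.restrict (Ioc 0 h))) := by
    refine memLp_prod_of_slices ?_ (fun s => ?_) ?_
    · refine StronglyMeasurable.aestronglyMeasurable ?_
      exact (hsm.comp_measurable (measurable_fst.add measurable_snd)).sub
        (hsm.comp_measurable measurable_fst)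
    · have := (Lp.memLp (translate s Y - Y)).integrable_sq
      refine this.congr ?_
      filter_upwards [coeFn_translate s Y, Lp.coeFn_sub (translate s Y) Y] with t h1 h2
      rw [h2, Pi.sub_apply, h1]
    · simp only [hn]
      exact (hc.integrableOn_Icc (a := 0) (b := h)).mono_set Ioc_subset_Icc_self
  obtain ⟨h1, h2⟩ := memLp_integral_prod hF
  have hst : ∀ᵐ t, steklov h Y t - Y t
      = h⁻¹ * ∫ s in Ioc 0 h, (Y (t + s) - Y t) := by
    refine Eventually.of_forall fun t => ?_
    have hYi : IntervalIntegrable (fun s => Y (t + s)) volume 0 h := by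
      have : IntervalIntegrable Y volume t (t + h) := by
        rw [intervalIntegrable_iff_integrableOn_Ioc_of_le (by linarith)]
        exact ((Lp.memLp Y).restrict _).integrable (by norm_num)
      simpa using this.comp_add_left (c := t)
    rw [steklov, ← intervalIntegral.integral_of_le hh.le, intervalIntegral.integral_sub hYi (by simp),
      intervalIntegral.integral_comp_add_left]
    simp only [add_zero, intervalIntegral.integral_const, sub_zero, smul_eq_mul]
    field_simp
  constructor
  · refine (h1.integrable_sq.const_mul (h⁻¹ ^ 2)).congr ?_
    filter_upwards [hst] with t ht
    rw [ht]; ring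
  · have e : ∫ t, (steklov h Y t - Y t) ^ 2
        = h⁻¹ ^ 2 * ∫ t, (∫ s in Ioc 0 h, (Y (t + s) - Y t)) ^ 2 := by
      rw [← integral_const_mul]
      refine integral_congr_ae ?_
      filter_upwards [hst] with t ht
      rw [ht]; ring
    rw [e]
    have h3 : (volume.restrict (Ioc 0 h)).real univ = h := by simp [hh.le]
    rw [h3, integral_prod_symm _ hF.integrable_sq] at h2
    simp only [hn] at h2
    rw [← intervalIntegral.integral_of_le hh.le] at h2
    calc h⁻¹ ^ 2 * ∫ t, (∫ s in Ioc 0 h, (Y (t + s) - Y t)) ^ 2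
        ≤ h⁻¹ ^ 2 * (h * ∫ s in (0 : ℝ)..h, ‖translate s Y - Y‖ ^ 2) := by gcongr
      _ = _ := by field_simp

/-- Steklov averages converge in `L²`. -/
lemma tendsto_integral_steklov_sub_sq {y : ℝ → ℝ} (hy : IsTrace y) {T : ℝ} (hT : 0 ≤ T) :
    Tendsto (fun h => ∫ t in (0 : ℝ)..T, (steklov h y t - y t) ^ 2) (𝓝[>] 0) (𝓝 0) := by
  set Y := (memLp_indicator_of_isTrace hy (T + 1)).toLp _
  have hY : Y =ᵐ[volume] (Ioc 0 (T + 1)).indicator y :=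
    (memLp_indicator_of_isTrace hy (T + 1)).coeFn_toLp
  have hc : Continuous fun s => ‖translate s Y - Y‖ ^ 2 :=
    ((continuous_translate Y).sub continuous_const).norm.pow 2
  have h0 : ‖translate 0 Y - Y‖ ^ 2 = 0 := by
    have : translate 0 Y = Y := by
      ext1
      filter_upwards [coeFn_translate 0 Y] with t ht
      rw [ht, add_zero]
    rw [this]; simp
  have hlim : Tendsto (fun h => h⁻¹ * ∫ s in (0 : ℝ)..h, ‖translate s Y - Y‖ ^ 2) (𝓝[>] 0) (𝓝 0) := by
    have hd : HasDerivAt (fun h => ∫ s in (0 : ℝ)..h, ‖translate s Y - Y‖ ^ 2)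
        (‖translate 0 Y - Y‖ ^ 2) 0 :=
      intervalIntegral.integral_hasDerivAt_right (hc.intervalIntegrable _ _)
        hc.stronglyMeasurable.stronglyMeasurableAtFilter hc.continuousAt
    rw [hasDerivAt_iff_tendsto_slope, h0] at hd
    refine (hd.mono_left (nhdsWithin_mono _ fun x hx => ne_of_gt hx)).congr fun h => ?_
    simp [slope_def_field, div_eq_inv_mul]
  refine squeeze_zero' ?_ ?_ hlim
  · exact Eventually.of_forall fun h =>
      intervalIntegral.integral_nonneg hT fun _ _ => sq_nonneg _
  · filter_upwards [Ioo_mem_nhdsGT (zero_lt_one (α := ℝ))] with h hh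
    obtain ⟨h1, h2⟩ := integral_steklov_sub_sq_le Y hh.1
    refine le_trans ?_ h2
    have hcongr : ∫ t in (0 : ℝ)..T, (steklov h y t - y t) ^ 2
        = ∫ t in (0 : ℝ)..T, (steklov h Y t - Y t) ^ 2 := by
      refine intervalIntegral.integral_congr_ae ?_
      filter_upwards [hY] with t ht htm
      rw [uIoc_of_le hT] at htm
      rw [ht, indicator_of_mem (show t ∈ Ioc 0 (T + 1) from ⟨htm.1, by linarith [htm.2]⟩), steklov,
        steklov]
      congr 3
      refine intervalIntegral.integral_congr_ae ?_
      filter_upwards [hY] with s hs hsm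
      rw [uIoc_of_le (by linarith [hh.1])] at hsm
      rw [hs, indicator_of_mem (show s ∈ Ioc 0 (T + 1) from
        ⟨htm.1.trans hsm.1, by linarith [htm.2, hsm.2, hh.2]⟩)]
    rw [hcongr, intervalIntegral.integral_of_le hT]
    exact setIntegral_le_integral h1 (Eventually.of_forall fun _ => sq_nonneg _)

end SquareIntegrable

/-! ### The energy identity -/

section Energy

variable {ℓ a : ℝ}

lemma eq_zero_of_inner_emb (hℓ : 0 ≤ ℓ) {w : L2 ℓ}
    (h : ∀ φ : C(ℝ, ℝ), inner ℝ w (emb ℓ φ) = 0) : w = 0 := by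
  refine (Lp.eq_zero_iff_ae_eq_zero).2 ?_
  have := isOpen_Ioo.ae_eq_zero_of_integral_contDiff_smul_eq_zero (f := w) (U := Ioo 0 ℓ)
    (μ := volume) (integrableOn_Ioo_coeFn w).locallyIntegrableOn (fun g hg _ hs => by
      have h1 := h ⟨g, hg.continuous⟩
      rw [inner_emb hℓ, ← setIntegral_Ioo_eq hℓ] at h1
      refine Eq.trans ?_ h1
      rw [← integral_indicator measurableSet_Ioo]
      refine integral_congr_ae (Eventually.of_forall fun x => ?_)
      by_cases hx : x ∈ Ioo 0 ℓ
      · simp [indicator_of_mem hx, mul_comm]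
      · simp [indicator_of_notMem hx, image_eq_zero_of_notMem_tsupport fun h' => hx (hs h')])
  rw [EventuallyEq, ae_restrict_iff' measurableSet_Ioo]
  exact this

lemma eq_of_inner_emb (hℓ : 0 ≤ ℓ) {v w : L2 ℓ}
    (h : ∀ φ : C(ℝ, ℝ), inner ℝ v (emb ℓ φ) = inner ℝ w (emb ℓ φ)) : v = w :=
  sub_eq_zero.1 (eq_zero_of_inner_emb hℓ fun φ => by rw [inner_sub_left, h, sub_self])

/-- A primitive of a continuous function. -/
def primitive (φ : C(ℝ, ℝ)) : C(ℝ, ℝ) :=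
  ⟨fun x => ∫ s in (0 : ℝ)..x, φ s,
    intervalIntegral.continuous_primitive (fun _ _ => φ.continuous.intervalIntegrable _ _) _⟩

lemma hasDerivAt_primitive (φ : C(ℝ, ℝ)) (x : ℝ) : HasDerivAt (primitive φ) (φ x) x :=
  intervalIntegral.integral_hasDerivAt_right (φ.continuous.intervalIntegrable _ _)
    φ.continuous.stronglyMeasurable.stronglyMeasurableAtFilter φ.continuous.continuousAt

/-- The energy identity for a stationary weak equation `-a w' = G`. -/
lemma stationary_energy (hℓ : 0 < ℓ) (ha : a ≠ 0) {w G : L2 ℓ} {y0 yL : ℝ}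
    (h : ∀ φ φ' : C(ℝ, ℝ), (∀ x, HasDerivAt φ (φ' x) x) →
      a * inner ℝ w (emb ℓ φ') + a * (y0 * φ 0 - yL * φ ℓ) = inner ℝ G (emb ℓ φ))
    {g g' : C(ℝ, ℝ)} (hg : ∀ x, HasDerivAt g (g' x) x) :
    2 * inner ℝ (mulH ℓ g w) G
      = a * inner ℝ (mulH ℓ g' w) w + a * (g 0 * y0 ^ 2 - g ℓ * yL ^ 2) := by
  set Y : ℝ → ℝ := fun x => y0 + ∫ s in (0 : ℝ)..x, (-a⁻¹) * G s with hYdef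
  have h0 : (0 : ℝ) ∈ Icc 0 ℓ := ⟨le_rfl, hℓ.le⟩
  have hl : ℓ ∈ Icc 0 ℓ := ⟨hℓ.le, le_rfl⟩
  have hY : IsPrimitive Y (fun s => (-a⁻¹) * G s) 0 ℓ :=
    IsPrimitive.const_add_integral ((intervalIntegrable_coeFn G h0 hl).const_mul _) _
  have hY0 : Y 0 = y0 := by simp [hYdef]
  have hYc : ContinuousOn Y (Icc 0 ℓ) := hY.continuousOn hℓ.le
  have hibp : ∀ φ φ' : C(ℝ, ℝ), (∀ x, HasDerivAt φ (φ' x) x) →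
      ∫ x in (0 : ℝ)..ℓ, Y x * φ' x = Y ℓ * φ ℓ - y0 * φ 0 + a⁻¹ * inner ℝ G (emb ℓ φ) := by
    intro φ φ' hφ
    have hm := (hY.mul hℓ.le (IsPrimitive.of_hasDerivAt hφ)).sub_eq h0 hl
    have hGφ : IntervalIntegrable (fun x => (-a⁻¹) * G x * φ x) volume 0 ℓ :=
      ((intervalIntegrable_coeFn G h0 hl).const_mul _).mul_continuousOn
        φ.continuous.continuousOn
    have hYφ : IntervalIntegrable (fun x => Y x * φ' x) volume 0 ℓ := by
      refine ContinuousOn.intervalIntegrable ?_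
      rw [uIcc_of_le hℓ.le]
      exact hYc.mul φ'.continuous.continuousOn
    rw [intervalIntegral.integral_add hGφ hYφ, hY0] at hm
    rw [inner_emb hℓ.le, hm, ← intervalIntegral.integral_const_mul]
    have : ∫ x in (0 : ℝ)..ℓ, -a⁻¹ * G x * φ x = -∫ x in (0 : ℝ)..ℓ, a⁻¹ * (G x * φ x) := by
      rw [← intervalIntegral.integral_neg]
      exact intervalIntegral.integral_congr fun x _ => by ring
    rw [this]; ring
  have hdiff : ∀ φ φ' : C(ℝ, ℝ), (∀ x, HasDerivAt φ (φ' x) x) →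
      inner ℝ w (emb ℓ φ') - ∫ x in (0 : ℝ)..ℓ, Y x * φ' x = (yL - Y ℓ) * φ ℓ := by
    intro φ φ' hφ
    rw [hibp φ φ' hφ, ← h φ φ' hφ]
    field_simp
    ring
  have hL : yL = Y ℓ := by
    have := hdiff 1 0 (fun x => hasDerivAt_const x (1 : ℝ))
    have e0 : emb ℓ (0 : C(ℝ, ℝ)) = 0 := by simpa using emb_smul (ℓ := ℓ) 0 0
    simp [e0] at this
    linarith
  have hw : w =ᵐ[volume.restrict (Ioo (0 : ℝ) ℓ)] Y := by
    have hYm : MemLp Y 2 (volume.restrict (Ioo (0 : ℝ) ℓ)) := by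
      obtain ⟨C, hC⟩ := isCompact_Icc.exists_bound_of_continuousOn hYc
      refine MemLp.of_bound ((hYc.mono Ioo_subset_Icc_self).aestronglyMeasurable measurableSet_Ioo)
        C ?_
      filter_upwards [ae_restrict_mem measurableSet_Ioo] with x hx
      exact hC x (Ioo_subset_Icc_self hx)
    have : w = hYm.toLp Y := by
      refine eq_of_inner_emb hℓ.le fun ψ => ?_
      have := hdiff (primitive ψ) ψ (hasDerivAt_primitive ψ)
      rw [hL, sub_self, zero_mul, sub_eq_zero] at this
      rw [this, inner_emb hℓ.le]
      refine intervalIntegral_congr_ae hℓ.le ?_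
      filter_upwards [hYm.coeFn_toLp] with x hx
      rw [hx]
    rw [this]
    exact hYm.coeFn_toLp
  have hfin := ((IsPrimitive.of_hasDerivAt hg).mul hℓ.le (hY.mul hℓ.le hY)).sub_eq h0 hl
  rw [hY0, ← hL] at hfin
  have e1 : inner ℝ (mulH ℓ g w) G = ∫ x in (0 : ℝ)..ℓ, g x * Y x * G x := by
    rw [inner_eq_integral hℓ.le]
    refine intervalIntegral_congr_ae hℓ.le ?_
    filter_upwards [coeFn_mulH g w, hw] with x h1 h2
    rw [h1, h2]
  have e2 : inner ℝ (mulH ℓ g' w) w = ∫ x in (0 : ℝ)..ℓ, g' x * Y x * Y x := by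
    rw [inner_eq_integral hℓ.le]
    refine intervalIntegral_congr_ae hℓ.le ?_
    filter_upwards [coeFn_mulH g' w, hw] with x h1 h2
    rw [h1, h2]
  have e3 : ∫ x in (0 : ℝ)..ℓ, (g' x * (Y x * Y x)
      + g x * (-a⁻¹ * G x * Y x + Y x * (-a⁻¹ * G x)))
      = (∫ x in (0 : ℝ)..ℓ, g' x * Y x * Y x)
        + (-2 * a⁻¹) * ∫ x in (0 : ℝ)..ℓ, g x * Y x * G x := by
    rw [← intervalIntegral.integral_const_mul, ← intervalIntegral.integral_add]
    · exact intervalIntegral.integral_congr fun x _ => by ring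
    · refine ContinuousOn.intervalIntegrable ?_
      rw [uIcc_of_le hℓ.le]
      exact (g'.continuous.continuousOn.mul hYc).mul hYc
    · refine ((intervalIntegrable_coeFn G h0 hl).continuousOn_mul ?_).const_mul _
      rw [uIcc_of_le hℓ.le]
      exact g.continuous.continuousOn.mul hYc
  rw [e3, ← e1, ← e2] at hfin
  have : g 0 * y0 ^ 2 - g ℓ * yL ^ 2 = -(inner ℝ (mulH ℓ g' w) w
      + (-2 * a⁻¹) * inner ℝ (mulH ℓ g w) G) := by
    rw [← hfin]; ring
  rw [this]
  field_simp
  ring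

/-- The Steklov average of a function with values in `L²`. -/
def steklovH (h : ℝ) (w : ℝ → L2 ℓ) (t : ℝ) : L2 ℓ := h⁻¹ • ∫ s in t..t + h, w s

lemma inner_steklovH {w : ℝ → L2 ℓ} (hw : Continuous w) (h t : ℝ) (φ : L2 ℓ) :
    inner ℝ (steklovH h w t) φ = h⁻¹ * ∫ s in t..t + h, inner ℝ (w s) φ := by
  rw [steklovH, inner_smul_left, real_inner_comm, ← innerSL_apply_apply (𝕜 := ℝ),
    ← ContinuousLinearMap.intervalIntegral_comp_comm _ (hw.intervalIntegrable _ _)]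
  simp only [innerSL_apply_apply, RCLike.conj_to_real]
  congr 1
  exact intervalIntegral.integral_congr fun s _ => real_inner_comm _ _

lemma hasDerivAt_steklovH {w : ℝ → L2 ℓ} (hw : Continuous w) (h t : ℝ) :
    HasDerivAt (steklovH h w) (h⁻¹ • (w (t + h) - w t)) t := by
  have hd : ∀ x, HasDerivAt (fun x => ∫ s in (0 : ℝ)..x, w s) (w x) x := fun x =>
    intervalIntegral.integral_hasDerivAt_right (hw.intervalIntegrable _ _)
      (hw.stronglyMeasurableAtFilter _ _) hw.continuousAt
  have h1 := ((hd (t + h)).comp_add_const t h).sub (hd t)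
  refine (h1.const_smul h⁻¹).congr_of_eventuallyEq (Eventually.of_forall fun x => ?_)
  simp only [steklovH, Pi.smul_apply, Pi.sub_apply]
  rw [intervalIntegral.integral_interval_sub_left (hw.intervalIntegrable _ _)
    (hw.intervalIntegrable _ _)]

lemma tendsto_steklovH {w : ℝ → L2 ℓ} (hw : Continuous w) (t : ℝ) :
    Tendsto (fun h => steklovH h w t) (𝓝[>] 0) (𝓝 (w t)) := by
  have hd : HasDerivAt (fun h => ∫ s in t..t + h, w s) (w (t + 0)) 0 := by
    have : HasDerivAt (fun x => ∫ s in t..x, w s) (w (t + 0)) (t + 0) :=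
      intervalIntegral.integral_hasDerivAt_right (hw.intervalIntegrable _ _)
        (hw.stronglyMeasurableAtFilter _ _) hw.continuousAt
    exact this.comp_const_add t 0
  rw [hasDerivAt_iff_tendsto_slope, add_zero] at hd
  refine (hd.mono_left (nhdsWithin_mono _ fun x hx => ne_of_gt hx)).congr fun h => ?_
  simp [slope_def_module, steklovH]

lemma norm_steklovH_le {w : ℝ → L2 ℓ} {T C : ℝ} (hC : ∀ s ∈ Icc 0 (T + 1), ‖w s‖ ≤ C) {h t : ℝ}
    (hh : h ∈ Ioo 0 1) (ht : t ∈ Icc 0 T) : ‖steklovH h w t‖ ≤ C := by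
  have h1 : ‖∫ s in t..t + h, w s‖ ≤ C * |t + h - t| := by
    refine intervalIntegral.norm_integral_le_of_norm_le_const fun s hs => hC s ?_
    rw [uIoc_of_le (by linarith [hh.1])] at hs
    exact ⟨by linarith [ht.1, hs.1], by linarith [ht.2, hs.2, hh.2]⟩
  rw [add_sub_cancel_left, abs_of_pos hh.1] at h1
  rw [steklovH, norm_smul, norm_inv, Real.norm_of_nonneg hh.1.le, inv_mul_le_iff₀ hh.1]
  linarith

/-- The averaged weak equation. -/
lemma WeakTransport.steklov {w F : ℝ → L2 ℓ} {w0 wL b : ℝ → ℝ} {p : L2 ℓ} (hw : Continuous w)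
    (hF : Continuous F) (h0 : IsTrace w0) (hL : IsTrace wL) (hb : IsTrace b)
    (hT : WeakTransport ℓ a w w0 wL fun s => F s + b s • p) {h t : ℝ} (hh : 0 < h) (ht : 0 ≤ t)
    {φ φ' : C(ℝ, ℝ)} (hφ : ∀ x, HasDerivAt φ (φ' x) x) :
    inner ℝ (h⁻¹ • (w (t + h) - w t)) (emb ℓ φ)
      = a * inner ℝ (steklovH h w t) (emb ℓ φ')
        + a * (STC.steklov h w0 t * φ 0 - STC.steklov h wL t * φ ℓ)
        + inner ℝ (steklovH h F t + STC.steklov h b t • p) (emb ℓ φ) := by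
  have hth : 0 ≤ t + h := by linarith
  have hwF : WeakIntegrable fun s => F s + b s • p :=
    (WeakIntegrable.of_continuousOn hF.continuousOn).add (hb.weakIntegrable_smul p)
  have i1 := WeakTransport.intervalIntegrable (a := a) hw.continuousOn h0 hL hwF φ φ' hth
  have i2 := WeakTransport.intervalIntegrable (a := a) hw.continuousOn h0 hL hwF φ φ' ht
  have j0 := h0.intervalIntegrable ht hth
  have jL := hL.intervalIntegrable ht hth
  have jb := hb.intervalIntegrable ht hth
  have ci : ∀ {f : ℝ → ℝ}, Continuous f → IntervalIntegrable f volume t (t + h) :=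
    fun hf => hf.intervalIntegrable _ _
  rw [inner_smul_left, inner_sub_left, hT φ φ' hφ (t + h) hth, hT φ φ' hφ t ht,
    add_sub_add_left_eq_sub, intervalIntegral.integral_interval_sub_left i1 i2, inner_add_left,
    inner_steklovH hw, inner_steklovH hF, inner_smul_left, STC.steklov, STC.steklov, STC.steklov]
  simp only [inner_add_left, inner_smul_left, RCLike.conj_to_real]
  rw [intervalIntegral.integral_add, intervalIntegral.integral_add, intervalIntegral.integral_add,
    intervalIntegral.integral_const_mul, intervalIntegral.integral_const_mul,
    intervalIntegral.integral_sub, intervalIntegral.integral_mul_const,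
    intervalIntegral.integral_mul_const, intervalIntegral.integral_mul_const]
  · ring
  · exact j0.mul_const _
  · exact jL.mul_const _
  · exact ci (by fun_prop)
  · exact jb.mul_const _
  · exact (ci (by fun_prop)).const_mul a
  · exact ((j0.mul_const _).sub (jL.mul_const _)).const_mul a
  · exact ((ci (by fun_prop)).const_mul a).add
      (((j0.mul_const _).sub (jL.mul_const _)).const_mul a)
  · exact (ci (by fun_prop)).add (jb.mul_const _)

lemma IsTrace.continuous_steklov_sq {y : ℝ → ℝ} (hy : IsTrace y) {h t : ℝ} (hh : 0 < h)
    (ht : 0 ≤ t) : ContinuousOn (STC.steklov h y) (Icc 0 t) := by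
  have hth : 0 ≤ t + h := by linarith
  have h1 := intervalIntegral.continuousOn_primitive_interval' (hy.intervalIntegrable le_rfl hth)
    left_mem_uIcc
  rw [uIcc_of_le hth] at h1
  have h2 : ContinuousOn (fun x => (∫ s in (0 : ℝ)..x + h, y s) - ∫ s in (0 : ℝ)..x, y s)
      (Icc 0 t) := by
    refine ContinuousOn.sub ?_ (h1.mono (Icc_subset_Icc_right (by linarith)))
    exact h1.comp (by fun_prop) fun x hx => ⟨by linarith [hx.1], by linarith [hx.2]⟩
  refine (continuousOn_const (c := h⁻¹)).mul (h2.congr fun x hx => ?_)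
  exact (intervalIntegral.integral_interval_sub_left
    (hy.intervalIntegrable le_rfl (by linarith [hx.1])) (hy.intervalIntegrable le_rfl hx.1)).symm

lemma averaged_energy (hℓ : 0 < ℓ) (ha : a ≠ 0) {w F : ℝ → L2 ℓ} {w0 wL b : ℝ → ℝ} {p : L2 ℓ}
    (hw : Continuous w) (hF : Continuous F) (h0 : IsTrace w0) (hL : IsTrace wL) (hb : IsTrace b)
    (hT : WeakTransport ℓ a w w0 wL fun s => F s + b s • p) {g g' : C(ℝ, ℝ)}
    (hg : ∀ x, HasDerivAt g (g' x) x) {h t : ℝ} (hh : 0 < h) (ht : 0 ≤ t) :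
    inner ℝ (mulH ℓ g (steklovH h w t)) (steklovH h w t)
      = inner ℝ (mulH ℓ g (steklovH h w 0)) (steklovH h w 0)
        + ∫ s in (0 : ℝ)..t, (a * inner ℝ (mulH ℓ g' (steklovH h w s)) (steklovH h w s)
          + a * (g 0 * STC.steklov h w0 s ^ 2 - g ℓ * STC.steklov h wL s ^ 2)
          + 2 * inner ℝ (mulH ℓ g (steklovH h w s)) (steklovH h F s + STC.steklov h b s • p)) := by
  set W := steklovH h w
  have hW : ∀ s, HasDerivAt W (h⁻¹ • (w (s + h) - w s)) s := hasDerivAt_steklovH hw h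
  have hWc : Continuous W := continuous_iff_continuousAt.2 fun s => (hW s).continuousAt
  have hd : ∀ s, HasDerivAt (fun s => inner ℝ (mulH ℓ g (W s)) (W s))
      (2 * inner ℝ (mulH ℓ g (W s)) (h⁻¹ • (w (s + h) - w s))) s := by
    intro s
    have h1 : HasDerivAt (fun s => mulH ℓ g (W s)) (mulH ℓ g (h⁻¹ • (w (s + h) - w s))) s :=
      (mulH ℓ g).hasFDerivAt.comp_hasDerivAt s (hW s)
    refine (h1.inner ℝ (hW s)).congr_deriv ?_
    rw [inner_mulH_comm hℓ.le g _ (W s), real_inner_comm]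
    ring
  have hcont : Continuous fun s => 2 * inner ℝ (mulH ℓ g (W s)) (h⁻¹ • (w (s + h) - w s)) := by
    fun_prop
  have hftc := intervalIntegral.integral_eq_sub_of_hasDerivAt (a := 0) (b := t) (fun s _ => hd s)
    (hcont.intervalIntegrable _ _)
  rw [eq_comm, sub_eq_iff_eq_add'] at hftc
  rw [hftc]
  congr 1
  refine intervalIntegral.integral_congr fun s hs => ?_
  rw [uIcc_of_le ht] at hs
  have := stationary_energy hℓ ha (w := W s) (G := h⁻¹ • (w (s + h) - w s)
    - (steklovH h F s + STC.steklov h b s • p)) (y0 := STC.steklov h w0 s)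
    (yL := STC.steklov h wL s) (fun φ φ' hφ => by
      rw [inner_sub_left, hT.steklov hw hF h0 hL hb hh hs.1 hφ]; ring) hg
  rw [inner_sub_right] at this
  linarith

lemma tendsto_integral_mul_steklov_sub {y k : ℝ → ℝ} (hy : IsTrace y) (hk : IsTrace k) {T : ℝ}
    (hT : 0 ≤ T) :
    Tendsto (fun h => ∫ t in (0 : ℝ)..T, |k t| * |STC.steklov h y t - y t|) (𝓝[>] 0) (𝓝 0) := by
  have h1 := (tendsto_integral_steklov_sub_sq hy hT).sqrt.const_mul
    (√(∫ t in (0 : ℝ)..T, k t ^ 2))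
  rw [Real.sqrt_zero, mul_zero] at h1
  refine squeeze_zero' (Eventually.of_forall fun h =>
    intervalIntegral.integral_nonneg hT fun _ _ => by positivity) ?_ h1
  filter_upwards [self_mem_nhdsWithin] with h hh
  have hm : MemLp (fun t => STC.steklov h y t - y t) 2 (volume.restrict (Ioc 0 T)) := by
    refine MemLp.sub ?_ (hy T)
    have hc := hy.continuous_steklov_sq hh hT
    obtain ⟨C, hC⟩ := isCompact_Icc.exists_bound_of_continuousOn hc
    refine MemLp.of_bound ((hc.mono Ioc_subset_Icc_self).aestronglyMeasurable measurableSet_Ioc)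
      C ?_
    filter_upwards [ae_restrict_mem measurableSet_Ioc] with x hx
    exact hC x (Ioc_subset_Icc_self hx)
  have := abs_integral_mul_le (hk T).abs hm.abs
  simp only [Pi.abs_apply, sq_abs] at this
  rw [intervalIntegral.integral_of_le hT, intervalIntegral.integral_of_le hT,
    intervalIntegral.integral_of_le hT]
  exact (le_abs_self _).trans this

lemma isTrace_const (c : ℝ) : IsTrace fun _ => c := fun _ => memLp_const c

lemma IsTrace.of_continuousOn {y : ℝ → ℝ} (hy : ContinuousOn y (Ici 0)) : IsTrace y := fun T => by
  obtain ⟨C, hC⟩ := (isCompact_Icc (a := 0) (b := T)).exists_bound_of_continuousOn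
    (hy.mono fun x hx => hx.1)
  refine MemLp.of_bound ((hy.mono fun x hx => hx.1.le).aestronglyMeasurable measurableSet_Ioc) C ?_
  filter_upwards [ae_restrict_mem measurableSet_Ioc] with x hx
  exact hC x (Ioc_subset_Icc_self hx)

lemma IsTrace.mul_intervalIntegrable {y z : ℝ → ℝ} (hy : IsTrace y) (hz : IsTrace z) {s t : ℝ}
    (hs : 0 ≤ s) (ht : 0 ≤ t) : IntervalIntegrable (fun r => y r * z r) volume s t := by
  rw [intervalIntegrable_iff]
  have : IntegrableOn (fun r => y r * z r) (Ioc 0 (max s t)) :=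
    (hy (max s t)).integrable_mul (hz (max s t))
  refine this.mono_set ?_
  rw [uIoc]
  exact Ioc_subset_Ioc_left (le_min hs ht)

lemma tendsto_integral_steklov_sq {y : ℝ → ℝ} (hy : IsTrace y) {T : ℝ} (hT : 0 ≤ T) :
    Tendsto (fun h => ∫ t in (0 : ℝ)..T, STC.steklov h y t ^ 2) (𝓝[>] 0)
      (𝓝 (∫ t in (0 : ℝ)..T, y t ^ 2)) := by
  have h1 := (tendsto_integral_steklov_sub_sq hy hT).add
    ((tendsto_integral_mul_steklov_sub hy hy hT).const_mul 2)
  rw [mul_zero, add_zero] at h1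
  rw [tendsto_iff_norm_sub_tendsto_zero]
  refine squeeze_zero' (Eventually.of_forall fun _ => norm_nonneg _) ?_ h1
  filter_upwards [self_mem_nhdsWithin] with h hh
  have hc := hy.continuous_steklov_sq hh hT
  have hst : MemLp (STC.steklov h y) 2 (volume.restrict (Ioc 0 T)) := by
    obtain ⟨C, hC⟩ := isCompact_Icc.exists_bound_of_continuousOn hc
    refine MemLp.of_bound ((hc.mono Ioc_subset_Icc_self).aestronglyMeasurable measurableSet_Ioc)
      C ?_
    filter_upwards [ae_restrict_mem measurableSet_Ioc] with x hx
    exact hC x (Ioc_subset_Icc_self hx)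
  have hm : MemLp (fun t => STC.steklov h y t - y t) 2 (volume.restrict (Ioc 0 T)) :=
    hst.sub (hy T)
  have i1 := hst.integrable_sq
  have i2 := (hy T).integrable_sq
  have i3 := hm.integrable_sq
  have i4 : Integrable (fun t => |y t| * |STC.steklov h y t - y t|)
      (volume.restrict (Ioc 0 T)) := (hy T).abs.integrable_mul hm.abs
  simp only [intervalIntegral.integral_of_le hT]
  rw [← integral_const_mul, ← integral_add i3 (i4.const_mul 2), ← integral_sub i1 i2]
  refine (norm_integral_le_integral_norm _).trans (integral_mono (i1.sub i2).norm
    (i3.add (i4.const_mul 2)) fun t => ?_)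
  simp only [Real.norm_eq_abs]
  rw [← abs_mul, ← sq_abs (STC.steklov h y t - y t)]
  have e : STC.steklov h y t ^ 2 - y t ^ 2 = (STC.steklov h y t - y t) ^ 2
      + 2 * (y t * (STC.steklov h y t - y t)) := by ring
  rw [e]
  refine (abs_add_le _ _).trans (le_of_eq ?_)
  rw [abs_mul 2, abs_of_pos (two_pos : (0 : ℝ) < 2), abs_pow]

lemma tendsto_integral_steklov_mul {y : ℝ → ℝ} (hy : IsTrace y) {T : ℝ} (hT : 0 ≤ T)
    {k : ℝ → ℝ → ℝ} {k0 : ℝ → ℝ} {C : ℝ} (hkc : ∀ h, Continuous (k h))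
    (hC : ∀ᶠ h in 𝓝[>] 0, ∀ t ∈ Icc 0 T, |k h t| ≤ C)
    (hk : ∀ t ∈ Icc 0 T, Tendsto (fun h => k h t) (𝓝[>] 0) (𝓝 (k0 t))) :
    Tendsto (fun h => ∫ t in (0 : ℝ)..T, STC.steklov h y t * k h t) (𝓝[>] 0)
      (𝓝 (∫ t in (0 : ℝ)..T, y t * k0 t)) := by
  have h1 : Tendsto (fun h => ∫ t in (0 : ℝ)..T, (STC.steklov h y t - y t) * k h t) (𝓝[>] 0)
      (𝓝 0) := by
    have h2 := tendsto_integral_mul_steklov_sub hy (isTrace_const C) hT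
    refine squeeze_zero_norm' ?_ h2
    filter_upwards [self_mem_nhdsWithin, hC] with h hh hCh
    have hi : IntervalIntegrable (fun t => STC.steklov h y t - y t) volume 0 T := by
      refine IntervalIntegrable.sub ?_ (hy.intervalIntegrable le_rfl hT)
      refine ContinuousOn.intervalIntegrable ?_
      rw [uIcc_of_le hT]
      exact hy.continuous_steklov_sq hh hT
    refine intervalIntegral.norm_integral_le_of_norm_le hT ?_ (hi.abs.const_mul _)
    refine Eventually.of_forall fun t ht => ?_
    rw [norm_mul, mul_comm, Real.norm_eq_abs, Real.norm_eq_abs]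
    exact mul_le_mul_of_nonneg_right ((hCh t (Ioc_subset_Icc_self ht)).trans (le_abs_self _))
      (abs_nonneg _)
  have h2 : Tendsto (fun h => ∫ t in (0 : ℝ)..T, y t * k h t) (𝓝[>] 0)
      (𝓝 (∫ t in (0 : ℝ)..T, y t * k0 t)) := by
    refine intervalIntegral.tendsto_integral_filter_of_dominated_convergence
      (fun t => |y t| * C) ?_ ?_ ?_ ?_
    · refine Eventually.of_forall fun h => ?_
      exact (intervalIntegrable_iff.1 ((hy.intervalIntegrable le_rfl hT).mul_continuousOn
        (hkc h).continuousOn)).aestronglyMeasurable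
    · filter_upwards [hC] with h hCh
      refine Eventually.of_forall fun t ht => ?_
      rw [uIoc_of_le hT] at ht
      rw [norm_mul]
      exact mul_le_mul_of_nonneg_left (hCh t (Ioc_subset_Icc_self ht)) (abs_nonneg _)
    · exact (hy.intervalIntegrable le_rfl hT).abs.mul_const _
    · refine Eventually.of_forall fun t ht => ?_
      rw [uIoc_of_le hT] at ht
      exact (hk t (Ioc_subset_Icc_self ht)).const_mul _
  have h3 := h1.add h2
  rw [zero_add] at h3
  refine h3.congr' ?_
  filter_upwards [self_mem_nhdsWithin] with h hh
  have hs : IntervalIntegrable (STC.steklov h y) volume 0 T := by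
    refine ContinuousOn.intervalIntegrable ?_
    rw [uIcc_of_le hT]
    exact hy.continuous_steklov_sq hh hT
  rw [← intervalIntegral.integral_add]
  · exact intervalIntegral.integral_congr fun t _ => by ring
  · exact (hs.sub (hy.intervalIntegrable le_rfl hT)).mul_continuousOn (hkc h).continuousOn
  · exact (hy.intervalIntegrable le_rfl hT).mul_continuousOn (hkc h).continuousOn

lemma continuous_steklovH {w : ℝ → L2 ℓ} (hw : Continuous w) (h : ℝ) :
    Continuous (steklovH h w) :=
  continuous_iff_continuousAt.2 fun s => (hasDerivAt_steklovH hw h s).continuousAt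

lemma tendsto_integral_inner_steklovH {w F : ℝ → L2 ℓ} (hw : Continuous w) (hF : Continuous F)
    (S : L2 ℓ →L[ℝ] L2 ℓ) {T : ℝ} (hT : 0 ≤ T) :
    Tendsto (fun h => ∫ t in (0 : ℝ)..T, inner ℝ (S (steklovH h w t)) (steklovH h F t)) (𝓝[>] 0)
      (𝓝 (∫ t in (0 : ℝ)..T, inner ℝ (S (w t)) (F t))) := by
  obtain ⟨C, hC⟩ := (isCompact_Icc (a := 0) (b := T + 1)).exists_bound_of_continuousOn
    hw.continuousOn
  obtain ⟨D, hD⟩ := (isCompact_Icc (a := 0) (b := T + 1)).exists_bound_of_continuousOn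
    hF.continuousOn
  refine intervalIntegral.tendsto_integral_filter_of_dominated_convergence
      (fun t => ‖S‖ * C * D) ?_ ?_ (by simp) ?_
  · refine Eventually.of_forall fun h => Continuous.aestronglyMeasurable ?_
    exact (S.continuous.comp (continuous_steklovH hw h)).inner (continuous_steklovH hF h)
  · filter_upwards [Ioo_mem_nhdsGT (zero_lt_one (α := ℝ))] with h hh
    refine Eventually.of_forall fun t ht => ?_
    rw [uIoc_of_le hT] at ht
    have h1 := norm_steklovH_le hC hh (Ioc_subset_Icc_self ht)
    have h2 := norm_steklovH_le hD hh (Ioc_subset_Icc_self ht)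
    calc ‖inner ℝ (S (steklovH h w t)) (steklovH h F t)‖
        ≤ ‖S (steklovH h w t)‖ * ‖steklovH h F t‖ := norm_inner_le_norm _ _
      _ ≤ (‖S‖ * ‖steklovH h w t‖) * ‖steklovH h F t‖ := by gcongr; exact S.le_opNorm _
      _ ≤ ‖S‖ * C * D := by
        have : 0 ≤ C := (norm_nonneg _).trans h1
        gcongr
  · refine Eventually.of_forall fun t _ => ?_
    exact (((S.continuous.tendsto _).comp (tendsto_steklovH hw t))).inner (tendsto_steklovH hF t)

lemma IsTrace.integrable_energy (g0 gL : ℝ) {w0 wL : ℝ → ℝ} (h0 : IsTrace w0) (hL : IsTrace wL)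
    {t : ℝ} (ht : 0 ≤ t) :
    IntervalIntegrable (fun s => a * (g0 * w0 s ^ 2 - gL * wL s ^ 2)) volume 0 t :=
  (((h0.sq_intervalIntegrable le_rfl ht).const_mul _).sub
    ((hL.sq_intervalIntegrable le_rfl ht).const_mul _)).const_mul _

lemma energy_identity_of_continuous (hℓ : 0 < ℓ) (ha : a ≠ 0) {w F : ℝ → L2 ℓ} {w0 wL b : ℝ → ℝ}
    {p : L2 ℓ} (hw : Continuous w) (hF : Continuous F) (h0 : IsTrace w0) (hL : IsTrace wL)
    (hb : IsTrace b) (hT : WeakTransport ℓ a w w0 wL fun s => F s + b s • p) {g g' : C(ℝ, ℝ)}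
    (hg : ∀ x, HasDerivAt g (g' x) x) {t : ℝ} (ht : 0 ≤ t) :
    inner ℝ (mulH ℓ g (w t)) (w t) = inner ℝ (mulH ℓ g (w 0)) (w 0)
        + ∫ s in (0 : ℝ)..t, (a * inner ℝ (mulH ℓ g' (w s)) (w s)
          + a * (g 0 * w0 s ^ 2 - g ℓ * wL s ^ 2)
          + 2 * inner ℝ (mulH ℓ g (w s)) (F s + b s • p)) := by
  have hE : ∀ s, Tendsto (fun h => inner ℝ (mulH ℓ g (steklovH h w s)) (steklovH h w s)) (𝓝[>] 0)
      (𝓝 (inner ℝ (mulH ℓ g (w s)) (w s))) := fun s =>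
    ((((mulH ℓ g).continuous.tendsto _).comp (tendsto_steklovH hw s))).inner (tendsto_steklovH hw s)
  have c1 : ∀ (k : C(ℝ, ℝ)) (h : ℝ),
      Continuous fun s => inner ℝ (mulH ℓ k (steklovH h w s)) (steklovH h w s) := fun k h =>
    ((mulH ℓ k).continuous.comp (continuous_steklovH hw h)).inner (continuous_steklovH hw h)
  have c2 : ∀ h : ℝ,
      Continuous fun s => inner ℝ (mulH ℓ g (steklovH h w s)) (steklovH h F s) := fun h =>
    ((mulH ℓ g).continuous.comp (continuous_steklovH hw h)).inner (continuous_steklovH hF h)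
  have c3 : ∀ h : ℝ, Continuous fun s => inner ℝ (mulH ℓ g (steklovH h w s)) p := fun h =>
    ((mulH ℓ g).continuous.comp (continuous_steklovH hw h)).inner continuous_const
  have l1 := tendsto_integral_inner_steklovH hw hw (mulH ℓ g') ht
  have l2 := tendsto_integral_steklov_sq h0 ht
  have l3 := tendsto_integral_steklov_sq hL ht
  have l4 := tendsto_integral_inner_steklovH hw hF (mulH ℓ g) ht
  obtain ⟨C, hC⟩ := (isCompact_Icc (a := 0) (b := t + 1)).exists_bound_of_continuousOn
    hw.continuousOn
  have l5 : Tendsto (fun h => ∫ s in (0 : ℝ)..t, STC.steklov h b s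
      * inner ℝ (mulH ℓ g (steklovH h w s)) p) (𝓝[>] 0)
      (𝓝 (∫ s in (0 : ℝ)..t, b s * inner ℝ (mulH ℓ g (w s)) p)) := by
    refine tendsto_integral_steklov_mul hb ht (C := ‖mulH ℓ g‖ * C * ‖p‖) c3 ?_ ?_
    · filter_upwards [Ioo_mem_nhdsGT (zero_lt_one (α := ℝ))] with h hh s hs
      have h1 := norm_steklovH_le hC hh hs
      refine (abs_real_inner_le_norm _ _).trans ?_
      gcongr
      exact ((mulH ℓ g).le_opNorm _).trans (by gcongr)
    · intro s _
      exact ((((mulH ℓ g).continuous.tendsto _).comp (tendsto_steklovH hw s))).inner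
        tendsto_const_nhds
  have hlim := (hE 0).add ((((l1.const_mul a).add
    (((l2.const_mul (g 0)).sub (l3.const_mul (g ℓ))).const_mul a)).add
      (l4.const_mul 2)).add (l5.const_mul 2))
  have hR := tendsto_nhds_unique ((hE t).congr' ?_) hlim
  · rw [hR]
    congr 1
    have i2 := h0.sq_intervalIntegrable le_rfl ht
    have i3 := hL.sq_intervalIntegrable le_rfl ht
    have hci : ∀ {f : ℝ → ℝ}, Continuous f → IntervalIntegrable f volume 0 t := fun hf =>
      hf.intervalIntegrable _ _
    have i5 : IntervalIntegrable (fun s => b s * inner ℝ (mulH ℓ g (w s)) p) volume 0 t :=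
      (hb.intervalIntegrable le_rfl ht).mul_continuousOn
        (((mulH ℓ g).continuous.comp hw).inner continuous_const).continuousOn
    rw [← intervalIntegral.integral_const_mul, ← intervalIntegral.integral_const_mul,
      ← intervalIntegral.integral_const_mul, ← intervalIntegral.integral_const_mul,
      ← intervalIntegral.integral_const_mul,
      ← intervalIntegral.integral_sub (i2.const_mul _) (i3.const_mul _),
      ← intervalIntegral.integral_const_mul,
      ← intervalIntegral.integral_add (hci (by fun_prop)) (h0.integrable_energy _ _ hL ht),
      ← intervalIntegral.integral_add ((hci (by fun_prop)).add (h0.integrable_energy _ _ hL ht))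
        (hci (by fun_prop)),
      ← intervalIntegral.integral_add (((hci (by fun_prop)).add
        (h0.integrable_energy _ _ hL ht)).add (hci (by fun_prop))) (i5.const_mul 2)]
    refine intervalIntegral.integral_congr fun s _ => ?_
    simp only [inner_add_right, inner_smul_right]
    ring
  · filter_upwards [self_mem_nhdsWithin] with h hh
    rw [averaged_energy hℓ ha hw hF h0 hL hb hT hg hh ht]
    congr 1
    have hsc : ∀ {y : ℝ → ℝ}, IsTrace y → ContinuousOn (STC.steklov h y) (uIcc 0 t) := fun hy => by
      rw [uIcc_of_le ht]; exact hy.continuous_steklov_sq hh ht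
    have i2 : IntervalIntegrable (fun s => STC.steklov h w0 s ^ 2) volume 0 t :=
      ((hsc h0).pow 2).intervalIntegrable
    have i3 : IntervalIntegrable (fun s => STC.steklov h wL s ^ 2) volume 0 t :=
      ((hsc hL).pow 2).intervalIntegrable
    have i23 := ((i2.const_mul (g 0)).sub (i3.const_mul (g ℓ))).const_mul a
    have hci : ∀ {f : ℝ → ℝ}, Continuous f → IntervalIntegrable f volume 0 t := fun hf =>
      hf.intervalIntegrable _ _
    have i5 : IntervalIntegrable (fun s => STC.steklov h b s
        * inner ℝ (mulH ℓ g (steklovH h w s)) p) volume 0 t :=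
      ((hsc hb).mul (c3 h).continuousOn).intervalIntegrable
    rw [← intervalIntegral.integral_const_mul, ← intervalIntegral.integral_const_mul,
      ← intervalIntegral.integral_const_mul, ← intervalIntegral.integral_const_mul,
      ← intervalIntegral.integral_const_mul,
      ← intervalIntegral.integral_sub (i2.const_mul _) (i3.const_mul _),
      ← intervalIntegral.integral_const_mul,
      ← intervalIntegral.integral_add ((hci (c1 g' h)).const_mul a) i23,
      ← intervalIntegral.integral_add (((hci (c1 g' h)).const_mul a).add i23)
        ((hci (c2 h)).const_mul 2),
      ← intervalIntegral.integral_add ((((hci (c1 g' h)).const_mul a).add i23).add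
        ((hci (c2 h)).const_mul 2)) (i5.const_mul 2)]
    refine intervalIntegral.integral_congr fun s _ => ?_
    simp only [inner_add_right, inner_smul_right]
    ring

/-- The energy identity: the weighted square of a weak solution of a transport equation. -/
lemma energy_identity (hℓ : 0 < ℓ) (ha : a ≠ 0) {w F : ℝ → L2 ℓ} {w0 wL b : ℝ → ℝ}
    {p : L2 ℓ} (hw : ContinuousOn w (Ici 0)) (hF : ContinuousOn F (Ici 0)) (h0 : IsTrace w0)
    (hL : IsTrace wL) (hb : IsTrace b) (hT : WeakTransport ℓ a w w0 wL fun s => F s + b s • p)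
    {g g' : C(ℝ, ℝ)} (hg : ∀ x, HasDerivAt g (g' x) x) {t : ℝ} (ht : 0 ≤ t) :
    inner ℝ (mulH ℓ g (w t)) (w t) = inner ℝ (mulH ℓ g (w 0)) (w 0)
        + ∫ s in (0 : ℝ)..t, (a * inner ℝ (mulH ℓ g' (w s)) (w s)
          + a * (g 0 * w0 s ^ 2 - g ℓ * wL s ^ 2)
          + 2 * inner ℝ (mulH ℓ g (w s)) (F s + b s • p)) := by
  have hmax : Continuous fun s : ℝ => max s 0 := by fun_prop
  have hw' : Continuous fun s => w (max s 0) := by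
    rw [← continuousOn_univ]
    exact hw.comp hmax.continuousOn fun s _ => mem_Ici.2 (le_max_right s 0)
  have hF' : Continuous fun s => F (max s 0) := by
    rw [← continuousOn_univ]
    exact hF.comp hmax.continuousOn fun s _ => mem_Ici.2 (le_max_right s 0)
  have hc : ∀ {f g : ℝ → ℝ} {t : ℝ}, 0 ≤ t → (∀ s, 0 ≤ s → f s = g s) →
      ∫ s in (0 : ℝ)..t, f s = ∫ s in (0 : ℝ)..t, g s := fun ht h =>
    intervalIntegral.integral_congr fun s hs => h s (by rw [uIcc_of_le ht] at hs; exact hs.1)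
  have hT' : WeakTransport ℓ a (fun s => w (max s 0)) w0 wL
      fun s => F (max s 0) + b s • p := by
    intro φ φ' hφ t ht
    simp only [max_eq_left ht, max_self]
    rw [hT φ φ' hφ t ht]
    congr 1
    exact hc ht fun s hs => by rw [max_eq_left hs]
  have := energy_identity_of_continuous hℓ ha hw' hF' h0 hL hb hT' hg ht
  simp only [max_eq_left ht, max_self] at this
  rw [this]
  congr 1
  exact hc ht fun s hs => by rw [max_eq_left hs]

end Energy

/-! ### Grönwall's inequality in integrated form -/

lemma le_gronwallBound_of_sub_le_integral {z : ℝ → ℝ} {a b c h : ℝ}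
    (hz : ContinuousOn z (Icc a b))
    (hle : ∀ s t, a ≤ s → s ≤ t → t ≤ b → z t - z s ≤ ∫ r in s..t, (c * z r + h)) {t : ℝ}
    (ht : t ∈ Icc a b) : z t ≤ gronwallBound (z a) c h (t - a) := by
  refine le_gronwallBound_of_liminf_deriv_right_le (f' := fun x => c * z x + h) hz ?_ le_rfl
    (fun _ _ => le_rfl) t ht
  intro x hx r hr
  refine Eventually.frequently ?_
  have hcx : ContinuousWithinAt (fun x => c * z x + h) (Icc a b) x :=
    ((hz x ⟨hx.1, hx.2.le⟩).const_mul c).add continuousWithinAt_const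
  obtain ⟨r', h1, h2⟩ := exists_between hr
  have hev : ∀ᶠ y in 𝓝[≥] x, c * z y + h < r' ∧ y < b := by
    have : 𝓝[≥] x = 𝓝[Icc x b] x := (nhdsWithin_Icc_eq_nhdsGE hx.2).symm
    rw [this]
    refine Eventually.and ?_ ?_
    · exact (hcx.mono (Icc_subset_Icc_left hx.1)).eventually_lt_const h1
    · exact mem_nhdsWithin_of_mem_nhds (Iio_mem_nhds hx.2)
  obtain ⟨u, hu, hsub⟩ := (mem_nhdsGE_iff_exists_Ico_subset.1 hev)
  filter_upwards [Ioo_mem_nhdsGT hu] with y hy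
  have hyb : y < b := (hsub ⟨hy.1.le, hy.2⟩).2
  have h3 : ∫ r in x..y, (c * z r + h) ≤ ∫ _ in x..y, r' := by
    refine intervalIntegral.integral_mono_on hy.1.le ?_ intervalIntegrable_const fun s hs => ?_
    · refine ContinuousOn.intervalIntegrable ?_
      rw [uIcc_of_le hy.1.le]
      exact ((hz.mono (Icc_subset_Icc hx.1 hyb.le)).const_smul c).add continuousOn_const
    · exact (hsub ⟨hs.1, hs.2.trans_lt hy.2⟩).1.le
  rw [intervalIntegral.integral_const, smul_eq_mul] at h3
  have h4 := hle x y hx.1 hy.1.le hyb.le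
  have hpos : 0 < y - x := sub_pos.2 hy.1
  rw [inv_mul_lt_iff₀ hpos]
  calc z y - z x ≤ (y - x) * r' := h4.trans h3
    _ < (y - x) * r := by gcongr

lemma eq_zero_of_sub_le_integral {z : ℝ → ℝ} {a b c : ℝ} (hz : ContinuousOn z (Icc a b))
    (hle : ∀ s t, a ≤ s → s ≤ t → t ≤ b → z t - z s ≤ ∫ r in s..t, c * z r) (ha : z a ≤ 0)
    {t : ℝ} (ht : t ∈ Icc a b) : z t ≤ 0 := by
  have h1 := le_gronwallBound_of_sub_le_integral (h := 0) hz (by simpa using hle) ht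
  rw [gronwallBound_ε0] at h1
  exact h1.trans (mul_nonpos_of_nonpos_of_nonneg ha (Real.exp_pos _).le)

lemma le_exp_of_sub_le_integral {z : ℝ → ℝ} {a b c : ℝ} (hz : ContinuousOn z (Icc a b))
    (hle : ∀ s t, a ≤ s → s ≤ t → t ≤ b → z t - z s ≤ ∫ r in s..t, c * z r)
    {t : ℝ} (ht : t ∈ Icc a b) : z t ≤ z a * Real.exp (c * (t - a)) := by
  have h1 := le_gronwallBound_of_sub_le_integral (h := 0) hz (by simpa using hle) ht
  rwa [gronwallBound_ε0] at h1

/-! ### Quadratic forms of multiplication operators -/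

section Quadratic

variable {ℓ : ℝ}

lemma inner_mulH_mono (hℓ : 0 ≤ ℓ) {φ ψ : C(ℝ, ℝ)} (h : ∀ x ∈ Icc 0 ℓ, φ x ≤ ψ x) (w : L2 ℓ) :
    inner ℝ (mulH ℓ φ w) w ≤ inner ℝ (mulH ℓ ψ w) w := by
  have hi : ∀ φ : C(ℝ, ℝ), Integrable (fun x => mulH ℓ φ w x * w x)
      (volume.restrict (Ioo (0 : ℝ) ℓ)) := fun φ =>
    (Lp.memLp (mulH ℓ φ w)).integrable_mul (Lp.memLp w)
  rw [inner_eq_integral hℓ, inner_eq_integral hℓ, ← setIntegral_Ioo_eq hℓ, ← setIntegral_Ioo_eq hℓ]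
  refine integral_mono_ae (hi φ) (hi ψ) ?_
  filter_upwards [coeFn_mulH φ w, coeFn_mulH ψ w, ae_restrict_mem measurableSet_Ioo] with x h1 h2 h3
  rw [h1, h2, mul_assoc, mul_assoc]
  exact mul_le_mul_of_nonneg_right (h x (Ioo_subset_Icc_self h3)) (mul_self_nonneg _)

lemma mulH_const (c : ℝ) (w : L2 ℓ) : mulH ℓ (ContinuousMap.const ℝ c) w = c • w := by
  ext1
  filter_upwards [coeFn_mulH (ContinuousMap.const ℝ c) w, Lp.coeFn_smul c w] with x h1 h2
  rw [h1, h2]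
  simp

lemma le_inner_mulH (hℓ : 0 ≤ ℓ) {φ : C(ℝ, ℝ)} {c : ℝ} (h : ∀ x ∈ Icc 0 ℓ, c ≤ φ x) (w : L2 ℓ) :
    c * ‖w‖ ^ 2 ≤ inner ℝ (mulH ℓ φ w) w := by
  have := inner_mulH_mono hℓ (φ := ContinuousMap.const ℝ c) h w
  rwa [mulH_const, inner_smul_left, real_inner_self_eq_norm_sq] at this

lemma two_mul_inner_le {H : Type*} [NormedAddCommGroup H] [InnerProductSpace ℝ H]
    (T S : H →L[ℝ] H) (v w : H) :
    2 * inner ℝ (T v) (S w) ≤ ‖T‖ * ‖S‖ * (‖v‖ ^ 2 + ‖w‖ ^ 2) := by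
  have h1 := real_inner_le_norm (T v) (S w)
  have h2 := mul_le_mul (T.le_opNorm v) (S.le_opNorm w) (norm_nonneg _) (by positivity)
  have h3 := mul_le_mul_of_nonneg_left (two_mul_le_add_sq ‖v‖ ‖w‖)
    (mul_nonneg (norm_nonneg T) (norm_nonneg S))
  linarith

lemma two_mul_inner_smul_le {H : Type*} [NormedAddCommGroup H] [InnerProductSpace ℝ H]
    (T : H →L[ℝ] H) (v p : H) (b : ℝ) :
    2 * inner ℝ (T v) (b • p) ≤ b ^ 2 + ‖T‖ ^ 2 * ‖p‖ ^ 2 * ‖v‖ ^ 2 := by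
  rw [inner_smul_right]
  have h1 := abs_real_inner_le_norm (T v) p
  have h2 := mul_le_mul_of_nonneg_right (T.le_opNorm v) (norm_nonneg p)
  have h3 := pow_le_pow_left₀ (abs_nonneg _) (h1.trans h2) 2
  rw [sq_abs] at h3
  nlinarith [sq_nonneg (b - inner ℝ (T v) p)]

end Quadratic

/-! ### Weak solutions of `2 × 2` systems -/

/-- `w` is a weak solution of `∂ₜw + s ∂ₓw = C w + b p` with boundary traces `w0` and `wL`. -/
structure IsPairSol (ℓ : ℝ) (s : Fin 2 → ℝ) (C : Fin 2 → Fin 2 → C(ℝ, ℝ)) (p : Fin 2 → L2 ℓ)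
    (b : ℝ → ℝ) (w : Fin 2 → ℝ → L2 ℓ) (w0 wL : Fin 2 → ℝ → ℝ) : Prop where
  cont : ∀ i, ContinuousOn (w i) (Ici 0)
  source : IsTrace b
  trace0 : ∀ i, IsTrace (w0 i)
  traceL : ∀ i, IsTrace (wL i)
  eq : ∀ i, WeakTransport ℓ (s i) (w i) (w0 i) (wL i)
    fun t => ∑ j, mulH ℓ (C i j) (w j t) + b t • p i

lemma integral_congr_ae_Ioi {f g : ℝ → ℝ} (h : ∀ᵐ r ∂volume.restrict (Ioi (0 : ℝ)), f r = g r)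
    {s t : ℝ} (hs : 0 ≤ s) (ht : 0 ≤ t) : ∫ r in s..t, f r = ∫ r in s..t, g r := by
  refine intervalIntegral.integral_congr_ae ?_
  filter_upwards [(ae_restrict_iff' measurableSet_Ioi).1 h] with r hr hrt
  refine hr ?_
  rw [uIoc] at hrt
  exact (le_min hs ht).trans_lt hrt.1

lemma WeakTransport.congr_ae {ℓ a : ℝ} {w F F' : ℝ → L2 ℓ} {w0 w0' wL wL' : ℝ → ℝ}
    (h : WeakTransport ℓ a w w0 wL F)
    (h0 : ∀ᵐ r ∂volume.restrict (Ioi (0 : ℝ)), w0 r = w0' r)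
    (hL : ∀ᵐ r ∂volume.restrict (Ioi (0 : ℝ)), wL r = wL' r)
    (hF : ∀ᵐ r ∂volume.restrict (Ioi (0 : ℝ)), F r = F' r) : WeakTransport ℓ a w w0' wL' F' := by
  intro φ φ' hφ t ht
  rw [h φ φ' hφ t ht]
  congr 1
  refine integral_congr_ae_Ioi ?_ le_rfl ht
  filter_upwards [h0, hL, hF] with r h1 h2 h3
  rw [h1, h2, h3]

lemma IsTrace.sub {y z : ℝ → ℝ} (hy : IsTrace y) (hz : IsTrace z) : IsTrace fun t => y t - z t :=
  fun T => (hy T).sub (hz T)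

lemma IsTrace.add {y z : ℝ → ℝ} (hy : IsTrace y) (hz : IsTrace z) : IsTrace fun t => y t + z t :=
  fun T => (hy T).add (hz T)

lemma IsTrace.const_mul {y : ℝ → ℝ} (hy : IsTrace y) (c : ℝ) : IsTrace fun t => c * y t :=
  fun T => (hy T).const_mul c

namespace IsPairSol

variable {ℓ : ℝ} {s : Fin 2 → ℝ} {C : Fin 2 → Fin 2 → C(ℝ, ℝ)} {p p' : Fin 2 → L2 ℓ}
  {b b' : ℝ → ℝ} {w w' : Fin 2 → ℝ → L2 ℓ} {w0 wL w0' wL' : Fin 2 → ℝ → ℝ}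

lemma continuousOn_coupling (h : IsPairSol ℓ s C p b w w0 wL) (i : Fin 2) :
    ContinuousOn (fun t => ∑ j, mulH ℓ (C i j) (w j t)) (Ici 0) :=
  continuousOn_finsetSum _ fun j _ => (mulH ℓ (C i j)).continuous.comp_continuousOn (h.cont j)

lemma weakIntegrable (h : IsPairSol ℓ s C p b w w0 wL) (i : Fin 2) :
    WeakIntegrable fun t => ∑ j, mulH ℓ (C i j) (w j t) + b t • p i :=
  (WeakIntegrable.of_continuousOn (h.continuousOn_coupling i)).add
    (h.source.weakIntegrable_smul _)

lemma congr_source (h : IsPairSol ℓ s C p b w w0 wL) (hb : IsTrace b')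
    (he : ∀ i, ∀ᵐ r ∂volume.restrict (Ioi (0 : ℝ)), b r • p i = b' r • p' i) :
    IsPairSol ℓ s C p' b' w w0 wL where
  cont := h.cont
  source := hb
  trace0 := h.trace0
  traceL := h.traceL
  eq i := (h.eq i).congr_ae (.of_forall fun _ => rfl) (.of_forall fun _ => rfl) (by
    filter_upwards [he i] with r hr
    rw [hr])

lemma sub (h : IsPairSol ℓ s C p b w w0 wL) (h' : IsPairSol ℓ s C p b' w' w0' wL') :
    IsPairSol ℓ s C p (fun t => b t - b' t) (fun i t => w i t - w' i t)
      (fun i t => w0 i t - w0' i t) (fun i t => wL i t - wL' i t) where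
  cont i := (h.cont i).sub (h'.cont i)
  source := h.source.sub h'.source
  trace0 i := (h.trace0 i).sub (h'.trace0 i)
  traceL i := (h.traceL i).sub (h'.traceL i)
  eq i φ φ' hφ t ht := by
    have e := h.eq i φ φ' hφ t ht
    have e' := h'.eq i φ φ' hφ t ht
    have := intervalIntegral.integral_sub
      (WeakTransport.intervalIntegrable (a := s i) (h.cont i) (h.trace0 i) (h.traceL i)
        (h.weakIntegrable i) φ φ' ht)
      (WeakTransport.intervalIntegrable (a := s i) (h'.cont i) (h'.trace0 i) (h'.traceL i)
        (h'.weakIntegrable i) φ φ' ht)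
    rw [inner_sub_left, inner_sub_left, e, e', add_sub_add_comm, ← this]
    congr 1
    refine intervalIntegral.integral_congr fun r _ => ?_
    simp only [Fin.sum_univ_two, map_sub, inner_sub_left, inner_add_left, sub_smul]
    ring

/-- The weighted square norm `∑ ∫ gᵢ wᵢ²`. -/
def _root_.STC.energy (ℓ : ℝ) (g : Fin 2 → C(ℝ, ℝ)) (w : Fin 2 → L2 ℓ) : ℝ :=
  ∑ i, inner ℝ (mulH ℓ (g i) (w i)) (w i)

/-- The contribution of one component to the time derivative of the energy. -/
def _root_.STC.energyRateTerm (ℓ : ℝ) (s : Fin 2 → ℝ) (C : Fin 2 → Fin 2 → C(ℝ, ℝ))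
    (p : Fin 2 → L2 ℓ) (g g' : Fin 2 → C(ℝ, ℝ)) (b : ℝ) (w : Fin 2 → L2 ℓ) (w0 wL : Fin 2 → ℝ)
    (i : Fin 2) : ℝ :=
  s i * inner ℝ (mulH ℓ (g' i) (w i)) (w i) + s i * (g i 0 * w0 i ^ 2 - g i ℓ * wL i ^ 2)
    + 2 * inner ℝ (mulH ℓ (g i) (w i)) (∑ j, mulH ℓ (C i j) (w j) + b • p i)

/-- The time derivative of the energy. -/
def _root_.STC.energyRate (ℓ : ℝ) (s : Fin 2 → ℝ) (C : Fin 2 → Fin 2 → C(ℝ, ℝ)) (p : Fin 2 → L2 ℓ)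
    (g g' : Fin 2 → C(ℝ, ℝ)) (b : ℝ) (w : Fin 2 → L2 ℓ) (w0 wL : Fin 2 → ℝ) : ℝ :=
  ∑ i, energyRateTerm ℓ s C p g g' b w w0 wL i

lemma continuousOn_energy (h : IsPairSol ℓ s C p b w w0 wL) (g : Fin 2 → C(ℝ, ℝ)) :
    ContinuousOn (fun t => energy ℓ g fun i => w i t) (Ici 0) :=
  continuousOn_finsetSum _ fun i _ =>
    ((mulH ℓ (g i)).continuous.comp_continuousOn (h.cont i)).inner (h.cont i)

lemma intervalIntegrable_energyRate_term (h : IsPairSol ℓ s C p b w w0 wL)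
    (g g' : Fin 2 → C(ℝ, ℝ)) (i : Fin 2) {t₁ t₂ : ℝ} (h1 : 0 ≤ t₁) (h2 : 0 ≤ t₂) :
    IntervalIntegrable (fun r => energyRateTerm ℓ s C p g g' (b r) (fun i => w i r)
      (fun i => w0 i r) (fun i => wL i r) i)
      volume t₁ t₂ := by
  have c1 : ∀ g : C(ℝ, ℝ), ContinuousOn (fun t => mulH ℓ g (w i t)) (Ici 0) := fun g =>
    (mulH ℓ g).continuous.comp_continuousOn (h.cont i)
  simp only [energyRateTerm, inner_add_right, inner_smul_right]
  refine IntervalIntegrable.add (IntervalIntegrable.add ?_ ?_) (IntervalIntegrable.const_mul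
    (IntervalIntegrable.add ?_ ?_) _)
  · exact (ContinuousOn.intervalIntegrable_Ici ((c1 _).inner (h.cont i)) h1 h2).const_mul _
  · exact (((h.trace0 i).sq_intervalIntegrable h1 h2).const_mul _).sub
      (((h.traceL i).sq_intervalIntegrable h1 h2).const_mul _) |>.const_mul _
  · exact ContinuousOn.intervalIntegrable_Ici ((c1 _).inner (h.continuousOn_coupling i)) h1 h2
  · refine h.source.mul_intervalIntegrable (IsTrace.of_continuousOn ?_) h1 h2
    exact (c1 _).inner continuousOn_const

lemma intervalIntegrable_energyRate (h : IsPairSol ℓ s C p b w w0 wL)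
    (g g' : Fin 2 → C(ℝ, ℝ)) {t₁ t₂ : ℝ} (h1 : 0 ≤ t₁) (h2 : 0 ≤ t₂) :
    IntervalIntegrable (fun r => energyRate ℓ s C p g g' (b r) (fun i => w i r) (fun i => w0 i r)
      fun i => wL i r) volume t₁ t₂ := by
  simp only [energyRate, Fin.sum_univ_two]
  exact (h.intervalIntegrable_energyRate_term g g' 0 h1 h2).add
    (h.intervalIntegrable_energyRate_term g g' 1 h1 h2)

lemma energy_sub (hℓ : 0 < ℓ) (hs : ∀ i, s i ≠ 0) (h : IsPairSol ℓ s C p b w w0 wL)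
    {g g' : Fin 2 → C(ℝ, ℝ)} (hg : ∀ i x, HasDerivAt (g i) (g' i x) x) {t₁ t₂ : ℝ} (h1 : 0 ≤ t₁)
    (h2 : 0 ≤ t₂) :
    (energy ℓ g fun i => w i t₂) - (energy ℓ g fun i => w i t₁)
      = ∫ r in t₁..t₂, energyRate ℓ s C p g g' (b r) (fun i => w i r) (fun i => w0 i r)
        fun i => wL i r := by
  have e := fun i t ht => energy_identity hℓ (hs i) (h.cont i) (h.continuousOn_coupling i)
    (h.trace0 i) (h.traceL i) h.source (h.eq i) (hg i) (t := t) ht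
  have i1 := fun i => h.intervalIntegrable_energyRate_term g g' i le_rfl h1
  have i2 := fun i => h.intervalIntegrable_energyRate_term g g' i le_rfl h2
  rw [← intervalIntegral.integral_interval_sub_left (h.intervalIntegrable_energyRate g g' le_rfl h2)
    (h.intervalIntegrable_energyRate g g' le_rfl h1)]
  simp only [energyRate, Fin.sum_univ_two]
  rw [intervalIntegral.integral_add (i1 0) (i1 1), intervalIntegral.integral_add (i2 0) (i2 1),
    energy, energy, Fin.sum_univ_two, Fin.sum_univ_two, e 0 t₁ h1, e 1 t₁ h1, e 0 t₂ h2, e 1 t₂ h2]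
  simp only [energyRateTerm]
  ring

lemma energy_sub_le (hℓ : 0 < ℓ) (hs : ∀ i, s i ≠ 0) (h : IsPairSol ℓ s C p b w w0 wL)
    {g g' : Fin 2 → C(ℝ, ℝ)} (hg : ∀ i x, HasDerivAt (g i) (g' i x) x) {t₁ t₂ : ℝ} (h1 : 0 ≤ t₁)
    (h12 : t₁ ≤ t₂) {H : ℝ → ℝ} (hH : IntervalIntegrable H volume t₁ t₂)
    (hle : ∀ᵐ r ∂volume.restrict (Ioc t₁ t₂), energyRate ℓ s C p g g' (b r) (fun i => w i r)
      (fun i => w0 i r) (fun i => wL i r) ≤ H r) :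
    (energy ℓ g fun i => w i t₂) - (energy ℓ g fun i => w i t₁) ≤ ∫ r in t₁..t₂, H r := by
  rw [h.energy_sub hℓ hs hg h1 (h1.trans h12), intervalIntegral.integral_of_le h12,
    intervalIntegral.integral_of_le h12]
  exact integral_mono_ae ((intervalIntegrable_iff_integrableOn_Ioc_of_le h12).1
    (h.intervalIntegrable_energyRate g g' h1 (h1.trans h12)))
    ((intervalIntegrable_iff_integrableOn_Ioc_of_le h12).1 hH) hle

/-- A solution with zero initial data and homogeneous boundary conditions vanishes. -/
lemma eq_zero (hℓ : 0 < ℓ) (hs0 : 0 < s 0) (hs1 : s 1 < 0) {q ρ : ℝ} (hρ : ρ ≠ 0)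
    (h : IsPairSol ℓ s C p (w0 1) w w0 wL) {t₀ t₁ : ℝ} (ht₀ : 0 ≤ t₀) (ht : t₀ ≤ t₁)
    (hz : ∀ i, w i t₀ = 0)
    (hb0 : ∀ᵐ r ∂volume.restrict (Ioc t₀ t₁), w0 0 r = q * w0 1 r)
    (hbL : ∀ᵐ r ∂volume.restrict (Ioc t₀ t₁), wL 1 r = ρ * wL 0 r) :
    (∀ i, ∀ t ∈ Icc t₀ t₁, w i t = 0) ∧
      ∀ᵐ r ∂volume.restrict (Ioc t₀ t₁), w0 1 r = 0 ∧ wL 0 r = 0 := by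
  have hs : ∀ i, s i ≠ 0 := by
    intro i; fin_cases i
    · exact hs0.ne'
    · exact hs1.ne
  set B0 : ℝ := (s 0 * q ^ 2 + 3) / -s 1 with hB0
  set BL : ℝ := s 0 / (2 * ρ ^ 2) / -s 1 with hBL
  have hs1' : 0 < -s 1 := neg_pos.2 hs1
  have hB0pos : 0 < B0 := by positivity
  have hBLpos : 0 < BL := by positivity
  have eB0 : s 1 * B0 = -(s 0 * q ^ 2 + 3) := by rw [hB0]; field_simp [hs1.ne]
  have eBL : s 1 * BL * ρ ^ 2 = -(s 0 / 2) := by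
    have := hs1.ne
    rw [hBL]; field_simp
  let g : Fin 2 → C(ℝ, ℝ) := ![ContinuousMap.const ℝ 1, ⟨fun x => B0 + (BL - B0) / ℓ * x, by fun_prop⟩]
  let g' : Fin 2 → C(ℝ, ℝ) := ![0, ContinuousMap.const ℝ ((BL - B0) / ℓ)]
  have hg : ∀ i x, HasDerivAt (g i) (g' i x) x := by
    intro i x
    fin_cases i
    · exact hasDerivAt_const x (1 : ℝ)
    · show HasDerivAt (fun x => B0 + (BL - B0) / ℓ * x) ((BL - B0) / ℓ) x
      simpa using ((hasDerivAt_id x).const_mul ((BL - B0) / ℓ)).const_add B0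
  set W : ℝ → ℝ := fun r => ‖w 0 r‖ ^ 2 + ‖w 1 r‖ ^ 2 with hW
  obtain ⟨c, hc0, hc⟩ : ∃ c, 0 ≤ c ∧ ∀ r, w0 0 r = q * w0 1 r → wL 1 r = ρ * wL 0 r →
      energyRate ℓ s C p g g' (w0 1 r) (fun i => w i r) (fun i => w0 i r) (fun i => wL i r)
        ≤ c * W r - (w0 1 r ^ 2 + s 0 / 2 * wL 0 r ^ 2) := by
    refine ⟨∑ i, ∑ j, ‖mulH ℓ (g i)‖ * ‖mulH ℓ (C i j)‖
      + ∑ i, ‖mulH ℓ (g i)‖ ^ 2 * ‖p i‖ ^ 2 + |s 1 * ((BL - B0) / ℓ)|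
      + ∑ i, ∑ j, ‖mulH ℓ (g i)‖ * ‖mulH ℓ (C i j)‖, by positivity, fun r e0 e1 => ?_⟩
    have hT := fun i j => two_mul_inner_le (mulH ℓ (g i)) (mulH ℓ (C i j)) (w i r) (w j r)
    have hp := fun i => two_mul_inner_smul_le (mulH ℓ (g i)) (w i r) (p i) (w0 1 r)
    have hn : ∀ i, ‖w i r‖ ^ 2 ≤ W r := fun i => by
      simp only [hW]
      fin_cases i
      · exact le_add_of_nonneg_right (sq_nonneg _)
      · exact le_add_of_nonneg_left (sq_nonneg _)
    have hT' : ∀ i j, 2 * inner ℝ (mulH ℓ (g i) (w i r)) (mulH ℓ (C i j) (w j r))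
        ≤ ‖mulH ℓ (g i)‖ * ‖mulH ℓ (C i j)‖ * (2 * W r) := fun i j =>
      (hT i j).trans (mul_le_mul_of_nonneg_left (by linarith [hn i, hn j]) (by positivity))
    have hp' : ∀ i, 2 * inner ℝ (mulH ℓ (g i) (w i r)) (w0 1 r • p i)
        ≤ w0 1 r ^ 2 + ‖mulH ℓ (g i)‖ ^ 2 * ‖p i‖ ^ 2 * W r := fun i =>
      (hp i).trans (by gcongr; exact hn i)
    have h1 : s 1 * inner ℝ (mulH ℓ (g' 1) (w 1 r)) (w 1 r)
        ≤ |s 1 * ((BL - B0) / ℓ)| * W r := by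
      have : mulH ℓ (g' 1) (w 1 r) = ((BL - B0) / ℓ) • w 1 r := mulH_const _ _
      rw [this, inner_smul_left, real_inner_self_eq_norm_sq, RCLike.conj_to_real, ← mul_assoc]
      exact (mul_le_mul_of_nonneg_right (le_abs_self _) (sq_nonneg _)).trans
        (mul_le_mul_of_nonneg_left (hn 1) (abs_nonneg _))
    have h0 : inner ℝ (mulH ℓ (g' 0) (w 0 r)) (w 0 r) = 0 := by
      have : mulH ℓ (g' 0) (w 0 r) = (0 : ℝ) • w 0 r := mulH_const _ _
      rw [this, zero_smul, inner_zero_left]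
    have v00 : g 0 0 = 1 := rfl
    have v0L : g 0 ℓ = 1 := rfl
    have v10 : g 1 0 = B0 := by simp [g]
    have v1L : g 1 ℓ = BL := by simp [g]; field_simp; ring
    have a1 := hT' 0 0
    have a2 := hT' 0 1
    have a3 := hT' 1 0
    have a4 := hT' 1 1
    have a5 := hp' 0
    have a6 := hp' 1
    simp only [energyRate, energyRateTerm, Fin.sum_univ_two, h0, v00, v0L, v10, v1L, e0, e1,
      inner_add_right]
    have e2 : s 1 * (B0 * w0 1 r ^ 2 - BL * (ρ * wL 0 r) ^ 2)
        = -(s 0 * q ^ 2 + 3) * w0 1 r ^ 2 + s 0 / 2 * wL 0 r ^ 2 := by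
      linear_combination w0 1 r ^ 2 * eB0 - wL 0 r ^ 2 * eBL
    rw [e2]
    linarith
  have hcont : ContinuousOn (fun t => energy ℓ g fun i => w i t) (Ici 0) := h.continuousOn_energy g
  have hWle : ∀ r, min 1 (min B0 BL) * W r ≤ energy ℓ g fun i => w i r := by
    intro r
    have h0 : 1 * ‖w 0 r‖ ^ 2 ≤ inner ℝ (mulH ℓ (g 0) (w 0 r)) (w 0 r) :=
      le_inner_mulH hℓ.le (fun x _ => le_rfl) _
    have h1 : min B0 BL * ‖w 1 r‖ ^ 2 ≤ inner ℝ (mulH ℓ (g 1) (w 1 r)) (w 1 r) := by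
      refine le_inner_mulH hℓ.le (fun x hx => ?_) _
      show min B0 BL ≤ B0 + (BL - B0) / ℓ * x
      have : B0 + (BL - B0) / ℓ * x = (1 - x / ℓ) * B0 + x / ℓ * BL := by field_simp; ring
      rw [this]
      have hx0 : 0 ≤ x / ℓ := div_nonneg hx.1 hℓ.le
      have hx1 : x / ℓ ≤ 1 := (div_le_one hℓ).2 hx.2
      nlinarith [min_le_left B0 BL, min_le_right B0 BL]
    have m0 : min 1 (min B0 BL) * ‖w 0 r‖ ^ 2 ≤ 1 * ‖w 0 r‖ ^ 2 :=
      mul_le_mul_of_nonneg_right (min_le_left (1 : ℝ) (min B0 BL)) (sq_nonneg _)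
    have m1 : min 1 (min B0 BL) * ‖w 1 r‖ ^ 2 ≤ min B0 BL * ‖w 1 r‖ ^ 2 :=
      mul_le_mul_of_nonneg_right (min_le_right (1 : ℝ) (min B0 BL)) (sq_nonneg _)
    simp only [hW, energy, Fin.sum_univ_two]
    linarith
  have hmin : 0 < min 1 (min B0 BL) := lt_min one_pos (lt_min hB0pos hBLpos)
  have hW0 : ∀ r, 0 ≤ W r := fun r => by simp only [hW]; positivity
  have hWE : ∀ r, c * W r ≤ c / min 1 (min B0 BL) * energy ℓ g fun i => w i r := fun r => by
    rw [div_mul_eq_mul_div, le_div_iff₀ hmin, mul_assoc, mul_comm (W r)]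
    exact mul_le_mul_of_nonneg_left (hWle r) hc0
  have htr : ∀ {t t'}, 0 ≤ t → 0 ≤ t' → IntervalIntegrable
      (fun r => w0 1 r ^ 2 + s 0 / 2 * wL 0 r ^ 2) volume t t' := fun h1 h2 =>
    ((h.trace0 1).sq_intervalIntegrable h1 h2).add
      (((h.traceL 0).sq_intervalIntegrable h1 h2).const_mul _)
  have hEi : ∀ {t t'}, 0 ≤ t → 0 ≤ t' → IntervalIntegrable
      (fun r => c / min 1 (min B0 BL) * energy ℓ g fun i => w i r) volume t t' := fun h1 h2 =>
    (ContinuousOn.intervalIntegrable_Ici hcont h1 h2).const_mul _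
  have hdiff : ∀ t t', t₀ ≤ t → t ≤ t' → t' ≤ t₁ →
      (energy ℓ g fun i => w i t') - (energy ℓ g fun i => w i t)
        ≤ ∫ r in t..t', ((c / min 1 (min B0 BL) * energy ℓ g fun i => w i r)
          - (w0 1 r ^ 2 + s 0 / 2 * wL 0 r ^ 2)) := by
    intro t t' h1 h2 h3
    refine h.energy_sub_le hℓ hs hg (ht₀.trans h1) h2 ((hEi (ht₀.trans h1)
      (ht₀.trans (h1.trans h2))).sub (htr (ht₀.trans h1) (ht₀.trans (h1.trans h2)))) ?_
    have hsub := Ioc_subset_Ioc h1 h3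
    filter_upwards [ae_restrict_of_ae_restrict_of_subset hsub hb0,
      ae_restrict_of_ae_restrict_of_subset hsub hbL] with r e0 e1
    linarith [hc r e0 e1, hWE r]
  have hE0 : (energy ℓ g fun i => w i t₀) = 0 := by simp [energy, hz]
  have hEz : ∀ t ∈ Icc t₀ t₁, (energy ℓ g fun i => w i t) ≤ 0 := fun t hti => by
    refine eq_zero_of_sub_le_integral (c := c / min 1 (min B0 BL))
      (hcont.mono fun x hx => mem_Ici.2 (ht₀.trans hx.1)) (fun a b h1 h2 h3 => ?_) hE0.le hti
    refine (hdiff a b h1 h2 h3).trans (intervalIntegral.integral_mono_on h2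
      ((hEi (ht₀.trans h1) (ht₀.trans (h1.trans h2))).sub
        (htr (ht₀.trans h1) (ht₀.trans (h1.trans h2))))
      (hEi (ht₀.trans h1) (ht₀.trans (h1.trans h2))) fun r _ => ?_)
    have : 0 ≤ w0 1 r ^ 2 + s 0 / 2 * wL 0 r ^ 2 := by positivity
    linarith
  have hWz : ∀ t ∈ Icc t₀ t₁, W t = 0 := fun t hti =>
    le_antisymm (nonpos_of_mul_nonpos_right ((hWle t).trans (hEz t hti)) hmin) (hW0 t)
  have hwz : ∀ i, ∀ t ∈ Icc t₀ t₁, w i t = 0 := by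
    intro i t hti
    have h1 := hWz t hti
    simp only [hW] at h1
    have h2 : ‖w i t‖ ^ 2 = 0 := by
      fin_cases i
      · show ‖w 0 t‖ ^ 2 = 0
        nlinarith [sq_nonneg ‖w 0 t‖, sq_nonneg ‖w 1 t‖]
      · show ‖w 1 t‖ ^ 2 = 0
        nlinarith [sq_nonneg ‖w 0 t‖, sq_nonneg ‖w 1 t‖]
    exact norm_eq_zero.1 (pow_eq_zero_iff two_ne_zero |>.1 h2)
  refine ⟨hwz, ?_⟩
  have hI := hdiff t₀ t₁ le_rfl ht le_rfl
  have e1 : ∫ r in t₀..t₁, ((c / min 1 (min B0 BL) * energy ℓ g fun i => w i r)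
      - (w0 1 r ^ 2 + s 0 / 2 * wL 0 r ^ 2))
      = -∫ r in t₀..t₁, (w0 1 r ^ 2 + s 0 / 2 * wL 0 r ^ 2) := by
    rw [← intervalIntegral.integral_neg]
    refine intervalIntegral.integral_congr fun r hr => ?_
    rw [uIcc_of_le ht] at hr
    simp [energy, hwz _ r hr]
  have e2 : (energy ℓ g fun i => w i t₁) = 0 := by
    simp [energy, hwz _ t₁ (right_mem_Icc.2 ht)]
  rw [e1, e2, hE0] at hI
  have hint := (intervalIntegrable_iff_integrableOn_Ioc_of_le ht).1 (htr ht₀ (ht₀.trans ht))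
  have hnn : ∀ r, 0 ≤ w0 1 r ^ 2 + s 0 / 2 * wL 0 r ^ 2 := fun r => by positivity
  have hzero : ∫ r in Ioc t₀ t₁, (w0 1 r ^ 2 + s 0 / 2 * wL 0 r ^ 2) = 0 := by
    rw [← intervalIntegral.integral_of_le ht]
    refine le_antisymm (by linarith) (intervalIntegral.integral_nonneg ht fun r _ => hnn r)
  have := (integral_eq_zero_iff_of_nonneg (fun r => hnn r) hint).1 hzero
  filter_upwards [this] with r hr
  simp only [Pi.zero_apply] at hr
  have h1 : 0 ≤ s 0 / 2 * wL 0 r ^ 2 := by positivity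
  have h2 : w0 1 r ^ 2 = 0 := by nlinarith [sq_nonneg (w0 1 r)]
  have h3 : wL 0 r ^ 2 = 0 := by
    have : s 0 / 2 * wL 0 r ^ 2 = 0 := by linarith
    exact (mul_eq_zero.1 this).resolve_left (by positivity)
  exact ⟨by simpa using h2, by simpa using h3⟩

end IsPairSol

/-! ### Continuous extensions of the coefficients and kernels -/

/-- The entries of a kernel matrix. -/
def Kernel.entry (k : Kernel) : Fin 2 → Fin 2 → ℝ → ℝ → ℝ := ![![k.k₁₁, k.k₁₂], ![k.k₂₁, k.k₂₂]]

/-- The transport velocities. -/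
def Plant.speed (pl : Plant) : Fin 2 → ℝ := ![pl.lam₁, -pl.lam₂]

@[simp] lemma Plant.speed_zero (pl : Plant) : pl.speed 0 = pl.lam₁ := rfl

@[simp] lemma Plant.speed_one (pl : Plant) : pl.speed 1 = -pl.lam₂ := rfl

/-- Continuous extensions of the coupling coefficients. -/
def Plant.coupling (pl : Plant) : Fin 2 → Fin 2 → C(ℝ, ℝ) :=
  ![![0, ⟨IccExtend pl.ℓ_pos.le ((Icc 0 pl.ℓ).domRestrict pl.c₁), pl.c₁_cont.domRestrict.Icc_extend'⟩],
    ![⟨IccExtend pl.ℓ_pos.le ((Icc 0 pl.ℓ).domRestrict pl.c₂), pl.c₂_cont.domRestrict.Icc_extend'⟩, 0]]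

lemma Plant.coupling_zero_one (pl : Plant) {x : ℝ} (hx : x ∈ Icc 0 pl.ℓ) :
    pl.coupling 0 1 x = pl.c₁ x :=
  IccExtend_of_mem pl.ℓ_pos.le ((Icc 0 pl.ℓ).domRestrict pl.c₁) hx

lemma Plant.coupling_one_zero (pl : Plant) {x : ℝ} (hx : x ∈ Icc 0 pl.ℓ) :
    pl.coupling 1 0 x = pl.c₂ x :=
  IccExtend_of_mem pl.ℓ_pos.le ((Icc 0 pl.ℓ).domRestrict pl.c₂) hx

@[simp] lemma Plant.coupling_zero_zero (pl : Plant) : pl.coupling 0 0 = 0 := rfl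

@[simp] lemma Plant.coupling_one_one (pl : Plant) : pl.coupling 1 1 = 0 := rfl

lemma eq_on_triangle_of_interior {ℓ : ℝ} (hℓ : 0 < ℓ) {F G : ℝ × ℝ → ℝ} (hF : Continuous F)
    (hG : Continuous G) (h : ∀ x ξ, 0 < ξ → ξ < x → x < ℓ → F (x, ξ) = G (x, ξ)) {x ξ : ℝ}
    (h0 : 0 ≤ ξ) (h1 : ξ ≤ x) (h2 : x ≤ ℓ) : F (x, ξ) = G (x, ξ) := by
  let z : ℝ → ℝ × ℝ := fun e => ((1 - e) * x + e * (2 * ℓ / 3), (1 - e) * ξ + e * (ℓ / 3))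
  have hz : Continuous z := by fun_prop
  have hz0 : z 0 = (x, ξ) := by simp [z]
  have hev : (fun e => F (z e)) =ᶠ[𝓝[>] 0] fun e => G (z e) := by
    filter_upwards [Ioo_mem_nhdsGT (zero_lt_one' ℝ)] with e he
    have he1 : 0 ≤ 1 - e := by linarith [he.2]
    refine h _ _ ?_ ?_ ?_
    · have : 0 < e * (ℓ / 3) := mul_pos he.1 (by positivity)
      have := mul_nonneg he1 h0
      linarith
    · have := mul_le_mul_of_nonneg_left h1 he1
      have : 0 < e * ℓ := mul_pos he.1 hℓ
      linarith
    · have := mul_le_mul_of_nonneg_left h2 he1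
      have : 0 < e * ℓ := mul_pos he.1 hℓ
      linarith
  have t1 : Tendsto (fun e => F (z e)) (𝓝[>] 0) (𝓝 (F (x, ξ))) := by
    have := (hF.comp hz).tendsto 0
    simp only [Function.comp, hz0] at this
    exact this.mono_left nhdsWithin_le_nhds
  have t2 : Tendsto (fun e => G (z e)) (𝓝[>] 0) (𝓝 (G (x, ξ))) := by
    have := (hG.comp hz).tendsto 0
    simp only [Function.comp, hz0] at this
    exact this.mono_left nhdsWithin_le_nhds
  exact tendsto_nhds_unique (t1.congr' hev) t2

lemma Kernel.IsC1.exists_extension {k : Kernel} {ℓ : ℝ} (hℓ : 0 < ℓ) (hk : k.IsC1 ℓ) :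
    ∃ M Mx Mξ : Fin 2 → Fin 2 → C(ℝ × ℝ, ℝ), (∀ i j, IsC1Kernel ℓ (M i j) (Mx i j) (Mξ i j)) ∧
      (∀ i j x ξ, 0 ≤ ξ → ξ ≤ x → x ≤ ℓ → M i j (x, ξ) = k.entry i j x ξ) ∧
      ∀ i j a b x ξ, 0 < ξ → ξ < x → x < ℓ →
        dirDeriv a b (k.entry i j) x ξ = a * Mx i j (x, ξ) + b * Mξ i j (x, ξ) := by
  have : ∀ i j, ContDiffOn ℝ 1 (fun z : ℝ × ℝ => k.entry i j z.1 z.2) (triangle ℓ) := by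
    intro i j
    fin_cases i <;> fin_cases j
    exacts [hk.1, hk.2.1, hk.2.2.1, hk.2.2.2]
  choose M Mx Mξ h1 h2 h3 using fun i j => exists_isC1Kernel hℓ (this i j)
  exact ⟨M, Mx, Mξ, h1, h2, h3⟩

lemma IsTransformKernel.of_interior {ℓ : ℝ} (hℓ : 0 < ℓ) {s : Fin 2 → ℝ}
    {M Mx Mξ : Fin 2 → Fin 2 → C(ℝ × ℝ, ℝ)} {Cin Cout : Fin 2 → Fin 2 → C(ℝ, ℝ)}
    (c1 : ∀ i j, IsC1Kernel ℓ (M i j) (Mx i j) (Mξ i j))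
    (pde : ∀ i j x ξ, 0 < ξ → ξ < x → x < ℓ →
      s i * Mx i j (x, ξ) + s j * Mξ i j (x, ξ)
        = ∑ n, Cout i n x * M n j (x, ξ) - ∑ n, M i n (x, ξ) * Cin n j ξ)
    (diag : ∀ i j x, x ∈ Icc 0 ℓ → (s i - s j) * M i j (x, x) = Cout i j x - Cin i j x) :
    IsTransformKernel ℓ s M Mx Mξ Cin Cout where
  c1 := c1
  pde i j x ξ h0 h1 h2 := eq_on_triangle_of_interior hℓ
    (F := fun z => s i * Mx i j z + s j * Mξ i j z)
    (G := fun z => ∑ n, Cout i n z.1 * M n j z - ∑ n, M i n z * Cin n j z.2)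
    (by fun_prop) (by fun_prop) (pde i j) h0 h1 h2
  diag := diag

variable {pl : Plant}

lemma IsKernelK.exists_extension {K : Kernel} (h : IsKernelK pl K) :
    ∃ M Mx Mξ : Fin 2 → Fin 2 → C(ℝ × ℝ, ℝ),
      IsTransformKernel pl.ℓ pl.speed M Mx Mξ pl.coupling 0 ∧
      ∀ i j x ξ, 0 ≤ ξ → ξ ≤ x → x ≤ pl.ℓ → M i j (x, ξ) = -K.entry i j x ξ := by
  obtain ⟨M, Mx, Mξ, h1, h2, h3⟩ := h.c1.exists_extension pl.ℓ_pos
  have hs : pl.lam₁ + pl.lam₂ ≠ 0 := (add_pos pl.lam₁_pos pl.lam₂_pos).ne'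
  refine ⟨fun i j => -M i j, fun i j => -Mx i j, fun i j => -Mξ i j,
    .of_interior pl.ℓ_pos (fun i j => (h1 i j).neg) (fun i j x ξ g0 g1 g2 => ?_)
      (fun i j x hx => ?_), fun i j x ξ g0 g1 g2 => by rw [ContinuousMap.neg_apply, h2 i j x ξ g0 g1 g2]⟩
  · have hm : ∀ i j, M i j (x, ξ) = K.entry i j x ξ := fun i j => h2 i j x ξ g0.le g1.le g2.le
    have hξ : ξ ∈ Icc 0 pl.ℓ := ⟨g0.le, (g1.trans g2).le⟩
    have e1 := pl.coupling_zero_one hξ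
    have e2 := pl.coupling_one_zero hξ
    have p11 := h3 0 0 pl.lam₁ pl.lam₁ x ξ g0 g1 g2
    have p12 := h3 0 1 pl.lam₁ (-pl.lam₂) x ξ g0 g1 g2
    have p21 := h3 1 0 pl.lam₂ (-pl.lam₁) x ξ g0 g1 g2
    have p22 := h3 1 1 pl.lam₂ pl.lam₂ x ξ g0 g1 g2
    have q11 := h.pde₁₁ x ξ g0 g1 g2
    have q12 := h.pde₁₂ x ξ g0 g1 g2
    have q21 := h.pde₂₁ x ξ g0 g1 g2
    have q22 := h.pde₂₂ x ξ g0 g1 g2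
    fin_cases i <;> fin_cases j <;>
      simp [Fin.sum_univ_two, hm, Kernel.entry, e1, e2] at p11 p12 p21 p22 ⊢ <;> linarith
  · have hm : ∀ i j, M i j (x, x) = K.entry i j x x := fun i j => h2 i j x x hx.1 le_rfl hx.2
    have b12 := h.bc₁₂ x hx
    have b21 := h.bc₂₁ x hx
    fin_cases i <;> fin_cases j <;>
      simp [hm, Kernel.entry, pl.coupling_zero_one hx, pl.coupling_one_zero hx, b12, b21] <;>
      field_simp <;> ring

lemma IsKernelL.exists_extension {L : Kernel} (h : IsKernelL pl L) :
    ∃ M Mx Mξ : Fin 2 → Fin 2 → C(ℝ × ℝ, ℝ),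
      IsTransformKernel pl.ℓ pl.speed M Mx Mξ 0 pl.coupling ∧
      ∀ i j x ξ, 0 ≤ ξ → ξ ≤ x → x ≤ pl.ℓ → M i j (x, ξ) = L.entry i j x ξ := by
  obtain ⟨M, Mx, Mξ, h1, h2, h3⟩ := h.c1.exists_extension pl.ℓ_pos
  have hs : pl.lam₁ + pl.lam₂ ≠ 0 := (add_pos pl.lam₁_pos pl.lam₂_pos).ne'
  refine ⟨M, Mx, Mξ, .of_interior pl.ℓ_pos h1 (fun i j x ξ g0 g1 g2 => ?_)
      (fun i j x hx => ?_), h2⟩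
  · have hm : ∀ i j, M i j (x, ξ) = L.entry i j x ξ := fun i j => h2 i j x ξ g0.le g1.le g2.le
    have hx : x ∈ Icc 0 pl.ℓ := ⟨(g0.trans g1).le, g2.le⟩
    have e1 := pl.coupling_zero_one hx
    have e2 := pl.coupling_one_zero hx
    have p11 := h3 0 0 pl.lam₁ pl.lam₁ x ξ g0 g1 g2
    have p12 := h3 0 1 pl.lam₁ (-pl.lam₂) x ξ g0 g1 g2
    have p21 := h3 1 0 pl.lam₂ (-pl.lam₁) x ξ g0 g1 g2
    have p22 := h3 1 1 pl.lam₂ pl.lam₂ x ξ g0 g1 g2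
    have q11 := h.pde₁₁ x ξ g0 g1 g2
    have q12 := h.pde₁₂ x ξ g0 g1 g2
    have q21 := h.pde₂₁ x ξ g0 g1 g2
    have q22 := h.pde₂₂ x ξ g0 g1 g2
    fin_cases i <;> fin_cases j <;>
      simp [Fin.sum_univ_two, hm, Kernel.entry, e1, e2] at p11 p12 p21 p22 ⊢ <;> linarith
  · have hm : ∀ i j, M i j (x, x) = L.entry i j x x := fun i j => h2 i j x x hx.1 le_rfl hx.2
    have b12 := h.bc₁₂ x hx
    have b21 := h.bc₂₁ x hx
    fin_cases i <;> fin_cases j <;>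
      simp [hm, Kernel.entry, pl.coupling_zero_one hx, pl.coupling_one_zero hx, b12, b21] <;>
      field_simp <;> ring

lemma IsKernelR.exists_extension {R : Kernel} (h : IsKernelR pl R) :
    ∃ M Mx Mξ : Fin 2 → Fin 2 → C(ℝ × ℝ, ℝ),
      IsTransformKernel pl.ℓ pl.speed M Mx Mξ pl.coupling 0 ∧
      ∀ i j x ξ, 0 ≤ ξ → ξ ≤ x → x ≤ pl.ℓ → M i j (x, ξ) = R.entry i j x ξ := by
  obtain ⟨M, Mx, Mξ, h1, h2, h3⟩ := h.c1.exists_extension pl.ℓ_pos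
  have hs : pl.lam₁ + pl.lam₂ ≠ 0 := (add_pos pl.lam₁_pos pl.lam₂_pos).ne'
  refine ⟨M, Mx, Mξ, .of_interior pl.ℓ_pos h1 (fun i j x ξ g0 g1 g2 => ?_)
      (fun i j x hx => ?_), h2⟩
  · have hm : ∀ i j, M i j (x, ξ) = R.entry i j x ξ := fun i j => h2 i j x ξ g0.le g1.le g2.le
    have hξ : ξ ∈ Icc 0 pl.ℓ := ⟨g0.le, (g1.trans g2).le⟩
    have e1 := pl.coupling_zero_one hξ
    have e2 := pl.coupling_one_zero hξ
    have p11 := h3 0 0 pl.lam₁ pl.lam₁ x ξ g0 g1 g2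
    have p12 := h3 0 1 pl.lam₁ (-pl.lam₂) x ξ g0 g1 g2
    have p21 := h3 1 0 pl.lam₂ (-pl.lam₁) x ξ g0 g1 g2
    have p22 := h3 1 1 pl.lam₂ pl.lam₂ x ξ g0 g1 g2
    have q11 := h.pde₁₁ x ξ g0 g1 g2
    have q12 := h.pde₁₂ x ξ g0 g1 g2
    have q21 := h.pde₂₁ x ξ g0 g1 g2
    have q22 := h.pde₂₂ x ξ g0 g1 g2
    fin_cases i <;> fin_cases j <;>
      simp [Fin.sum_univ_two, hm, Kernel.entry, e1, e2] at p11 p12 p21 p22 ⊢ <;> linarith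
  · have hm : ∀ i j, M i j (x, x) = R.entry i j x x := fun i j => h2 i j x x hx.1 le_rfl hx.2
    have b12 := h.bc₁₂ x hx
    have b21 := h.bc₂₁ x hx
    fin_cases i <;> fin_cases j <;>
      simp [hm, Kernel.entry, pl.coupling_zero_one hx, pl.coupling_one_zero hx, b12, b21] <;>
      field_simp <;> ring

lemma IsKernelP.exists_extension {P : Kernel} (h : IsKernelP pl P) :
    ∃ M Mx Mξ : Fin 2 → Fin 2 → C(ℝ × ℝ, ℝ),
      IsTransformKernel pl.ℓ pl.speed M Mx Mξ 0 pl.coupling ∧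
      ∀ i j x ξ, 0 ≤ ξ → ξ ≤ x → x ≤ pl.ℓ → M i j (x, ξ) = -P.entry i j x ξ := by
  obtain ⟨M, Mx, Mξ, h1, h2, h3⟩ := h.c1.exists_extension pl.ℓ_pos
  have hs : pl.lam₁ + pl.lam₂ ≠ 0 := (add_pos pl.lam₁_pos pl.lam₂_pos).ne'
  refine ⟨fun i j => -M i j, fun i j => -Mx i j, fun i j => -Mξ i j,
    .of_interior pl.ℓ_pos (fun i j => (h1 i j).neg) (fun i j x ξ g0 g1 g2 => ?_)
      (fun i j x hx => ?_), fun i j x ξ g0 g1 g2 => by rw [ContinuousMap.neg_apply, h2 i j x ξ g0 g1 g2]⟩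
  · have hm : ∀ i j, M i j (x, ξ) = P.entry i j x ξ := fun i j => h2 i j x ξ g0.le g1.le g2.le
    have hx : x ∈ Icc 0 pl.ℓ := ⟨(g0.trans g1).le, g2.le⟩
    have e1 := pl.coupling_zero_one hx
    have e2 := pl.coupling_one_zero hx
    have p11 := h3 0 0 pl.lam₁ pl.lam₁ x ξ g0 g1 g2
    have p12 := h3 0 1 pl.lam₁ (-pl.lam₂) x ξ g0 g1 g2
    have p21 := h3 1 0 pl.lam₂ (-pl.lam₁) x ξ g0 g1 g2
    have p22 := h3 1 1 pl.lam₂ pl.lam₂ x ξ g0 g1 g2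
    have q11 := h.pde₁₁ x ξ g0 g1 g2
    have q12 := h.pde₁₂ x ξ g0 g1 g2
    have q21 := h.pde₂₁ x ξ g0 g1 g2
    have q22 := h.pde₂₂ x ξ g0 g1 g2
    fin_cases i <;> fin_cases j <;>
      simp [Fin.sum_univ_two, hm, Kernel.entry, e1, e2] at p11 p12 p21 p22 ⊢ <;> linarith
  · have hm : ∀ i j, M i j (x, x) = P.entry i j x x := fun i j => h2 i j x x hx.1 le_rfl hx.2
    have b12 := h.bc₁₂ x hx
    have b21 := h.bc₂₁ x hx
    fin_cases i <;> fin_cases j <;>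
      simp [hm, Kernel.entry, pl.coupling_zero_one hx, pl.coupling_one_zero hx, b12, b21] <;>
      field_simp <;> ring

/-- Continuous extensions of `-K`, `L`, `-P` and `R`. -/
structure Extension (pl : Plant) (ker : Kernels) where
  MK : Fin 2 → Fin 2 → C(ℝ × ℝ, ℝ)
  MKx : Fin 2 → Fin 2 → C(ℝ × ℝ, ℝ)
  MKξ : Fin 2 → Fin 2 → C(ℝ × ℝ, ℝ)
  ML : Fin 2 → Fin 2 → C(ℝ × ℝ, ℝ)
  MLx : Fin 2 → Fin 2 → C(ℝ × ℝ, ℝ)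
  MLξ : Fin 2 → Fin 2 → C(ℝ × ℝ, ℝ)
  MP : Fin 2 → Fin 2 → C(ℝ × ℝ, ℝ)
  MPx : Fin 2 → Fin 2 → C(ℝ × ℝ, ℝ)
  MPξ : Fin 2 → Fin 2 → C(ℝ × ℝ, ℝ)
  MR : Fin 2 → Fin 2 → C(ℝ × ℝ, ℝ)
  MRx : Fin 2 → Fin 2 → C(ℝ × ℝ, ℝ)
  MRξ : Fin 2 → Fin 2 → C(ℝ × ℝ, ℝ)
  K_isTransform : IsTransformKernel pl.ℓ pl.speed MK MKx MKξ pl.coupling 0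
  L_isTransform : IsTransformKernel pl.ℓ pl.speed ML MLx MLξ 0 pl.coupling
  P_isTransform : IsTransformKernel pl.ℓ pl.speed MP MPx MPξ 0 pl.coupling
  R_isTransform : IsTransformKernel pl.ℓ pl.speed MR MRx MRξ pl.coupling 0
  K_eq : ∀ i j x ξ, 0 ≤ ξ → ξ ≤ x → x ≤ pl.ℓ → MK i j (x, ξ) = -ker.K.entry i j x ξ
  L_eq : ∀ i j x ξ, 0 ≤ ξ → ξ ≤ x → x ≤ pl.ℓ → ML i j (x, ξ) = ker.L.entry i j x ξ
  P_eq : ∀ i j x ξ, 0 ≤ ξ → ξ ≤ x → x ≤ pl.ℓ → MP i j (x, ξ) = -ker.P.entry i j x ξ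
  R_eq : ∀ i j x ξ, 0 ≤ ξ → ξ ≤ x → x ≤ pl.ℓ → MR i j (x, ξ) = ker.R.entry i j x ξ

lemma Kernels.Solve.exists_extension {ker : Kernels} (h : ker.Solve pl) :
    Nonempty (Extension pl ker) := by
  obtain ⟨_, _, _, h1, h2⟩ := h.K.exists_extension
  obtain ⟨_, _, _, h3, h4⟩ := h.L.exists_extension
  obtain ⟨_, _, _, h5, h6⟩ := h.P.exists_extension
  obtain ⟨_, _, _, h7, h8⟩ := h.R.exists_extension
  exact ⟨⟨_, _, _, _, _, _, _, _, _, _, _, _, h1, h3, h5, h7, h2, h4, h6, h8⟩⟩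

namespace Extension

variable {ker : Kernels} (X : Extension pl ker)

lemma K_col (h : ker.Solve pl) (i : Fin 2) {x : ℝ} (hx : x ∈ Icc 0 pl.ℓ) :
    X.MK i 1 (x, 0) = pl.q * pl.lam₁ / pl.lam₂ * X.MK i 0 (x, 0) := by
  have b1 := h.K.bc₁₁ x hx
  have b2 := h.K.bc₂₂ x hx
  have := pl.q_ne
  have := pl.lam₁_pos.ne'
  have := pl.lam₂_pos.ne'
  rw [X.K_eq i 0 x 0 le_rfl hx.1 hx.2, X.K_eq i 1 x 0 le_rfl hx.1 hx.2]
  fin_cases i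
  · show -ker.K.k₁₂ x 0 = pl.q * pl.lam₁ / pl.lam₂ * -ker.K.k₁₁ x 0
    rw [b1]; field_simp
  · show -ker.K.k₂₂ x 0 = pl.q * pl.lam₁ / pl.lam₂ * -ker.K.k₂₁ x 0
    rw [b2]; ring

lemma L_col (h : ker.Solve pl) (i : Fin 2) {x : ℝ} (hx : x ∈ Icc 0 pl.ℓ) :
    X.ML i 1 (x, 0) = pl.q * pl.lam₁ / pl.lam₂ * X.ML i 0 (x, 0) := by
  have b1 := h.L.bc₁₁ x hx
  have b2 := h.L.bc₂₂ x hx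
  have := pl.q_ne
  have := pl.lam₁_pos.ne'
  have := pl.lam₂_pos.ne'
  rw [X.L_eq i 0 x 0 le_rfl hx.1 hx.2, X.L_eq i 1 x 0 le_rfl hx.1 hx.2]
  fin_cases i
  · show ker.L.k₁₂ x 0 = pl.q * pl.lam₁ / pl.lam₂ * ker.L.k₁₁ x 0
    rw [b1]; field_simp
  · show ker.L.k₂₂ x 0 = pl.q * pl.lam₁ / pl.lam₂ * ker.L.k₂₁ x 0
    rw [b2]

lemma P_row (h : ker.Solve pl) (j : Fin 2) {ξ : ℝ} (hξ : ξ ∈ Icc 0 pl.ℓ) :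
    X.MP 1 j (pl.ℓ, ξ) = pl.ρ * X.MP 0 j (pl.ℓ, ξ) := by
  have b1 := h.P.bc₁₁ ξ hξ
  have b2 := h.P.bc₂₂ ξ hξ
  have := pl.ρ_ne
  rw [X.P_eq 0 j _ ξ hξ.1 hξ.2 le_rfl, X.P_eq 1 j _ ξ hξ.1 hξ.2 le_rfl]
  fin_cases j
  · show -ker.P.k₂₁ pl.ℓ ξ = pl.ρ * -ker.P.k₁₁ pl.ℓ ξ
    rw [b1]; field_simp
  · show -ker.P.k₂₂ pl.ℓ ξ = pl.ρ * -ker.P.k₁₂ pl.ℓ ξ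
    rw [b2]; ring

lemma R_row (h : ker.Solve pl) (j : Fin 2) {ξ : ℝ} (hξ : ξ ∈ Icc 0 pl.ℓ) :
    X.MR 1 j (pl.ℓ, ξ) = pl.ρ * X.MR 0 j (pl.ℓ, ξ) := by
  have b1 := h.R.bc₁₁ ξ hξ
  have b2 := h.R.bc₂₂ ξ hξ
  have := pl.ρ_ne
  rw [X.R_eq 0 j _ ξ hξ.1 hξ.2 le_rfl, X.R_eq 1 j _ ξ hξ.1 hξ.2 le_rfl]
  fin_cases j
  · show ker.R.k₂₁ pl.ℓ ξ = pl.ρ * ker.R.k₁₁ pl.ℓ ξ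
    rw [b1]; field_simp
  · show ker.R.k₂₂ pl.ℓ ξ = pl.ρ * ker.R.k₁₂ pl.ℓ ξ
    rw [b2]

lemma speed_zero_pos : 0 < pl.speed 0 := pl.lam₁_pos

lemma speed_one_neg : pl.speed 1 < 0 := neg_lt_zero.2 pl.lam₂_pos

lemma speed_ne_zero (i : Fin 2) : pl.speed i ≠ 0 := by
  fin_cases i
  exacts [speed_zero_pos.ne', speed_one_neg.ne]

/-- `-K` and `L` are inverse to each other. -/
lemma compKernel_K_L (h : ker.Solve pl) : ∀ i j x ξ, 0 ≤ ξ → ξ < x → x ≤ pl.ℓ →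
    compKernel X.MK X.ML i j (x, ξ) = 0 := fun i j _ _ h0 h1 h2 =>
  compKernel_eq_zero X.K_isTransform X.L_isTransform speed_zero_pos speed_one_neg
    (ρ := pl.q * pl.lam₁ / pl.lam₂)
    (div_ne_zero (mul_ne_zero pl.q_ne pl.lam₁_pos.ne') pl.lam₂_pos.ne')
    (.inl fun M hM i x hx => by
      rcases hM with rfl | hM
      · exact X.K_col h i hx
      · obtain rfl := hM
        exact X.L_col h i hx) i j h0 h1 h2

/-- `R` and `-P` are inverse to each other. -/
lemma compKernel_R_P (h : ker.Solve pl) : ∀ i j x ξ, 0 ≤ ξ → ξ < x → x ≤ pl.ℓ →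
    compKernel X.MR X.MP i j (x, ξ) = 0 := fun i j _ _ h0 h1 h2 =>
  compKernel_eq_zero X.R_isTransform X.P_isTransform speed_zero_pos speed_one_neg pl.ρ_ne
    (.inr fun M hM j ξ hξ => by
      rcases hM with rfl | hM
      · exact X.R_row h j hξ
      · obtain rfl := hM
        exact X.P_row h j hξ) i j h0 h1 h2

end Extension

/-! ### Delay lines -/

lemma map_affine {κ : ℝ} (hκ : κ ≠ 0) (c : ℝ) :
    Measure.map (fun x : ℝ => c + κ * x) volume = ENNReal.ofReal |κ⁻¹| • (volume : Measure ℝ) := by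
  have : (fun x : ℝ => c + κ * x) = (fun y => c + y) ∘ fun x => κ * x := rfl
  rw [this, ← Measure.map_map (by fun_prop) (by fun_prop), Real.map_volume_mul_left hκ,
    Measure.map_smul, map_add_left_eq_self]

lemma ae_comp_affine {κ : ℝ} (hκ : κ ≠ 0) (c : ℝ) {P : ℝ → Prop} (h : ∀ᵐ y, P y) :
    ∀ᵐ x : ℝ, P (c + κ * x) := by
  have hq : Measure.QuasiMeasurePreserving (fun x : ℝ => c + κ * x) volume volume := by
    refine ⟨by fun_prop, ?_⟩
    rw [map_affine hκ]
    exact Measure.smul_absolutelyContinuous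
  exact hq.ae h

lemma memLp_comp_affine {κ : ℝ} (hκ : κ ≠ 0) (c : ℝ) {A : ℝ → ℝ} (hA : MemLp A 2 volume) :
    MemLp (fun x => A (c + κ * x)) 2 volume := by
  refine MemLp.comp_of_map (g := A) (f := fun x => c + κ * x) ?_ (by fun_prop)
  rw [map_affine hκ]
  exact hA.smul_measure ENNReal.ofReal_ne_top

/-- Measurable and locally square integrable functions on the line. -/
structure LocL2 (A : ℝ → ℝ) : Prop where
  measurable : Measurable A
  memLp : ∀ T : ℝ, MemLp A 2 (volume.restrict (Ioc (-T) T))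

namespace LocL2

variable {A B : ℝ → ℝ}

lemma of_memLp (hm : Measurable A) (h : MemLp A 2 volume) : LocL2 A := ⟨hm, fun _ => h.restrict _⟩

lemma indicator (hA : LocL2 A) (T : ℝ) : MemLp ((Ioc (-T) T).indicator A) 2 volume :=
  (memLp_indicator_iff_restrict measurableSet_Ioc).2 (hA.memLp T)

lemma intervalIntegrable (hA : LocL2 A) (a b : ℝ) : IntervalIntegrable A volume a b := by
  rw [intervalIntegrable_iff]
  have : IntegrableOn A (Ioc (-(|a| + |b| + 1)) (|a| + |b| + 1)) :=
    (hA.memLp _).integrable (by norm_num)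
  refine this.mono_set fun x hx => ?_
  rw [uIoc] at hx
  have h1 := neg_abs_le a
  have h2 := neg_abs_le b
  have h3 := le_abs_self a
  have h4 := le_abs_self b
  have h5 : min a b ≥ -(|a| + |b| + 1) := by
    refine le_min ?_ ?_ <;> linarith [abs_nonneg a, abs_nonneg b]
  have h6 : max a b ≤ |a| + |b| + 1 := by
    refine max_le ?_ ?_ <;> linarith [abs_nonneg a, abs_nonneg b]
  exact ⟨by linarith [hx.1], by linarith [hx.2]⟩

lemma comp_add (hA : LocL2 A) (c : ℝ) : LocL2 fun t => A (t + c) := by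
  refine ⟨hA.measurable.comp (by fun_prop), fun T => ?_⟩
  have h1 : MemLp (fun t => (Ioc (-(T + |c|)) (T + |c|)).indicator A (c + 1 * t)) 2
      (volume.restrict (Ioc (-T) T)) :=
    (memLp_comp_affine one_ne_zero c (hA.indicator _)).restrict _
  refine h1.ae_eq ?_
  filter_upwards [ae_restrict_mem measurableSet_Ioc] with t ht
  have h2 := neg_abs_le c
  have h3 := le_abs_self c
  rw [indicator_of_mem (show c + 1 * t ∈ Ioc (-(T + |c|)) (T + |c|) from
    ⟨by linarith [ht.1], by linarith [ht.2]⟩), one_mul, add_comm]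

lemma add (hA : LocL2 A) (hB : LocL2 B) : LocL2 fun t => A t + B t :=
  ⟨hA.measurable.add hB.measurable, fun T => (hA.memLp T).add (hB.memLp T)⟩

lemma const_mul (hA : LocL2 A) (c : ℝ) : LocL2 fun t => c * A t :=
  ⟨hA.measurable.const_mul c, fun T => (hA.memLp T).const_mul c⟩

lemma isTrace (hA : LocL2 A) : IsTrace A := fun T => by
  refine (hA.memLp |T|).mono_measure (Measure.restrict_mono ?_ le_rfl)
  exact Ioc_subset_Ioc (neg_nonpos.2 (abs_nonneg T)) (le_abs_self T)

end LocL2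

section Delay

variable {ℓ κ : ℝ} {A B : ℝ → ℝ}

lemma affine_mem_Ioc (κ : ℝ) {t x : ℝ} (hx : x ∈ Ioo 0 ℓ) {T : ℝ}
    (hT : |t| + |κ| * ℓ < T) : t + κ * x ∈ Ioc (-T) T := by
  have h1 : |t + κ * x| < T := by
    refine (abs_add_le _ _).trans_lt (lt_of_le_of_lt ?_ hT)
    rw [abs_mul, abs_of_pos hx.1]
    gcongr
    exact hx.2.le
  exact ⟨(abs_lt.1 h1).1, (abs_lt.1 h1).2.le⟩

lemma LocL2.memLp_delay (hA : LocL2 A) (hκ : κ ≠ 0) (t : ℝ) :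
    MemLp (fun x => A (t + κ * x)) 2 (volume.restrict (Ioo 0 ℓ)) := by
  have h1 : MemLp (fun x => (Ioc (-(|t| + |κ| * ℓ + 1)) (|t| + |κ| * ℓ + 1)).indicator A
      (t + κ * x)) 2 (volume.restrict (Ioo 0 ℓ)) :=
    (memLp_comp_affine hκ t (hA.indicator _)).restrict _
  refine h1.ae_eq ?_
  filter_upwards [ae_restrict_mem measurableSet_Ioo] with x hx
  exact indicator_of_mem (affine_mem_Ioc κ hx (lt_add_one _)) _

open Classical in
/-- The profile `x ↦ A(t + κ x)`. -/
def delay (ℓ κ : ℝ) (A : ℝ → ℝ) (t : ℝ) : L2 ℓ :=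
  if h : MemLp (fun x => A (t + κ * x)) 2 (volume.restrict (Ioo 0 ℓ)) then h.toLp _ else 0

lemma LocL2.coeFn_delay (hA : LocL2 A) (hκ : κ ≠ 0) (t : ℝ) :
    delay ℓ κ A t =ᵐ[volume.restrict (Ioo 0 ℓ)] fun x => A (t + κ * x) := by
  rw [delay, dif_pos (hA.memLp_delay hκ t)]
  exact MemLp.coeFn_toLp _

lemma LocL2.inner_delay (hA : LocL2 A) (hℓ : 0 ≤ ℓ) (hκ : κ ≠ 0) (t : ℝ) (φ : C(ℝ, ℝ)) :
    inner ℝ (delay ℓ κ A t) (emb ℓ φ) = ∫ x in (0 : ℝ)..ℓ, A (t + κ * x) * φ x := by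
  rw [inner_emb hℓ]
  refine intervalIntegral_congr_ae hℓ ?_
  filter_upwards [hA.coeFn_delay hκ t] with x hx
  rw [hx]

lemma LocL2.norm_delay_sq (hA : LocL2 A) (hℓ : 0 ≤ ℓ) (hκ : κ ≠ 0) (t : ℝ) :
    ‖delay ℓ κ A t‖ ^ 2 = κ⁻¹ * ∫ y in t..t + κ * ℓ, A y ^ 2 := by
  rw [norm_sq_eq_integral hℓ, intervalIntegral_congr_ae hℓ (g := fun x => A (t + κ * x) ^ 2),
    intervalIntegral.integral_comp_add_mul (fun y => A y ^ 2) hκ]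
  · simp
  · filter_upwards [hA.coeFn_delay hκ t] with x hx
    rw [hx]

lemma LocL2.continuous_delay (hA : LocL2 A) (hκ : κ ≠ 0) :
    Continuous fun t => delay ℓ κ A t := by
  rw [continuous_iff_continuousAt]
  intro t₀
  set T : ℝ := |t₀| + 1 + |κ| * ℓ + 1 with hT
  set Y : Lp ℝ 2 (volume : Measure ℝ) := (hA.indicator T).toLp _
  have hY : Y =ᵐ[volume] (Ioc (-T) T).indicator A := (hA.indicator T).coeFn_toLp
  have hle : ∀ t, |t - t₀| < 1 →
      ‖delay ℓ κ A t - delay ℓ κ A t₀‖ ^ 2 ≤ |κ⁻¹| * ‖translate t Y - translate t₀ Y‖ ^ 2 := by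
    intro t ht
    have htT : |t| + |κ| * ℓ < T := by
      have := abs_add_le (t - t₀) t₀
      rw [sub_add_cancel] at this
      linarith
    have ht₀T : |t₀| + |κ| * ℓ < T := by linarith
    have e1 : ‖delay ℓ κ A t - delay ℓ κ A t₀‖ ^ 2
        = ∫ x in Ioo 0 ℓ, (translate t Y - translate t₀ Y : Lp ℝ 2 volume) (0 + κ * x) ^ 2 := by
      rw [norm_sq_Lp]
      refine integral_congr_ae ?_
      have h1 := ae_comp_affine hκ 0 (coeFn_translate t Y)
      have h2 := ae_comp_affine hκ 0 (coeFn_translate t₀ Y)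
      have h3 := ae_comp_affine hκ 0 (Lp.coeFn_sub (translate t Y) (translate t₀ Y))
      have h4 := ae_comp_affine hκ t hY
      have h5 := ae_comp_affine hκ t₀ hY
      filter_upwards [hA.coeFn_delay hκ t, hA.coeFn_delay hκ t₀, ae_restrict_of_ae h1,
        ae_restrict_of_ae h2, ae_restrict_of_ae h3, ae_restrict_of_ae h4, ae_restrict_of_ae h5,
        Lp.coeFn_sub (delay ℓ κ A t) (delay ℓ κ A t₀), ae_restrict_mem measurableSet_Ioo]
        with x g1 g2 g3 g4 g5 g6 g7 g8 g9
      rw [g8, g5, Pi.sub_apply, Pi.sub_apply, g3, g4, g1, g2,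
        show 0 + κ * x + t = t + κ * x by ring, show 0 + κ * x + t₀ = t₀ + κ * x by ring, g6, g7,
        indicator_of_mem (affine_mem_Ioc κ g9 htT),
        indicator_of_mem (affine_mem_Ioc κ g9 ht₀T)]
    have e2 : ∫ x, (translate t Y - translate t₀ Y : Lp ℝ 2 volume) (0 + κ * x) ^ 2
        = |κ⁻¹| * ‖translate t Y - translate t₀ Y‖ ^ 2 := by
      simp only [zero_add]
      rw [norm_sq_Lp]
      exact Measure.integral_comp_mul_left
        (fun y => (translate t Y - translate t₀ Y : Lp ℝ 2 volume) y ^ 2) κ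
    rw [e1, ← e2]
    exact setIntegral_le_integral (memLp_comp_affine hκ 0 (Lp.memLp _)).integrable_sq
      (.of_forall fun _ => sq_nonneg _)
  have hlim : Tendsto (fun t => |κ⁻¹| * ‖translate t Y - translate t₀ Y‖ ^ 2) (𝓝 t₀) (𝓝 0) := by
    have : Continuous fun t => |κ⁻¹| * ‖translate t Y - translate t₀ Y‖ ^ 2 :=
      (((continuous_translate Y).sub continuous_const).norm.pow 2).const_smul |κ⁻¹|
    simpa using this.tendsto t₀
  rw [ContinuousAt, tendsto_iff_norm_sub_tendsto_zero]
  have h2 : Tendsto (fun t => ‖delay ℓ κ A t - delay ℓ κ A t₀‖ ^ 2) (𝓝 t₀) (𝓝 0) := by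
    refine tendsto_of_tendsto_of_tendsto_of_le_of_le' tendsto_const_nhds hlim
      (.of_forall fun _ => sq_nonneg _) ?_
    filter_upwards [Metric.ball_mem_nhds t₀ one_pos] with t ht
    exact hle t (by rwa [Metric.mem_ball, Real.dist_eq] at ht)
  have h3 := h2.sqrt
  simpa [Real.sqrt_sq (norm_nonneg _)] using h3

/-- Sums of delayed values, as a function of the time and the delay. -/
lemma LocL2.memLp_prod (hA : MemLp A 2 volume) (hm : Measurable A) (k : C(ℝ, ℝ)) (c κ : ℝ) :
    MemLp (fun z : ℝ × ℝ => k z.2 * A (z.1 + c + κ * z.2)) 2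
        (volume.prod (volume.restrict (Ioc 0 ℓ))) ∧
      ∫ z, (k z.2 * A (z.1 + c + κ * z.2)) ^ 2 ∂(volume.prod (volume.restrict (Ioc 0 ℓ)))
        = (∫ x in Ioc 0 ℓ, k x ^ 2) * ∫ t, A t ^ 2 := by
  have hsl : ∀ y : ℝ, Integrable (fun x => (k y * A (x + c + κ * y)) ^ 2) := fun y => by
    have := ((memLp_comp_affine one_ne_zero (c + κ * y) hA).const_mul (k y)).integrable_sq
    refine this.congr (.of_forall fun x => ?_)
    simp only
    rw [show c + κ * y + 1 * x = x + c + κ * y by ring]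
  have hsv : ∀ y : ℝ, ∫ x, (k y * A (x + c + κ * y)) ^ 2 = k y ^ 2 * ∫ t, A t ^ 2 := fun y => by
    simp only [mul_pow, integral_const_mul, add_assoc]
    rw [integral_add_right_eq_self (fun x => A x ^ 2)]
  have hmeas : Measurable fun z : ℝ × ℝ => k z.2 * A (z.1 + c + κ * z.2) :=
    (k.continuous.measurable.comp measurable_snd).mul (hm.comp (by fun_prop))
  have h2 : Integrable (fun y => ∫ x, (k y * A (x + c + κ * y)) ^ 2) (volume.restrict (Ioc 0 ℓ)) := by
    simp only [hsv]
    refine Integrable.mul_const ?_ _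
    exact (Continuous.integrableOn_Icc (by fun_prop)).mono_set Ioc_subset_Icc_self
  have hL := memLp_prod_of_slices hmeas.aestronglyMeasurable hsl h2
  refine ⟨hL, ?_⟩
  rw [integral_prod_symm _ hL.integrable_sq]
  simp only [hsv, integral_mul_const]

lemma LocL2.integral_delay_swap (hA : LocL2 A) (hℓ : 0 ≤ ℓ) {t : ℝ} (ht : 0 ≤ t) (φ : C(ℝ, ℝ)) :
    ∫ s in (0 : ℝ)..t, ∫ x in (0 : ℝ)..ℓ, A (s + κ * x) * φ x
      = ∫ x in (0 : ℝ)..ℓ, (∫ s in (0 : ℝ)..t, A (s + κ * x)) * φ x := by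
  set T : ℝ := |t| + |κ| * ℓ + 1 with hT
  have hmI : Measurable ((Ioc (-T) T).indicator A) := hA.measurable.indicator measurableSet_Ioc
  have h1 := (LocL2.memLp_prod (ℓ := ℓ) (hA.indicator T) hmI φ 0 κ).1
  have h2 : MemLp (fun z : ℝ × ℝ => φ z.2 * (Ioc (-T) T).indicator A (z.1 + 0 + κ * z.2)) 2
      ((volume.restrict (Ioc 0 t)).prod (volume.restrict (Ioc 0 ℓ))) := by
    refine h1.mono_measure ?_
    exact Measure.prod_mono Measure.restrict_le_self le_rfl
  have h3 := h2.integrable (by norm_num)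
  have h4 := integral_integral_swap
    (f := fun s x => φ x * (Ioc (-T) T).indicator A (s + 0 + κ * x)) h3
  have e : ∀ s ∈ Ioc 0 t, ∀ x ∈ Ioo 0 ℓ, (Ioc (-T) T).indicator A (s + 0 + κ * x)
      = A (s + κ * x) := fun s hs x hx => by
    rw [add_zero]
    refine indicator_of_mem (affine_mem_Ioc κ hx ?_) _
    rw [hT, abs_of_pos hs.1, abs_of_nonneg ht]
    linarith [hs.2]
  rw [intervalIntegral.integral_of_le ht, intervalIntegral.integral_of_le hℓ]
  have l1 : ∫ s in Ioc 0 t, ∫ x in (0 : ℝ)..ℓ, A (s + κ * x) * φ x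
      = ∫ s in Ioc 0 t, ∫ x in Ioc 0 ℓ, φ x * (Ioc (-T) T).indicator A (s + 0 + κ * x) := by
    refine setIntegral_congr_fun measurableSet_Ioc fun s hs => ?_
    rw [intervalIntegral.integral_of_le hℓ, integral_Ioc_eq_integral_Ioo,
      integral_Ioc_eq_integral_Ioo]
    refine setIntegral_congr_fun measurableSet_Ioo fun x hx => ?_
    rw [e s hs x hx, mul_comm]
  rw [l1, h4, integral_Ioc_eq_integral_Ioo, integral_Ioc_eq_integral_Ioo]
  refine setIntegral_congr_fun measurableSet_Ioo fun x hx => ?_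
  rw [intervalIntegral.integral_of_le ht, integral_const_mul, mul_comm]
  congr 1
  exact setIntegral_congr_fun measurableSet_Ioc fun s hs => e s hs x hx

/-- A delay line solves the transport equation with velocity `-1/κ`. -/
lemma LocL2.weakTransport_delay (hA : LocL2 A) (hℓ : 0 ≤ ℓ) (hκ : κ ≠ 0) :
    WeakTransport ℓ (-κ⁻¹) (delay ℓ κ A) A (fun t => A (t + κ * ℓ)) fun _ => 0 := by
  intro φ φ' hφ t ht
  set I : ℝ → ℝ := fun y => ∫ s in (0 : ℝ)..y, A s with hI
  have hIc : Continuous I := intervalIntegral.continuous_primitive hA.intervalIntegrable 0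
  have hIsub : ∀ a b, ∫ s in a..b, A s = I b - I a := fun a b =>
    (intervalIntegral.integral_interval_sub_left (hA.intervalIntegrable _ _)
      (hA.intervalIntegrable _ _)).symm
  have hshift : ∀ x, ∫ s in (0 : ℝ)..t, A (s + κ * x) = I (t + κ * x) - I (κ * x) := fun x => by
    rw [intervalIntegral.integral_comp_add_right (fun y => A y), hIsub, zero_add]
  have hprim : ∀ t, IsPrimitive (fun x => I (t + κ * x)) (fun x => κ * A (t + κ * x)) 0 ℓ := by
    intro t
    have hi : ∀ x, IntervalIntegrable (fun x => κ * A (t + κ * x)) volume 0 x := fun x => by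
      have := ((hA.intervalIntegrable (t + κ * 0) (t + κ * x)).comp_add_left t)
      have h2 := (this.comp_mul_left (c := κ)).const_mul κ
      simpa [hκ, mul_div_cancel_left₀] using h2
    refine ⟨hi ℓ, fun x _ => ?_⟩
    rw [intervalIntegral.integral_const_mul, intervalIntegral.integral_comp_add_mul _ hκ, hIsub,
      smul_eq_mul, mul_inv_cancel_left₀ hκ]
    ring
  have hparts : ∀ t, κ * ∫ x in (0 : ℝ)..ℓ, A (t + κ * x) * φ x
      = I (t + κ * ℓ) * φ ℓ - I t * φ 0 - ∫ x in (0 : ℝ)..ℓ, I (t + κ * x) * φ' x := fun t => by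
    have hp := (hprim t).mul hℓ (IsPrimitive.of_hasDerivAt hφ)
    have h1 := hp.eq ℓ ⟨hℓ, le_rfl⟩
    have i1 : IntervalIntegrable (fun x => I (t + κ * x) * φ' x) volume 0 ℓ :=
      Continuous.intervalIntegrable (by fun_prop) _ _
    have i2 : IntervalIntegrable (fun x => κ * A (t + κ * x) * φ x) volume 0 ℓ :=
      (hprim t).integrable.mul_continuousOn φ.continuous.continuousOn
    rw [intervalIntegral.integral_add i2 i1] at h1
    simp only [mul_assoc, intervalIntegral.integral_const_mul, mul_zero, add_zero] at h1
    linarith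
  have hsw := hA.integral_delay_swap (κ := κ) hℓ ht φ'
  simp only [hshift, sub_mul] at hsw
  rw [intervalIntegral.integral_sub (Continuous.intervalIntegrable (by fun_prop) _ _)
    (Continuous.intervalIntegrable (by fun_prop) _ _)] at hsw
  have hcd : Continuous fun s => inner ℝ (delay ℓ κ A s) (emb ℓ φ') :=
    (hA.continuous_delay hκ).inner continuous_const
  simp only [inner_zero_left, add_zero]
  rw [intervalIntegral.integral_add (hcd.intervalIntegrable _ _ |>.const_mul _),
    intervalIntegral.integral_const_mul, intervalIntegral.integral_const_mul,
    intervalIntegral.integral_sub, intervalIntegral.integral_mul_const,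
    intervalIntegral.integral_mul_const, intervalIntegral.integral_comp_add_right (fun y => A y),
    hIsub, hIsub, zero_add]
  · simp only [hA.inner_delay hℓ hκ]
    rw [hsw]
    have p1 := hparts t
    have p2 := hparts 0
    have I0 : I 0 = 0 := by simp [hI]
    simp only [I0, zero_add] at p2 ⊢
    field_simp
    linarith
  · exact (hA.intervalIntegrable _ _).mul_const _
  · exact ((hA.comp_add _).intervalIntegrable _ _).mul_const _
  · exact (((hA.intervalIntegrable _ _).mul_const _).sub
      (((hA.comp_add _).intervalIntegrable _ _).mul_const _)).const_mul _

end Delay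

/-! ### Linear delay equations -/

section DelayEquation

variable {ℓ : ℝ}

/-- The distributed delay `∫₀^ℓ k(x) A(t + c + κ x) dx`. -/
def distDelay (ℓ : ℝ) (k : C(ℝ, ℝ)) (c κ : ℝ) (A : ℝ → ℝ) (t : ℝ) : ℝ :=
  ∫ x in Ioc 0 ℓ, k x * A (t + c + κ * x)

lemma LocL2.integrable_distDelay {A : ℝ → ℝ} (hA : LocL2 A) (k : C(ℝ, ℝ)) (c : ℝ) {κ : ℝ}
    (hκ : κ ≠ 0) (t : ℝ) :
    Integrable (fun x => k x * A (t + c + κ * x)) (volume.restrict (Ioc 0 ℓ)) := by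
  rcases le_or_gt ℓ 0 with hℓ | hℓ
  · simp [Ioc_eq_empty_of_le hℓ]
  have h1 : IntegrableOn (fun x => A (t + c + κ * x)) (Ioc 0 ℓ) :=
    (integrableOn_Ioc_iff_integrableOn_Ioo (by simp)).2
      ((hA.memLp_delay hκ (t + c)).integrable (by norm_num))
  have h2 : IntervalIntegrable (fun x => A (t + c + κ * x)) volume 0 ℓ :=
    (intervalIntegrable_iff_integrableOn_Ioc_of_le hℓ.le).2 h1
  exact (intervalIntegrable_iff_integrableOn_Ioc_of_le hℓ.le).1
    (h2.continuousOn_mul k.continuous.continuousOn)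

lemma distDelay_sub {A B : ℝ → ℝ} (hA : LocL2 A) (hB : LocL2 B) (k : C(ℝ, ℝ)) (c : ℝ) {κ : ℝ}
    (hκ : κ ≠ 0) (t : ℝ) : distDelay ℓ k c κ (fun t => A t - B t) t
      = distDelay ℓ k c κ A t - distDelay ℓ k c κ B t := by
  simp only [distDelay, mul_sub]
  exact integral_sub (hA.integrable_distDelay k c hκ t) (hB.integrable_distDelay k c hκ t)

lemma distDelay_add {A B : ℝ → ℝ} (hA : LocL2 A) (hB : LocL2 B) (k : C(ℝ, ℝ)) (c : ℝ) {κ : ℝ}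
    (hκ : κ ≠ 0) (t : ℝ) : distDelay ℓ k c κ (fun t => A t + B t) t
      = distDelay ℓ k c κ A t + distDelay ℓ k c κ B t := by
  simp only [distDelay, mul_add]
  exact integral_add (hA.integrable_distDelay k c hκ t) (hB.integrable_distDelay k c hκ t)

lemma memLp_distDelay (hℓ : 0 ≤ ℓ) {A : ℝ → ℝ} (hm : Measurable A) (hA : MemLp A 2 volume)
    (k : C(ℝ, ℝ)) (c κ : ℝ) : MemLp (distDelay ℓ k c κ A) 2 volume ∧
      ∫ t, distDelay ℓ k c κ A t ^ 2 ≤ ℓ * (∫ x in Ioc 0 ℓ, k x ^ 2) * ∫ t, A t ^ 2 := by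
  obtain ⟨h1, h2⟩ := LocL2.memLp_prod (ℓ := ℓ) hA hm k c κ
  obtain ⟨h3, h4⟩ := memLp_integral_prod h1
  refine ⟨h3, h4.trans_eq ?_⟩
  rw [h2, ← mul_assoc]
  congr 2
  simp [measureReal_def, hℓ]

/-- One discrete and two distributed delays. -/
def delayOp (ℓ H r : ℝ) (k : Fin 2 → C(ℝ, ℝ)) (c κ : Fin 2 → ℝ) (b : ℝ → ℝ) (t : ℝ) : ℝ :=
  r * b (t - H) + distDelay ℓ (k 0) (c 0) (κ 0) b t + distDelay ℓ (k 1) (c 1) (κ 1) b t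

variable {H r : ℝ} {k : Fin 2 → C(ℝ, ℝ)} {c κ : Fin 2 → ℝ}

lemma memLp_delayOp (hℓ : 0 ≤ ℓ) {b : ℝ → ℝ} (hm : Measurable b) (hb : MemLp b 2 volume) :
    MemLp (delayOp ℓ H r k c κ b) 2 volume ∧
      ∫ t, delayOp ℓ H r k c κ b t ^ 2 ≤ (3 * r ^ 2 + 3 * (ℓ * ∫ x in Ioc 0 ℓ, k 0 x ^ 2)
        + 3 * (ℓ * ∫ x in Ioc 0 ℓ, k 1 x ^ 2)) * ∫ t, b t ^ 2 := by
  obtain ⟨a1, a2⟩ := memLp_distDelay hℓ hm hb (k 0) (c 0) (κ 0)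
  obtain ⟨b1, b2⟩ := memLp_distDelay hℓ hm hb (k 1) (c 1) (κ 1)
  have c1 : MemLp (fun t => b (t - H)) 2 volume := by
    refine (memLp_comp_affine one_ne_zero (-H) hb).ae_eq (.of_forall fun t => ?_)
    simp only
    rw [show -H + 1 * t = t - H by ring]
  have c2 : ∫ t, b (t - H) ^ 2 = ∫ t, b t ^ 2 := integral_sub_right_eq_self (fun t => b t ^ 2) H
  have hM : MemLp (delayOp ℓ H r k c κ b) 2 volume := ((c1.const_mul r).add a1).add b1
  refine ⟨hM, ?_⟩
  have hle : ∀ t, delayOp ℓ H r k c κ b t ^ 2 ≤ 3 * r ^ 2 * b (t - H) ^ 2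
      + 3 * distDelay ℓ (k 0) (c 0) (κ 0) b t ^ 2 + 3 * distDelay ℓ (k 1) (c 1) (κ 1) b t ^ 2 := by
    intro t
    rw [delayOp]
    nlinarith [sq_nonneg (r * b (t - H) - distDelay ℓ (k 0) (c 0) (κ 0) b t),
      sq_nonneg (r * b (t - H) - distDelay ℓ (k 1) (c 1) (κ 1) b t),
      sq_nonneg (distDelay ℓ (k 0) (c 0) (κ 0) b t - distDelay ℓ (k 1) (c 1) (κ 1) b t)]
  have i1 := c1.integrable_sq.const_mul (3 * r ^ 2)
  have i2 := a1.integrable_sq.const_mul 3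
  have i3 := b1.integrable_sq.const_mul 3
  refine (integral_mono hM.integrable_sq ((i1.add i2).add i3) hle).trans ?_
  have e1 := integral_add (i1.add i2) i3
  simp only [Pi.add_apply] at e1 ⊢
  rw [e1, integral_add i1 i2, integral_const_mul, integral_const_mul, integral_const_mul, c2]
  nlinarith

lemma delayOp_sub {b b' : ℝ → ℝ} (hb : LocL2 b) (hb' : LocL2 b') (hκ : ∀ i, κ i ≠ 0) (t : ℝ) :
    delayOp ℓ H r k c κ (fun t => b t - b' t) t
      = delayOp ℓ H r k c κ b t - delayOp ℓ H r k c κ b' t := by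
  simp only [delayOp, distDelay_sub hb hb' _ _ (hκ _)]
  ring

/-- A linear delay equation with a contractive delay operator has a square integrable solution. -/
lemma exists_delay_fixedPoint (hℓ : 0 ≤ ℓ) (hκ : ∀ i, κ i ≠ 0) {f : ℝ → ℝ} (hf : MemLp f 2 volume)
    (hsmall : 3 * r ^ 2 + 3 * (ℓ * ∫ x in Ioc 0 ℓ, k 0 x ^ 2)
        + 3 * (ℓ * ∫ x in Ioc 0 ℓ, k 1 x ^ 2) ≤ 1 / 4) :
    ∃ b : ℝ → ℝ, Measurable b ∧ MemLp b 2 volume ∧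
      ∀ᵐ t, b t = f t + (Ioi 0).indicator (delayOp ℓ H r k c κ b) t := by
  have hop : ∀ b : Lp ℝ 2 (volume : Measure ℝ),
      MemLp (fun t => f t + (Ioi 0).indicator (delayOp ℓ H r k c κ b) t) 2 volume := fun b =>
    hf.add ((memLp_delayOp hℓ (Lp.stronglyMeasurable b).measurable (Lp.memLp b)).1.indicator
      measurableSet_Ioi)
  let Φ : Lp ℝ 2 (volume : Measure ℝ) → Lp ℝ 2 (volume : Measure ℝ) := fun b => (hop b).toLp _
  have hΦ : ContractingWith (1 / 2) Φ := by
    refine ⟨by rw [div_lt_one (by norm_num)]; norm_num, LipschitzWith.of_dist_le_mul fun b b' => ?_⟩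
    rw [dist_eq_norm, dist_eq_norm]
    have hbm := (Lp.stronglyMeasurable b).measurable
    have hbm' := (Lp.stronglyMeasurable b').measurable
    have hd := memLp_delayOp (H := H) (r := r) (k := k) (c := c) (κ := κ) hℓ (hbm.sub hbm')
      ((Lp.memLp b).sub (Lp.memLp b'))
    have e1 : ‖Φ b - Φ b'‖ ^ 2 ≤ ∫ t, delayOp ℓ H r k c κ (fun t => b t - b' t) t ^ 2 := by
      rw [norm_sq_Lp]
      refine integral_mono_ae (Lp.memLp (Φ b - Φ b')).integrable_sq hd.1.integrable_sq ?_
      filter_upwards [Lp.coeFn_sub (Φ b) (Φ b'), (hop b).coeFn_toLp, (hop b').coeFn_toLp]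
        with t h1 h2 h3
      rw [h1, Pi.sub_apply, h2, h3, delayOp_sub (.of_memLp hbm (Lp.memLp b))
        (.of_memLp hbm' (Lp.memLp b')) hκ]
      by_cases ht : t ∈ Ioi (0 : ℝ)
      · rw [indicator_of_mem ht, indicator_of_mem ht, add_sub_add_left_eq_sub]
      · rw [indicator_of_notMem ht, indicator_of_notMem ht, sub_self,
          zero_pow two_ne_zero]
        exact sq_nonneg _
    have e2 : ∫ t, (b t - b' t) ^ 2 = ‖b - b'‖ ^ 2 := by
      rw [norm_sq_Lp]
      refine integral_congr_ae ?_
      filter_upwards [Lp.coeFn_sub b b'] with t h1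
      rw [h1, Pi.sub_apply]
    have e3 : ‖Φ b - Φ b'‖ ^ 2 ≤ (1 / 2 * ‖b - b'‖) ^ 2 := by
      refine e1.trans (hd.2.trans ?_)
      simp only [Pi.sub_apply]
      rw [e2]
      calc _ ≤ 1 / 4 * ‖b - b'‖ ^ 2 := mul_le_mul_of_nonneg_right hsmall (sq_nonneg _)
        _ = _ := by ring
    have := abs_le_of_sq_le_sq' e3 (by positivity)
    simpa using this.2
  refine ⟨_, (Lp.stronglyMeasurable (hΦ.fixedPoint Φ)).measurable, Lp.memLp _, ?_⟩
  have h1 := hΦ.fixedPoint_isFixedPt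
  have h2 := (hop (hΦ.fixedPoint Φ)).coeFn_toLp
  have h3 : (hop (hΦ.fixedPoint Φ)).toLp _ = hΦ.fixedPoint Φ := h1
  rw [h3] at h2
  exact h2

/-- Linear delay equations on the half-line are solvable. -/
lemma exists_delay_solution (hℓ : 0 ≤ ℓ) (hH : 0 < H) (hκ : ∀ i, κ i ≠ 0)
    (hneg : ∀ i, ∀ x ∈ Ioo 0 ℓ, c i + κ i * x < 0) {f : ℝ → ℝ} (hf : MemLp f 2 volume) {S : ℝ}
    (hS : ∀ t < -S, f t = 0) :
    ∃ B : ℝ → ℝ, LocL2 B ∧ ∀ᵐ t, B t = f t + (Ioi 0).indicator (delayOp ℓ H r k c κ B) t := by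
  let K : ℝ → Fin 2 → C(ℝ, ℝ) := fun γ i =>
    ⟨fun x => k i x * Real.exp (γ * (c i + κ i * x)), by fun_prop⟩
  have hlimK : ∀ i, Tendsto (fun γ => ∫ x in Ioc 0 ℓ, K γ i x ^ 2) atTop (𝓝 0) := by
    intro i
    have h0 : 𝓝 (0 : ℝ) = 𝓝 (∫ x in Ioo 0 ℓ, (0 : ℝ)) := by simp
    simp only [integral_Ioc_eq_integral_Ioo]
    rw [h0]
    refine tendsto_integral_filter_of_dominated_convergence (fun x => k i x ^ 2)
      (.of_forall fun γ => (Continuous.aestronglyMeasurable (by fun_prop))) ?_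
      ((Continuous.integrableOn_Icc (by fun_prop)).mono_set Ioo_subset_Icc_self) ?_
    · filter_upwards [eventually_ge_atTop (0 : ℝ)] with γ hγ
      filter_upwards [ae_restrict_mem measurableSet_Ioo] with x hx
      have h1 : Real.exp (γ * (c i + κ i * x)) ≤ 1 :=
        Real.exp_le_one_iff.2 (mul_nonpos_of_nonneg_of_nonpos hγ (hneg i x hx).le)
      simp only [K, ContinuousMap.coe_mk, norm_pow, norm_mul, Real.norm_eq_abs, Real.abs_exp,
        mul_pow, sq_abs]
      exact mul_le_of_le_one_right (sq_nonneg _) (pow_le_one₀ (Real.exp_pos _).le h1)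
    · filter_upwards [ae_restrict_mem measurableSet_Ioo] with x hx
      have h1 : Tendsto (fun γ : ℝ => Real.exp (γ * (c i + κ i * x))) atTop (𝓝 0) :=
        Real.tendsto_exp_atBot.comp (tendsto_id.atTop_mul_const_of_neg (hneg i x hx))
      have h2 := ((h1.const_mul (k i x)).pow 2)
      simpa [K] using h2
  have hlim : Tendsto (fun γ => 3 * (r * Real.exp (-(γ * H))) ^ 2
      + 3 * (ℓ * ∫ x in Ioc 0 ℓ, K γ 0 x ^ 2) + 3 * (ℓ * ∫ x in Ioc 0 ℓ, K γ 1 x ^ 2)) atTop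
      (𝓝 0) := by
    have h1 : Tendsto (fun γ : ℝ => Real.exp (-(γ * H))) atTop (𝓝 0) :=
      Real.tendsto_exp_neg_atTop_nhds_zero.comp (tendsto_id.atTop_mul_const hH)
    have h2 := ((((h1.const_mul r).pow 2).const_mul 3).add
      (((hlimK 0).const_mul ℓ).const_mul 3)).add (((hlimK 1).const_mul ℓ).const_mul 3)
    simpa using h2
  obtain ⟨γ, hγ, hγ0⟩ := ((hlim.eventually_le_const (show (0 : ℝ) < 1 / 4 by norm_num)).and
    (eventually_ge_atTop 0)).exists
  have hf' : MemLp (fun t => Real.exp (-(γ * t)) * f t) 2 volume := by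
    refine MemLp.of_le_mul (c := Real.exp (γ * S)) hf
      ((Continuous.aestronglyMeasurable (by fun_prop)).mul hf.aestronglyMeasurable)
      (.of_forall fun t => ?_)
    rw [norm_mul, Real.norm_of_nonneg (Real.exp_pos _).le]
    rcases lt_or_ge t (-S) with ht | ht
    · simp [hS t ht]
    · gcongr
      nlinarith
  obtain ⟨b, hbm, hb, hbe⟩ := exists_delay_fixedPoint (H := H) (c := c) hℓ hκ hf' hγ
  refine ⟨fun t => Real.exp (γ * t) * b t, ⟨by fun_prop, fun T => ?_⟩, ?_⟩
  · refine MemLp.of_le_mul (c := Real.exp (γ * T)) (hb.restrict _) (by fun_prop) ?_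
    filter_upwards [ae_restrict_mem measurableSet_Ioc] with t ht
    rw [norm_mul, Real.norm_of_nonneg (Real.exp_pos _).le]
    gcongr
    exact ht.2
  · filter_upwards [hbe] with t ht
    have hd : ∀ i, Real.exp (γ * t) * distDelay ℓ (K γ i) (c i) (κ i) b t
        = distDelay ℓ (k i) (c i) (κ i) (fun t => Real.exp (γ * t) * b t) t := fun i => by
      rw [distDelay, distDelay, ← integral_const_mul]
      refine integral_congr_ae (.of_forall fun x => ?_)
      simp only [K, ContinuousMap.coe_mk]
      rw [show γ * (t + c i + κ i * x) = γ * t + γ * (c i + κ i * x) by ring, Real.exp_add]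
      ring
    have he : Real.exp (γ * t) * Real.exp (-(γ * t)) = 1 := by
      rw [← Real.exp_add, add_neg_cancel, Real.exp_zero]
    have hH' : Real.exp (γ * t) * Real.exp (-(γ * H)) = Real.exp (γ * (t - H)) := by
      rw [← Real.exp_add]; congr 1; ring
    rw [ht, mul_add, ← mul_assoc, he, one_mul]
    congr 1
    by_cases h0 : t ∈ Ioi (0 : ℝ)
    · rw [indicator_of_mem h0, indicator_of_mem h0, delayOp, delayOp, mul_add, mul_add, hd, hd,
        ← hH']
      ring
    · rw [indicator_of_notMem h0, indicator_of_notMem h0, mul_zero]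

end DelayEquation

/-! ### Solutions of the decoupled system -/

section History

variable {ℓ κ : ℝ}

/-- The signal on the line whose profile at time `0` is `f`. -/
def history (κ : ℝ) (f : L2 ℓ) (t : ℝ) : ℝ := (Ioo 0 ℓ).indicator f (κ⁻¹ * t)

lemma measurable_history (f : L2 ℓ) : Measurable (history κ f) :=
  ((Lp.stronglyMeasurable f).measurable.indicator measurableSet_Ioo).comp (by fun_prop)

lemma memLp_indicator_coeFn (f : L2 ℓ) : MemLp ((Ioo 0 ℓ).indicator f) 2 volume :=
  (memLp_indicator_iff_restrict measurableSet_Ioo).2 (Lp.memLp f)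

lemma memLp_history (hκ : κ ≠ 0) (f : L2 ℓ) : MemLp (history κ f) 2 volume :=
  (memLp_comp_affine (inv_ne_zero hκ) 0 (memLp_indicator_coeFn f)).ae_eq
    (.of_forall fun t => by simp [history])

lemma locL2_history (hκ : κ ≠ 0) (f : L2 ℓ) : LocL2 (history κ f) :=
  .of_memLp (measurable_history f) (memLp_history hκ f)

lemma history_eq_zero (f : L2 ℓ) {t : ℝ} (h : κ⁻¹ * t ∉ Ioo 0 ℓ) : history κ f t = 0 :=
  indicator_of_notMem h _

lemma history_mul (hκ : κ ≠ 0) (f : L2 ℓ) {x : ℝ} (hx : x ∈ Ioo 0 ℓ) :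
    history κ f (κ * x) = f x := by
  rw [history, inv_mul_cancel_left₀ hκ, indicator_of_mem hx]

lemma integral_history_sq (f : L2 ℓ) : ∫ t, history κ f t ^ 2 = |κ| * ‖f‖ ^ 2 := by
  have h1 := Measure.integral_comp_mul_left (fun t => (Ioo 0 ℓ).indicator f t ^ 2) κ⁻¹
  simp only [inv_inv, smul_eq_mul] at h1
  have h2 : ∀ t, (Ioo 0 ℓ).indicator f t ^ 2 = (Ioo 0 ℓ).indicator (fun t => f t ^ 2) t := fun t => by
    by_cases ht : t ∈ Ioo 0 ℓ <;> simp [ht]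
  simp only [history]
  rw [h1, norm_sq_Lp]
  simp only [h2, integral_indicator measurableSet_Ioo]

lemma history_sq_le (hκ : κ ≠ 0) (f : L2 ℓ) {M : ℝ} (hM : 0 ≤ M)
    (h : ∀ᵐ x ∂volume.restrict (Ioo 0 ℓ), f x ^ 2 ≤ M) : ∀ᵐ t, history κ f t ^ 2 ≤ M := by
  have h1 := ae_comp_affine (inv_ne_zero hκ) 0 ((ae_restrict_iff' measurableSet_Ioo).1 h)
  filter_upwards [h1] with t ht
  rw [zero_add] at ht
  rw [history]
  by_cases hx : κ⁻¹ * t ∈ Ioo 0 ℓ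
  · rw [indicator_of_mem hx]; exact ht hx
  · rw [indicator_of_notMem hx]; simpa using hM

lemma delay_eq (hκ : κ ≠ 0) {A : ℝ → ℝ} (hA : LocL2 A) {t : ℝ} {f : L2 ℓ}
    (h : ∀ᵐ x ∂volume.restrict (Ioo 0 ℓ), A (t + κ * x) = f x) : delay ℓ κ A t = f := by
  ext1
  filter_upwards [hA.coeFn_delay hκ t, h] with x h1 h2
  rw [h1, h2]

end History

section Target

variable (pl : Plant)

/-- The pair of delay lines driven by the boundary values `A` and `B` at `x = 0`. -/
def delayPair (A B : ℝ → ℝ) : Fin 2 → ℝ → L2 pl.ℓ :=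
  ![delay pl.ℓ (-pl.lam₁⁻¹) A, delay pl.ℓ pl.lam₂⁻¹ B]

variable {pl}

lemma isPairSol_delayPair {A B : ℝ → ℝ} (hA : LocL2 A) (hB : LocL2 B) :
    IsPairSol pl.ℓ pl.speed 0 0 (fun _ => 0) (delayPair pl A B) ![A, B]
      ![fun t => A (t + -pl.lam₁⁻¹ * pl.ℓ), fun t => B (t + pl.lam₂⁻¹ * pl.ℓ)] := by
  have h1 : -pl.lam₁⁻¹ ≠ 0 := neg_ne_zero.2 (inv_ne_zero pl.lam₁_pos.ne')
  have h2 : pl.lam₂⁻¹ ≠ 0 := inv_ne_zero pl.lam₂_pos.ne'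
  refine ⟨fun i => ?_, isTrace_const 0, fun i => ?_, fun i => ?_, fun i => ?_⟩
  · fin_cases i
    · exact (hA.continuous_delay h1).continuousOn
    · exact (hB.continuous_delay h2).continuousOn
  · fin_cases i
    exacts [hA.isTrace, hB.isTrace]
  · fin_cases i
    exacts [(hA.comp_add _).isTrace, (hB.comp_add _).isTrace]
  · have hz : ∀ φ : L2 pl.ℓ, mulH pl.ℓ 0 φ = 0 := fun φ => by
      have := mulH_const (0 : ℝ) φ
      rwa [zero_smul] at this
    have e : (fun t => ∑ j, mulH pl.ℓ ((0 : Fin 2 → Fin 2 → C(ℝ, ℝ)) i j) (delayPair pl A B j t)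
        + (0 : ℝ) • (0 : Fin 2 → L2 pl.ℓ) i) = fun _ => 0 := by
      funext t
      simp [hz]
    rw [e]
    fin_cases i
    · have := hA.weakTransport_delay pl.ℓ_pos.le h1
      simpa [delayPair] using this
    · have := hB.weakTransport_delay pl.ℓ_pos.le h2
      simpa [delayPair] using this

lemma exists_target_solution (n : Fin 2 → C(ℝ, ℝ)) (α : Fin 2 → L2 pl.ℓ) {g : ℝ → ℝ}
    (hg : MemLp g 2 (volume.restrict (Ioi 0))) :
    ∃ A B : ℝ → ℝ, LocL2 A ∧ LocL2 B ∧ (∀ i, delayPair pl A B i 0 = α i) ∧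
      (∀ t > 0, A t = pl.q * B t) ∧
      ∀ᵐ t ∂volume.restrict (Ioi (0 : ℝ)), B (t + pl.lam₂⁻¹ * pl.ℓ)
        = pl.ρ * A (t + -pl.lam₁⁻¹ * pl.ℓ) + g t
          - ∑ j, inner ℝ (delayPair pl A B j t) (emb pl.ℓ (n j)) := by
  have hℓ := pl.ℓ_pos
  have hk1 : -pl.lam₁⁻¹ ≠ 0 := neg_ne_zero.2 (inv_ne_zero pl.lam₁_pos.ne')
  have hk2 : pl.lam₂⁻¹ ≠ 0 := inv_ne_zero pl.lam₂_pos.ne'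
  have hl1 : 0 < pl.lam₁⁻¹ := inv_pos.2 pl.lam₁_pos
  have hl2 : 0 < pl.lam₂⁻¹ := inv_pos.2 pl.lam₂_pos
  set h₁ := pl.lam₁⁻¹ * pl.ℓ with hh₁
  set h₂ := pl.lam₂⁻¹ * pl.ℓ with hh₂
  have ph1 : 0 < h₁ := mul_pos hl1 hℓ
  have ph2 : 0 < h₂ := mul_pos hl2 hℓ
  set A₀ : ℝ → ℝ := history (-pl.lam₁⁻¹) (α 0) with hA₀
  set B₀ : ℝ → ℝ := fun t => history pl.lam₂⁻¹ (α 1) (t + h₂) with hB₀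
  have hA0z : ∀ t, 0 ≤ t → A₀ t = 0 := fun t ht => history_eq_zero _ fun h => by
    have h1 := h.1
    rw [inv_neg, inv_inv] at h1
    nlinarith [pl.lam₁_pos]
  have hB0z : ∀ t, t ≤ -h₂ ∨ 0 ≤ t → B₀ t = 0 := fun t ht => history_eq_zero _ fun h => by
    rw [inv_inv] at h
    have e : pl.lam₂ * h₂ = pl.ℓ := by rw [hh₂, mul_inv_cancel_left₀ pl.lam₂_pos.ne']
    rcases ht with ht | ht
    · nlinarith [h.1, pl.lam₂_pos]
    · nlinarith [h.2, pl.lam₂_pos]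
  have hA0L : LocL2 A₀ := locL2_history hk1 _
  have mA0 : MemLp A₀ 2 volume := memLp_history hk1 _
  have mshift : ∀ {F : ℝ → ℝ} (c : ℝ), MemLp F 2 volume → MemLp (fun t => F (t + c)) 2 volume :=
    fun {F} c h => by
      refine (memLp_comp_affine one_ne_zero c h).ae_eq (.of_forall fun t => ?_)
      simp only
      rw [one_mul, add_comm]
  have mB0 : MemLp B₀ 2 volume := mshift _ (memLp_history hk2 _)
  set D₀ : ℝ → ℝ := distDelay pl.ℓ (n 0) 0 (-pl.lam₁⁻¹) A₀ with hD₀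
  have mD0 : MemLp D₀ 2 volume := (memLp_distDelay hℓ.le hA0L.measurable mA0 _ _ _).1
  have mg : MemLp ((Ioi 0).indicator g) 2 volume := (memLp_indicator_iff_restrict measurableSet_Ioi).2 hg
  set f : ℝ → ℝ := fun t => B₀ t
    + (Ioi 0).indicator (fun t => pl.ρ * A₀ (t + -h₁) + (Ioi 0).indicator g t - D₀ t) t with hf
  have mf : MemLp f 2 volume := mB0.add
    (((((mshift _ mA0).const_mul _).add mg).sub mD0).indicator measurableSet_Ioi)
  have hfS : ∀ t < -h₂, f t = 0 := fun t ht => by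
    have h0 : t ∉ Ioi (0 : ℝ) := fun h => by
      have := mem_Ioi.1 h
      linarith
    simp only [hf]
    rw [hB0z t (.inl ht.le), indicator_of_notMem h0, add_zero]
  let k : Fin 2 → C(ℝ, ℝ) := ![-(pl.q • n 0), -n 1]
  let c : Fin 2 → ℝ := fun _ => -h₂
  let κ : Fin 2 → ℝ := ![-pl.lam₁⁻¹, pl.lam₂⁻¹]
  have hκ : ∀ i, κ i ≠ 0 := fun i => by fin_cases i; exacts [hk1, hk2]
  have hneg : ∀ i, ∀ x ∈ Ioo 0 pl.ℓ, c i + κ i * x < 0 := fun i x hx => by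
    fin_cases i
    · show -h₂ + -pl.lam₁⁻¹ * x < 0
      nlinarith [mul_pos hl1 hx.1]
    · show -h₂ + pl.lam₂⁻¹ * x < 0
      nlinarith [mul_lt_mul_of_pos_left hx.2 hl2]
  obtain ⟨B, hB, hBe⟩ := exists_delay_solution (H := h₁ + h₂) (r := pl.ρ * pl.q) (k := k) hℓ.le
    (by positivity) hκ hneg mf hfS
  have hneg0 : ∀ᵐ t, t < 0 → B t = B₀ t := by
    filter_upwards [hBe] with t ht h0
    have h1 : t ∉ Ioi (0 : ℝ) := fun h => absurd (mem_Ioi.1 h) (not_lt.2 h0.le)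
    rw [ht]
    simp only [hf]
    rw [indicator_of_notMem h1, indicator_of_notMem h1, add_zero, add_zero]
  have hB' : LocL2 fun t => B (t + -h₂) := hB.comp_add _
  have hA : LocL2 fun t => A₀ t + pl.q * B (t + -h₂) := hA0L.add (hB'.const_mul _)
  refine ⟨fun t => A₀ t + pl.q * B (t + -h₂), fun t => B (t + -h₂), hA, hB', ?_, fun t ht => ?_, ?_⟩
  · intro i
    fin_cases i
    · refine delay_eq hk1 hA ?_
      have h1 := ae_comp_affine hk1 (-h₂) hneg0
      filter_upwards [ae_restrict_of_ae h1, ae_restrict_mem measurableSet_Ioo] with x hx hxm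
      have hx0 : -pl.lam₁⁻¹ * x < 0 := by nlinarith [mul_pos hl1 hxm.1]
      rw [zero_add, add_comm (-pl.lam₁⁻¹ * x) (-h₂), hx (by linarith), hB0z _ (.inl (by linarith)),
        mul_zero, add_zero, hA₀, history_mul hk1 _ hxm]
      rfl
    · refine delay_eq hk2 hB' ?_
      have h1 := ae_comp_affine hk2 (-h₂) hneg0
      filter_upwards [ae_restrict_of_ae h1, ae_restrict_mem measurableSet_Ioo] with x hx hxm
      have hx0 := mul_lt_mul_of_pos_left hxm.2 hl2
      rw [zero_add, add_comm (pl.lam₂⁻¹ * x) (-h₂), hx (by linarith)]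
      simp only [hB₀]
      rw [show -h₂ + pl.lam₂⁻¹ * x + h₂ = pl.lam₂⁻¹ * x by ring, history_mul hk2 _ hxm]
      rfl
  · simp only
    rw [hA0z t (le_of_lt ht), zero_add]
  · filter_upwards [ae_restrict_of_ae hBe, ae_restrict_mem measurableSet_Ioi] with t ht h0
    have e1 : inner ℝ (delayPair pl (fun t => A₀ t + pl.q * B (t + -h₂)) (fun t => B (t + -h₂)) 0 t)
        (emb pl.ℓ (n 0)) = D₀ t + pl.q * distDelay pl.ℓ (n 0) (-h₂) (-pl.lam₁⁻¹) B t := by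
      have h1 := hA.inner_delay hℓ.le hk1 t (n 0)
      have h2 := distDelay_add (ℓ := pl.ℓ) hA0L (hB'.const_mul pl.q) (n 0) 0 hk1 t
      rw [show delayPair pl (fun t => A₀ t + pl.q * B (t + -h₂)) (fun t => B (t + -h₂)) 0 t
        = delay pl.ℓ (-pl.lam₁⁻¹) (fun t => A₀ t + pl.q * B (t + -h₂)) t from rfl, h1,
        intervalIntegral.integral_of_le hℓ.le]
      have h3 : ∫ x in Ioc 0 pl.ℓ, (A₀ (t + -pl.lam₁⁻¹ * x)
          + pl.q * B (t + -pl.lam₁⁻¹ * x + -h₂)) * n 0 x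
          = distDelay pl.ℓ (n 0) 0 (-pl.lam₁⁻¹) (fun t => A₀ t + pl.q * B (t + -h₂)) t := by
        simp only [distDelay, add_zero, mul_comm (n 0 _)]
      have h4 : distDelay pl.ℓ (n 0) 0 (-pl.lam₁⁻¹) (fun t => pl.q * B (t + -h₂)) t
          = pl.q * distDelay pl.ℓ (n 0) (-h₂) (-pl.lam₁⁻¹) B t := by
        simp only [distDelay]
        rw [← integral_const_mul]
        refine integral_congr_ae (.of_forall fun x => ?_)
        simp only
        rw [show t + 0 + -pl.lam₁⁻¹ * x + -h₂ = t + -h₂ + -pl.lam₁⁻¹ * x by ring]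
        ring
      rw [h3, h2, h4]
    have e2 : inner ℝ (delayPair pl (fun t => A₀ t + pl.q * B (t + -h₂)) (fun t => B (t + -h₂)) 1 t)
        (emb pl.ℓ (n 1)) = distDelay pl.ℓ (n 1) (-h₂) pl.lam₂⁻¹ B t := by
      have h1 := hB'.inner_delay hℓ.le hk2 t (n 1)
      rw [show delayPair pl (fun t => A₀ t + pl.q * B (t + -h₂)) (fun t => B (t + -h₂)) 1 t
        = delay pl.ℓ pl.lam₂⁻¹ (fun t => B (t + -h₂)) t from rfl, h1,
        intervalIntegral.integral_of_le hℓ.le, distDelay]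
      refine integral_congr_ae (.of_forall fun x => ?_)
      simp only
      rw [show t + pl.lam₂⁻¹ * x + -h₂ = t + -h₂ + pl.lam₂⁻¹ * x by ring, mul_comm]
    have e3 : distDelay pl.ℓ (k 0) (c 0) (κ 0) B t
        = -(pl.q * distDelay pl.ℓ (n 0) (-h₂) (-pl.lam₁⁻¹) B t) := by
      simp only [distDelay]
      rw [← integral_const_mul, ← integral_neg]
      refine integral_congr_ae (.of_forall fun x => ?_)
      simp [k, c, κ]
      ring
    have e4 : distDelay pl.ℓ (k 1) (c 1) (κ 1) B t = -distDelay pl.ℓ (n 1) (-h₂) pl.lam₂⁻¹ B t := by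
      simp only [distDelay]
      rw [← integral_neg]
      refine integral_congr_ae (.of_forall fun x => ?_)
      simp [k, c, κ]
    rw [Fin.sum_univ_two, e1, e2]
    rw [show t + h₂ + -h₂ = t by ring, ht, indicator_of_mem h0, delayOp, e3, e4]
    simp only [hf]
    rw [hB0z t (.inr (le_of_lt h0)), indicator_of_mem h0, indicator_of_mem h0,
      show t + -pl.lam₁⁻¹ * pl.ℓ = t + -h₁ by rw [hh₁]; ring,
      show t - (h₁ + h₂) = t + -h₁ + -h₂ by ring]
    ring

end Target

/-! ### Transformation of solutions -/

section TransformSol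

variable {ℓ : ℝ} {s : Fin 2 → ℝ} {M Mx Mξ : Fin 2 → Fin 2 → C(ℝ × ℝ, ℝ)}
  {Cin Cout : Fin 2 → Fin 2 → C(ℝ, ℝ)} {p p' : Fin 2 → L2 ℓ} {b b' : ℝ → ℝ}
  {w : Fin 2 → ℝ → L2 ℓ} {w0 wL : Fin 2 → ℝ → ℝ}

lemma transform_smul (M : Fin 2 → Fin 2 → C(ℝ × ℝ, ℝ)) (c : ℝ) (w : Fin 2 → L2 ℓ) (i : Fin 2) :
    transform ℓ M (fun j => c • w j) i = c • transform ℓ M w i := by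
  simp only [transform, map_smul, Fin.sum_univ_two, smul_add]

lemma continuousOn_transform (M : Fin 2 → Fin 2 → C(ℝ × ℝ, ℝ)) {S : Set ℝ}
    (hw : ∀ i, ContinuousOn (w i) S) (i : Fin 2) :
    ContinuousOn (fun t => transform ℓ M (fun j => w j t) i) S :=
  (hw i).add (continuousOn_finsetSum _ fun j _ => (volH ℓ _).continuous.comp_continuousOn (hw j))

lemma IsPairSol.transform (hℓ : 0 ≤ ℓ) (hM : IsTransformKernel ℓ s M Mx Mξ Cin Cout)
    (h : IsPairSol ℓ s Cin p b w w0 wL) (hb' : IsTrace b')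
    (he : ∀ i, ∀ᵐ r ∂volume.restrict (Ioi (0 : ℝ)), b r • STC.transform ℓ M p i
      + ∑ j, (s j * w0 j r) • emb ℓ (colZero (M i j)) = b' r • p' i) :
    IsPairSol ℓ s Cout p' b' (fun i t => STC.transform ℓ M (fun j => w j t) i) w0
      (fun i t => wL i t + ∑ j, inner ℝ (w j t) (emb ℓ (rowEnd ℓ (M i j)))) where
  cont := continuousOn_transform M h.cont
  source := hb'
  trace0 := h.trace0
  traceL i := (h.traceL i).add (IsTrace.of_continuousOn
    (continuousOn_finsetSum _ fun j _ => (h.cont j).inner continuousOn_const))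
  eq i := by
    have := hM.weakTransport hℓ h.cont h.trace0 h.traceL
      (fun i => h.source.weakIntegrable_smul (p i)) h.eq i
    refine this.congr_ae (.of_forall fun _ => rfl) (.of_forall fun _ => rfl) ?_
    filter_upwards [he i] with r hr
    rw [add_assoc, transform_smul, hr]

lemma exists_norm_transform_sq_le (M : Fin 2 → Fin 2 → C(ℝ × ℝ, ℝ)) :
    ∃ c, 0 < c ∧ ∀ (w : Fin 2 → L2 ℓ) i,
      ‖transform ℓ M w i‖ ^ 2 ≤ c * (‖w 0‖ ^ 2 + ‖w 1‖ ^ 2) := by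
  refine ⟨3 * (1 + ∑ i, ∑ j, ‖volH ℓ (M i j)‖ ^ 2), by positivity, fun w i => ?_⟩
  have h0 := (volH ℓ (M i 0)).le_opNorm (w 0)
  have h1 := (volH ℓ (M i 1)).le_opNorm (w 1)
  have h2 : ‖transform ℓ M w i‖ ≤ ‖w i‖ + ‖volH ℓ (M i 0)‖ * ‖w 0‖ + ‖volH ℓ (M i 1)‖ * ‖w 1‖ := by
    simp only [transform, Fin.sum_univ_two]
    refine (norm_add_le _ _).trans ?_
    linarith [norm_add_le (volH ℓ (M i 0) (w 0)) (volH ℓ (M i 1) (w 1))]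
  have h3 : ‖transform ℓ M w i‖ ^ 2
      ≤ 3 * (‖w i‖ ^ 2 + ‖volH ℓ (M i 0)‖ ^ 2 * ‖w 0‖ ^ 2 + ‖volH ℓ (M i 1)‖ ^ 2 * ‖w 1‖ ^ 2) := by
    refine (pow_le_pow_left₀ (norm_nonneg _) h2 2).trans ?_
    nlinarith [sq_nonneg (‖w i‖ - ‖volH ℓ (M i 0)‖ * ‖w 0‖),
      sq_nonneg (‖w i‖ - ‖volH ℓ (M i 1)‖ * ‖w 1‖),
      sq_nonneg (‖volH ℓ (M i 0)‖ * ‖w 0‖ - ‖volH ℓ (M i 1)‖ * ‖w 1‖)]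
  refine h3.trans ?_
  have hS : ∀ i j, ‖volH ℓ (M i j)‖ ^ 2 ≤ ∑ i, ∑ j, ‖volH ℓ (M i j)‖ ^ 2 := fun i j =>
    (Finset.single_le_sum (f := fun j => ‖volH ℓ (M i j)‖ ^ 2) (fun _ _ => sq_nonneg _)
      (Finset.mem_univ j)).trans (Finset.single_le_sum (f := fun i => ∑ j, ‖volH ℓ (M i j)‖ ^ 2)
      (fun _ _ => by positivity) (Finset.mem_univ i))
  have hi : ‖w i‖ ^ 2 ≤ ‖w 0‖ ^ 2 + ‖w 1‖ ^ 2 := by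
    fin_cases i
    · exact le_add_of_nonneg_right (sq_nonneg _)
    · exact le_add_of_nonneg_left (sq_nonneg _)
  have e0 := mul_le_mul_of_nonneg_right (hS i 0) (sq_nonneg ‖w 0‖)
  have e1 := mul_le_mul_of_nonneg_right (hS i 1) (sq_nonneg ‖w 1‖)
  linarith

end TransformSol

/-! ### Gluing of solutions -/

lemma ae_ceil_eq {y : ℕ → ℝ → ℝ}
    (h : ∀ m n : ℕ, m ≤ n → ∀ᵐ r ∂volume.restrict (Ioc (0 : ℝ) m), y m r = y n r) (n : ℕ) :
    ∀ᵐ r ∂volume.restrict (Ioc (0 : ℝ) n), y ⌈r⌉₊ r = y n r := by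
  rw [ae_restrict_iff' measurableSet_Ioc]
  have := ae_all_iff.2 fun m => ae_all_iff.2 fun hm : m ≤ n =>
    (ae_restrict_iff' measurableSet_Ioc).1 (h m n hm)
  filter_upwards [this] with r hr h0
  exact hr ⌈r⌉₊ (Nat.ceil_le.2 h0.2) ⟨h0.1, Nat.le_ceil r⟩

lemma IsTrace.glue {y : ℕ → ℝ → ℝ} (hy : ∀ n, IsTrace (y n))
    (h : ∀ m n : ℕ, m ≤ n → ∀ᵐ r ∂volume.restrict (Ioc (0 : ℝ) m), y m r = y n r) :
    IsTrace fun r => y ⌈r⌉₊ r := fun T => by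
  have hs : Ioc 0 T ⊆ Ioc (0 : ℝ) ⌈T⌉₊ := Ioc_subset_Ioc_right (Nat.le_ceil T)
  refine (hy ⌈T⌉₊ T).ae_eq ?_
  filter_upwards [ae_restrict_of_ae_restrict_of_subset hs (ae_ceil_eq h ⌈T⌉₊)] with r hr
  exact hr.symm

lemma IsPairSol.glue {ℓ : ℝ} {s : Fin 2 → ℝ} {C : Fin 2 → Fin 2 → C(ℝ, ℝ)} {p : Fin 2 → L2 ℓ}
    {b : ℝ → ℝ} {w : ℕ → Fin 2 → ℝ → L2 ℓ} {w0 wL : ℕ → Fin 2 → ℝ → ℝ}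
    (h : ∀ n, IsPairSol ℓ s C p b (w n) (w0 n) (wL n))
    (hw : ∀ m n : ℕ, m ≤ n → ∀ i, ∀ t ∈ Icc (0 : ℝ) m, w m i t = w n i t)
    (h0 : ∀ m n : ℕ, m ≤ n → ∀ i, ∀ᵐ r ∂volume.restrict (Ioc (0 : ℝ) m), w0 m i r = w0 n i r)
    (hL : ∀ m n : ℕ, m ≤ n → ∀ i, ∀ᵐ r ∂volume.restrict (Ioc (0 : ℝ) m), wL m i r = wL n i r) :
    IsPairSol ℓ s C p b (fun i t => w ⌈t⌉₊ i t) (fun i t => w0 ⌈t⌉₊ i t)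
      fun i t => wL ⌈t⌉₊ i t := by
  have hwn : ∀ (n : ℕ) i, ∀ t ∈ Icc (0 : ℝ) n, w ⌈t⌉₊ i t = w n i t := fun n i t ht =>
    hw _ _ (Nat.ceil_le.2 ht.2) i t ⟨ht.1, Nat.le_ceil t⟩
  refine ⟨fun i => ?_, (h 0).source, fun i => .glue (fun n => (h n).trace0 i)
    fun m n hmn => h0 m n hmn i, fun i => .glue (fun n => (h n).traceL i)
    fun m n hmn => hL m n hmn i, fun i => ?_⟩
  · intro t ht
    have hlt : t < (⌈t⌉₊ + 1 : ℕ) := by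
      push_cast
      linarith [Nat.le_ceil t]
    have hc := (h (⌈t⌉₊ + 1)).cont i t ht
    refine ContinuousWithinAt.congr_of_eventuallyEq hc ?_ (hwn _ i t ⟨ht, hlt.le⟩)
    filter_upwards [self_mem_nhdsWithin, mem_nhdsWithin_of_mem_nhds (Iio_mem_nhds hlt)] with r h1 h2
    exact hwn _ i r ⟨h1, le_of_lt h2⟩
  · intro φ φ' hφ t ht
    beta_reduce
    have htn : t ∈ Icc (0 : ℝ) ⌈t⌉₊ := ⟨ht, Nat.le_ceil t⟩
    rw [hwn 0 i 0 ⟨le_rfl, by simp⟩, hw 0 ⌈t⌉₊ (Nat.zero_le _) i 0 ⟨le_rfl, by simp⟩,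
      (h ⌈t⌉₊).eq i φ φ' hφ t ht]
    congr 1
    rw [intervalIntegral.integral_of_le ht, intervalIntegral.integral_of_le ht]
    refine integral_congr_ae ?_
    have hs : Ioc 0 t ⊆ Ioc (0 : ℝ) ⌈t⌉₊ := Ioc_subset_Ioc_right htn.2
    filter_upwards [ae_restrict_of_ae_restrict_of_subset hs
      (ae_ceil_eq (y := fun n => w0 n i) (fun m n hmn => h0 m n hmn i) ⌈t⌉₊),
      ae_restrict_of_ae_restrict_of_subset hs
      (ae_ceil_eq (y := fun n => wL n i) (fun m n hmn => hL m n hmn i) ⌈t⌉₊),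
      ae_restrict_mem measurableSet_Ioc] with r g1 g2 g3
    rw [g1, g2, hwn _ i r ⟨g3.1.le, g3.2.trans htn.2⟩]
    simp only [hwn _ _ r ⟨g3.1.le, g3.2.trans htn.2⟩]

/-! ### The plant with a given input -/

section PlantSol

variable {pl : Plant}

/-- `w = (u, v)` solves the plant with input `g` and initial state `u`. -/
structure IsPlantSol (pl : Plant) (g : ℝ → ℝ) (u : Fin 2 → L2 pl.ℓ) (w : Fin 2 → ℝ → L2 pl.ℓ)
    (w0 wL : Fin 2 → ℝ → ℝ) : Prop where
  sol : IsPairSol pl.ℓ pl.speed pl.coupling 0 (fun _ => 0) w w0 wL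
  init : ∀ i, w i 0 = u i
  bc0 : ∀ᵐ t ∂volume.restrict (Ioi (0 : ℝ)), w0 0 t = pl.q * w0 1 t
  bcL : ∀ᵐ t ∂volume.restrict (Ioi (0 : ℝ)), wL 1 t = pl.ρ * wL 0 t + g t

lemma IsPlantSol.unique {g g' : ℝ → ℝ} {u : Fin 2 → L2 pl.ℓ} {w w' : Fin 2 → ℝ → L2 pl.ℓ}
    {w0 wL w0' wL' : Fin 2 → ℝ → ℝ} (h : IsPlantSol pl g u w w0 wL)
    (h' : IsPlantSol pl g' u w' w0' wL') {T : ℝ} (hT : 0 ≤ T)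
    (hg : ∀ᵐ r ∂volume.restrict (Ioc 0 T), g r = g' r) :
    (∀ i, ∀ t ∈ Icc 0 T, w i t = w' i t) ∧
      (∀ i, ∀ᵐ r ∂volume.restrict (Ioc 0 T), w0 i r = w0' i r) ∧
      ∀ i, ∀ᵐ r ∂volume.restrict (Ioc 0 T), wL i r = wL' i r := by
  have hd := h.sol.sub h'.sol
  have hd' := hd.congr_source (p' := 0) (hd.trace0 1) fun i => .of_forall fun r => by simp
  have hsub : Ioc 0 T ⊆ Ioi 0 := Ioc_subset_Ioi_self
  have r0 := ae_restrict_of_ae_restrict_of_subset hsub h.bc0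
  have r0' := ae_restrict_of_ae_restrict_of_subset hsub h'.bc0
  have rL := ae_restrict_of_ae_restrict_of_subset hsub h.bcL
  have rL' := ae_restrict_of_ae_restrict_of_subset hsub h'.bcL
  obtain ⟨h1, h2⟩ := hd'.eq_zero (w := fun i t => w i t - w' i t)
    (w0 := fun i t => w0 i t - w0' i t) (wL := fun i t => wL i t - wL' i t) pl.ℓ_pos
    Extension.speed_zero_pos Extension.speed_one_neg
    (q := pl.q) pl.ρ_ne le_rfl hT (fun i => by rw [h.init, h'.init, sub_self])
    (by filter_upwards [r0, r0'] with r e1 e2; rw [e1, e2]; ring)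
    (by filter_upwards [rL, rL', hg] with r e1 e2 e3; rw [e1, e2, e3]; ring)
  refine ⟨fun i t ht => sub_eq_zero.1 (h1 i t ht), fun i => ?_, fun i => ?_⟩
  · filter_upwards [h2, r0, r0'] with r e1 e2 e3
    have := sub_eq_zero.1 e1.1
    fin_cases i
    · show w0 0 r = w0' 0 r
      rw [e2, e3, this]
    · exact this
  · filter_upwards [h2, rL, rL', hg] with r e1 e2 e3 e4
    have := sub_eq_zero.1 e1.2
    fin_cases i
    · exact this
    · show wL 1 r = wL' 1 r
      rw [e2, e3, this, e4]

lemma sum_smul_colZero_eq_zero {M : Fin 2 → Fin 2 → C(ℝ × ℝ, ℝ)}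
    (h : ∀ i, ∀ x ∈ Icc 0 pl.ℓ, M i 1 (x, 0) = pl.q * pl.lam₁ / pl.lam₂ * M i 0 (x, 0)) (i : Fin 2) :
    emb pl.ℓ (colZero (M i 1)) = (pl.q * pl.lam₁ / pl.lam₂) • emb pl.ℓ (colZero (M i 0)) := by
  rw [← emb_smul]
  exact emb_congr fun x hx => h i x hx

lemma exists_isPlantSol_of_memLp {ker : Kernels} (X : Extension pl ker) (hker : ker.Solve pl)
    (u : Fin 2 → L2 pl.ℓ) {g : ℝ → ℝ} (hg : MemLp g 2 (volume.restrict (Ioi 0))) :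
    ∃ w w0 wL, IsPlantSol pl g u w w0 wL := by
  obtain ⟨A, B, hA, hB, hi, h0, hL⟩ := exists_target_solution
    (fun j => rowEnd pl.ℓ (X.ML 1 j) - pl.ρ • rowEnd pl.ℓ (X.ML 0 j)) (transform pl.ℓ X.MK u) hg
  have hp := isPairSol_delayPair (pl := pl) hA hB
  have hs := hp.transform pl.ℓ_pos.le X.L_isTransform (p' := 0) (isTrace_const 0) fun i => by
    filter_upwards [ae_restrict_mem measurableSet_Ioi] with r hr
    have e : ∀ r, (![A, B] : Fin 2 → ℝ → ℝ) 0 r = A r ∧ (![A, B] : Fin 2 → ℝ → ℝ) 1 r = B r :=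
      fun r => ⟨rfl, rfl⟩
    rw [Fin.sum_univ_two, sum_smul_colZero_eq_zero (fun i x hx => X.L_col hker i hx) i, (e r).1,
      (e r).2, h0 r hr, smul_smul, ← add_smul]
    have : pl.speed 0 * (pl.q * B r) + pl.speed 1 * B r * (pl.q * pl.lam₁ / pl.lam₂) = 0 := by
      have := pl.lam₂_pos.ne'
      simp only [Plant.speed_zero, Plant.speed_one]
      field_simp
      ring
    rw [this]
    simp
  refine ⟨_, _, _, hs, fun i => ?_, ?_, ?_⟩
  · have : (fun j => delayPair pl A B j 0) = transform pl.ℓ X.MK u := funext hi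
    rw [this, transform_transform' pl.ℓ_pos (X.compKernel_K_L hker)]
  · filter_upwards [ae_restrict_mem measurableSet_Ioi] with r hr
    exact h0 r hr
  · filter_upwards [hL] with r hr
    have e : ∀ r i, (![fun t => A (t + -pl.lam₁⁻¹ * pl.ℓ), fun t => B (t + pl.lam₂⁻¹ * pl.ℓ)] :
      Fin 2 → ℝ → ℝ) i r = (![A (r + -pl.lam₁⁻¹ * pl.ℓ), B (r + pl.lam₂⁻¹ * pl.ℓ)] : Fin 2 → ℝ) i :=
      fun r i => by fin_cases i <;> rfl
    have hsub : ∀ φ ψ : C(ℝ, ℝ), emb pl.ℓ (φ - pl.ρ • ψ) = emb pl.ℓ φ - pl.ρ • emb pl.ℓ ψ :=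
      fun _ _ => rfl
    simp only [Fin.sum_univ_two, hsub, inner_sub_right, inner_smul_right] at hr
    rw [e, e]
    simp only [Fin.sum_univ_two, Matrix.cons_val_zero, Matrix.cons_val_one]
    rw [hr]
    ring

/-- The plant has a solution for every locally square integrable input. -/
lemma exists_isPlantSol {ker : Kernels} (X : Extension pl ker) (hker : ker.Solve pl)
    (u : Fin 2 → L2 pl.ℓ) {g : ℝ → ℝ} (hg : IsTrace g) : ∃ w w0 wL, IsPlantSol pl g u w w0 wL := by
  choose w w0 wL h using fun n : ℕ => exists_isPlantSol_of_memLp X hker u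
    ((memLp_indicator_of_isTrace hg n).restrict (Ioi 0))
  have hu := fun (m n : ℕ) (hmn : m ≤ n) => (h m).unique (h n) (T := m) (Nat.cast_nonneg m) (by
    filter_upwards [ae_restrict_mem measurableSet_Ioc] with r hr
    have : r ∈ Ioc (0 : ℝ) n := ⟨hr.1, hr.2.trans (Nat.cast_le.2 hmn)⟩
    rw [indicator_of_mem hr, indicator_of_mem this])
  refine ⟨_, _, _, IsPairSol.glue (fun n => (h n).sol) (fun m n hmn => (hu m n hmn).1)
    (fun m n hmn => (hu m n hmn).2.1) (fun m n hmn => (hu m n hmn).2.2), fun i => ?_, ?_, ?_⟩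
  · exact (h _).init i
  · have := ae_all_iff.2 fun n => (h n).bc0
    filter_upwards [this] with r hr
    exact hr _
  · have := ae_all_iff.2 fun n => (h n).bcL
    filter_upwards [this, ae_restrict_mem measurableSet_Ioi] with r hr h0
    have h1 : r ∈ Ioc (0 : ℝ) ⌈r⌉₊ := ⟨h0, Nat.le_ceil r⟩
    have h2 := hr ⌈r⌉₊
    rwa [indicator_of_mem h1] at h2

end PlantSol

/-! ### Pointwise bounds of Volterra transformations -/

section Bounds

variable {ℓ : ℝ}

lemma volterra_sq_le (k : C(ℝ × ℝ, ℝ)) {f : L2 ℓ} {M : ℝ}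
    (hf : ∀ᵐ x ∂volume.restrict (Ioo 0 ℓ), f x ^ 2 ≤ M) {x : ℝ} (hx : x ∈ Icc 0 ℓ) :
    volterra k f x ^ 2 ≤ M * x * ∫ ξ in (0 : ℝ)..x, k (x, ξ) ^ 2 := by
  have hsub : Ioo 0 x ⊆ Ioo 0 ℓ := Ioo_subset_Ioo_right hx.2
  have h1 : MemLp (fun ξ => k (x, ξ)) 2 (volume.restrict (Ioo 0 x)) :=
    memLp_of_continuous x (by fun_prop)
  have h2 : MemLp f 2 (volume.restrict (Ioo 0 x)) :=
    (Lp.memLp f).mono_measure (Measure.restrict_mono hsub le_rfl)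
  have h3 := pow_le_pow_left₀ (abs_nonneg _) (abs_integral_mul_le h1 h2) 2
  rw [sq_abs, mul_pow, Real.sq_sqrt (integral_nonneg fun _ => sq_nonneg _),
    Real.sq_sqrt (integral_nonneg fun _ => sq_nonneg _)] at h3
  have h4 : ∫ ξ in Ioo 0 x, f ξ ^ 2 ≤ M * x := by
    refine (integral_mono_ae h2.integrable_sq (integrable_const M)
      (ae_restrict_of_ae_restrict_of_subset hsub hf)).trans_eq ?_
    simp [measureReal_def, hx.1, mul_comm]
  rw [volterra, ← setIntegral_Ioo_eq hx.1, ← setIntegral_Ioo_eq hx.1, mul_comm (M * x)]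
  exact h3.trans (mul_le_mul_of_nonneg_left h4 (integral_nonneg fun _ => sq_nonneg _))

lemma sq_add_volterra_le_sSup {k l : C(ℝ × ℝ, ℝ)} {K L : ℝ → ℝ → ℝ}
    (hk : ∀ x ξ, 0 ≤ ξ → ξ ≤ x → x ≤ ℓ → k (x, ξ) = K x ξ)
    (hl : ∀ x ξ, 0 ≤ ξ → ξ ≤ x → x ≤ ℓ → l (x, ξ) = L x ξ) {f g h : L2 ℓ} {M N O : ℝ}
    (hf : ∀ᵐ x ∂volume.restrict (Ioo 0 ℓ), f x ^ 2 ≤ M)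
    (hg : ∀ᵐ x ∂volume.restrict (Ioo 0 ℓ), g x ^ 2 ≤ N)
    (hh : ∀ᵐ x ∂volume.restrict (Ioo 0 ℓ), h x ^ 2 ≤ O) :
    ∀ᵐ x ∂volume.restrict (Ioo 0 ℓ), (h + (volH ℓ k f + volH ℓ l g) : L2 ℓ) x ^ 2
      ≤ 3 * sSup ((fun x : ℝ => O + M * x * (∫ ξ in (0 : ℝ)..x, K x ξ ^ 2)
        + N * x * ∫ ξ in (0 : ℝ)..x, L x ξ ^ 2) '' Icc 0 ℓ) := by
  have hcongr : ∀ {k : C(ℝ × ℝ, ℝ)} {K : ℝ → ℝ → ℝ},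
      (∀ x ξ, 0 ≤ ξ → ξ ≤ x → x ≤ ℓ → k (x, ξ) = K x ξ) → ∀ x ∈ Icc 0 ℓ,
      ∫ ξ in (0 : ℝ)..x, K x ξ ^ 2 = ∫ ξ in (0 : ℝ)..x, k (x, ξ) ^ 2 := fun hk x hx => by
    refine intervalIntegral.integral_congr fun ξ hξ => ?_
    rw [uIcc_of_le hx.1] at hξ
    rw [hk x ξ hξ.1 hξ.2 hx.2]
  have hcont : ∀ k : C(ℝ × ℝ, ℝ), Continuous fun x : ℝ => ∫ ξ in (0 : ℝ)..x, k (x, ξ) ^ 2 := fun k =>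
    intervalIntegral.continuous_parametric_intervalIntegral_of_continuous
      (f := fun x ξ => k (x, ξ) ^ 2) (by fun_prop) continuous_id
  have hbdd : BddAbove ((fun x : ℝ => O + M * x * (∫ ξ in (0 : ℝ)..x, K x ξ ^ 2)
      + N * x * ∫ ξ in (0 : ℝ)..x, L x ξ ^ 2) '' Icc 0 ℓ) := by
    refine isCompact_Icc.bddAbove_image ?_
    have h1 := hcont k
    have h2 := hcont l
    refine ContinuousOn.congr (f := fun x : ℝ => O + M * x * (∫ ξ in (0 : ℝ)..x, k (x, ξ) ^ 2)
      + N * x * ∫ ξ in (0 : ℝ)..x, l (x, ξ) ^ 2) (by fun_prop) fun x hx => ?_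
    simp only
    rw [hcongr hk x hx, hcongr hl x hx]
  filter_upwards [hh, Lp.coeFn_add h (volH ℓ k f + volH ℓ l g),
    Lp.coeFn_add (volH ℓ k f) (volH ℓ l g), coeFn_volH k f, coeFn_volH l g,
    ae_restrict_mem measurableSet_Ioo] with x h1 h2 h3 h4 h5 h6
  have hx := Ioo_subset_Icc_self h6
  have h7 := volterra_sq_le k hf hx
  have h8 := volterra_sq_le l hg hx
  have h9 := le_csSup hbdd (mem_image_of_mem _ hx)
  rw [hcongr hk x hx, hcongr hl x hx] at h9
  rw [h2, Pi.add_apply, h3, Pi.add_apply, h4, h5]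
  nlinarith [sq_nonneg (h x - volterra k f x), sq_nonneg (h x - volterra l g x),
    sq_nonneg (volterra k f x - volterra l g x)]

end Bounds

/-! ### The observer error -/

section ErrorSol

variable {pl : Plant} {ker : Kernels}

/-- Continuous extensions of the observer gains. -/
def Extension.gain (X : Extension pl ker) (i : Fin 2) : C(ℝ, ℝ) := pl.lam₂ • colZero (X.MP i 1)

lemma Extension.gain_zero (X : Extension pl ker) {x : ℝ} (hx : x ∈ Icc 0 pl.ℓ) :
    X.gain 0 x = p₁ pl ker x := by
  show pl.lam₂ * X.MP 0 1 (x, 0) = -pl.lam₂ * ker.P.k₁₂ x 0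
  rw [X.P_eq 0 1 x 0 le_rfl hx.1 hx.2]
  show pl.lam₂ * -ker.P.k₁₂ x 0 = -pl.lam₂ * ker.P.k₁₂ x 0
  ring

lemma Extension.gain_one (X : Extension pl ker) {x : ℝ} (hx : x ∈ Icc 0 pl.ℓ) :
    X.gain 1 x = p₂ pl ker x := by
  show pl.lam₂ * X.MP 1 1 (x, 0) = -pl.lam₂ * ker.P.k₂₂ x 0
  rw [X.P_eq 1 1 x 0 le_rfl hx.1 hx.2]
  show pl.lam₂ * -ker.P.k₂₂ x 0 = -pl.lam₂ * ker.P.k₂₂ x 0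
  ring

/-- The observer error `(ũ, ṽ)` with initial value `e`. -/
structure IsErrorSol (X : Extension pl ker) (e : Fin 2 → L2 pl.ℓ) (w : Fin 2 → ℝ → L2 pl.ℓ)
    (w0 wL : Fin 2 → ℝ → ℝ) : Prop where
  sol : IsPairSol pl.ℓ pl.speed pl.coupling (fun i => -emb pl.ℓ (X.gain i)) (w0 1) w w0 wL
  init : ∀ i, w i 0 = e i
  bc0 : ∀ t > 0, w0 0 t = 0
  bcL : ∀ t > 0, wL 1 t = pl.ρ * wL 0 t
  eq_zero : ∀ t, pl.ℓ / pl.lam₁ + pl.ℓ / pl.lam₂ ≤ t → ∀ i, w i t = 0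
  trace_eq_zero : ∀ t, pl.ℓ / pl.lam₁ + pl.ℓ / pl.lam₂ ≤ t → w0 1 t = 0
  trace_bound : ∀ φu φv, 0 < φu → 0 < φv →
    (∀ᵐ x ∂volume.restrict (Ioo 0 pl.ℓ), e 0 x ^ 2 ≤ φu) →
    (∀ᵐ x ∂volume.restrict (Ioo 0 pl.ℓ), e 1 x ^ 2 ≤ φv) →
    ∀ᵐ t, w0 1 t ^ 2 ≤ max (pl.ρ ^ 2 * φα pl ker φu φv) (φβ pl ker φu φv)

lemma integral_sq_le_of_locL2 {B : ℝ → ℝ} (hB : MemLp B 2 volume) {a b : ℝ} (hab : a ≤ b) :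
    ∫ y in a..b, B y ^ 2 ≤ ∫ y, B y ^ 2 := by
  rw [intervalIntegral.integral_of_le hab]
  exact setIntegral_le_integral hB.integrable_sq (.of_forall fun _ => sq_nonneg _)

lemma exists_isErrorSol (X : Extension pl ker) (hker : ker.Solve pl) :
    ∃ c, 0 < c ∧ ∀ e : Fin 2 → L2 pl.ℓ, ∃ w w0 wL, IsErrorSol X e w w0 wL ∧
      (∀ t i, ‖w i t‖ ^ 2 ≤ c * (‖e 0‖ ^ 2 + ‖e 1‖ ^ 2)) ∧
      ∀ t, 0 ≤ t → ∫ s in (0 : ℝ)..t, w0 1 s ^ 2 ≤ c * (‖e 0‖ ^ 2 + ‖e 1‖ ^ 2) := by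
  have hℓ := pl.ℓ_pos
  have hk1 : -pl.lam₁⁻¹ ≠ 0 := neg_ne_zero.2 (inv_ne_zero pl.lam₁_pos.ne')
  have hk2 : pl.lam₂⁻¹ ≠ 0 := inv_ne_zero pl.lam₂_pos.ne'
  have hl1 : 0 < pl.lam₁⁻¹ := inv_pos.2 pl.lam₁_pos
  have hl2 : 0 < pl.lam₂⁻¹ := inv_pos.2 pl.lam₂_pos
  obtain ⟨cR, hcR, hR⟩ := exists_norm_transform_sq_le (ℓ := pl.ℓ) X.MR
  obtain ⟨cP, hcP, hP⟩ := exists_norm_transform_sq_le (ℓ := pl.ℓ) X.MP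
  set H := pl.ℓ / pl.lam₁ + pl.ℓ / pl.lam₂ with hH
  set D := 2 * pl.lam₂⁻¹ + 2 * pl.ρ ^ 2 * pl.lam₁⁻¹ with hD
  have hDpos : 0 < D := by positivity
  refine ⟨cP * ((1 + pl.lam₂ * D) * (2 * cR)) + D * (2 * cR), by have := pl.lam₂_pos; positivity,
    fun e => ?_⟩
  set α := transform pl.ℓ X.MR e with hα
  set E := ‖e 0‖ ^ 2 + ‖e 1‖ ^ 2 with hE
  have hE0 : 0 ≤ E := by positivity
  set A : ℝ → ℝ := history (-pl.lam₁⁻¹) (α 0) with hA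
  set B₀ : ℝ → ℝ := history pl.lam₂⁻¹ (α 1) with hB₀
  set B : ℝ → ℝ := fun t => B₀ t + pl.ρ * A (t + -H) with hB
  have hAz : ∀ t, 0 ≤ t ∨ t ≤ -(pl.ℓ / pl.lam₁) → A t = 0 := fun t ht =>
    history_eq_zero _ fun h => by
      rw [inv_neg, inv_inv] at h
      have e1 : pl.lam₁ * (pl.ℓ / pl.lam₁) = pl.ℓ := mul_div_cancel₀ _ pl.lam₁_pos.ne'
      rcases ht with ht | ht
      · nlinarith [h.1, pl.lam₁_pos]
      · nlinarith [h.2, pl.lam₁_pos]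
  have hBz : ∀ t, t ≤ 0 ∨ pl.ℓ / pl.lam₂ ≤ t → B₀ t = 0 := fun t ht =>
    history_eq_zero _ fun h => by
      rw [inv_inv] at h
      have e1 : pl.lam₂ * (pl.ℓ / pl.lam₂) = pl.ℓ := mul_div_cancel₀ _ pl.lam₂_pos.ne'
      rcases ht with ht | ht
      · nlinarith [h.1, pl.lam₂_pos]
      · nlinarith [h.2, pl.lam₂_pos]
  have hA2 : MemLp A 2 volume := memLp_history hk1 _
  have hAs2 : MemLp (fun t => A (t + -H)) 2 volume := by
    refine (memLp_comp_affine one_ne_zero (-H) hA2).ae_eq (.of_forall fun t => ?_)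
    simp only
    rw [one_mul, add_comm]
  have hB02 : MemLp B₀ 2 volume := memLp_history hk2 _
  have hB2 : MemLp B 2 volume := hB02.add (hAs2.const_mul _)
  have hAL : LocL2 A := locL2_history hk1 _
  have hBL : LocL2 B := (locL2_history hk2 _).add ((hAL.comp_add _).const_mul _)
  have hA1 : ∫ t, A t ^ 2 = pl.lam₁⁻¹ * ‖α 0‖ ^ 2 := by
    rw [hA, integral_history_sq, abs_neg, abs_of_pos hl1]
  have hBint : ∫ t, B t ^ 2 ≤ D * (‖α 0‖ ^ 2 + ‖α 1‖ ^ 2) := by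
    have h1 : ∫ t, B₀ t ^ 2 = pl.lam₂⁻¹ * ‖α 1‖ ^ 2 := by
      rw [hB₀, integral_history_sq, abs_of_pos hl2]
    have h2 : ∫ t, A (t + -H) ^ 2 = pl.lam₁⁻¹ * ‖α 0‖ ^ 2 := by
      rw [integral_add_right_eq_self (fun t => A t ^ 2), hA1]
    have i1 := hB02.integrable_sq.const_mul 2
    have i2 := hAs2.integrable_sq.const_mul (2 * pl.ρ ^ 2)
    have h3 : ∫ t, B t ^ 2 ≤ ∫ t, (2 * B₀ t ^ 2 + 2 * pl.ρ ^ 2 * A (t + -H) ^ 2) := by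
      refine integral_mono hB2.integrable_sq (i1.add i2) fun t => ?_
      simp only [hB]
      nlinarith [sq_nonneg (B₀ t - pl.ρ * A (t + -H))]
    rw [integral_add i1 i2, integral_const_mul, integral_const_mul, h1, h2] at h3
    refine h3.trans ?_
    have g1 : 0 ≤ pl.lam₂⁻¹ * ‖α 0‖ ^ 2 := by positivity
    have g2 : 0 ≤ pl.ρ ^ 2 * pl.lam₁⁻¹ * ‖α 1‖ ^ 2 := by positivity
    rw [hD]
    nlinarith
  have hαE : ‖α 0‖ ^ 2 + ‖α 1‖ ^ 2 ≤ 2 * cR * E := by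
    have h0 := hR e 0
    have h1 := hR e 1
    linarith
  have hBE : ∫ t, B t ^ 2 ≤ D * (2 * cR) * E := by
    rw [mul_assoc]
    exact hBint.trans (mul_le_mul_of_nonneg_left hαE hDpos.le)
  have hp := isPairSol_delayPair (pl := pl) hAL hBL
  have ev : ∀ r, (![A, B] : Fin 2 → ℝ → ℝ) 0 r = A r ∧ (![A, B] : Fin 2 → ℝ → ℝ) 1 r = B r :=
    fun r => ⟨rfl, rfl⟩
  have hs := hp.transform hℓ.le X.P_isTransform (p' := fun i => -emb pl.ℓ (X.gain i))
    (b' := B) hBL.isTrace fun i => by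
      filter_upwards [ae_restrict_mem measurableSet_Ioi] with r hr
      have hg : emb pl.ℓ (X.gain i) = pl.lam₂ • emb pl.ℓ (colZero (X.MP i 1)) := emb_smul _ _
      rw [Fin.sum_univ_two, (ev r).1, (ev r).2, hAz r (.inl (le_of_lt hr)), hg]
      simp only [zero_smul, mul_zero, zero_add, Plant.speed_one, smul_neg, smul_smul]
      rw [← neg_smul]
      congr 1
      ring
  have hdz : ∀ t, H ≤ t → ∀ i, delayPair pl A B i t = 0 := by
    intro t ht i
    have d1 : 0 < pl.ℓ / pl.lam₁ := div_pos hℓ pl.lam₁_pos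
    have d2 : 0 < pl.ℓ / pl.lam₂ := div_pos hℓ pl.lam₂_pos
    fin_cases i
    · refine delay_eq hk1 hAL ?_
      filter_upwards [ae_restrict_mem measurableSet_Ioo, Lp.coeFn_zero ℝ 2 (volume.restrict
        (Ioo 0 pl.ℓ))] with x hx h0
      rw [h0, hAz _ (.inl _)]
      · rfl
      · have := mul_lt_mul_of_pos_left hx.2 hl1
        have e1 : pl.lam₁⁻¹ * pl.ℓ = pl.ℓ / pl.lam₁ := by rw [div_eq_inv_mul]
        linarith
    · refine delay_eq hk2 hBL ?_
      filter_upwards [ae_restrict_mem measurableSet_Ioo, Lp.coeFn_zero ℝ 2 (volume.restrict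
        (Ioo 0 pl.ℓ))] with x hx h0
      have := mul_pos hl2 hx.1
      rw [h0]
      simp only [hB]
      rw [hBz _ (.inr (by linarith)), hAz _ (.inl (by linarith))]
      simp
  have hdn : ∀ t, ‖delayPair pl A B 0 t‖ ^ 2 + ‖delayPair pl A B 1 t‖ ^ 2
      ≤ (1 + pl.lam₂ * D) * (2 * cR) * E := by
    intro t
    have h0 : ‖delayPair pl A B 0 t‖ ^ 2 ≤ ‖α 0‖ ^ 2 := by
      show ‖delay pl.ℓ (-pl.lam₁⁻¹) A t‖ ^ 2 ≤ ‖α 0‖ ^ 2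
      rw [hAL.norm_delay_sq hℓ.le hk1, intervalIntegral.integral_symm, inv_neg, inv_inv]
      have h1 : t + -pl.lam₁⁻¹ * pl.ℓ ≤ t := by nlinarith
      have h2 := integral_sq_le_of_locL2 hA2 h1
      rw [hA1] at h2
      have h3 := mul_le_mul_of_nonneg_left h2 pl.lam₁_pos.le
      rw [mul_inv_cancel_left₀ pl.lam₁_pos.ne'] at h3
      linarith
    have h1 : ‖delayPair pl A B 1 t‖ ^ 2 ≤ pl.lam₂ * (D * (‖α 0‖ ^ 2 + ‖α 1‖ ^ 2)) := by
      show ‖delay pl.ℓ pl.lam₂⁻¹ B t‖ ^ 2 ≤ _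
      rw [hBL.norm_delay_sq hℓ.le hk2, inv_inv]
      have h1 : t ≤ t + pl.lam₂⁻¹ * pl.ℓ := by nlinarith
      exact mul_le_mul_of_nonneg_left ((integral_sq_le_of_locL2 hB2 h1).trans hBint)
        pl.lam₂_pos.le
    have h2 : 0 ≤ 1 + pl.lam₂ * D := by have := pl.lam₂_pos; positivity
    have h3 := mul_le_mul_of_nonneg_left hαE h2
    have h4 : 0 ≤ ‖α 1‖ ^ 2 := sq_nonneg _
    nlinarith
  refine ⟨_, ![A, B], _, ⟨hs, fun i => ?_, fun t ht => ?_, fun t ht => ?_, fun t ht i => ?_,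
    fun t ht => ?_, ?_⟩, fun t i => ?_, fun t ht => ?_⟩
  · have h1 : (fun j => delayPair pl A B j 0) = α := by
      funext j
      fin_cases j
      · refine delay_eq hk1 hAL ?_
        filter_upwards [ae_restrict_mem measurableSet_Ioo] with x hx
        rw [zero_add, hA, history_mul hk1 _ hx]
        rfl
      · refine delay_eq hk2 hBL ?_
        filter_upwards [ae_restrict_mem measurableSet_Ioo] with x hx
        have h1 := mul_lt_mul_of_pos_left hx.2 hl2
        have e1 : pl.lam₂⁻¹ * pl.ℓ = pl.ℓ / pl.lam₂ := by rw [div_eq_inv_mul]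
        simp only [hB]
        rw [zero_add, hAz _ (.inr (by linarith)), mul_zero, add_zero, hB₀, history_mul hk2 _ hx]
        rfl
    rw [h1, hα, transform_transform' hℓ (X.compKernel_R_P hker)]
  · exact hAz t (.inl (le_of_lt ht))
  · have h1 : emb pl.ℓ (rowEnd pl.ℓ (X.MP 1 0)) = pl.ρ • emb pl.ℓ (rowEnd pl.ℓ (X.MP 0 0)) := by
      rw [← emb_smul]
      exact emb_congr fun ξ hξ => X.P_row hker 0 hξ
    have h2 : emb pl.ℓ (rowEnd pl.ℓ (X.MP 1 1)) = pl.ρ • emb pl.ℓ (rowEnd pl.ℓ (X.MP 0 1)) := by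
      rw [← emb_smul]
      exact emb_congr fun ξ hξ => X.P_row hker 1 hξ
    have e1 : pl.lam₂⁻¹ * pl.ℓ = pl.ℓ / pl.lam₂ := by rw [div_eq_inv_mul]
    have e2 : -pl.lam₁⁻¹ * pl.ℓ = -(pl.ℓ / pl.lam₁) := by rw [div_eq_inv_mul]; ring
    have h3 : B (t + pl.lam₂⁻¹ * pl.ℓ) = pl.ρ * A (t + -pl.lam₁⁻¹ * pl.ℓ) := by
      simp only [hB]
      rw [hBz _ (.inr (by rw [e1]; linarith [ht])), zero_add, e1, e2, hH]
      congr 2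
      ring
    have ev' : ∀ r i, (![fun t => A (t + -pl.lam₁⁻¹ * pl.ℓ), fun t => B (t + pl.lam₂⁻¹ * pl.ℓ)] :
      Fin 2 → ℝ → ℝ) i r = (![A (r + -pl.lam₁⁻¹ * pl.ℓ), B (r + pl.lam₂⁻¹ * pl.ℓ)] : Fin 2 → ℝ) i :=
      fun r i => by fin_cases i <;> rfl
    rw [ev', ev']
    simp only [Fin.sum_univ_two, Matrix.cons_val_zero, Matrix.cons_val_one, h1, h2,
      inner_smul_right, h3]
    ring
  · simp [transform, hdz t ht]
  · have d1 : 0 < pl.ℓ / pl.lam₁ := div_pos hℓ pl.lam₁_pos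
    rw [(ev t).2]
    simp only [hB]
    rw [hBz _ (.inr (by linarith)), hAz _ (.inl (by linarith))]
    simp
  · intro φu φv hφu hφv he0 he1
    have bα : ∀ᵐ x ∂volume.restrict (Ioo 0 pl.ℓ), α 0 x ^ 2 ≤ φα pl ker φu φv := by
      have := sq_add_volterra_le_sSup (X.R_eq 0 0) (X.R_eq 0 1) he0 he1 he0
      have e : α 0 = e 0 + (volH pl.ℓ (X.MR 0 0) (e 0) + volH pl.ℓ (X.MR 0 1) (e 1)) := by
        simp only [hα, transform, Fin.sum_univ_two]
      rw [e]
      exact this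
    have bβ : ∀ᵐ x ∂volume.restrict (Ioo 0 pl.ℓ), α 1 x ^ 2 ≤ φβ pl ker φu φv := by
      have := sq_add_volterra_le_sSup (X.R_eq 1 0) (X.R_eq 1 1) he0 he1 he1
      have e : α 1 = e 1 + (volH pl.ℓ (X.MR 1 0) (e 0) + volH pl.ℓ (X.MR 1 1) (e 1)) := by
        simp only [hα, transform, Fin.sum_univ_two]
      rw [e]
      exact this
    have hne : (volume.restrict (Ioo 0 pl.ℓ)) ≠ 0 := by
      intro h0
      have := congrArg (fun μ => μ univ) h0
      simp at this
      linarith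
    have : (ae (volume.restrict (Ioo 0 pl.ℓ))).NeBot := ae_neBot.2 hne
    obtain ⟨xα, hxα⟩ := bα.exists
    obtain ⟨xβ, hxβ⟩ := bβ.exists
    have pα := (sq_nonneg _).trans hxα
    have pβ := (sq_nonneg _).trans hxβ
    have h1 := history_sq_le hk1 (α 0) pα bα
    have h1' := ae_comp_affine one_ne_zero (-H) h1
    have h2 := history_sq_le hk2 (α 1) pβ bβ
    filter_upwards [h1', h2] with t g1 g2
    rw [one_mul, add_comm] at g1
    show (B₀ t + pl.ρ * A (t + -H)) ^ 2 ≤ _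
    rcases le_or_gt (pl.ℓ / pl.lam₂) t with ht | ht
    · rw [hBz t (.inr ht), zero_add, mul_pow]
      exact (mul_le_mul_of_nonneg_left g1 (sq_nonneg _)).trans (le_max_left _ _)
    · rw [hAz (t + -H) (.inr (by linarith)), mul_zero, add_zero]
      exact g2.trans (le_max_right _ _)
  · refine (hP _ i).trans ?_
    have h1 := mul_le_mul_of_nonneg_left (hdn t) hcP.le
    have h2 : 0 ≤ D * (2 * cR) * E := by positivity
    linarith
  · have h1 := (integral_sq_le_of_locL2 hB2 ht).trans hBE
    have h2 : 0 ≤ cP * ((1 + pl.lam₂ * D) * (2 * cR)) * E := by have := pl.lam₂_pos; positivity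
    show ∫ s in (0 : ℝ)..t, B s ^ 2 ≤ _
    linarith

end ErrorSol

/-! ### Weak formulations -/

section Weak

variable {ℓ : ℝ}

lemma weak_integrals_eq (hℓ : 0 ≤ ℓ) {a : ℝ} {w F : ℝ → L2 ℓ} {w0 wL : ℝ → ℝ} {f : ℝ → ℝ → ℝ}
    (hF : ∀ s, 0 ≤ s → F s =ᵐ[volume.restrict (Ioo 0 ℓ)] f s) (φ φ' : C(ℝ, ℝ)) {t : ℝ}
    (ht : 0 ≤ t) :
    ∫ s in (0 : ℝ)..t, (a * (∫ x in (0 : ℝ)..ℓ, w s x * φ' x) + a * (w0 s * φ 0 - wL s * φ ℓ)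
        + ∫ x in (0 : ℝ)..ℓ, f s x * φ x)
      = ∫ s in (0 : ℝ)..t, (a * inner ℝ (w s) (emb ℓ φ') + a * (w0 s * φ 0 - wL s * φ ℓ)
        + inner ℝ (F s) (emb ℓ φ)) := by
  refine intervalIntegral.integral_congr fun s hs => ?_
  rw [uIcc_of_le ht] at hs
  rw [inner_emb hℓ, inner_emb hℓ]
  congr 1
  refine intervalIntegral_congr_ae hℓ ?_
  filter_upwards [hF s hs.1] with x hx
  rw [hx]

lemma isWeakTransport_iff (hℓ : 0 ≤ ℓ) {a : ℝ} {w F : ℝ → L2 ℓ} {w0 wL : ℝ → ℝ} {f : ℝ → ℝ → ℝ}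
    (hF : ∀ s, 0 ≤ s → F s =ᵐ[volume.restrict (Ioo 0 ℓ)] f s) :
    IsWeakTransport ℓ a w w0 wL f ↔ WeakTransport ℓ a w w0 wL F := by
  refine ⟨fun h φ φ' hφ t ht => ?_, fun h φ hφ t ht => ?_⟩
  · have hd : deriv φ = φ' := funext fun x => (hφ x).deriv
    have := h φ (contDiff_one_iff_deriv.2 ⟨fun x => (hφ x).differentiableAt, by
      rw [hd]; exact φ'.continuous⟩) t ht
    rw [hd, weak_integrals_eq hℓ hF φ φ' ht] at this
    rw [inner_emb hℓ, inner_emb hℓ, this]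
  · have hc := contDiff_one_iff_deriv.1 hφ
    have := h ⟨φ, hc.1.continuous⟩ ⟨deriv φ, hc.2⟩ (fun x => (hc.1 x).hasDerivAt) t ht
    rw [← weak_integrals_eq hℓ hF _ _ ht, inner_emb hℓ, inner_emb hℓ] at this
    exact this

lemma mulH_zero (w : L2 ℓ) : mulH ℓ 0 w = 0 := by
  have := mulH_const 0 w
  rw [zero_smul] at this
  exact this

end Weak

/-! ### The triggering quantities of an observer state -/

section Observer

variable {pl : Plant} {ker : Kernels}

/-- Riesz representatives of the control law. -/
def Extension.ctrl (X : Extension pl ker) (j : Fin 2) : C(ℝ, ℝ) :=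
  pl.ρ • rowEnd pl.ℓ (X.MK 0 j) - rowEnd pl.ℓ (X.MK 1 j)

/-- Riesz representatives of the control law in the backstepping variables. -/
def Extension.ctrlTarget (X : Extension pl ker) (j : Fin 2) : C(ℝ, ℝ) :=
  rowEnd pl.ℓ (X.ML 1 j) - pl.ρ • rowEnd pl.ℓ (X.ML 0 j)

lemma integral_mul_eq_inner {f : ℝ → ℝ} {φ : C(ℝ, ℝ)} (h : ∀ x ∈ Icc 0 pl.ℓ, f x = φ x)
    (w : L2 pl.ℓ) : ∫ ξ in (0 : ℝ)..pl.ℓ, f ξ * w ξ = inner ℝ w (emb pl.ℓ φ) := by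
  rw [inner_emb pl.ℓ_pos.le]
  refine intervalIntegral.integral_congr fun ξ hξ => ?_
  rw [uIcc_of_le pl.ℓ_pos.le] at hξ
  rw [h ξ hξ, mul_comm]

lemma Extension.control_eq (X : Extension pl ker) (w : Fin 2 → L2 pl.ℓ) :
    control pl ker (w 0) (w 1) = ∑ j, inner ℝ (w j) (emb pl.ℓ (X.ctrl j)) := by
  have h : ∀ j, ∀ ξ ∈ Icc 0 pl.ℓ, X.ctrl j ξ
      = ker.K.entry 1 j pl.ℓ ξ - pl.ρ * ker.K.entry 0 j pl.ℓ ξ := fun j ξ hξ => by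
    show pl.ρ * X.MK 0 j (pl.ℓ, ξ) - X.MK 1 j (pl.ℓ, ξ) = _
    rw [X.K_eq 0 j _ ξ hξ.1 hξ.2 le_rfl, X.K_eq 1 j _ ξ hξ.1 hξ.2 le_rfl]
    ring
  rw [control, integral_mul_eq_inner (f := Nu pl ker) (φ := X.ctrl 0) fun ξ hξ => (h 0 ξ hξ).symm,
    integral_mul_eq_inner (f := Nv pl ker) (φ := X.ctrl 1) fun ξ hξ => (h 1 ξ hξ).symm, Fin.sum_univ_two]

lemma Extension.control_eq_target (X : Extension pl ker) (hker : ker.Solve pl) (w : Fin 2 → L2 pl.ℓ) :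
    control pl ker (w 0) (w 1)
      = ∑ j, inner ℝ (transform pl.ℓ X.MK w j) (emb pl.ℓ (X.ctrlTarget j)) := by
  have h := fun i => inner_transform_rowEnd pl.ℓ_pos.le (X.compKernel_K_L hker)
    (transform pl.ℓ X.MK w) i
  have e : ∀ j, emb pl.ℓ (X.ctrl j) = pl.ρ • emb pl.ℓ (rowEnd pl.ℓ (X.MK 0 j))
    - emb pl.ℓ (rowEnd pl.ℓ (X.MK 1 j)) := fun _ => rfl
  have e' : ∀ j, emb pl.ℓ (X.ctrlTarget j) = emb pl.ℓ (rowEnd pl.ℓ (X.ML 1 j))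
    - pl.ρ • emb pl.ℓ (rowEnd pl.ℓ (X.ML 0 j)) := fun _ => rfl
  rw [transform_transform' pl.ℓ_pos (X.compKernel_K_L hker)] at h
  have h0 := h 0
  have h1 := h 1
  simp only [Fin.sum_univ_two] at h0 h1
  rw [X.control_eq]
  simp only [Fin.sum_univ_two, e, e', inner_sub_right, inner_smul_right]
  linear_combination pl.ρ * h0 - h1

lemma volterra_eq_neg {k : ℝ → ℝ → ℝ} {l : C(ℝ × ℝ, ℝ)}
    (h : ∀ x ξ, 0 ≤ ξ → ξ ≤ x → x ≤ pl.ℓ → l (x, ξ) = -k x ξ) {x : ℝ} (hx : x ∈ Icc 0 pl.ℓ)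
    (w : ℝ → ℝ) : ∫ ξ in (0 : ℝ)..x, k x ξ * w ξ = -volterra l w x := by
  rw [volterra, ← intervalIntegral.integral_neg]
  refine intervalIntegral.integral_congr fun ξ hξ => ?_
  rw [uIcc_of_le hx.1] at hξ
  rw [h x ξ hξ.1 hξ.2 hx.2]
  ring

lemma coeFn_transform {ℓ : ℝ} (M : Fin 2 → Fin 2 → C(ℝ × ℝ, ℝ)) (w : Fin 2 → L2 ℓ) (i : Fin 2) :
    ∀ᵐ x ∂volume.restrict (Ioo 0 ℓ),
      transform ℓ M w i x = w i x + (volterra (M i 0) (w 0) x + volterra (M i 1) (w 1) x) := by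
  simp only [transform, Fin.sum_univ_two]
  filter_upwards [Lp.coeFn_add (w i) (volH ℓ (M i 0) (w 0) + volH ℓ (M i 1) (w 1)),
    Lp.coeFn_add (volH ℓ (M i 0) (w 0)) (volH ℓ (M i 1) (w 1)), coeFn_volH (M i 0) (w 0),
    coeFn_volH (M i 1) (w 1)] with x h1 h2 h3 h4
  rw [h1, Pi.add_apply, h2, Pi.add_apply, h3, h4]

lemma Extension.coeFn_target_zero (X : Extension pl ker) (w : Fin 2 → L2 pl.ℓ) :
    ∀ᵐ x ∂volume.restrict (Ioo 0 pl.ℓ),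
      αh pl ker (w 0) (w 1) x = transform pl.ℓ X.MK w 0 x := by
  filter_upwards [coeFn_transform X.MK w 0, ae_restrict_mem measurableSet_Ioo] with x h1 h2
  rw [h1, αh, volterra_eq_neg (k := ker.K.k₁₁) (X.K_eq 0 0) (Ioo_subset_Icc_self h2),
    volterra_eq_neg (k := ker.K.k₁₂) (X.K_eq 0 1) (Ioo_subset_Icc_self h2)]
  ring

lemma Extension.coeFn_target_one (X : Extension pl ker) (w : Fin 2 → L2 pl.ℓ) :
    ∀ᵐ x ∂volume.restrict (Ioo 0 pl.ℓ),
      βh pl ker (w 0) (w 1) x = transform pl.ℓ X.MK w 1 x := by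
  filter_upwards [coeFn_transform X.MK w 1, ae_restrict_mem measurableSet_Ioo] with x h1 h2
  rw [h1, βh, volterra_eq_neg (k := ker.K.k₂₁) (X.K_eq 1 0) (Ioo_subset_Icc_self h2),
    volterra_eq_neg (k := ker.K.k₂₂) (X.K_eq 1 1) (Ioo_subset_Icc_self h2)]
  ring

lemma Extension.targetNormSq_eq (X : Extension pl ker) (w : Fin 2 → L2 pl.ℓ) :
    targetNormSq pl ker (w 0) (w 1)
      = ‖transform pl.ℓ X.MK w 0‖ ^ 2 + ‖transform pl.ℓ X.MK w 1‖ ^ 2 := by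
  rw [targetNormSq, norm_sq_eq_integral pl.ℓ_pos.le, norm_sq_eq_integral pl.ℓ_pos.le]
  congr 1
  · refine intervalIntegral_congr_ae pl.ℓ_pos.le ?_
    filter_upwards [X.coeFn_target_zero w] with x hx
    rw [hx]
  · refine intervalIntegral_congr_ae pl.ℓ_pos.le ?_
    filter_upwards [X.coeFn_target_one w] with x hx
    rw [hx]

lemma Extension.αhEnd_eq (X : Extension pl ker) (w : Fin 2 → L2 pl.ℓ) (y : ℝ) :
    αhEnd pl ker (w 0) (w 1) y
      = y + ∑ j, inner ℝ (w j) (emb pl.ℓ (rowEnd pl.ℓ (X.MK 0 j))) := by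
  have h : ∀ j, inner ℝ (w j) (emb pl.ℓ (rowEnd pl.ℓ (X.MK 0 j)))
      = volterra (X.MK 0 j) (w j) pl.ℓ := fun j => by
    rw [inner_emb pl.ℓ_pos.le]
    refine intervalIntegral.integral_congr fun ξ _ => ?_
    exact mul_comm _ _
  have hm : pl.ℓ ∈ Icc 0 pl.ℓ := right_mem_Icc.2 pl.ℓ_pos.le
  rw [αhEnd, volterra_eq_neg (k := ker.K.k₁₁) (X.K_eq 0 0) hm,
    volterra_eq_neg (k := ker.K.k₁₂) (X.K_eq 0 1) hm, Fin.sum_univ_two, h, h]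
  ring

/-- The forcing of the dynamic variable, for an input value `U`, an observer state `w`, and
boundary values `y = û(ℓ)` and `b = ṽ(0)`. -/
def mRate (pl : Plant) (ker : Kernels) (ds : Design) (U : ℝ) (w : Fin 2 → L2 pl.ℓ) (y b : ℝ) : ℝ :=
  θm pl ds * (U - control pl ker (w 0) (w 1)) ^ 2 - κ₀ pl ker ds * targetNormSq pl ker (w 0) (w 1)
    - κ₁ pl ker ds * αhEnd pl ker (w 0) (w 1) y ^ 2 - κ₂ pl ker ds * b ^ 2

lemma Extension.continuousOn_control (X : Extension pl ker) {w : Fin 2 → ℝ → L2 pl.ℓ}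
    (hw : ∀ i, ContinuousOn (w i) (Ici 0)) :
    ContinuousOn (fun t => control pl ker (w 0 t) (w 1 t)) (Ici 0) := by
  have : (fun t => control pl ker (w 0 t) (w 1 t))
      = fun t => ∑ j, inner ℝ (w j t) (emb pl.ℓ (X.ctrl j)) :=
    funext fun t => X.control_eq fun i => w i t
  rw [this]
  exact continuousOn_finsetSum _ fun j _ => (hw j).inner continuousOn_const

lemma Extension.continuousOn_targetNormSq (X : Extension pl ker) {w : Fin 2 → ℝ → L2 pl.ℓ}
    (hw : ∀ i, ContinuousOn (w i) (Ici 0)) :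
    ContinuousOn (fun t => targetNormSq pl ker (w 0 t) (w 1 t)) (Ici 0) := by
  have : (fun t => targetNormSq pl ker (w 0 t) (w 1 t))
      = fun t => ‖transform pl.ℓ X.MK (fun i => w i t) 0‖ ^ 2
        + ‖transform pl.ℓ X.MK (fun i => w i t) 1‖ ^ 2 :=
    funext fun t => X.targetNormSq_eq fun i => w i t
  rw [this]
  exact ((continuousOn_transform X.MK hw 0).norm.pow 2).add
    ((continuousOn_transform X.MK hw 1).norm.pow 2)

lemma Extension.isTrace_αhEnd (X : Extension pl ker) {w : Fin 2 → ℝ → L2 pl.ℓ} {y : ℝ → ℝ}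
    (hw : ∀ i, ContinuousOn (w i) (Ici 0)) (hy : IsTrace y) :
    IsTrace fun t => αhEnd pl ker (w 0 t) (w 1 t) (y t) := by
  have : (fun t => αhEnd pl ker (w 0 t) (w 1 t) (y t))
      = fun t => y t + ∑ j, inner ℝ (w j t) (emb pl.ℓ (rowEnd pl.ℓ (X.MK 0 j))) :=
    funext fun t => X.αhEnd_eq (fun i => w i t) (y t)
  rw [this]
  exact hy.add (IsTrace.of_continuousOn
    (continuousOn_finsetSum _ fun j _ => (hw j).inner continuousOn_const))

lemma Extension.intervalIntegrable_mRate (X : Extension pl ker) (ds : Design)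
    {w : Fin 2 → ℝ → L2 pl.ℓ} {g y b : ℝ → ℝ}
    (hw : ∀ i, ContinuousOn (w i) (Ici 0)) (hg : IsTrace g) (hy : IsTrace y) (hb : IsTrace b)
    {s t : ℝ} (hs : 0 ≤ s) (ht : 0 ≤ t) :
    IntervalIntegrable (fun r => mRate pl ker ds (g r) (fun i => w i r) (y r) (b r)) volume s t := by
  have h1 : IsTrace fun t => g t - control pl ker (w 0 t) (w 1 t) :=
    hg.sub (IsTrace.of_continuousOn (X.continuousOn_control hw))
  exact ((((h1.sq_intervalIntegrable hs ht).const_mul _).sub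
    ((ContinuousOn.intervalIntegrable_Ici (X.continuousOn_targetNormSq hw) hs ht).const_mul _)).sub
    (((X.isTrace_αhEnd hw hy).sq_intervalIntegrable hs ht).const_mul _)).sub
    ((hb.sq_intervalIntegrable hs ht).const_mul _)

end Observer

/-! ### Positivity of the design constants -/

section Constants

variable {pl : Plant} {ker : Kernels} {ds : Design}

lemma ε₀_nonneg : 0 ≤ ε₀ pl ker :=
  mul_nonneg (by norm_num) (le_max_of_le_left (mul_nonneg (sq_nonneg _)
    (intervalIntegral.integral_nonneg pl.ℓ_pos.le fun _ _ => sq_nonneg _)))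

lemma ε₁_nonneg : 0 ≤ ε₁ pl ker := mul_nonneg (by norm_num) (sq_nonneg _)

lemma ε₂_nonneg : 0 ≤ ε₂ pl ker := mul_nonneg (by norm_num) (sq_nonneg _)

lemma ε₃_nonneg : 0 ≤ ε₃ pl ker := mul_nonneg (by norm_num) (sq_nonneg _)

lemma rConst_pos : 0 < rConst pl ds := by
  have := pl.lam₁_pos
  have := pl.lam₂_pos
  have := pl.q_ne
  exact lt_min (by positivity) (by positivity)

lemma aConst_pos (h : ds.Admissible pl ker) : 0 < aConst pl ker ds := by
  have := ε₃_nonneg (pl := pl) (ker := ker)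
  have := h.η_pos
  unfold aConst
  linarith

lemma κ₀_nonneg (h : ds.Admissible pl ker) : 0 ≤ κ₀ pl ker ds :=
  div_nonneg (mul_nonneg h.θ_pos.le ε₀_nonneg) (sub_nonneg.2 h.σ_lt.le)

lemma κ₁_nonneg (h : ds.Admissible pl ker) : 0 ≤ κ₁ pl ker ds :=
  div_nonneg (mul_nonneg h.θ_pos.le ε₁_nonneg) (sub_nonneg.2 h.σ_lt.le)

lemma κ₂_nonneg (h : ds.Admissible pl ker) : 0 ≤ κ₂ pl ker ds :=
  div_nonneg (mul_nonneg h.θ_pos.le ε₂_nonneg) (sub_nonneg.2 h.σ_lt.le)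

lemma Design.Admissible.C_pos (h : ds.Admissible pl ker) : 0 < ds.C :=
  (div_nonneg (κ₀_nonneg h) (mul_nonneg (sub_nonneg.2 h.δ_lt.le) rConst_pos.le)).trans_lt h.C_gt₀

lemma θm_pos (h : ds.Admissible pl ker) : 0 < θm pl ds := by
  have := h.C_pos
  have := pl.q_ne
  unfold θm
  positivity

lemma τ_pos (h : ds.Admissible pl ker) : 0 < τ pl ker ds := by
  have h1 := aConst_pos h
  have h2 := θm_pos h
  have h3 := h.θ_pos
  have h4 := h.σ_pos
  have h5 := sub_pos.2 h.σ_lt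
  exact mul_pos (one_div_pos.2 h1) (Real.log_pos (lt_add_of_pos_right _ (by positivity)))

lemma τ_le_waiting {φu φv t : ℝ} {uh vh : L2 pl.ℓ} {m : ℝ} :
    τ pl ker ds ≤ waiting pl ker ds φu φv t uh vh m := by
  unfold waiting
  split_ifs
  · exact le_rfl
  · exact le_max_left _ _

end Constants

/-! ### Event times -/

section Times

variable {t : ℕ → ℝ} {c : ℝ}

lemma times_ge (hc : ∀ k, t k + c ≤ t (k + 1)) (h0 : t 0 = 0) (k : ℕ) : k * c ≤ t k := by
  induction k with
  | zero => simp [h0]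
  | succ k ih =>
    push_cast
    linarith [hc k]

lemma times_mono (h : 0 < c) (hc : ∀ k, t k + c ≤ t (k + 1)) : StrictMono t :=
  strictMono_nat_of_lt_succ fun k => by linarith [hc k]

lemma times_nonneg (h : 0 < c) (hc : ∀ k, t k + c ≤ t (k + 1)) (h0 : t 0 = 0) (k : ℕ) : 0 ≤ t k :=
  (by positivity : (0 : ℝ) ≤ k * c).trans (times_ge hc h0 k)

lemma exists_lt_times (h : 0 < c) (hc : ∀ k, t k + c ≤ t (k + 1)) (h0 : t 0 = 0) (s : ℝ) :
    ∃ k, s < t k := by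
  obtain ⟨k, hk⟩ := exists_nat_gt (s / c)
  exact ⟨k, ((div_lt_iff₀ h).1 hk).trans_le (times_ge hc h0 k)⟩

lemma exists_mem_Ico_times (h : 0 < c) (hc : ∀ k, t k + c ≤ t (k + 1)) (h0 : t 0 = 0) {s : ℝ}
    (hs : 0 ≤ s) : ∃ k, s ∈ Ico (t k) (t (k + 1)) := by
  classical
  have hex := exists_lt_times h hc h0 s
  obtain ⟨k, hk⟩ : ∃ k, Nat.find hex = k + 1 := Nat.exists_eq_succ_of_ne_zero fun h1 => by
    have := Nat.find_spec hex
    rw [h1, h0] at this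
    linarith
  refine ⟨k, not_lt.1 (Nat.find_min hex (by omega)), ?_⟩
  rw [← hk]
  exact Nat.find_spec hex

lemma ae_Ioi_of_ae_Ico (h : 0 < c) (hc : ∀ k, t k + c ≤ t (k + 1)) (h0 : t 0 = 0)
    {P : ℝ → Prop} (hP : ∀ k, ∀ᵐ r ∂volume.restrict (Ico (t k) (t (k + 1))), P r) :
    ∀ᵐ r ∂volume.restrict (Ioi (0 : ℝ)), P r := by
  rw [ae_restrict_iff' measurableSet_Ioi]
  have := ae_all_iff.2 fun k => (ae_restrict_iff' measurableSet_Ico).1 (hP k)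
  filter_upwards [this] with r hr hr0
  obtain ⟨k, hk⟩ := exists_mem_Ico_times h hc h0 (le_of_lt hr0)
  exact hr k hk

lemma exists_held (ht : StrictMono t) (U : ℕ → ℝ) :
    ∃ g : ℝ → ℝ, ∀ k, ∀ s ∈ Ico (t k) (t (k + 1)), g s = U k := by
  have : ∀ s, ∃ y, ∀ k, s ∈ Ico (t k) (t (k + 1)) → y = U k := fun s => by
    by_cases h : ∃ k, s ∈ Ico (t k) (t (k + 1))
    · obtain ⟨k, hk⟩ := h
      refine ⟨U k, fun j hj => ?_⟩
      have h1 := ht.lt_iff_lt.1 (hk.1.trans_lt hj.2)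
      have h2 := ht.lt_iff_lt.1 (hj.1.trans_lt hk.2)
      rw [show k = j by omega]
    · exact ⟨0, fun k hk => absurd ⟨k, hk⟩ h⟩
  choose g hg using this
  exact ⟨g, fun k s hs => hg s k hs⟩

end Times

/-! ### The closed loop in plant and error coordinates -/

section Loop

variable {pl : Plant} {ker : Kernels}

/-- The plant state, the observer error, their traces, the held input, the dynamic variable and the
event times. -/
structure Loop (ℓ : ℝ) where
  w : Fin 2 → ℝ → L2 ℓ
  w0 : Fin 2 → ℝ → ℝ
  wL : Fin 2 → ℝ → ℝ
  e : Fin 2 → ℝ → L2 ℓ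
  e0 : Fin 2 → ℝ → ℝ
  eL : Fin 2 → ℝ → ℝ
  g : ℝ → ℝ
  m : ℝ → ℝ
  t : ℕ → ℝ

/-- The observer state. -/
def Loop.obs {ℓ : ℝ} (D : Loop ℓ) (i : Fin 2) (s : ℝ) : L2 ℓ := D.w i s - D.e i s

/-- The control law along the observer state. -/
def Loop.control (pl : Plant) (ker : Kernels) (D : Loop pl.ℓ) (s : ℝ) : ℝ :=
  STC.control pl ker (D.obs 0 s) (D.obs 1 s)

/-- `D` is a solution of the closed loop. -/
structure IsLoop (X : Extension pl ker) (ds : Design) (φu φv : ℝ) (ini : InitialData pl.ℓ)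
    (D : Loop pl.ℓ) : Prop where
  plant : IsPlantSol pl D.g ![ini.u, ini.v] D.w D.w0 D.wL
  err : IsPairSol pl.ℓ pl.speed pl.coupling (fun i => -emb pl.ℓ (X.gain i)) (D.e0 1) D.e D.e0 D.eL
  err_init : ∀ i, D.e i 0 = ![ini.u - ini.uh, ini.v - ini.vh] i
  err_bc0 : ∀ᵐ s ∂volume.restrict (Ioi (0 : ℝ)), D.e0 0 s = 0
  err_bcL : ∀ᵐ s ∂volume.restrict (Ioi (0 : ℝ)), D.eL 1 s = pl.ρ * D.eL 0 s
  m_cont : ContinuousOn D.m (Ici 0)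
  m_init : D.m 0 = ini.m
  held : ∀ k, ∀ s ∈ Ico (D.t k) (D.t (k + 1)), D.g s = D.control pl ker (D.t k)
  m_eq : ∀ k, ∀ s ∈ Icc (D.t k) (D.t (k + 1)), D.m s = D.m (D.t k) + ∫ r in (D.t k)..s,
    (-ds.η * D.m r + mRate pl ker ds (D.control pl ker (D.t k)) (fun i => D.obs i r)
      (D.wL 0 r - D.eL 0 r) (D.e0 1 r))
  t_zero : D.t 0 = 0
  t_succ : ∀ k, D.t (k + 1) = D.t k +
    waiting pl ker ds φu φv (D.t k) (D.obs 0 (D.t k)) (D.obs 1 (D.t k)) (D.m (D.t k))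

lemma coeFn_source_zero (p : L2 pl.ℓ) (b : ℝ) (w : Fin 2 → L2 pl.ℓ) :
    ∀ᵐ x ∂volume.restrict (Ioo 0 pl.ℓ), (∑ j, mulH pl.ℓ (pl.coupling 0 j) (w j) + b • p : L2 pl.ℓ) x
      = pl.c₁ x * w 1 x + b * p x := by
  rw [Fin.sum_univ_two, Plant.coupling_zero_zero, mulH_zero, zero_add]
  filter_upwards [Lp.coeFn_add (mulH pl.ℓ (pl.coupling 0 1) (w 1)) (b • p), Lp.coeFn_smul b p,
    coeFn_mulH (pl.coupling 0 1) (w 1), ae_restrict_mem measurableSet_Ioo] with x h1 h2 h3 h4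
  rw [h1, Pi.add_apply, h2, h3, pl.coupling_zero_one (Ioo_subset_Icc_self h4)]
  rfl

lemma coeFn_source_one (p : L2 pl.ℓ) (b : ℝ) (w : Fin 2 → L2 pl.ℓ) :
    ∀ᵐ x ∂volume.restrict (Ioo 0 pl.ℓ), (∑ j, mulH pl.ℓ (pl.coupling 1 j) (w j) + b • p : L2 pl.ℓ) x
      = pl.c₂ x * w 0 x + b * p x := by
  rw [Fin.sum_univ_two, Plant.coupling_one_one, mulH_zero, add_zero]
  filter_upwards [Lp.coeFn_add (mulH pl.ℓ (pl.coupling 1 0) (w 0)) (b • p), Lp.coeFn_smul b p,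
    coeFn_mulH (pl.coupling 1 0) (w 0), ae_restrict_mem measurableSet_Ioo] with x h1 h2 h3 h4
  rw [h1, Pi.add_apply, h2, h3, pl.coupling_one_zero (Ioo_subset_Icc_self h4)]
  rfl

lemma isPairSol_iff {p : Fin 2 → L2 pl.ℓ} {b : ℝ → ℝ} {w : Fin 2 → ℝ → L2 pl.ℓ}
    {w0 wL : Fin 2 → ℝ → ℝ} {f : Fin 2 → ℝ → ℝ → ℝ} (hw : ∀ i, ContinuousOn (w i) (Ici 0))
    (hb : IsTrace b) (h0 : ∀ i, IsTrace (w0 i)) (hL : ∀ i, IsTrace (wL i))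
    (hf0 : ∀ s, ∀ᵐ x ∂volume.restrict (Ioo 0 pl.ℓ), f 0 s x = pl.c₁ x * w 1 s x + b s * p 0 x)
    (hf1 : ∀ s, ∀ᵐ x ∂volume.restrict (Ioo 0 pl.ℓ), f 1 s x = pl.c₂ x * w 0 s x + b s * p 1 x) :
    IsPairSol pl.ℓ pl.speed pl.coupling p b w w0 wL ↔
      IsWeakTransport pl.ℓ pl.lam₁ (w 0) (w0 0) (wL 0) (f 0) ∧
      IsWeakTransport pl.ℓ (-pl.lam₂) (w 1) (w0 1) (wL 1) (f 1) := by
  have e0 := isWeakTransport_iff pl.ℓ_pos.le (a := pl.lam₁) (w := w 0) (w0 := w0 0) (wL := wL 0)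
    (f := f 0) (F := fun t => ∑ j, mulH pl.ℓ (pl.coupling 0 j) (w j t) + b t • p 0) fun s _ => by
      filter_upwards [hf0 s, coeFn_source_zero (p 0) (b s) fun i => w i s] with x h1 h2
      rw [h1, h2]
  have e1 := isWeakTransport_iff pl.ℓ_pos.le (a := -pl.lam₂) (w := w 1) (w0 := w0 1) (wL := wL 1)
    (f := f 1) (F := fun t => ∑ j, mulH pl.ℓ (pl.coupling 1 j) (w j t) + b t • p 1) fun s _ => by
      filter_upwards [hf1 s, coeFn_source_one (p 1) (b s) fun i => w i s] with x h1 h2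
      rw [h1, h2]
  rw [e0, e1]
  refine ⟨fun h => ⟨h.eq 0, h.eq 1⟩, fun h => ⟨hw, hb, h0, hL, fun i => ?_⟩⟩
  fin_cases i
  exacts [h.1, h.2]

variable {X : Extension pl ker} {ds : Design} {φu φv : ℝ} {ini : InitialData pl.ℓ} {D : Loop pl.ℓ}

lemma coeFn_gain_zero (X : Extension pl ker) :
    ∀ᵐ x ∂volume.restrict (Ioo 0 pl.ℓ), emb pl.ℓ (X.gain 0) x = p₁ pl ker x := by
  filter_upwards [coeFn_emb (X.gain 0), ae_restrict_mem measurableSet_Ioo] with x h1 h2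
  rw [h1, X.gain_zero (Ioo_subset_Icc_self h2)]

lemma coeFn_gain_one (X : Extension pl ker) :
    ∀ᵐ x ∂volume.restrict (Ioo 0 pl.ℓ), emb pl.ℓ (X.gain 1) x = p₂ pl ker x := by
  filter_upwards [coeFn_emb (X.gain 1), ae_restrict_mem measurableSet_Ioo] with x h1 h2
  rw [h1, X.gain_one (Ioo_subset_Icc_self h2)]

namespace IsLoop

lemma observer (h : IsLoop X ds φu φv ini D) :
    IsPairSol pl.ℓ pl.speed pl.coupling (fun i => emb pl.ℓ (X.gain i)) (D.e0 1) D.obs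
      (fun i s => D.w0 i s - D.e0 i s) (fun i s => D.wL i s - D.eL i s) := by
  have h1 := h.plant.sol.congr_source (b' := fun _ => 0) (p' := fun i => emb pl.ℓ (X.gain i))
    (isTrace_const 0) fun i => .of_forall fun r => by simp
  have h2 := h.err.congr_source (b' := fun s => -1 * D.e0 1 s)
    (p' := fun i => emb pl.ℓ (X.gain i)) ((h.err.trace0 1).const_mul _)
    fun i => .of_forall fun r => by simp
  exact (h1.sub h2).congr_source (h.err.trace0 1) fun i => .of_forall fun r => by simp

lemma τ_le (h : IsLoop X ds φu φv ini D) (k : ℕ) : D.t k + τ pl ker ds ≤ D.t (k + 1) := by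
  rw [h.t_succ]
  exact add_le_add_right τ_le_waiting _

end IsLoop

/-- The signals of the closed loop. -/
def Loop.signals {ℓ : ℝ} (D : Loop ℓ) : Signals ℓ where
  u := D.w 0
  v := D.w 1
  uh := D.obs 0
  vh := D.obs 1
  uAt0 := D.w0 0
  uAtL := D.wL 0
  vAt0 := D.w0 1
  vAtL := D.wL 1
  uhAt0 s := D.w0 0 s - D.e0 0 s
  uhAtL s := D.wL 0 s - D.eL 0 s
  vhAt0 s := D.w0 1 s - D.e0 1 s
  vhAtL s := D.wL 1 s - D.eL 1 s
  m := D.m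
  t := D.t

lemma IsLoop.isClosedLoop (hds : ds.Admissible pl ker) (h : IsLoop X ds φu φv ini D) :
    IsClosedLoop pl ker ds φu φv ini D.signals := by
  have ho := h.observer
  have hp := (isPairSol_iff (f := ![fun s x => pl.c₁ x * D.w 1 s x, fun s x => pl.c₂ x * D.w 0 s x])
    h.plant.sol.cont h.plant.sol.source h.plant.sol.trace0 h.plant.sol.traceL
    (fun s => .of_forall fun x => by simp) (fun s => .of_forall fun x => by simp)).1 h.plant.sol
  have ho' := (isPairSol_iff (f := ![fun s x => pl.c₁ x * D.obs 1 s x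
      + p₁ pl ker x * (D.w0 1 s - (D.w0 1 s - D.e0 1 s)),
      fun s x => pl.c₂ x * D.obs 0 s x + p₂ pl ker x * (D.w0 1 s - (D.w0 1 s - D.e0 1 s))])
    ho.cont ho.source ho.trace0 ho.traceL
    (fun s => by
      filter_upwards [coeFn_gain_zero X] with x hx
      rw [hx]
      simp only [Matrix.cons_val_zero, sub_sub_cancel]
      ring)
    (fun s => by
      filter_upwards [coeFn_gain_one X] with x hx
      rw [hx]
      simp only [Matrix.cons_val_one, Matrix.cons_val_zero, sub_sub_cancel]
      ring)).1 ho
  have hI : ∀ k, Ico (D.t k) (D.t (k + 1)) ⊆ insert 0 (Ioi (0 : ℝ)) := fun k s hs => by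
    have := (times_nonneg (τ_pos hds) h.τ_le h.t_zero k).trans hs.1
    rcases this.eq_or_lt with h0 | h0
    exacts [.inl h0.symm, .inr h0]
  have hae : ∀ {P : ℝ → Prop}, (∀ᵐ s ∂volume.restrict (Ioi (0 : ℝ)), P s) → ∀ k,
      ∀ᵐ s ∂volume.restrict (Ico (D.t k) (D.t (k + 1))), P s := fun hP k =>
    ae_restrict_of_ae_restrict_of_subset (hI k) (by
      rw [Ioi_insert, ← restrict_Ioi_eq_restrict_Ici]
      exact hP)
  constructor
  case u_cont => exact h.plant.sol.cont 0
  case v_cont => exact h.plant.sol.cont 1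
  case uh_cont => exact ho.cont 0
  case vh_cont => exact ho.cont 1
  case m_cont => exact h.m_cont
  case u_init => exact h.plant.init 0
  case v_init => exact h.plant.init 1
  case uh_init =>
    show D.w 0 0 - D.e 0 0 = _
    rw [h.plant.init, h.err_init]
    exact sub_sub_cancel _ _
  case vh_init =>
    show D.w 1 0 - D.e 1 0 = _
    rw [h.plant.init, h.err_init]
    exact sub_sub_cancel _ _
  case m_init => exact h.m_init
  case uAt0_trace => exact h.plant.sol.trace0 0
  case uAtL_trace => exact h.plant.sol.traceL 0
  case vAt0_trace => exact h.plant.sol.trace0 1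
  case vAtL_trace => exact h.plant.sol.traceL 1
  case uhAt0_trace => exact ho.trace0 0
  case uhAtL_trace => exact ho.traceL 0
  case vhAt0_trace => exact ho.trace0 1
  case vhAtL_trace => exact ho.traceL 1
  case u_eq => exact hp.1
  case v_eq => exact hp.2
  case uh_eq => exact ho'.1
  case vh_eq => exact ho'.2
  case bc_u => exact h.plant.bc0
  case bc_uh =>
    filter_upwards [h.plant.bc0, h.err_bc0] with s h1 h2
    show D.w0 0 s - D.e0 0 s = _
    rw [h1, h2, sub_zero]
    rfl
  case bc_v =>
    intro k
    filter_upwards [hae h.plant.bcL k, ae_restrict_mem measurableSet_Ico] with s h1 h2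
    rw [h.held k s h2] at h1
    exact h1
  case bc_vh =>
    intro k
    filter_upwards [hae h.plant.bcL k, hae h.err_bcL k, ae_restrict_mem measurableSet_Ico]
      with s h1 h2 h3
    rw [h.held k s h3] at h1
    show D.wL 1 s - D.eL 1 s = pl.ρ * (D.wL 0 s - D.eL 0 s) + D.control pl ker (D.t k)
    rw [h1, h2]
    ring
  case m_eq =>
    intro k s hs
    refine (h.m_eq k s hs).trans ?_
    congr 1
    refine intervalIntegral.integral_congr fun r _ => ?_
    simp only [mRate, Loop.signals, Loop.control, sub_sub_cancel]
    ring
  case t_zero => exact h.t_zero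
  case t_succ => exact h.t_succ

lemma IsClosedLoop.exists_isLoop (X : Extension pl ker) (hds : ds.Admissible pl ker)
    {S : Signals pl.ℓ} (h : IsClosedLoop pl ker ds φu φv ini S) :
    ∃ D : Loop pl.ℓ, IsLoop X ds φu φv ini D ∧ D.w = ![S.u, S.v] ∧
      D.obs = ![S.uh, S.vh] ∧ D.m = S.m ∧ D.t = S.t := by
  have hτ : ∀ k, S.t k + τ pl ker ds ≤ S.t (k + 1) := fun k => by
    rw [h.t_succ]
    exact add_le_add_right τ_le_waiting _
  obtain ⟨g, hg⟩ := exists_held (times_mono (τ_pos hds) hτ)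
    fun k => control pl ker (S.uh (S.t k)) (S.vh (S.t k))
  have hp : IsPairSol pl.ℓ pl.speed pl.coupling 0 (fun _ => 0) ![S.u, S.v] ![S.uAt0, S.vAt0]
      ![S.uAtL, S.vAtL] := by
    refine (isPairSol_iff (f := ![fun s x => pl.c₁ x * S.v s x, fun s x => pl.c₂ x * S.u s x])
      (fun i => ?_) (isTrace_const 0) (fun i => ?_) (fun i => ?_)
      (fun s => .of_forall fun x => by simp) (fun s => .of_forall fun x => by simp)).2
      ⟨h.u_eq, h.v_eq⟩ <;> fin_cases i
    exacts [h.u_cont, h.v_cont, h.uAt0_trace, h.vAt0_trace, h.uAtL_trace, h.vAtL_trace]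
  have ho : IsPairSol pl.ℓ pl.speed pl.coupling (fun i => emb pl.ℓ (X.gain i))
      (fun s => S.vAt0 s - S.vhAt0 s) ![S.uh, S.vh] ![S.uhAt0, S.vhAt0] ![S.uhAtL, S.vhAtL] := by
    refine (isPairSol_iff (f := ![fun s x => pl.c₁ x * S.vh s x
        + p₁ pl ker x * (S.vAt0 s - S.vhAt0 s),
        fun s x => pl.c₂ x * S.uh s x + p₂ pl ker x * (S.vAt0 s - S.vhAt0 s)])
      (fun i => ?_) (h.vAt0_trace.sub h.vhAt0_trace) (fun i => ?_) (fun i => ?_)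
      (fun s => ?_) (fun s => ?_)).2 ⟨h.uh_eq, h.vh_eq⟩
    rotate_right 2
    · filter_upwards [coeFn_gain_zero X] with x hx
      rw [hx, mul_comm (S.vAt0 s - S.vhAt0 s)]
      rfl
    · filter_upwards [coeFn_gain_one X] with x hx
      rw [hx, mul_comm (S.vAt0 s - S.vhAt0 s)]
      rfl
    all_goals fin_cases i
    exacts [h.uh_cont, h.vh_cont, h.uhAt0_trace, h.vhAt0_trace, h.uhAtL_trace, h.vhAtL_trace]
  have he := ((hp.congr_source (b' := fun _ => 0) (p' := fun i => emb pl.ℓ (X.gain i))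
    (isTrace_const 0) fun i => .of_forall fun r => by simp).sub ho).congr_source
    (b' := fun s => S.vAt0 s - S.vhAt0 s) (p' := fun i => -emb pl.ℓ (X.gain i))
    (h.vAt0_trace.sub h.vhAt0_trace) fun i => .of_forall fun r => by
      rw [zero_sub, neg_smul, smul_neg]
  have hbv := ae_Ioi_of_ae_Ico (τ_pos hds) hτ h.t_zero (P := fun s => S.vAtL s
    = pl.ρ * S.uAtL s + g s) fun k => by
      filter_upwards [h.bc_v k, ae_restrict_mem measurableSet_Ico] with s h1 h2
      rw [h1, hg k s h2]
  have hbvh := ae_Ioi_of_ae_Ico (τ_pos hds) hτ h.t_zero (P := fun s => S.vhAtL s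
    = pl.ρ * S.uhAtL s + g s) fun k => by
      filter_upwards [h.bc_vh k, ae_restrict_mem measurableSet_Ico] with s h1 h2
      rw [h1, hg k s h2]
  let D : Loop pl.ℓ := ⟨![S.u, S.v], ![S.uAt0, S.vAt0], ![S.uAtL, S.vAtL],
    fun i s => (![S.u, S.v] : Fin 2 → ℝ → L2 pl.ℓ) i s - (![S.uh, S.vh] : Fin 2 → ℝ → L2 pl.ℓ) i s,
    fun i s => (![S.uAt0, S.vAt0] : Fin 2 → ℝ → ℝ) i s
      - (![S.uhAt0, S.vhAt0] : Fin 2 → ℝ → ℝ) i s,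
    fun i s => (![S.uAtL, S.vAtL] : Fin 2 → ℝ → ℝ) i s
      - (![S.uhAtL, S.vhAtL] : Fin 2 → ℝ → ℝ) i s, g, S.m, S.t⟩
  have hobs : D.obs = ![S.uh, S.vh] := funext fun i => funext fun s => sub_sub_cancel _ _
  have hctl : ∀ s, D.control pl ker s = control pl ker (S.uh s) (S.vh s) := fun s => by
    rw [Loop.control, hobs]
    rfl
  refine ⟨D, ⟨⟨hp, fun i => ?_, h.bc_u, hbv⟩, he, fun i => ?_, ?_, ?_, h.m_cont, h.m_init,
    fun k s hs => ?_, fun k s hs => ?_, h.t_zero, fun k => ?_⟩, rfl, hobs, rfl, rfl⟩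
  · fin_cases i
    exacts [h.u_init, h.v_init]
  · fin_cases i
    · show S.u 0 - S.uh 0 = ini.u - ini.uh
      rw [h.u_init, h.uh_init]
    · show S.v 0 - S.vh 0 = ini.v - ini.vh
      rw [h.v_init, h.vh_init]
  · filter_upwards [h.bc_u, h.bc_uh] with s h1 h2
    show S.uAt0 s - S.uhAt0 s = 0
    rw [h1, h2, sub_self]
  · filter_upwards [hbv, hbvh] with s h1 h2
    show S.vAtL s - S.vhAtL s = pl.ρ * (S.uAtL s - S.uhAtL s)
    rw [h1, h2]
    ring
  · rw [hctl]
    exact hg k s hs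
  · refine (h.m_eq k s hs).trans ?_
    congr 1
    refine intervalIntegral.integral_congr fun r _ => ?_
    have e1 : D.wL 0 r - D.eL 0 r = S.uhAtL r := sub_sub_cancel _ _
    rw [e1, hobs, hctl, mRate]
    show _ = -ds.η * S.m r + (θm pl ds * (control pl ker (S.uh (S.t k)) (S.vh (S.t k))
      - control pl ker (S.uh r) (S.vh r)) ^ 2 - κ₀ pl ker ds * targetNormSq pl ker (S.uh r) (S.vh r)
      - κ₁ pl ker ds * αhEnd pl ker (S.uh r) (S.vh r) (S.uhAtL r) ^ 2
      - κ₂ pl ker ds * (S.vAt0 r - S.vhAt0 r) ^ 2)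
    ring
  · rw [hobs]
    exact h.t_succ k

end Loop

/-! ### The scalar equation of the dynamic variable -/

section Scalar

lemma eqOn_of_linear_integral {m m' R R' : ℝ → ℝ} {η a b : ℝ} (hm : ContinuousOn m (Icc a b))
    (hm' : ContinuousOn m' (Icc a b)) (hR : IntervalIntegrable R volume a b)
    (he : ∀ s ∈ Icc a b, m s = m a + ∫ r in a..s, (-η * m r + R r))
    (he' : ∀ s ∈ Icc a b, m' s = m' a + ∫ r in a..s, (-η * m' r + R' r))
    (hRR : ∀ᵐ r ∂volume.restrict (Ioc a b), R r = R' r) (ha : m a = m' a) : EqOn m m' (Icc a b) := by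
  intro s hs
  have hab : a ≤ b := hs.1.trans hs.2
  have hsub : ∀ {x y : ℝ}, a ≤ x → x ≤ y → y ≤ b → uIcc x y ⊆ uIcc a b := fun hx hxy hy => by
    rw [uIcc_of_le hab, uIcc_of_le hxy]; exact Icc_subset_Icc hx hy
  have hR' : IntervalIntegrable R' volume a b := by
    rw [intervalIntegrable_iff_integrableOn_Ioc_of_le hab] at hR ⊢
    exact hR.congr hRR
  have hc : ∀ {m : ℝ → ℝ}, ContinuousOn m (Icc a b) →
      IntervalIntegrable (fun r => -η * m r) volume a b := fun hm => by
    rw [← uIcc_of_le hab] at hm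
    exact hm.intervalIntegrable.const_mul _
  have p : IsPrimitive m (fun r => -η * m r + R r) a b := ⟨(hc hm).add hR, he⟩
  have p' : IsPrimitive m' (fun r => -η * m' r + R' r) a b := ⟨(hc hm').add hR', he'⟩
  have key : ∀ x y, a ≤ x → x ≤ y → y ≤ b →
      (m y - m' y) - (m x - m' x) = ∫ r in x..y, -η * (m r - m' r) := fun x y hx hxy hy => by
    have h1 := p.sub_eq ⟨hx, hxy.trans hy⟩ ⟨hx.trans hxy, hy⟩
    have h2 := p'.sub_eq ⟨hx, hxy.trans hy⟩ ⟨hx.trans hxy, hy⟩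
    have e : (m y - m' y) - (m x - m' x) = (m y - m x) - (m' y - m' x) := by ring
    rw [e, h1, h2, ← intervalIntegral.integral_sub (p.integrable.mono_set (hsub hx hxy hy))
      (p'.integrable.mono_set (hsub hx hxy hy))]
    refine intervalIntegral.integral_congr_ae ?_
    filter_upwards [(ae_restrict_iff' measurableSet_Ioc).1 hRR] with r hr hrr
    rw [uIoc_of_le hxy] at hrr
    rw [hr ⟨hx.trans_lt hrr.1, hrr.2.trans hy⟩]
    ring
  have h1 := eq_zero_of_sub_le_integral (z := fun r => m r - m' r) (c := -η) (hm.sub hm')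
    (fun x y hx hxy hy => (key x y hx hxy hy).le) (by simp [ha]) hs
  have h2 := eq_zero_of_sub_le_integral (z := fun r => -(m r - m' r)) (c := -η) (hm.sub hm').neg
    (fun x y hx hxy hy => by
      have := key x y hx hxy hy
      simp only [mul_neg, intervalIntegral.integral_neg]
      linarith) (by simp [ha]) hs
  linarith

/-- Variation of constants for `m' = -η m + R`. -/
def linearFlow (η m0 : ℝ) (R : ℝ → ℝ) (s : ℝ) : ℝ :=
  Real.exp (-η * s) * (m0 + ∫ r in (0 : ℝ)..s, Real.exp (η * r) * R r)

lemma isPrimitive_linearFlow {η m0 b : ℝ} {R : ℝ → ℝ} (hR : IntervalIntegrable R volume 0 b)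
    (hb : 0 ≤ b) :
    IsPrimitive (linearFlow η m0 R) (fun r => -η * linearFlow η m0 R r + R r) 0 b := by
  have h1 : IsPrimitive (fun s => Real.exp (-η * s)) (fun s => -η * Real.exp (-η * s)) 0 b :=
    .of_hasDerivAt' (fun x => (((hasDerivAt_id' x).const_mul (-η)).exp).congr_deriv (by ring))
      (by fun_prop)
  have h2 : IsPrimitive (fun s => m0 + ∫ r in (0 : ℝ)..s, Real.exp (η * r) * R r)
      (fun r => Real.exp (η * r) * R r) 0 b :=
    .const_add_integral (hR.continuousOn_mul (by fun_prop)) m0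
  have h3 := h1.mul hb h2
  have e : (fun r => -η * linearFlow η m0 R r + R r) = fun r => -η * Real.exp (-η * r)
      * (m0 + ∫ r in (0 : ℝ)..r, Real.exp (η * r) * R r)
      + Real.exp (-η * r) * (Real.exp (η * r) * R r) := funext fun r => by
    rw [linearFlow, ← mul_assoc (Real.exp (-η * r)) (Real.exp (η * r)), ← Real.exp_add]
    simp [mul_assoc]
  rw [e]
  exact h3

end Scalar

section LoopExistence

variable {pl : Plant} {ker : Kernels} {X : Extension pl ker} {ds : Design} {φu φv : ℝ}
  {ini : InitialData pl.ℓ} {D D' : Loop pl.ℓ}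

lemma err_unique {e e' : Fin 2 → ℝ → L2 pl.ℓ} {e0 eL e0' eL' : Fin 2 → ℝ → ℝ} {p : Fin 2 → L2 pl.ℓ}
    (h : IsPairSol pl.ℓ pl.speed pl.coupling p (e0 1) e e0 eL)
    (h' : IsPairSol pl.ℓ pl.speed pl.coupling p (e0' 1) e' e0' eL')
    (hi : ∀ i, e i 0 = e' i 0)
    (h0 : ∀ᵐ s ∂volume.restrict (Ioi (0 : ℝ)), e0 0 s = 0)
    (h0' : ∀ᵐ s ∂volume.restrict (Ioi (0 : ℝ)), e0' 0 s = 0)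
    (hL : ∀ᵐ s ∂volume.restrict (Ioi (0 : ℝ)), eL 1 s = pl.ρ * eL 0 s)
    (hL' : ∀ᵐ s ∂volume.restrict (Ioi (0 : ℝ)), eL' 1 s = pl.ρ * eL' 0 s) {T : ℝ} (hT : 0 ≤ T) :
    (∀ i, ∀ t ∈ Icc 0 T, e i t = e' i t) ∧
      ∀ᵐ r ∂volume.restrict (Ioc 0 T), e0 1 r = e0' 1 r ∧ eL 0 r = eL' 0 r := by
  have hsub : Ioc 0 T ⊆ Ioi 0 := Ioc_subset_Ioi_self
  have r0 := ae_restrict_of_ae_restrict_of_subset hsub h0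
  have r0' := ae_restrict_of_ae_restrict_of_subset hsub h0'
  have rL := ae_restrict_of_ae_restrict_of_subset hsub hL
  have rL' := ae_restrict_of_ae_restrict_of_subset hsub hL'
  obtain ⟨h1, h2⟩ := IsPairSol.eq_zero (w := fun i t => e i t - e' i t)
    (w0 := fun i t => e0 i t - e0' i t) (wL := fun i t => eL i t - eL' i t) pl.ℓ_pos
    Extension.speed_zero_pos Extension.speed_one_neg (q := 0) pl.ρ_ne (h.sub h') le_rfl hT
    (fun i => by rw [hi, sub_self])
    (by filter_upwards [r0, r0'] with r e1 e2; rw [e1, e2]; ring)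
    (by filter_upwards [rL, rL'] with r e1 e2; rw [e1, e2]; ring)
  refine ⟨fun i t ht => sub_eq_zero.1 (h1 i t ht), ?_⟩
  filter_upwards [h2] with r hr
  exact ⟨sub_eq_zero.1 hr.1, sub_eq_zero.1 hr.2⟩

/-- The closed loop has at most one solution. -/
lemma IsLoop.unique (hds : ds.Admissible pl ker) (h : IsLoop X ds φu φv ini D)
    (h' : IsLoop X ds φu φv ini D') :
    (∀ i, EqOn (D.w i) (D'.w i) (Ici 0)) ∧ (∀ i, EqOn (D.obs i) (D'.obs i) (Ici 0)) ∧
      EqOn D.m D'.m (Ici 0) ∧ D.t = D'.t := by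
  have hτ := τ_pos hds
  have he := fun T (hT : 0 ≤ T) => err_unique h.err h'.err
    (fun i => by rw [h.err_init, h'.err_init]) h.err_bc0 h'.err_bc0 h.err_bcL h'.err_bcL hT
  have hg : ∀ k, (∀ j ≤ k, D.t j = D'.t j) →
      (∀ j < k, D.control pl ker (D.t j) = D'.control pl ker (D'.t j)) →
      ∀ s ∈ Ico 0 (D.t k), D.g s = D'.g s := fun k ht hU s hs => by
    obtain ⟨j, hj⟩ := exists_mem_Ico_times hτ h.τ_le h.t_zero hs.1
    have hjk : j < k := (times_mono hτ h.τ_le).lt_iff_lt.1 (hj.1.trans_lt hs.2)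
    have hj' := hj
    rw [ht j hjk.le, ht (j + 1) hjk] at hj'
    rw [h.held j s hj, h'.held j s hj', hU j hjk]
  have hp : ∀ k, (∀ j ≤ k, D.t j = D'.t j) →
      (∀ j < k, D.control pl ker (D.t j) = D'.control pl ker (D'.t j)) →
      (∀ i, ∀ t ∈ Icc 0 (D.t k), D.w i t = D'.w i t) ∧
      (∀ i, ∀ᵐ r ∂volume.restrict (Ioc 0 (D.t k)), D.w0 i r = D'.w0 i r) ∧
      ∀ i, ∀ᵐ r ∂volume.restrict (Ioc 0 (D.t k)), D.wL i r = D'.wL i r := fun k ht hU => by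
    refine h.plant.unique h'.plant (times_nonneg hτ h.τ_le h.t_zero k) ?_
    rw [← Measure.restrict_congr_set Ioo_ae_eq_Ioc]
    filter_upwards [ae_restrict_mem measurableSet_Ioo] with r hr
    exact hg k ht hU r ⟨hr.1.le, hr.2⟩
  have hobs : ∀ k, (∀ j ≤ k, D.t j = D'.t j) →
      (∀ j < k, D.control pl ker (D.t j) = D'.control pl ker (D'.t j)) →
      ∀ i, ∀ t ∈ Icc 0 (D.t k), D.obs i t = D'.obs i t := fun k ht hU i t h0 => by
    rw [Loop.obs, Loop.obs, (hp k ht hU).1 i t h0, (he t h0.1).1 i t ⟨h0.1, le_rfl⟩]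
  have key : ∀ k, (∀ j ≤ k, D.t j = D'.t j) ∧
      (∀ j < k, D.control pl ker (D.t j) = D'.control pl ker (D'.t j)) ∧
      EqOn D.m D'.m (Icc 0 (D.t k)) := fun k => by
    induction k with
    | zero =>
      refine ⟨fun j hj => ?_, fun j hj => absurd hj (Nat.not_lt_zero j), fun s hs => ?_⟩
      · rw [Nat.le_zero.1 hj, h.t_zero, h'.t_zero]
      · rw [h.t_zero, Icc_self] at hs
        rw [hs, h.m_init, h'.m_init]
    | succ k ih =>
      obtain ⟨ht, hU, hm⟩ := ih
      have h0 := times_nonneg hτ h.τ_le h.t_zero k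
      have hk : D.t k ≤ D.t (k + 1) := by linarith [h.τ_le k]
      have hmem : D.t k ∈ Icc 0 (D.t k) := ⟨h0, le_rfl⟩
      have htk := ht k le_rfl
      have ho := fun i => hobs k ht hU i _ hmem
      have hUk : D.control pl ker (D.t k) = D'.control pl ker (D'.t k) := by
        rw [Loop.control, Loop.control, ho 0, ho 1, htk]
      have hmk := hm hmem
      have htk' : D.t (k + 1) = D'.t (k + 1) := by
        rw [h.t_succ, h'.t_succ, ho 0, ho 1, hmk, htk]
      have ht1 : ∀ j ≤ k + 1, D.t j = D'.t j := fun j hj => by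
        rcases Nat.le_succ_iff.1 hj with h1 | rfl
        exacts [ht j h1, htk']
      have hU1 : ∀ j < k + 1, D.control pl ker (D.t j) = D'.control pl ker (D'.t j) :=
        fun j hj => by
          rcases Nat.lt_succ_iff_lt_or_eq.1 hj with h1 | rfl
          exacts [hU j h1, hUk]
      refine ⟨ht1, hU1, ?_⟩
      have hin : Icc (D.t k) (D.t (k + 1)) ⊆ Ici 0 := fun s hs => h0.trans hs.1
      have h1 := eqOn_of_linear_integral (h.m_cont.mono hin) (h'.m_cont.mono hin)
        (X.intervalIntegrable_mRate ds h.observer.cont (isTrace_const (D.control pl ker (D.t k)))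
          (h.observer.traceL 0) (h.err.trace0 1) h0 (h0.trans hk)) (h.m_eq k)
        (fun s hs => by
          rw [htk, htk'] at hs
          rw [htk]
          exact h'.m_eq k s hs) (by
          have hs : Ioc (D.t k) (D.t (k + 1)) ⊆ Ioc 0 (D.t (k + 1)) := Ioc_subset_Ioc_left h0
          filter_upwards [ae_restrict_of_ae_restrict_of_subset hs ((hp _ ht1 hU1).2.2 0),
            ae_restrict_of_ae_restrict_of_subset hs (he _ (h0.trans hk)).2,
            ae_restrict_mem measurableSet_Ioc] with r e1 e2 e3
          have e4 := fun i => hobs _ ht1 hU1 i r ⟨h0.trans e3.1.le, e3.2⟩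
          simp only [e1, e2.1, e2.2, e4, hUk]) hmk
      intro s hs
      rcases le_total s (D.t k) with h2 | h2
      exacts [hm ⟨hs.1, h2⟩, h1 ⟨h2, hs.2⟩]
  have hex : ∀ s, ∃ k, s < D.t k := exists_lt_times hτ h.τ_le h.t_zero
  refine ⟨fun i s hs => ?_, fun i s hs => ?_, fun s hs => ?_, funext fun k => (key k).1 k le_rfl⟩
  all_goals obtain ⟨k, hk⟩ := hex s
  · exact (hp k (key k).1 (key k).2.1).1 i s ⟨hs, hk.le⟩
  · exact hobs k (key k).1 (key k).2.1 i s ⟨hs, hk.le⟩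
  · exact (key k).2.2 ⟨hs, hk.le⟩

lemma IsTrace.piecewise {g : ℝ → ℝ} (hg : IsTrace g) (T c : ℝ) :
    IsTrace fun s => if s < T then g s else c := fun T' => by
  have h := ((hg T').indicator (measurableSet_Iio (a := T))).add
    ((isTrace_const c T').indicator (measurableSet_Ici (a := T)))
  refine h.ae_eq (.of_forall fun s => ?_)
  by_cases hs : s < T
  · simp [hs]
  · simp [hs, not_lt.1 hs]

/-- The closed loop has a solution. -/
lemma exists_isLoop (X : Extension pl ker) (hker : ker.Solve pl) (hds : ds.Admissible pl ker)
    (φu φv : ℝ) {e : Fin 2 → ℝ → L2 pl.ℓ} {e0 eL : Fin 2 → ℝ → ℝ}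
    (he : IsErrorSol X ![ini.u - ini.uh, ini.v - ini.vh] e e0 eL) :
    ∃ D : Loop pl.ℓ, IsLoop X ds φu φv ini D ∧ D.e = e ∧ D.e0 = e0 := by
  have hτ := τ_pos hds
  choose W W0 WL hW using fun g : {g : ℝ → ℝ // IsTrace g} =>
    exists_isPlantSol X hker ![ini.u, ini.v] g.2
  let obs : {g : ℝ → ℝ // IsTrace g} → Fin 2 → ℝ → L2 pl.ℓ := fun g i s => W g i s - e i s
  let ctl : {g : ℝ → ℝ // IsTrace g} → ℝ → ℝ := fun g s => control pl ker (obs g 0 s) (obs g 1 s)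
  let R : {g : ℝ → ℝ // IsTrace g} → ℝ → ℝ := fun g r =>
    mRate pl ker ds (g.1 r) (fun i => obs g i r) (WL g 0 r - eL 0 r) (e0 1 r)
  let M : {g : ℝ → ℝ // IsTrace g} → ℝ → ℝ := fun g => linearFlow ds.η ini.m (R g)
  let step : {g : ℝ → ℝ // IsTrace g} × ℝ → {g : ℝ → ℝ // IsTrace g} × ℝ := fun p =>
    (⟨_, p.1.2.piecewise p.2 (ctl p.1 p.2)⟩,
      p.2 + waiting pl ker ds φu φv p.2 (obs p.1 0 p.2) (obs p.1 1 p.2) (M p.1 p.2))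
  let seq : ℕ → {g : ℝ → ℝ // IsTrace g} × ℝ :=
    Nat.rec (⟨fun _ => 0, isTrace_const 0⟩, 0) fun _ p => step p
  let t : ℕ → ℝ := fun k => (seq k).2
  let G : ℕ → {g : ℝ → ℝ // IsTrace g} := fun k => (seq k).1
  have ht0 : t 0 = 0 := rfl
  have hts : ∀ k, t (k + 1) = t k
    + waiting pl ker ds φu φv (t k) (obs (G k) 0 (t k)) (obs (G k) 1 (t k)) (M (G k) (t k)) :=
    fun _ => rfl
  have hGs : ∀ k s, (G (k + 1)).1 s = if s < t k then (G k).1 s else ctl (G k) (t k) :=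
    fun _ _ => rfl
  have htτ : ∀ k, t k + τ pl ker ds ≤ t (k + 1) := fun k => by
    rw [hts]
    exact add_le_add_right τ_le_waiting _
  have htn := times_nonneg hτ htτ ht0
  have htm := times_mono hτ htτ
  have hGm : ∀ m n, m ≤ n → ∀ s < t m, (G n).1 s = (G m).1 s := fun m n hmn s hs => by
    induction n, hmn using Nat.le_induction with
    | base => rfl
    | succ n hmn ih => rw [hGs, if_pos (hs.trans_le (htm.monotone hmn)), ih]
  choose N hN using exists_lt_times hτ htτ ht0
  have hg : ∀ n, ∀ s < t n, (G (N s)).1 s = (G n).1 s := fun n s hs => by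
    rcases le_total (N s) n with h | h
    exacts [(hGm _ _ h s (hN s)).symm, hGm _ _ h s hs]
  have hgt : IsTrace fun s => (G (N s)).1 s := fun T => by
    refine ((G (N T)).2 T).ae_eq ?_
    filter_upwards [ae_restrict_mem measurableSet_Ioc] with s hs
    exact (hg _ s (hs.2.trans_lt (hN T))).symm
  let g : {g : ℝ → ℝ // IsTrace g} := ⟨_, hgt⟩
  have hun := fun n => (hW g).unique (hW (G n)) (htn n) (by
    rw [← Measure.restrict_congr_set Ioo_ae_eq_Ioc]
    filter_upwards [ae_restrict_mem measurableSet_Ioo] with r hr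
    exact hg n r hr.2)
  have hob : ∀ n i, ∀ s ∈ Icc 0 (t n), obs g i s = obs (G n) i s := fun n i s hs => by
    show W g i s - e i s = W (G n) i s - e i s
    rw [(hun n).1 i s hs]
  have hRn : ∀ n, ∀ᵐ r ∂volume.restrict (Ioc 0 (t n)), R g r = R (G n) r := fun n => by
    have h1 : ∀ᵐ r ∂volume.restrict (Ioc 0 (t n)), g.1 r = (G n).1 r := by
      rw [← Measure.restrict_congr_set Ioo_ae_eq_Ioc]
      filter_upwards [ae_restrict_mem measurableSet_Ioo] with r hr
      exact hg n r hr.2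
    filter_upwards [h1, (hun n).2.2 0, ae_restrict_mem measurableSet_Ioc] with r e1 e2 e3
    have e4 := fun i => hob n i r ⟨e3.1.le, e3.2⟩
    simp only [R, e1, e2, e4]
  have hMn : ∀ n, M g (t n) = M (G n) (t n) := fun n => by
    have : ∫ r in (0 : ℝ)..t n, Real.exp (ds.η * r) * R g r
        = ∫ r in (0 : ℝ)..t n, Real.exp (ds.η * r) * R (G n) r := by
      rw [intervalIntegral.integral_of_le (htn n), intervalIntegral.integral_of_le (htn n)]
      refine integral_congr_ae ?_
      filter_upwards [hRn n] with r hr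
      rw [hr]
    simp only [M, linearFlow, this]
  have hctl : ∀ n, ctl g (t n) = ctl (G n) (t n) := fun n => by
    simp only [ctl, hob n _ (t n) ⟨htn n, le_rfl⟩]
  have hheld : ∀ k, ∀ s ∈ Ico (t k) (t (k + 1)), g.1 s = ctl g (t k) := fun k s hs => by
    have e1 : g.1 s = (G (k + 1)).1 s := hg (k + 1) s hs.2
    rw [hctl, e1, hGs, if_neg (not_lt.2 hs.1)]
  have hcont : ∀ i, ContinuousOn (obs g i) (Ici 0) := fun i => ((hW g).sol.cont i).sub (he.sol.cont i)
  have hRi : ∀ b, 0 ≤ b → IntervalIntegrable (R g) volume 0 b := fun b hb =>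
    X.intervalIntegrable_mRate ds hcont g.2 (((hW g).sol.traceL 0).sub (he.sol.traceL 0))
      (he.sol.trace0 1) le_rfl hb
  have hprim : ∀ b, 0 ≤ b → IsPrimitive (M g) (fun r => -ds.η * M g r + R g r) 0 b := fun b hb =>
    isPrimitive_linearFlow (hRi b hb) hb
  let D : Loop pl.ℓ := ⟨W g, W0 g, WL g, e, e0, eL, g.1, M g, t⟩
  refine ⟨D, ⟨hW g, he.sol, he.init, ?_, ?_, fun s hs => ?_, ?_, hheld, fun k s hs => ?_, ht0,
    fun k => ?_⟩, rfl, rfl⟩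
  · filter_upwards [ae_restrict_mem measurableSet_Ioi] with s hs
    exact he.bc0 s hs
  · filter_upwards [ae_restrict_mem measurableSet_Ioi] with s hs
    exact he.bcL s hs
  · have h1 : s + 1 ∈ Ioi s := lt_add_one s
    have hs0 : (0 : ℝ) ≤ s := hs
    have h2 := (hprim (s + 1) (by linarith)).continuousOn (by linarith) s ⟨hs0, by linarith⟩
    refine h2.mono_of_mem_nhdsWithin ?_
    filter_upwards [self_mem_nhdsWithin, mem_nhdsWithin_of_mem_nhds (Iio_mem_nhds h1)] with r h3 h4
    exact ⟨h3, le_of_lt h4⟩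
  · simp [D, M, linearFlow]
  · have h0 : 0 ≤ s := (htn k).trans hs.1
    have h1 := (hprim s h0).sub_eq ⟨htn k, hs.1⟩ ⟨h0, le_rfl⟩
    refine sub_eq_iff_eq_add'.1 (h1.trans ?_)
    rw [intervalIntegral.integral_of_le hs.1, intervalIntegral.integral_of_le hs.1,
      ← Measure.restrict_congr_set Ioo_ae_eq_Ioc]
    refine integral_congr_ae ?_
    filter_upwards [ae_restrict_mem measurableSet_Ioo] with r hr
    simp only [R, hheld k r ⟨hr.1.le, hr.2.trans_le hs.2⟩]
    rfl
  · have e1 := fun i => hob k i (t k) ⟨htn k, le_rfl⟩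
    refine (hts k).trans ?_
    rw [← e1 0, ← e1 1, ← hMn]
    rfl

end LoopExistence

/-! ### Constants as Hilbert space quantities -/

section Target

variable {pl : Plant} {ker : Kernels} {ds : Design}

/-- The source `(p̄₁, p̄₂)` of the observer target system. -/
def Extension.pbar (X : Extension pl ker) (i : Fin 2) : L2 pl.ℓ :=
  transform pl.ℓ X.MK (fun j => emb pl.ℓ (X.gain j)) i
    + (pl.q * pl.lam₁) • emb pl.ℓ (colZero (X.MK i 0))

lemma integral_mul_coeFn_congr {f : L2 pl.ℓ} {g : ℝ → ℝ}
    (h : ∀ᵐ x ∂volume.restrict (Ioo 0 pl.ℓ), f x = g x) (k : ℝ → ℝ) {x : ℝ} (hx : x ∈ Icc 0 pl.ℓ) :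
    ∫ ξ in (0 : ℝ)..x, k ξ * f ξ = ∫ ξ in (0 : ℝ)..x, k ξ * g ξ := by
  refine intervalIntegral_congr_ae hx.1 ?_
  filter_upwards [ae_restrict_of_ae_restrict_of_subset (Ioo_subset_Ioo_right hx.2) h] with ξ hξ
  rw [hξ]

lemma coeFn_pbar_zero (X : Extension pl ker) :
    ∀ᵐ x ∂volume.restrict (Ioo 0 pl.ℓ), X.pbar 0 x = pbar₁ pl ker x := by
  filter_upwards [coeFn_transform X.MK (fun j => emb pl.ℓ (X.gain j)) 0, coeFn_gain_zero X,
    Lp.coeFn_add (transform pl.ℓ X.MK (fun j => emb pl.ℓ (X.gain j)) 0)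
      ((pl.q * pl.lam₁) • emb pl.ℓ (colZero (X.MK 0 0))),
    Lp.coeFn_smul (pl.q * pl.lam₁) (emb pl.ℓ (colZero (X.MK 0 0))), coeFn_emb (colZero (X.MK 0 0)),
    ae_restrict_mem measurableSet_Ioo] with x h1 h2 h3 h4 h5 h6
  have hx := Ioo_subset_Icc_self h6
  have e1 := volterra_eq_neg (k := ker.K.k₁₁) (X.K_eq 0 0) hx (emb pl.ℓ (X.gain 0))
  have e2 := volterra_eq_neg (k := ker.K.k₁₂) (X.K_eq 0 1) hx (emb pl.ℓ (X.gain 1))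
  rw [integral_mul_coeFn_congr (coeFn_gain_zero X) _ hx] at e1
  rw [integral_mul_coeFn_congr (coeFn_gain_one X) _ hx] at e2
  have e3 : colZero (X.MK 0 0) x = -ker.K.k₁₁ x 0 := X.K_eq 0 0 x 0 le_rfl hx.1 hx.2
  rw [Extension.pbar, h3, Pi.add_apply, h4, Pi.smul_apply, h5, e3, h1, h2, pbar₁, e1, e2, smul_eq_mul]
  ring

lemma coeFn_pbar_one (X : Extension pl ker) :
    ∀ᵐ x ∂volume.restrict (Ioo 0 pl.ℓ), X.pbar 1 x = pbar₂ pl ker x := by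
  filter_upwards [coeFn_transform X.MK (fun j => emb pl.ℓ (X.gain j)) 1, coeFn_gain_one X,
    Lp.coeFn_add (transform pl.ℓ X.MK (fun j => emb pl.ℓ (X.gain j)) 1)
      ((pl.q * pl.lam₁) • emb pl.ℓ (colZero (X.MK 1 0))),
    Lp.coeFn_smul (pl.q * pl.lam₁) (emb pl.ℓ (colZero (X.MK 1 0))), coeFn_emb (colZero (X.MK 1 0)),
    ae_restrict_mem measurableSet_Ioo] with x h1 h2 h3 h4 h5 h6
  have hx := Ioo_subset_Icc_self h6
  have e1 := volterra_eq_neg (k := ker.K.k₂₁) (X.K_eq 1 0) hx (emb pl.ℓ (X.gain 0))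
  have e2 := volterra_eq_neg (k := ker.K.k₂₂) (X.K_eq 1 1) hx (emb pl.ℓ (X.gain 1))
  rw [integral_mul_coeFn_congr (coeFn_gain_zero X) _ hx] at e1
  rw [integral_mul_coeFn_congr (coeFn_gain_one X) _ hx] at e2
  have e3 : colZero (X.MK 1 0) x = -ker.K.k₂₁ x 0 := X.K_eq 1 0 x 0 le_rfl hx.1 hx.2
  rw [Extension.pbar, h3, Pi.add_apply, h4, Pi.smul_apply, h5, e3, h1, h2, pbar₂, e1, e2, smul_eq_mul]
  ring

/-- The weights of the Lyapunov functional. -/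
def Plant.weight (pl : Plant) (A μ : ℝ) : Fin 2 → C(ℝ, ℝ) :=
  ![⟨fun x => A / pl.lam₁ * Real.exp (-(μ * x / pl.lam₁)), by fun_prop⟩,
    ⟨fun x => 2 * A * pl.q ^ 2 / pl.lam₂ * Real.exp (μ * x / pl.lam₂), by fun_prop⟩]

lemma Plant.weight_zero (A μ x : ℝ) :
    pl.weight A μ 0 x = A / pl.lam₁ * Real.exp (-(μ * x / pl.lam₁)) := rfl

lemma Plant.weight_one (A μ x : ℝ) :
    pl.weight A μ 1 x = 2 * A * pl.q ^ 2 / pl.lam₂ * Real.exp (μ * x / pl.lam₂) := rfl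

/-- The derivatives of the weights. -/
def Plant.weightDeriv (pl : Plant) (A μ : ℝ) (i : Fin 2) : C(ℝ, ℝ) :=
  (-μ / pl.speed i) • pl.weight A μ i

lemma Plant.hasDerivAt_weight (A μ : ℝ) (i : Fin 2) (x : ℝ) :
    HasDerivAt (pl.weight A μ i) (pl.weightDeriv A μ i x) x := by
  have h : ∀ c y : ℝ, HasDerivAt (fun x => y * x / c) (y / c) x := fun c y => by
    have := ((hasDerivAt_id' x).const_mul y).div_const c
    rwa [mul_one] at this
  fin_cases i
  · refine (((h pl.lam₁ μ).fun_neg.exp).const_mul (A / pl.lam₁)).congr_deriv ?_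
    show _ = -μ / pl.lam₁ * (A / pl.lam₁ * Real.exp (-(μ * x / pl.lam₁)))
    ring
  · refine (((h pl.lam₂ μ).exp).const_mul (2 * A * pl.q ^ 2 / pl.lam₂)).congr_deriv ?_
    show _ = -μ / -pl.lam₂ * (2 * A * pl.q ^ 2 / pl.lam₂ * Real.exp (μ * x / pl.lam₂))
    rw [neg_div_neg_eq]
    ring

lemma mulH_smul {ℓ : ℝ} (c : ℝ) (φ : C(ℝ, ℝ)) (w : L2 ℓ) : mulH ℓ (c • φ) w = c • mulH ℓ φ w := by
  ext1
  filter_upwards [coeFn_mulH (c • φ) w, coeFn_mulH φ w, Lp.coeFn_smul c (mulH ℓ φ w)] with x h1 h2 h3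
  rw [h1, h3, Pi.smul_apply, h2]
  exact mul_assoc _ _ _

lemma inner_mulH_self {ℓ : ℝ} (hℓ : 0 ≤ ℓ) (φ : C(ℝ, ℝ)) (w : L2 ℓ) :
    inner ℝ (mulH ℓ φ w) w = ∫ x in (0 : ℝ)..ℓ, φ x * w x ^ 2 := by
  rw [inner_eq_integral hℓ]
  refine intervalIntegral_congr_ae hℓ ?_
  filter_upwards [coeFn_mulH φ w] with x hx
  rw [hx]
  ring

lemma integral_energy_eq (g : Fin 2 → C(ℝ, ℝ)) (w : Fin 2 → L2 pl.ℓ) {f₀ f₁ : ℝ → ℝ}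
    (h0 : ∀ᵐ x ∂volume.restrict (Ioo 0 pl.ℓ), w 0 x = f₀ x)
    (h1 : ∀ᵐ x ∂volume.restrict (Ioo 0 pl.ℓ), w 1 x = f₁ x) :
    energy pl.ℓ g w = ∫ x in (0 : ℝ)..pl.ℓ, (g 0 x * f₀ x ^ 2 + g 1 x * f₁ x ^ 2) := by
  have hℓ := pl.ℓ_pos.le
  have hi : ∀ i, IntervalIntegrable (fun x => g i x * w i x ^ 2) volume 0 pl.ℓ := fun i => by
    rw [intervalIntegrable_iff_integrableOn_Ioo_of_le hℓ]
    have : IntegrableOn (fun x => mulH pl.ℓ (g i) (w i) x * w i x) (Ioo 0 pl.ℓ) :=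
      (Lp.memLp (mulH pl.ℓ (g i) (w i))).integrable_mul (Lp.memLp (w i))
    refine this.congr ?_
    filter_upwards [coeFn_mulH (g i) (w i)] with x hx
    rw [hx]
    ring
  rw [energy, Fin.sum_univ_two, inner_mulH_self hℓ, inner_mulH_self hℓ,
    ← intervalIntegral.integral_add (hi 0) (hi 1)]
  refine intervalIntegral_congr_ae hℓ ?_
  filter_upwards [h0, h1] with x e0 e1
  rw [e0, e1]

lemma V₂_eq (X : Extension pl ker) (w : Fin 2 → L2 pl.ℓ) :
    V₂ pl ker (w 0) (w 1) = energy pl.ℓ (pl.weight 1 (μbar pl)) (transform pl.ℓ X.MK w) := by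
  rw [integral_energy_eq _ _ ((X.coeFn_target_zero w).mono fun _ h => h.symm)
    ((X.coeFn_target_one w).mono fun _ h => h.symm), V₂]
  refine intervalIntegral.integral_congr fun x _ => ?_
  simp only [Plant.weight_zero, Plant.weight_one, Dbar]
  ring

lemma PV₂_eq (X : Extension pl ker) :
    PV₂ pl ker ds = 1 / ds.δb * energy pl.ℓ (pl.weight 1 (μbar pl)) X.pbar := by
  rw [integral_energy_eq _ _ (coeFn_pbar_zero X) (coeFn_pbar_one X), PV₂]
  congr 1
  refine intervalIntegral.integral_congr fun x _ => ?_
  simp only [Plant.weight_zero, Plant.weight_one, Dbar]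
  ring

/-! ### The control law along the target system -/

lemma Nα_eq (X : Extension pl ker) {ξ : ℝ} (hξ : ξ ∈ Icc 0 pl.ℓ) :
    Nα pl ker ξ = X.ctrlTarget 0 ξ := by
  have h0 := X.L_eq 0 0 pl.ℓ ξ hξ.1 hξ.2 le_rfl
  have h1 := X.L_eq 1 0 pl.ℓ ξ hξ.1 hξ.2 le_rfl
  show ker.L.entry 1 0 pl.ℓ ξ - pl.ρ * ker.L.entry 0 0 pl.ℓ ξ
    = X.ML 1 0 (pl.ℓ, ξ) - pl.ρ * X.ML 0 0 (pl.ℓ, ξ)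
  rw [h0, h1]

lemma Nβ_eq (X : Extension pl ker) {ξ : ℝ} (hξ : ξ ∈ Icc 0 pl.ℓ) :
    Nβ pl ker ξ = X.ctrlTarget 1 ξ := by
  have h0 := X.L_eq 0 1 pl.ℓ ξ hξ.1 hξ.2 le_rfl
  have h1 := X.L_eq 1 1 pl.ℓ ξ hξ.1 hξ.2 le_rfl
  show ker.L.entry 1 1 pl.ℓ ξ - pl.ρ * ker.L.entry 0 1 pl.ℓ ξ
    = X.ML 1 1 (pl.ℓ, ξ) - pl.ρ * X.ML 0 1 (pl.ℓ, ξ)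
  rw [h0, h1]

/-- The derivative of `ctrlTarget`. -/
def Extension.ctrlDeriv (X : Extension pl ker) (j : Fin 2) : C(ℝ, ℝ) :=
  rowEnd pl.ℓ (X.MLξ 1 j) - pl.ρ • rowEnd pl.ℓ (X.MLξ 0 j)

/-- A continuously differentiable function that agrees with `ctrlTarget` on `[0,ℓ]`. -/
def Extension.ctrlExt (X : Extension pl ker) (j : Fin 2) : C(ℝ, ℝ) :=
  ContinuousMap.const ℝ (X.ctrlTarget j 0) + primitive (X.ctrlDeriv j)

lemma Extension.hasDerivAt_ctrlExt (X : Extension pl ker) (j : Fin 2) (x : ℝ) :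
    HasDerivAt (X.ctrlExt j) (X.ctrlDeriv j x) x :=
  (hasDerivAt_primitive (X.ctrlDeriv j) x).const_add _

lemma Extension.ctrlExt_eq (X : Extension pl ker) (j : Fin 2) {ξ : ℝ} (hξ : ξ ∈ Icc 0 pl.ℓ) :
    X.ctrlExt j ξ = X.ctrlTarget j ξ := by
  have h0 := (X.L_isTransform.c1 0 j).snd pl.ℓ 0 ξ le_rfl hξ.1 hξ.2 le_rfl
  have h1 := (X.L_isTransform.c1 1 j).snd pl.ℓ 0 ξ le_rfl hξ.1 hξ.2 le_rfl
  have h2 : ∫ s in (0 : ℝ)..ξ, X.ctrlDeriv j s = (∫ s in (0 : ℝ)..ξ, X.MLξ 1 j (pl.ℓ, s))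
      - pl.ρ * ∫ s in (0 : ℝ)..ξ, X.MLξ 0 j (pl.ℓ, s) := by
    rw [← intervalIntegral.integral_const_mul, ← intervalIntegral.integral_sub]
    · rfl
    · exact Continuous.intervalIntegrable (by fun_prop) _ _
    · exact Continuous.intervalIntegrable (by fun_prop) _ _
  show X.ML 1 j (pl.ℓ, 0) - pl.ρ * X.ML 0 j (pl.ℓ, 0) + ∫ s in (0 : ℝ)..ξ, X.ctrlDeriv j s
    = X.ML 1 j (pl.ℓ, ξ) - pl.ρ * X.ML 0 j (pl.ℓ, ξ)
  rw [h2, ← h0, ← h1]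
  ring

lemma integral_deriv_sq_eq (X : Extension pl ker) {N : ℝ → ℝ} {j : Fin 2}
    (hN : ∀ ξ ∈ Icc 0 pl.ℓ, N ξ = X.ctrlTarget j ξ) :
    ∫ ξ in (0 : ℝ)..pl.ℓ, deriv N ξ ^ 2 = ‖emb pl.ℓ (X.ctrlDeriv j)‖ ^ 2 := by
  rw [norm_sq_eq_integral pl.ℓ_pos.le]
  refine intervalIntegral_congr_ae pl.ℓ_pos.le ?_
  filter_upwards [coeFn_emb (X.ctrlDeriv j), ae_restrict_mem measurableSet_Ioo] with ξ h1 h2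
  have : N =ᶠ[𝓝 ξ] X.ctrlExt j := by
    filter_upwards [Ioo_mem_nhds h2.1 h2.2] with y hy
    rw [hN y (Ioo_subset_Icc_self hy), X.ctrlExt_eq j (Ioo_subset_Icc_self hy)]
  rw [h1, this.deriv_eq, (X.hasDerivAt_ctrlExt j ξ).deriv]

lemma integral_sq_eq {N : ℝ → ℝ} {φ : C(ℝ, ℝ)} (hN : ∀ ξ ∈ Icc 0 pl.ℓ, N ξ = φ ξ) :
    ∫ ξ in (0 : ℝ)..pl.ℓ, N ξ ^ 2 = ‖emb pl.ℓ φ‖ ^ 2 := by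
  rw [norm_sq_eq_integral pl.ℓ_pos.le]
  refine intervalIntegral_congr_ae pl.ℓ_pos.le ?_
  filter_upwards [coeFn_emb φ, ae_restrict_mem measurableSet_Ioo] with ξ h1 h2
  rw [h1, hN ξ (Ioo_subset_Icc_self h2)]

lemma ε₀_eq (X : Extension pl ker) : ε₀ pl ker
    = 5 * max (pl.lam₁ ^ 2 * ‖emb pl.ℓ (X.ctrlDeriv 0)‖ ^ 2)
      (pl.lam₂ ^ 2 * ‖emb pl.ℓ (X.ctrlDeriv 1)‖ ^ 2) := by
  rw [ε₀, integral_deriv_sq_eq X (N := Nα pl ker) fun ξ hξ => Nα_eq X hξ,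
    integral_deriv_sq_eq X (N := Nβ pl ker) fun ξ hξ => Nβ_eq X hξ]

lemma ε₂_eq (X : Extension pl ker) : ε₂ pl ker = 5 * ((∑ j, inner ℝ (X.pbar j)
    (emb pl.ℓ (X.ctrlTarget j))) + pl.q * pl.lam₁ * X.ctrlTarget 0 0) ^ 2 := by
  have hℓ := pl.ℓ_pos.le
  have hi : ∀ j, IntervalIntegrable (fun x => X.pbar j x * X.ctrlTarget j x) volume 0 pl.ℓ :=
    fun j => by
      have := intervalIntegrable_mul_coeFn (X.ctrlTarget j).continuous (X.pbar j)
        (left_mem_Icc.2 hℓ) (right_mem_Icc.2 hℓ)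
      simpa only [mul_comm] using this
  rw [ε₂, Nα_eq X (left_mem_Icc.2 hℓ), Fin.sum_univ_two, inner_emb hℓ, inner_emb hℓ,
    ← intervalIntegral.integral_add (hi 0) (hi 1)]
  congr 3
  refine intervalIntegral_congr_ae hℓ ?_
  filter_upwards [coeFn_pbar_zero X, coeFn_pbar_one X, ae_restrict_mem measurableSet_Ioo]
    with x h0 h1 hx
  rw [h0, h1, Nα_eq X (Ioo_subset_Icc_self hx), Nβ_eq X (Ioo_subset_Icc_self hx)]
  ring

/-- The control law as a functional of the target state. -/
def Extension.ctl (X : Extension pl ker) (z : Fin 2 → L2 pl.ℓ) : ℝ :=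
  ∑ j, inner ℝ (z j) (emb pl.ℓ (X.ctrlTarget j))

/-- The target solution on `[t₀,t₁]` with held input value `U`. -/
structure IsTargetOn (X : Extension pl ker) (U t₀ t₁ : ℝ) (b : ℝ → ℝ) (z : Fin 2 → ℝ → L2 pl.ℓ)
    (z0 zL : Fin 2 → ℝ → ℝ) : Prop where
  sol : IsPairSol pl.ℓ pl.speed 0 X.pbar b z z0 zL
  nonneg : 0 ≤ t₀
  le : t₀ ≤ t₁
  bc0 : ∀ᵐ r ∂volume.restrict (Ioc t₀ t₁), z0 0 r = pl.q * (z0 1 r + b r)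
  bcL : ∀ᵐ r ∂volume.restrict (Ioc t₀ t₁),
    zL 1 r = pl.ρ * zL 0 r + (U - X.ctl fun i => z i r)

/-- The target state of the observer. -/
def Loop.target (X : Extension pl ker) (D : Loop pl.ℓ) (i : Fin 2) (s : ℝ) : L2 pl.ℓ :=
  transform pl.ℓ X.MK (fun j => D.obs j s) i

/-- The traces of the target state at `ℓ`. -/
def Loop.targetL (X : Extension pl ker) (D : Loop pl.ℓ) (i : Fin 2) (s : ℝ) : ℝ :=
  D.wL i s - D.eL i s + ∑ j, inner ℝ (D.obs j s) (emb pl.ℓ (rowEnd pl.ℓ (X.MK i j)))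

variable {X : Extension pl ker} {φu φv : ℝ} {ini : InitialData pl.ℓ} {D : Loop pl.ℓ}

lemma Loop.control_eq (hker : ker.Solve pl) (D : Loop pl.ℓ) (s : ℝ) :
    D.control pl ker s = X.ctl fun i => D.target X i s :=
  X.control_eq_target hker fun i => D.obs i s

lemma IsLoop.isTargetOn (hker : ker.Solve pl) (hds : ds.Admissible pl ker)
    (h : IsLoop X ds φu φv ini D) (k : ℕ) :
    IsTargetOn X (D.control pl ker (D.t k)) (D.t k) (D.t (k + 1)) (D.e0 1) (D.target X)
      (fun i s => D.w0 i s - D.e0 i s) (D.targetL X) := by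
  have h0 := times_nonneg (τ_pos hds) h.τ_le h.t_zero k
  have hsub : Ioc (D.t k) (D.t (k + 1)) ⊆ Ioi 0 := fun r hr => h0.trans_lt hr.1
  refine ⟨?_, h0, by linarith [h.τ_le k, τ_pos hds], ?_, ?_⟩
  · refine h.observer.transform pl.ℓ_pos.le X.K_isTransform (h.err.trace0 1) fun i => ?_
    filter_upwards [h.plant.bc0, h.err_bc0] with r h1 h2
    rw [Fin.sum_univ_two, sum_smul_colZero_eq_zero (fun i x hx => X.K_col hker i hx) i, h1, h2,
      Extension.pbar, smul_add, smul_smul, smul_smul, ← add_smul]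
    congr 2
    have := pl.lam₂_pos.ne'
    simp only [Plant.speed_zero, Plant.speed_one]
    field_simp
    ring
  · filter_upwards [ae_restrict_of_ae_restrict_of_subset hsub h.plant.bc0,
      ae_restrict_of_ae_restrict_of_subset hsub h.err_bc0] with r h1 h2
    rw [h1, h2]
    ring
  · rw [← Measure.restrict_congr_set Ioo_ae_eq_Ioc]
    have hsub' := Ioo_subset_Ioc_self.trans hsub
    filter_upwards [ae_restrict_of_ae_restrict_of_subset hsub' h.plant.bcL,
      ae_restrict_of_ae_restrict_of_subset hsub' h.err_bcL, ae_restrict_mem measurableSet_Ioo]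
      with r h1 h2 h3
    rw [h.held k r ⟨h3.1.le, h3.2⟩] at h1
    have h4 : D.control pl ker r = _ := X.control_eq fun i => D.obs i r
    rw [← D.control_eq hker r, h4]
    have e : ∀ j, emb pl.ℓ (X.ctrl j) = pl.ρ • emb pl.ℓ (rowEnd pl.ℓ (X.MK 0 j))
      - emb pl.ℓ (rowEnd pl.ℓ (X.MK 1 j)) := fun _ => rfl
    simp only [Loop.targetL, Fin.sum_univ_two, e, inner_sub_right, inner_smul_right]
    rw [h1, h2]
    ring

lemma IsLoop.mRate_eq (hker : ker.Solve pl) (U y : ℝ) (b : ℝ) (s : ℝ) :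
    mRate pl ker ds U (fun i => D.obs i s) y b
      = θm pl ds * (U - X.ctl fun i => D.target X i s) ^ 2
        - κ₀ pl ker ds * (‖D.target X 0 s‖ ^ 2 + ‖D.target X 1 s‖ ^ 2)
        - κ₁ pl ker ds * (y + ∑ j, inner ℝ (D.obs j s) (emb pl.ℓ (rowEnd pl.ℓ (X.MK 0 j)))) ^ 2
        - κ₂ pl ker ds * b ^ 2 := by
  have h1 := X.targetNormSq_eq fun i => D.obs i s
  have h2 := X.αhEnd_eq (fun i => D.obs i s) y
  have h3 := D.control_eq (X := X) hker s
  rw [Loop.control] at h3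
  rw [mRate, h1, h2, h3]
  rfl

end Target

/-! ### Estimates along the target system -/

section Primitive

variable {f f' g' : ℝ → ℝ} {a b c d : ℝ}

lemma IsPrimitive.mono (hf : IsPrimitive f f' a b) (hac : a ≤ c) (hcd : c ≤ d) (hdb : d ≤ b) :
    IsPrimitive f f' c d := by
  refine ⟨hf.integrable.mono_set ?_, fun x hx => ?_⟩
  · rw [uIcc_of_le hcd, uIcc_of_le (hac.trans (hcd.trans hdb))]
    exact Icc_subset_Icc hac hdb
  · rw [← hf.sub_eq ⟨hac, hcd.trans hdb⟩ ⟨hac.trans hx.1, hx.2.trans hdb⟩]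
    ring

lemma IsPrimitive.sub_le (hf : IsPrimitive f f' a b) {h : ℝ → ℝ} (hh : IntervalIntegrable h volume a b)
    (hle : ∀ᵐ r ∂volume.restrict (Ioc a b), f' r ≤ h r) {s t : ℝ} (hs : a ≤ s) (hst : s ≤ t)
    (ht : t ≤ b) : f t - f s ≤ ∫ r in s..t, h r := by
  have hab := hs.trans (hst.trans ht)
  have hsub : uIcc s t ⊆ uIcc a b := by
    rw [uIcc_of_le hst, uIcc_of_le hab]
    exact Icc_subset_Icc hs ht
  rw [hf.sub_eq ⟨hs, hst.trans ht⟩ ⟨hs.trans hst, ht⟩]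
  exact intervalIntegral.integral_mono_ae_restrict hst (hf.integrable.mono_set hsub)
    (hh.mono_set hsub) (by
      rw [← Measure.restrict_congr_set Ioc_ae_eq_Icc]
      exact ae_restrict_of_ae_restrict_of_subset (Ioc_subset_Ioc hs ht) hle)

end Primitive

lemma sq_add_five_le (a b c d e : ℝ) :
    (a + b + c + d + e) ^ 2 ≤ 5 * (a ^ 2 + b ^ 2 + c ^ 2 + d ^ 2 + e ^ 2) := by
  linarith [sq_nonneg (a - b), sq_nonneg (a - c), sq_nonneg (a - d), sq_nonneg (a - e),
    sq_nonneg (b - c), sq_nonneg (b - d), sq_nonneg (b - e), sq_nonneg (c - d),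
    sq_nonneg (c - e), sq_nonneg (d - e)]

section Estimates

variable {pl : Plant} {ker : Kernels} {ds : Design} {X : Extension pl ker}

lemma Plant.weight_nonneg {A : ℝ} (hA : 0 ≤ A) (μ : ℝ) (i : Fin 2) (x : ℝ) :
    0 ≤ pl.weight A μ i x := by
  have := pl.lam₁_pos
  have := pl.lam₂_pos
  fin_cases i
  · show 0 ≤ A / pl.lam₁ * Real.exp (-(μ * x / pl.lam₁))
    positivity
  · show 0 ≤ 2 * A * pl.q ^ 2 / pl.lam₂ * Real.exp (μ * x / pl.lam₂)
    positivity

lemma inner_mulH_nonneg {ℓ : ℝ} (hℓ : 0 ≤ ℓ) {φ : C(ℝ, ℝ)} (h : ∀ x, 0 ≤ φ x) (w : L2 ℓ) :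
    0 ≤ inner ℝ (mulH ℓ φ w) w := by
  have := le_inner_mulH hℓ (c := 0) (fun x _ => h x) w
  rwa [zero_mul] at this

lemma two_mul_inner_mulH_le {ℓ : ℝ} (hℓ : 0 ≤ ℓ) {φ : C(ℝ, ℝ)} (h : ∀ x, 0 ≤ φ x) (z p : L2 ℓ)
    {δ : ℝ} (hδ : 0 < δ) (b : ℝ) : 2 * inner ℝ (mulH ℓ φ z) (b • p)
      ≤ δ * inner ℝ (mulH ℓ φ z) z + 1 / δ * inner ℝ (mulH ℓ φ p) p * b ^ 2 := by
  have h1 := inner_mulH_nonneg hℓ h (δ • z - b • p)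
  have h2 : inner ℝ (mulH ℓ φ p) z = inner ℝ (mulH ℓ φ z) p := by
    rw [inner_mulH_comm hℓ, real_inner_comm]
  simp only [map_sub, map_smul, inner_sub_left, inner_sub_right, inner_smul_left, inner_smul_right,
    RCLike.conj_to_real, h2] at h1 ⊢
  rw [← mul_le_mul_iff_right₀ hδ]
  have e : δ * (δ * inner ℝ (mulH ℓ φ z) z + 1 / δ * inner ℝ (mulH ℓ φ p) p * b ^ 2)
      = δ ^ 2 * inner ℝ (mulH ℓ φ z) z + inner ℝ (mulH ℓ φ p) p * b ^ 2 := by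
    field_simp
  rw [e]
  linarith

lemma energyRate_weight_le {A μ δ b d : ℝ} (hA : 0 ≤ A) (hδ : 0 < δ) (p z : Fin 2 → L2 pl.ℓ)
    {z0 zL : Fin 2 → ℝ} (h0 : z0 0 = pl.q * (z0 1 + b)) (hL : zL 1 = pl.ρ * zL 0 + d) :
    energyRate pl.ℓ pl.speed 0 p (pl.weight A μ) (pl.weightDeriv A μ) b z z0 zL
      ≤ (δ - μ) * energy pl.ℓ (pl.weight A μ) z
        - A * (Real.exp (-(μ * pl.ℓ / pl.lam₁))
          - 4 * pl.ρ ^ 2 * pl.q ^ 2 * Real.exp (μ * pl.ℓ / pl.lam₂)) * zL 0 ^ 2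
        + 2 * (2 * A * pl.q ^ 2) * Real.exp (μ * pl.ℓ / pl.lam₂) * d ^ 2
        + (2 * A * pl.q ^ 2 + 1 / δ * energy pl.ℓ (pl.weight A μ) p) * b ^ 2 := by
  have hℓ := pl.ℓ_pos.le
  have e1 : ∀ i, pl.speed i * inner ℝ (mulH pl.ℓ (pl.weightDeriv A μ i) (z i)) (z i)
      = -μ * inner ℝ (mulH pl.ℓ (pl.weight A μ i) (z i)) (z i) := fun i => by
    rw [Plant.weightDeriv, mulH_smul, real_inner_smul_left, ← mul_assoc, mul_div_cancel₀]
    exact Extension.speed_ne_zero i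
  have e2 : ∀ i, (∑ j, mulH pl.ℓ ((0 : Fin 2 → Fin 2 → C(ℝ, ℝ)) i j) (z j) + b • p i : L2 pl.ℓ)
      = b • p i := fun i => by simp [mulH_zero]
  have h3 := fun i => two_mul_inner_mulH_le hℓ (Plant.weight_nonneg (pl := pl) hA μ i) (z i) (p i)
    hδ b
  have f0 := h3 0
  have f1 := h3 1
  have l1 := pl.lam₁_pos.ne'
  have l2 := pl.lam₂_pos.ne'
  have w00 : pl.lam₁ * pl.weight A μ 0 0 = A := by
    rw [Plant.weight_zero]; simp; field_simp
  have w0L : pl.lam₁ * pl.weight A μ 0 pl.ℓ = A * Real.exp (-(μ * pl.ℓ / pl.lam₁)) := by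
    rw [Plant.weight_zero]; field_simp
  have w10 : pl.lam₂ * pl.weight A μ 1 0 = 2 * A * pl.q ^ 2 := by
    rw [Plant.weight_one]; simp; field_simp
  have w1L : pl.lam₂ * pl.weight A μ 1 pl.ℓ
      = 2 * A * pl.q ^ 2 * Real.exp (μ * pl.ℓ / pl.lam₂) := by
    rw [Plant.weight_one]; field_simp
  have g0 : A * z0 0 ^ 2 ≤ 2 * A * pl.q ^ 2 * z0 1 ^ 2 + 2 * A * pl.q ^ 2 * b ^ 2 := by
    rw [h0]
    have : 0 ≤ A * pl.q ^ 2 * (z0 1 - b) ^ 2 := by positivity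
    linarith
  have g1 : 2 * A * pl.q ^ 2 * Real.exp (μ * pl.ℓ / pl.lam₂) * zL 1 ^ 2
      ≤ 2 * A * pl.q ^ 2 * Real.exp (μ * pl.ℓ / pl.lam₂) * (2 * pl.ρ ^ 2 * zL 0 ^ 2 + 2 * d ^ 2) := by
    refine mul_le_mul_of_nonneg_left ?_ (by positivity)
    rw [hL]
    nlinarith [sq_nonneg (pl.ρ * zL 0 - d)]
  simp only [energyRate, energyRateTerm, Fin.sum_univ_two, e1, energy]
  have e20 := e2 0
  have e21 := e2 1
  simp only [Fin.sum_univ_two] at e20 e21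
  rw [e20, e21, Plant.speed_zero, Plant.speed_one]
  linear_combination f0 + f1 + g0 + g1 + z0 0 ^ 2 * w00 - zL 0 ^ 2 * w0L - z0 1 ^ 2 * w10
    + zL 1 ^ 2 * w1L

namespace IsTargetOn

variable {U t₀ t₁ : ℝ} {b : ℝ → ℝ} {z : Fin 2 → ℝ → L2 pl.ℓ} {z0 zL : Fin 2 → ℝ → ℝ}

lemma isPrimitive_inner (h : IsTargetOn X U t₀ t₁ b z z0 zL) (j : Fin 2) :
    IsPrimitive (fun r => inner ℝ (z j r) (emb pl.ℓ (X.ctrlTarget j)))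
      (fun r => pl.speed j * inner ℝ (z j r) (emb pl.ℓ (X.ctrlDeriv j))
        + pl.speed j * (z0 j r * X.ctrlTarget j 0 - zL j r * X.ctrlTarget j pl.ℓ)
        + b r * inner ℝ (X.pbar j) (emb pl.ℓ (X.ctrlTarget j))) t₀ t₁ := by
  have hℓ := pl.ℓ_pos.le
  have h1 := h.nonneg.trans h.le
  have e1 : emb pl.ℓ (X.ctrlExt j) = emb pl.ℓ (X.ctrlTarget j) :=
    emb_congr fun ξ hξ => X.ctrlExt_eq j hξ
  have hi := WeakTransport.intervalIntegrable (a := pl.speed j) (h.sol.cont j) (h.sol.trace0 j)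
    (h.sol.traceL j) (h.sol.weakIntegrable j) (X.ctrlExt j) (X.ctrlDeriv j) h1
  have he := h.sol.eq j (X.ctrlExt j) (X.ctrlDeriv j) (X.hasDerivAt_ctrlExt j)
  simp only [X.ctrlExt_eq j (left_mem_Icc.2 hℓ), X.ctrlExt_eq j (right_mem_Icc.2 hℓ), e1,
    Pi.zero_apply, mulH_zero, Finset.sum_const_zero, zero_add, inner_smul_left,
    RCLike.conj_to_real] at hi he
  exact IsPrimitive.mono ⟨hi, fun x hx => he x hx.1⟩ h.nonneg h.le le_rfl

/-- The held-input deviation is absolutely continuous, with the stated bound of its derivative. -/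
lemma exists_isPrimitive_deviation (hker : ker.Solve pl) (h : IsTargetOn X U t₀ t₁ b z z0 zL) :
    ∃ d', IsPrimitive (fun r => U - X.ctl fun i => z i r) d' t₀ t₁ ∧
      ∀ᵐ r ∂volume.restrict (Ioc t₀ t₁), d' r ^ 2 ≤ ε₀ pl ker * (‖z 0 r‖ ^ 2 + ‖z 1 r‖ ^ 2)
        + ε₁ pl ker * zL 0 r ^ 2 + ε₂ pl ker * b r ^ 2
        + ε₃ pl ker * (U - X.ctl fun i => z i r) ^ 2 := by
  have hℓ := pl.ℓ_pos.le
  have hs := (h.isPrimitive_inner 0).add h.le (h.isPrimitive_inner 1)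
  have hc : ∀ r, X.ctl (fun i => z i r) = inner ℝ (z 0 r) (emb pl.ℓ (X.ctrlTarget 0))
      + inner ℝ (z 1 r) (emb pl.ℓ (X.ctrlTarget 1)) := fun r => Fin.sum_univ_two _
  refine ⟨_, ⟨hs.integrable.neg, fun x hx => ?_⟩, ?_⟩
  · have := hs.eq x hx
    simp only [Pi.neg_apply, intervalIntegral.integral_neg]
    rw [hc, hc]
    linarith
  filter_upwards [h.bc0, h.bcL] with r h0 hL
  have hcol : pl.lam₂ * X.ctrlTarget 1 0 = pl.q * pl.lam₁ * X.ctrlTarget 0 0 := by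
    have c0 := X.L_col hker 0 (right_mem_Icc.2 hℓ)
    have c1 := X.L_col hker 1 (right_mem_Icc.2 hℓ)
    show pl.lam₂ * (X.ML 1 1 (pl.ℓ, 0) - pl.ρ * X.ML 0 1 (pl.ℓ, 0))
      = pl.q * pl.lam₁ * (X.ML 1 0 (pl.ℓ, 0) - pl.ρ * X.ML 0 0 (pl.ℓ, 0))
    have := pl.lam₂_pos.ne'
    rw [c0, c1]
    field_simp
  have cs : ∀ j, inner ℝ (z j r) (emb pl.ℓ (X.ctrlDeriv j)) ^ 2
      ≤ ‖emb pl.ℓ (X.ctrlDeriv j)‖ ^ 2 * ‖z j r‖ ^ 2 := fun j => by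
    have := pow_le_pow_left₀ (abs_nonneg _)
      (abs_real_inner_le_norm (z j r) (emb pl.ℓ (X.ctrlDeriv j))) 2
    rw [sq_abs, mul_pow] at this
    linarith
  have m0 := mul_le_mul_of_nonneg_right (le_max_left (pl.lam₁ ^ 2 * ‖emb pl.ℓ (X.ctrlDeriv 0)‖ ^ 2)
    (pl.lam₂ ^ 2 * ‖emb pl.ℓ (X.ctrlDeriv 1)‖ ^ 2)) (sq_nonneg ‖z 0 r‖)
  have m1 := mul_le_mul_of_nonneg_right (le_max_right (pl.lam₁ ^ 2 * ‖emb pl.ℓ (X.ctrlDeriv 0)‖ ^ 2)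
    (pl.lam₂ ^ 2 * ‖emb pl.ℓ (X.ctrlDeriv 1)‖ ^ 2)) (sq_nonneg ‖z 1 r‖)
  have n0 := mul_le_mul_of_nonneg_left (cs 0) (sq_nonneg pl.lam₁)
  have n1 := mul_le_mul_of_nonneg_left (cs 1) (sq_nonneg pl.lam₂)
  rw [ε₀_eq X, ε₂_eq X, ε₁, ε₃, Nα_eq X (right_mem_Icc.2 hℓ), Nβ_eq X (right_mem_Icc.2 hℓ),
    Fin.sum_univ_two]
  set d := U - X.ctl fun i => z i r
  set x1 := pl.lam₁ * inner ℝ (z 0 r) (emb pl.ℓ (X.ctrlDeriv 0))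
  set x2 := pl.lam₂ * inner ℝ (z 1 r) (emb pl.ℓ (X.ctrlDeriv 1))
  set x3 := (pl.lam₁ * X.ctrlTarget 0 pl.ℓ - pl.ρ * pl.lam₂ * X.ctrlTarget 1 pl.ℓ) * zL 0 r
  set x4 := (inner ℝ (X.pbar 0) (emb pl.ℓ (X.ctrlTarget 0))
    + inner ℝ (X.pbar 1) (emb pl.ℓ (X.ctrlTarget 1)) + pl.q * pl.lam₁ * X.ctrlTarget 0 0) * b r
  set x5 := pl.lam₂ * X.ctrlTarget 1 pl.ℓ * d
  simp only [Pi.neg_apply, Plant.speed_zero, Plant.speed_one]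
  have e : -(pl.lam₁ * inner ℝ (z 0 r) (emb pl.ℓ (X.ctrlDeriv 0))
      + pl.lam₁ * (z0 0 r * X.ctrlTarget 0 0 - zL 0 r * X.ctrlTarget 0 pl.ℓ)
      + b r * inner ℝ (X.pbar 0) (emb pl.ℓ (X.ctrlTarget 0))
      + (-pl.lam₂ * inner ℝ (z 1 r) (emb pl.ℓ (X.ctrlDeriv 1))
      + -pl.lam₂ * (z0 1 r * X.ctrlTarget 1 0 - zL 1 r * X.ctrlTarget 1 pl.ℓ)
      + b r * inner ℝ (X.pbar 1) (emb pl.ℓ (X.ctrlTarget 1)))) = -x1 + x2 + x3 - x4 - x5 := by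
    rw [h0, hL]
    simp only [x1, x2, x3, x4, x5]
    linear_combination z0 1 r * hcol
  rw [e]
  have hsq : (-x1 + x2 + x3 - x4 - x5) ^ 2
      ≤ 5 * (x1 ^ 2 + x2 ^ 2 + x3 ^ 2 + x4 ^ 2 + x5 ^ 2) := by
    have := sq_add_five_le (-x1) x2 x3 (-x4) (-x5)
    rwa [neg_sq, neg_sq, neg_sq, ← sub_eq_add_neg, ← sub_eq_add_neg] at this
  refine hsq.trans ?_
  have q1 : x1 ^ 2 = pl.lam₁ ^ 2 * inner ℝ (z 0 r) (emb pl.ℓ (X.ctrlDeriv 0)) ^ 2 := mul_pow _ _ _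
  have q2 : x2 ^ 2 = pl.lam₂ ^ 2 * inner ℝ (z 1 r) (emb pl.ℓ (X.ctrlDeriv 1)) ^ 2 := mul_pow _ _ _
  have q3 := mul_pow (pl.lam₁ * X.ctrlTarget 0 pl.ℓ - pl.ρ * pl.lam₂ * X.ctrlTarget 1 pl.ℓ)
    (zL 0 r) 2
  have q4 := mul_pow (inner ℝ (X.pbar 0) (emb pl.ℓ (X.ctrlTarget 0))
    + inner ℝ (X.pbar 1) (emb pl.ℓ (X.ctrlTarget 1)) + pl.q * pl.lam₁ * X.ctrlTarget 0 0) (b r) 2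
  have q5 := mul_pow (pl.lam₂ * X.ctrlTarget 1 pl.ℓ) d 2
  rw [show x3 ^ 2 = _ from q3, show x4 ^ 2 = _ from q4, show x5 ^ 2 = _ from q5, q1, q2]
  linarith

end IsTargetOn

end Estimates

/-! ### The dynamic variable stays negative -/

section Negative

variable {pl : Plant} {ker : Kernels} {ds : Design}

/-- During the minimum dwell-time the dynamic variable decays. -/
lemma dwell_time_bound (hds : ds.Admissible pl ker) {m d d' n y b : ℝ → ℝ} {t₀ : ℝ}
    (hm : IsPrimitive m (fun r => -ds.η * m r + (θm pl ds * d r ^ 2 - κ₀ pl ker ds * n r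
      - κ₁ pl ker ds * y r ^ 2 - κ₂ pl ker ds * b r ^ 2)) t₀ (t₀ + τ pl ker ds))
    (hd : IsPrimitive d d' t₀ (t₀ + τ pl ker ds)) (hd0 : d t₀ = 0) (hn : ∀ r, 0 ≤ n r)
    (hle : ∀ᵐ r ∂volume.restrict (Ioc t₀ (t₀ + τ pl ker ds)), d' r ^ 2 ≤ ε₀ pl ker * n r
      + ε₁ pl ker * y r ^ 2 + ε₂ pl ker * b r ^ 2 + ε₃ pl ker * d r ^ 2) {s : ℝ}
    (hs : s ∈ Icc t₀ (t₀ + τ pl ker ds)) : m s ≤ m t₀ * Real.exp (-ds.η * (s - t₀)) := by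
  have hτ := τ_pos hds
  have hab : t₀ ≤ t₀ + τ pl ker ds := by linarith
  have ha := aConst_pos hds
  have hθm := θm_pos hds
  have hθ := hds.θ_pos
  have hσ := hds.σ_pos
  have hσ1 := sub_pos.2 hds.σ_lt
  set a := aConst pl ker ds with ha_def
  set w0 := ds.θ / (1 - ds.σ) with hw0
  have hw0pos : 0 < w0 := div_pos hθ hσ1
  set w : ℝ → ℝ := fun s => Real.exp (-a * (s - t₀)) * (w0 + θm pl ds / a) - θm pl ds / a with hw
  have hwd : ∀ x, HasDerivAt w (-a * w x - θm pl ds) x := fun x => by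
    refine ((((((hasDerivAt_id' x).sub_const t₀).const_mul (-a)).exp).mul_const
      (w0 + θm pl ds / a)).sub_const (θm pl ds / a)).congr_deriv ?_
    simp only [hw]
    field_simp
    ring
  have hwp : IsPrimitive w (fun x => -a * w x - θm pl ds) t₀ (t₀ + τ pl ker ds) :=
    .of_hasDerivAt' hwd (by simp only [hw]; fun_prop)
  have hwle : ∀ r ∈ Icc t₀ (t₀ + τ pl ker ds), w r ≤ w0 := fun r hr => by
    have h1 : Real.exp (-a * (r - t₀)) ≤ 1 := Real.exp_le_one_iff.2 (by nlinarith [hr.1])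
    have h2 : 0 < w0 + θm pl ds / a := by positivity
    simp only [hw]
    nlinarith
  have hwnn : ∀ r ∈ Icc t₀ (t₀ + τ pl ker ds), 0 ≤ w r := fun r hr => by
    have h1 : Real.exp (a * τ pl ker ds)
        = 1 + a * ds.θ * ds.σ / ((a * ds.θ + θm pl ds) * (1 - ds.σ)) := by
      have : a * τ pl ker ds = Real.log (1 + a * ds.θ * ds.σ /
          ((a * ds.θ + θm pl ds) * (1 - ds.σ))) := by
        rw [τ, ← mul_assoc, mul_one_div_cancel ha.ne', one_mul]
      rw [this, Real.exp_log (by positivity)]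
    have h2 : Real.exp (a * τ pl ker ds) * θm pl ds ≤ a * w0 + θm pl ds := by
      have h3 : a * ds.θ * ds.σ / ((a * ds.θ + θm pl ds) * (1 - ds.σ)) * θm pl ds ≤ a * w0 := by
        rw [hw0, div_mul_eq_mul_div, mul_div_assoc', div_le_div_iff₀ (by positivity) hσ1]
        have h4 : ds.σ * θm pl ds ≤ a * ds.θ + θm pl ds := by
          have h5 : 0 ≤ (1 - ds.σ) * θm pl ds := by positivity
          have h6 : 0 ≤ a * ds.θ := by positivity
          linarith
        have h7 : 0 ≤ a * ds.θ * (1 - ds.σ) := by positivity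
        have := mul_le_mul_of_nonneg_left h4 h7
        linarith
      rw [h1]
      linarith
    have h3 : Real.exp (a * (r - t₀)) ≤ Real.exp (a * τ pl ker ds) :=
      Real.exp_le_exp.2 (mul_le_mul_of_nonneg_left (by linarith [hr.2]) ha.le)
    have h4 : Real.exp (-a * (r - t₀)) * Real.exp (a * (r - t₀)) = 1 := by
      rw [← Real.exp_add]
      simp
    have h5 : Real.exp (a * (r - t₀)) * (θm pl ds / a) ≤ w0 + θm pl ds / a := by
      rw [mul_div_assoc', div_le_iff₀ ha, add_mul, div_mul_cancel₀ _ ha.ne']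
      have := mul_le_mul_of_nonneg_right h3 hθm.le
      linarith
    have h6 := mul_le_mul_of_nonneg_left h5 (Real.exp_pos (-a * (r - t₀))).le
    rw [← mul_assoc, h4, one_mul] at h6
    simp only [hw]
    linarith
  have hdd := hd.mul hab hd
  have hP := hm.add hab (hwp.mul hab hdd)
  have hQ : ContinuousOn (fun r => m r + w r * (d r * d r)) (Icc t₀ (t₀ + τ pl ker ds)) :=
    hP.continuousOn hab
  have hQi : IntervalIntegrable (fun r => -ds.η * (m r + w r * (d r * d r))) volume t₀
      (t₀ + τ pl ker ds) := by
    rw [← uIcc_of_le hab] at hQ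
    exact hQ.intervalIntegrable.const_mul _
  have hfin := le_exp_of_sub_le_integral (c := -ds.η) hQ (fun x₁ x₂ hx hxy hy =>
    hP.sub_le hQi (by
      filter_upwards [hle, ae_restrict_mem measurableSet_Ioc] with r h1 h2
      have hr := Ioc_subset_Icc_self h2
      have k1 := hwnn r hr
      have k2 := hwle r hr
      have e0 := ε₀_nonneg (pl := pl) (ker := ker)
      have e1 := ε₁_nonneg (pl := pl) (ker := ker)
      have e2 := ε₂_nonneg (pl := pl) (ker := ker)
      have g0 : κ₀ pl ker ds = w0 * ε₀ pl ker := by rw [κ₀, hw0]; ring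
      have g1 : κ₁ pl ker ds = w0 * ε₁ pl ker := by rw [κ₁, hw0]; ring
      have g2 : κ₂ pl ker ds = w0 * ε₂ pl ker := by rw [κ₂, hw0]; ring
      have f0 := mul_le_mul_of_nonneg_right k2 (mul_nonneg e0 (hn r))
      have f1 := mul_le_mul_of_nonneg_right k2 (mul_nonneg e1 (sq_nonneg (y r)))
      have f2 := mul_le_mul_of_nonneg_right k2 (mul_nonneg e2 (sq_nonneg (b r)))
      have f3 := mul_le_mul_of_nonneg_left h1 k1
      have f4 := mul_nonneg k1 (sq_nonneg (d r - d' r))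
      have g3 : a = 1 + ε₃ pl ker + ds.η := rfl
      rw [g0, g1, g2, g3]
      linarith) hx hxy hy) hs
  have h0 : m t₀ + w t₀ * (d t₀ * d t₀) = m t₀ := by rw [hd0]; ring
  beta_reduce at hfin
  rw [h0] at hfin
  have := mul_nonneg (hwnn s hs) (mul_self_nonneg (d s))
  linarith

/-- Until the predicted time `Ḡ` the dynamic variable stays negative. -/
lemma predicted_bound (hds : ds.Admissible pl ker) {m d R : ℝ → ℝ} {t₀ F : ℝ} (hF : 0 < F)
    (hm0 : m t₀ < 0) (hG : 0 ≤ Gbar pl ker ds F (m t₀))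
    (hm : IsPrimitive m (fun r => -ds.η * m r + R r) t₀ (t₀ + Gbar pl ker ds F (m t₀)))
    (hR : ∀ᵐ r ∂volume.restrict (Ioc t₀ (t₀ + Gbar pl ker ds F (m t₀))),
      R r ≤ θm pl ds * d r ^ 2)
    (hd : ∀ r ∈ Icc t₀ (t₀ + Gbar pl ker ds F (m t₀)),
      d r ^ 2 ≤ F * Real.exp (growth pl ker ds * (r - t₀))) {s : ℝ}
    (hs : s ∈ Icc t₀ (t₀ + Gbar pl ker ds F (m t₀))) : m s < 0 := by
  have hϱ := hds.growth_pos
  have hη := hds.η_pos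
  have hθ := hds.θ_pos
  have hθm := θm_pos hds
  set ϱ := growth pl ker ds with hϱ_def
  set T := Gbar pl ker ds F (m t₀) with hT
  have hab : t₀ ≤ t₀ + T := by linarith
  have hsum : 0 < ϱ + ds.η := by positivity
  set w : ℝ → ℝ := fun r => -(θm pl ds * F / (ϱ + ds.η)) * Real.exp (ϱ * (r - t₀)) with hw
  have hwp : IsPrimitive w (fun r => ϱ * w r) t₀ (t₀ + T) :=
    .of_hasDerivAt' (fun x => by
      refine ((((hasDerivAt_id' x).sub_const t₀).const_mul ϱ).exp.const_mul
        (-(θm pl ds * F / (ϱ + ds.η)))).congr_deriv ?_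
      simp only [hw]
      ring) (by simp only [hw]; fun_prop)
  have hP := hm.add hab hwp
  have hQ := hP.continuousOn hab
  have hQi : IntervalIntegrable (fun r => -ds.η * (m r + w r)) volume t₀ (t₀ + T) := by
    rw [← uIcc_of_le hab] at hQ
    exact hQ.intervalIntegrable.const_mul _
  have hfin := le_exp_of_sub_le_integral (c := -ds.η) hQ (fun x y hx hxy hy =>
    hP.sub_le hQi (by
      filter_upwards [hR, ae_restrict_mem measurableSet_Ioc] with r h1 h2
      have h3 := mul_le_mul_of_nonneg_left (hd r (Ioc_subset_Icc_self h2)) hθm.le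
      have h4 : (ϱ + ds.η) * w r = -(θm pl ds * (F * Real.exp (ϱ * (r - t₀)))) := by
        simp only [hw]
        field_simp
      linarith) hx hxy hy) hs
  beta_reduce at hfin
  set E := Real.exp (-ds.η * (s - t₀)) with hE
  have hEpos : 0 < E := Real.exp_pos _
  have e1 : Real.exp (ϱ * (s - t₀)) = Real.exp ((ϱ + ds.η) * (s - t₀)) * E := by
    rw [hE, ← Real.exp_add]
    congr 1
    ring
  have e2 : Real.exp ((ϱ + ds.η) * (s - t₀)) ≤ Real.exp ((ϱ + ds.η) * T) :=
    Real.exp_le_exp.2 (mul_le_mul_of_nonneg_left (by linarith [hs.2]) hsum.le)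
  have hnum : 0 < θm pl ds * F - m t₀ * (ϱ + ds.η) := by nlinarith
  have e3 : Real.exp ((ϱ + ds.η) * T)
      = (θm pl ds * F - m t₀ * (ϱ + ds.η)) / (F * (ds.θ * (ϱ + ds.η) + θm pl ds)) := by
    have : (ϱ + ds.η) * T = Real.log ((θm pl ds * F - m t₀ * (ϱ + ds.η)) /
        (F * (ds.θ * (ϱ + ds.η) + θm pl ds))) := by
      rw [hT, Gbar, ← mul_assoc, mul_one_div_cancel hsum.ne', one_mul]
    rw [this, Real.exp_log (by positivity)]
  have e4 : Real.exp ((ϱ + ds.η) * (s - t₀)) * (θm pl ds * F)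
      < θm pl ds * F - m t₀ * (ϱ + ds.η) := by
    have h1 := mul_le_mul_of_nonneg_right e2 (by positivity : 0 ≤ θm pl ds * F)
    refine h1.trans_lt ?_
    rw [e3, div_mul_eq_mul_div, div_lt_iff₀ (by positivity)]
    refine mul_lt_mul_of_pos_left ?_ hnum
    have : 0 < F * (ds.θ * (ϱ + ds.η)) := by positivity
    linarith
  have h0 : w t₀ = -(θm pl ds * F / (ϱ + ds.η)) := by simp [hw]
  have hs' : w s = -(θm pl ds * F / (ϱ + ds.η)) * (Real.exp ((ϱ + ds.η) * (s - t₀)) * E) := by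
    simp only [hw, e1]
  rw [h0, hs'] at hfin
  have h5 : (ϱ + ds.η) * m s ≤ E * ((ϱ + ds.η) * m t₀ - θm pl ds * F
      + Real.exp ((ϱ + ds.η) * (s - t₀)) * (θm pl ds * F)) := by
    have := mul_le_mul_of_nonneg_left hfin hsum.le
    have c : (ϱ + ds.η) * (θm pl ds * F / (ϱ + ds.η)) = θm pl ds * F :=
      mul_div_cancel₀ _ hsum.ne'
    linear_combination this + (E - Real.exp ((ϱ + ds.η) * (s - t₀)) * E) * -c
  have h6 : (ϱ + ds.η) * m s < 0 :=
    h5.trans_lt (mul_neg_of_pos_of_neg hEpos (by linarith))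
  exact neg_of_mul_neg_right h6 hsum.le

end Negative

/-! ### Lyapunov analysis of the closed loop -/

section Lyapunov

variable {pl : Plant} {ker : Kernels} {ds : Design} {X : Extension pl ker}

lemma Design.Admissible.μbar_pos (hds : ds.Admissible pl ker) : 0 < μbar pl :=
  hds.μ_pos.trans hds.μ_lt

lemma exp_μbar (pl : Plant) : 4 * pl.ρ ^ 2 * pl.q ^ 2
    * Real.exp (μbar pl * (pl.ℓ / pl.lam₁ + pl.ℓ / pl.lam₂)) = 1 := by
  have h1 := pl.lam₁_pos
  have h2 := pl.lam₂_pos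
  have h3 := pl.ℓ_pos
  have h4 := pl.q_ne
  have h5 := pl.ρ_ne
  have hpos : 0 < 1 / (2 * |pl.q * pl.ρ|) := by positivity
  have e : μbar pl * (pl.ℓ / pl.lam₁ + pl.ℓ / pl.lam₂)
      = Real.log (1 / (2 * |pl.q * pl.ρ|)) + Real.log (1 / (2 * |pl.q * pl.ρ|)) := by
    have h6 : pl.lam₁ + pl.lam₂ ≠ 0 := by positivity
    rw [μbar]
    field_simp
    ring
  have e2 : (1 / (2 * |pl.q * pl.ρ|)) * (1 / (2 * |pl.q * pl.ρ|)) = 1 / (4 * (pl.q * pl.ρ) ^ 2) := by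
    rw [← sq_abs (pl.q * pl.ρ)]
    field_simp
    norm_num
  rw [e, Real.exp_add, Real.exp_log hpos, e2]
  field_simp

lemma exp_split (μ : ℝ) : Real.exp (-(μ * pl.ℓ / pl.lam₁))
    * Real.exp (μ * (pl.ℓ / pl.lam₁ + pl.ℓ / pl.lam₂)) = Real.exp (μ * pl.ℓ / pl.lam₂) := by
  rw [← Real.exp_add]
  congr 1
  ring

lemma exp_μbar_sub (pl : Plant) : Real.exp (-(μbar pl * pl.ℓ / pl.lam₁))
    - 4 * pl.ρ ^ 2 * pl.q ^ 2 * Real.exp (μbar pl * pl.ℓ / pl.lam₂) = 0 := by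
  rw [← exp_split]
  linear_combination -Real.exp (-(μbar pl * pl.ℓ / pl.lam₁)) * exp_μbar pl

lemma energy_weight_nonneg {A : ℝ} (hA : 0 ≤ A) (μ : ℝ) (z : Fin 2 → L2 pl.ℓ) :
    0 ≤ energy pl.ℓ (pl.weight A μ) z :=
  Finset.sum_nonneg fun i _ => inner_mulH_nonneg pl.ℓ_pos.le (Plant.weight_nonneg hA μ i) (z i)

lemma le_energy_weight {A μ c : ℝ} (hA : 0 ≤ A) (hμ : 0 ≤ μ)
    (h0 : c ≤ A / pl.lam₁ * Real.exp (-(μ * pl.ℓ / pl.lam₁))) (h1 : c ≤ 2 * A * pl.q ^ 2 / pl.lam₂)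
    (z : Fin 2 → L2 pl.ℓ) : c * (‖z 0‖ ^ 2 + ‖z 1‖ ^ 2) ≤ energy pl.ℓ (pl.weight A μ) z := by
  have l1 := pl.lam₁_pos
  have l2 := pl.lam₂_pos
  have g0 := le_inner_mulH pl.ℓ_pos.le (φ := pl.weight A μ 0) (c := c) (fun x hx => by
    rw [Plant.weight_zero]
    refine h0.trans (mul_le_mul_of_nonneg_left (Real.exp_le_exp.2 (neg_le_neg ?_)) (by positivity))
    have := mul_le_mul_of_nonneg_left hx.2 hμ
    gcongr) (z 0)
  have g1 := le_inner_mulH pl.ℓ_pos.le (φ := pl.weight A μ 1) (c := c) (fun x hx => by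
    rw [Plant.weight_one]
    refine h1.trans (le_mul_of_one_le_right (by positivity) (Real.one_le_exp ?_))
    have := hx.1
    positivity) (z 1)
  rw [energy, Fin.sum_univ_two]
  linarith

lemma energy_le {ℓ : ℝ} (g : Fin 2 → C(ℝ, ℝ)) (z : Fin 2 → L2 ℓ) :
    energy ℓ g z ≤ (‖mulH ℓ (g 0)‖ + ‖mulH ℓ (g 1)‖) * (‖z 0‖ ^ 2 + ‖z 1‖ ^ 2) := by
  have h : ∀ i, inner ℝ (mulH ℓ (g i) (z i)) (z i) ≤ ‖mulH ℓ (g i)‖ * ‖z i‖ ^ 2 := fun i => by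
    refine (real_inner_le_norm _ _).trans ?_
    have := mul_le_mul_of_nonneg_right ((mulH ℓ (g i)).le_opNorm (z i)) (norm_nonneg (z i))
    rwa [mul_assoc, ← sq] at this
  have h0 := h 0
  have h1 := h 1
  have n0 := mul_nonneg (norm_nonneg (mulH ℓ (g 0))) (sq_nonneg ‖z 1‖)
  have n1 := mul_nonneg (norm_nonneg (mulH ℓ (g 1))) (sq_nonneg ‖z 0‖)
  rw [energy, Fin.sum_univ_two]
  linarith

lemma rd_nonneg : 0 ≤ rd pl ker := by
  have h1 := pl.lam₁_pos
  have h2 := pl.lam₂_pos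
  refine div_nonneg (mul_nonneg (by norm_num) (le_max_of_le_left ?_)) (le_min (by positivity) ?_)
  · exact intervalIntegral.integral_nonneg pl.ℓ_pos.le fun _ _ => sq_nonneg _
  · unfold Dbar
    positivity

lemma ctl_sq_le (hds : ds.Admissible pl ker) (X : Extension pl ker) (z : Fin 2 → L2 pl.ℓ) :
    X.ctl z ^ 2 ≤ rd pl ker / 2 * energy pl.ℓ (pl.weight 1 (μbar pl)) z := by
  have l1 := pl.lam₁_pos
  have l2 := pl.lam₂_pos
  have hq := pl.q_ne
  have cs : ∀ j, inner ℝ (z j) (emb pl.ℓ (X.ctrlTarget j)) ^ 2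
      ≤ ‖emb pl.ℓ (X.ctrlTarget j)‖ ^ 2 * ‖z j‖ ^ 2 := fun j => by
    have := pow_le_pow_left₀ (abs_nonneg _)
      (abs_real_inner_le_norm (z j) (emb pl.ℓ (X.ctrlTarget j))) 2
    rw [sq_abs, mul_pow] at this
    linarith
  set c := min (Real.exp (-(μbar pl * pl.ℓ / pl.lam₁)) / pl.lam₁) (Dbar pl / pl.lam₂) with hc
  have hcpos : 0 < c := lt_min (by positivity) (by unfold Dbar; positivity)
  set N := max (‖emb pl.ℓ (X.ctrlTarget 0)‖ ^ 2) (‖emb pl.ℓ (X.ctrlTarget 1)‖ ^ 2) with hN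
  have hrd : rd pl ker = 4 * N / c := by
    rw [rd, integral_sq_eq (N := Nα pl ker) (φ := X.ctrlTarget 0) fun ξ hξ => Nα_eq X hξ,
      integral_sq_eq (N := Nβ pl ker) (φ := X.ctrlTarget 1) fun ξ hξ => Nβ_eq X hξ]
  have hV := le_energy_weight (c := c) zero_le_one hds.μbar_pos.le
    ((min_le_left _ _).trans_eq (by ring)) ((min_le_right _ _).trans_eq (by rw [Dbar]; ring)) z
  have h1 : X.ctl z ^ 2 ≤ 2 * N * (‖z 0‖ ^ 2 + ‖z 1‖ ^ 2) := by
    have m0 := mul_le_mul_of_nonneg_right (le_max_left (‖emb pl.ℓ (X.ctrlTarget 0)‖ ^ 2)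
      (‖emb pl.ℓ (X.ctrlTarget 1)‖ ^ 2)) (sq_nonneg ‖z 0‖)
    have m1 := mul_le_mul_of_nonneg_right (le_max_right (‖emb pl.ℓ (X.ctrlTarget 0)‖ ^ 2)
      (‖emb pl.ℓ (X.ctrlTarget 1)‖ ^ 2)) (sq_nonneg ‖z 1‖)
    have c0 := cs 0
    have c1 := cs 1
    rw [Extension.ctl, Fin.sum_univ_two]
    have := sq_nonneg (inner ℝ (z 0) (emb pl.ℓ (X.ctrlTarget 0))
      - inner ℝ (z 1) (emb pl.ℓ (X.ctrlTarget 1)))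
    linarith
  have h2 : 0 ≤ rd pl ker / 2 := div_nonneg rd_nonneg (by norm_num)
  have h3 := mul_le_mul_of_nonneg_left hV h2
  have h4 : rd pl ker / 2 * (c * (‖z 0‖ ^ 2 + ‖z 1‖ ^ 2)) = 2 * N * (‖z 0‖ ^ 2 + ‖z 1‖ ^ 2) := by
    rw [hrd]
    field_simp
    ring
  linarith

namespace IsTargetOn

variable {U t₀ t₁ : ℝ} {b : ℝ → ℝ} {z : Fin 2 → ℝ → L2 pl.ℓ} {z0 zL : Fin 2 → ℝ → ℝ}

lemma isPrimitive_energy (h : IsTargetOn X U t₀ t₁ b z z0 zL) (A μ : ℝ) :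
    IsPrimitive (fun r => energy pl.ℓ (pl.weight A μ) fun i => z i r)
      (fun r => energyRate pl.ℓ pl.speed 0 X.pbar (pl.weight A μ) (pl.weightDeriv A μ) (b r)
        (fun i => z i r) (fun i => z0 i r) fun i => zL i r) t₀ t₁ :=
  ⟨h.sol.intervalIntegrable_energyRate _ _ h.nonneg (h.nonneg.trans h.le), fun x hx => by
    have := h.sol.energy_sub pl.ℓ_pos (fun i => Extension.speed_ne_zero i)
      (pl.hasDerivAt_weight A μ) h.nonneg (h.nonneg.trans hx.1)
    linarith⟩

/-- The predicted growth of the held-input deviation. -/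
lemma deviation_sq_le (hds : ds.Admissible pl ker) (h : IsTargetOn X U t₀ t₁ b z z0 zL)
    (hU : U = X.ctl fun i => z i t₀) {φ : ℝ} (hφ : 0 ≤ φ)
    (hb : ∀ᵐ r ∂volume.restrict (Ioc t₀ t₁), b r ^ 2 ≤ φ) {V : ℝ}
    (hV : V = energy pl.ℓ (pl.weight 1 (μbar pl)) fun i => z i t₀) {r : ℝ} (hr : r ∈ Icc t₀ t₁) :
    (U - X.ctl fun i => z i r) ^ 2 ≤ rd pl ker * (2 * V
      + (2 * rd pl ker * Dbar pl * Real.exp (μbar pl * pl.ℓ / pl.lam₂) * V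
        + (2 * pl.q ^ 2 + PV₂ pl ker ds) * φ) / growth pl ker ds)
      * Real.exp (growth pl ker ds * (r - t₀)) := by
  have hϱ := hds.growth_pos
  have hrd := rd_nonneg (pl := pl) (ker := ker)
  set W : ℝ → ℝ := fun r => energy pl.ℓ (pl.weight 1 (μbar pl)) fun i => z i r with hW
  have hWnn : ∀ r, 0 ≤ W r := fun r => energy_weight_nonneg zero_le_one _ _
  set Q := 2 * rd pl ker * Dbar pl * Real.exp (μbar pl * pl.ℓ / pl.lam₂) * V
    + (2 * pl.q ^ 2 + PV₂ pl ker ds) * φ with hQ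
  have hd : ∀ r, (U - X.ctl fun i => z i r) ^ 2 ≤ rd pl ker * (V + W r) := fun r => by
    have h1 := ctl_sq_le hds X fun i => z i t₀
    have h2 := ctl_sq_le hds X fun i => z i r
    rw [← hU, ← hV] at h1
    have h3 := sq_nonneg (U + X.ctl fun i => z i r)
    simp only [hW]
    linarith
  have hP := h.isPrimitive_energy 1 (μbar pl)
  have hPV := PV₂_eq (ds := ds) X
  have hPnn : 0 ≤ 2 * pl.q ^ 2 + PV₂ pl ker ds := by
    have h1 := energy_weight_nonneg zero_le_one (μbar pl) X.pbar
    have := hds.δb_pos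
    rw [hPV]
    positivity
  have hD : 0 ≤ 2 * Dbar pl * Real.exp (μbar pl * pl.ℓ / pl.lam₂) := by
    unfold Dbar
    positivity
  have hWc := hP.continuousOn h.le
  have hi : IntervalIntegrable (fun r => growth pl ker ds * W r + Q) volume t₀ t₁ := by
    have : ContinuousOn W (uIcc t₀ t₁) := by rwa [uIcc_of_le h.le]
    exact (this.intervalIntegrable.const_mul _).add intervalIntegrable_const
  have hG := le_gronwallBound_of_sub_le_integral hWc (fun x y hx hxy hy => hP.sub_le hi (by
    filter_upwards [h.bc0, h.bcL, hb] with r h0 hL h3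
    have h4 := energyRate_weight_le (μ := μbar pl) (b := b r)
      (d := U - X.ctl fun i => z i r) zero_le_one hds.δb_pos X.pbar (fun i => z i r)
      (z0 := fun i => z0 i r) (zL := fun i => zL i r) h0 hL
    rw [exp_μbar_sub, ← hPV] at h4
    have h5 := mul_le_mul_of_nonneg_left (hd r) hD
    have h6 := mul_le_mul_of_nonneg_left h3 hPnn
    rw [growth, hQ]
    simp only [hW, Dbar] at h5 ⊢
    linarith) hx hxy hy) hr
  rw [gronwallBound_of_K_ne_0 hϱ.ne'] at hG
  simp only [← hV] at hG
  have hVnn : 0 ≤ V := hV ▸ hWnn t₀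
  have hQ0 : 0 ≤ Q := by
    have := mul_nonneg (mul_nonneg hrd hD) hVnn
    have := mul_nonneg hPnn hφ
    rw [hQ]
    linarith
  have hE : 1 ≤ Real.exp (growth pl ker ds * (r - t₀)) :=
    Real.one_le_exp (mul_nonneg hϱ.le (by linarith [hr.1]))
  have h7 := mul_le_mul_of_nonneg_left hE hVnn
  have h8 : 0 ≤ Q / growth pl ker ds := by positivity
  have h9 : V + W r ≤ (2 * V + Q / growth pl ker ds)
      * Real.exp (growth pl ker ds * (r - t₀)) := by
    simp only [hW]
    linarith
  calc _ ≤ rd pl ker * (V + W r) := hd r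
    _ ≤ rd pl ker * ((2 * V + Q / growth pl ker ds)
      * Real.exp (growth pl ker ds * (r - t₀))) := mul_le_mul_of_nonneg_left h9 hrd
    _ = _ := by ring

end IsTargetOn

end Lyapunov

/-! ### Exponential decay of the closed loop -/

section Decay

variable {pl : Plant} {ker : Kernels} {ds : Design} {X : Extension pl ker} {φu φv : ℝ}
  {ini : InitialData pl.ℓ} {D : Loop pl.ℓ}

lemma IsPrimitive.neg {f f' : ℝ → ℝ} {a b : ℝ} (hf : IsPrimitive f f' a b) :
    IsPrimitive (fun x => -f x) (fun x => -f' x) a b :=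
  ⟨hf.integrable.neg, fun x hx => by
    rw [intervalIntegral.integral_neg, hf.eq x hx]
    ring⟩

lemma IsErrorSol.sq_le_φ₀ {e : Fin 2 → L2 pl.ℓ} {w : Fin 2 → ℝ → L2 pl.ℓ} {w0 wL : Fin 2 → ℝ → ℝ}
    (h : IsErrorSol X e w w0 wL) (hu : 0 < φu) (hv : 0 < φv)
    (h0 : ∀ᵐ x ∂volume.restrict (Ioo 0 pl.ℓ), e 0 x ^ 2 ≤ φu)
    (h1 : ∀ᵐ x ∂volume.restrict (Ioo 0 pl.ℓ), e 1 x ^ 2 ≤ φv) (s : ℝ) :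
    ∀ᵐ r ∂volume.restrict (Ioi s), w0 1 r ^ 2 ≤ φ₀ pl ker φu φv s := by
  unfold φ₀
  split_ifs with hs
  · exact ae_restrict_of_ae (h.trace_bound φu φv hu hv h0 h1)
  · filter_upwards [ae_restrict_mem measurableSet_Ioi] with r hr
    rw [h.trace_eq_zero r ((not_le.1 hs).le.trans (le_of_lt hr)), zero_pow two_ne_zero]

lemma nonneg_of_ae_sq_le {b : ℝ → ℝ} {s c : ℝ} (h : ∀ᵐ r ∂volume.restrict (Ioi s), b r ^ 2 ≤ c) :
    0 ≤ c := by
  have hne : (ae (volume.restrict (Ioi s))).NeBot := by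
    rw [ae_neBot, Ne, Measure.restrict_eq_zero, Real.volume_Ioi]
    exact ENNReal.top_ne_zero
  obtain ⟨x, hx⟩ := h.exists
  exact (sq_nonneg _).trans hx

lemma IsLoop.isPrimitive_m (hker : ker.Solve pl) (hds : ds.Admissible pl ker)
    (h : IsLoop X ds φu φv ini D) (k : ℕ) :
    IsPrimitive D.m (fun r => -ds.η * D.m r
      + (θm pl ds * (D.control pl ker (D.t k) - X.ctl fun i => D.target X i r) ^ 2
        - κ₀ pl ker ds * (‖D.target X 0 r‖ ^ 2 + ‖D.target X 1 r‖ ^ 2)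
        - κ₁ pl ker ds * D.targetL X 0 r ^ 2 - κ₂ pl ker ds * D.e0 1 r ^ 2))
      (D.t k) (D.t (k + 1)) := by
  have h0 := times_nonneg (τ_pos hds) h.τ_le h.t_zero
  have e : ∀ r, mRate pl ker ds (D.control pl ker (D.t k)) (fun i => D.obs i r)
      (D.wL 0 r - D.eL 0 r) (D.e0 1 r) = _ := fun r => IsLoop.mRate_eq (X := X) hker _ _ _ r
  have hi := (ContinuousOn.intervalIntegrable_Ici h.m_cont (h0 k) (h0 (k + 1))).const_mul (-ds.η)
    |>.add (X.intervalIntegrable_mRate ds h.observer.cont (isTrace_const (D.control pl ker (D.t k)))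
      (y := fun r => D.wL 0 r - D.eL 0 r) (b := D.e0 1)
      ((h.plant.sol.traceL 0).sub (h.err.traceL 0)) (h.err.trace0 1) (h0 k) (h0 (k + 1)))
  have hP : IsPrimitive D.m _ (D.t k) (D.t (k + 1)) := ⟨hi, h.m_eq k⟩
  simp only [e] at hP
  exact hP

lemma IsLoop.m_neg_step (hker : ker.Solve pl) (hds : ds.Admissible pl ker)
    (h : IsLoop X ds φu φv ini D)
    (hb : ∀ s, 0 ≤ s → ∀ᵐ r ∂volume.restrict (Ioi s), D.e0 1 r ^ 2 ≤ φ₀ pl ker φu φv s) (k : ℕ)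
    (hk : D.m (D.t k) < 0) {s : ℝ} (hs : s ∈ Icc (D.t k) (D.t (k + 1))) : D.m s < 0 := by
  have hτ := τ_pos hds
  have hT := h.isTargetOn hker hds k
  have hP := h.isPrimitive_m hker hds k
  have hU := D.control_eq (X := X) hker (D.t k)
  have hϱ := hds.growth_pos
  have hφ := nonneg_of_ae_sq_le (hb _ hT.nonneg)
  rcases le_or_gt s (D.t k + τ pl ker ds) with h1 | h1
  · obtain ⟨d', hd, hle⟩ := hT.exists_isPrimitive_deviation hker
    have hle' := h.τ_le k
    have hab : D.t k ≤ D.t k + τ pl ker ds := by linarith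
    refine (dwell_time_bound hds (hP.mono le_rfl hab hle') (hd.mono le_rfl hab hle')
      (by rw [hU, sub_self]) (n := fun r => ‖D.target X 0 r‖ ^ 2 + ‖D.target X 1 r‖ ^ 2)
      (fun r => by positivity)
      (ae_restrict_of_ae_restrict_of_subset (Ioc_subset_Ioc_right hle') hle) ⟨hs.1, h1⟩).trans_lt ?_
    exact mul_neg_of_neg_of_pos hk (Real.exp_pos _)
  · set F := Fpred pl ker ds φu φv (D.t k) (D.obs 0 (D.t k)) (D.obs 1 (D.t k)) with hF
    have hsucc := h.t_succ k
    have hlt := h1.trans_le hs.2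
    rw [hsucc, add_lt_add_iff_left, waiting, ← hF] at hlt
    rw [waiting, ← hF] at hsucc
    have hF0 : F ≠ 0 := fun h0 => by
      rw [if_pos h0] at hlt
      exact lt_irrefl _ hlt
    rw [if_neg hF0] at hlt hsucc
    have hG : τ pl ker ds < Gbar pl ker ds F (D.m (D.t k)) := by
      rcases lt_max_iff.1 hlt with h2 | h2
      · exact absurd h2 (lt_irrefl _)
      · exact h2
    rw [max_eq_right hG.le] at hsucc
    have hdev : ∀ r ∈ Icc (D.t k) (D.t (k + 1)),
        (D.control pl ker (D.t k) - X.ctl fun i => D.target X i r) ^ 2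
          ≤ F * Real.exp (growth pl ker ds * (r - D.t k)) := fun r hr =>
      hT.deviation_sq_le hds hU hφ (ae_restrict_of_ae_restrict_of_subset Ioc_subset_Ioi_self
        (hb _ hT.nonneg)) (V₂_eq X fun i => D.obs i (D.t k)) hr
    have hFpos : 0 < F := by
      have := hdev (D.t k) (left_mem_Icc.2 hT.le)
      rw [sub_self, mul_zero, Real.exp_zero, mul_one] at this
      exact lt_of_le_of_ne ((sq_nonneg _).trans this) hF0.symm
    rw [hsucc] at hP hdev hs
    refine predicted_bound hds hFpos hk (hτ.trans hG).le hP (.of_forall fun r => ?_) hdev hs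
    have k0 := mul_nonneg (κ₀_nonneg (pl := pl) (ker := ker) hds)
      (add_nonneg (sq_nonneg ‖D.target X 0 r‖) (sq_nonneg ‖D.target X 1 r‖))
    have k1 := mul_nonneg (κ₁_nonneg (pl := pl) (ker := ker) hds) (sq_nonneg (D.targetL X 0 r))
    have k2 := mul_nonneg (κ₂_nonneg (pl := pl) (ker := ker) hds) (sq_nonneg (D.e0 1 r))
    linarith

lemma IsLoop.m_neg (hker : ker.Solve pl) (hds : ds.Admissible pl ker)
    (h : IsLoop X ds φu φv ini D) (hm : ini.m < 0)
    (hb : ∀ s, 0 ≤ s → ∀ᵐ r ∂volume.restrict (Ioi s), D.e0 1 r ^ 2 ≤ φ₀ pl ker φu φv s) {s : ℝ}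
    (hs : 0 ≤ s) : D.m s < 0 := by
  have ht : ∀ k, D.m (D.t k) < 0 := fun k => by
    induction k with
    | zero => rwa [h.t_zero, h.m_init]
    | succ k ih =>
      exact h.m_neg_step hker hds hb k ih (right_mem_Icc.2 (h.isTargetOn hker hds k).le)
  obtain ⟨k, hk⟩ := exists_mem_Ico_times (τ_pos hds) h.τ_le h.t_zero hs
  exact h.m_neg_step hker hds hb k (ht k) (Ico_subset_Icc_self hk)

/-- The decay rate of the Lyapunov functional. -/
def decayRate (pl : Plant) (ker : Kernels) (ds : Design) : ℝ :=
  min (ds.μ - ds.δ - κ₀ pl ker ds / (ds.C * rConst pl ds)) ds.η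

lemma decayRate_pos (hds : ds.Admissible pl ker) : 0 < decayRate pl ker ds := by
  have hC := hds.C_pos
  have hr := rConst_pos (pl := pl) (ds := ds)
  have hδ := sub_pos.2 hds.δ_lt
  refine lt_min (sub_pos.2 ?_) hds.η_pos
  have := hds.C_gt₀
  rw [div_lt_iff₀ (by positivity)] at this ⊢
  linarith

/-- The gain of the Lyapunov functional with respect to the observer error. -/
def errorGain (X : Extension pl ker) (ds : Design) : ℝ :=
  2 * ds.C * pl.q ^ 2 + 1 / ds.δ * energy pl.ℓ (pl.weight ds.C ds.μ) X.pbar + κ₂ pl ker ds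

lemma errorGain_nonneg (hds : ds.Admissible pl ker) : 0 ≤ errorGain X ds := by
  have hC := hds.C_pos.le
  have hδ := hds.δ_pos
  have h1 := energy_weight_nonneg hC ds.μ X.pbar
  have h2 := κ₂_nonneg (pl := pl) (ker := ker) hds
  unfold errorGain
  positivity

/-- The Lyapunov functional along the closed loop. -/
def Loop.lyapunov (X : Extension pl ker) (ds : Design) (D : Loop pl.ℓ) (s : ℝ) : ℝ :=
  energy pl.ℓ (pl.weight ds.C ds.μ) (fun i => D.target X i s) - D.m s

lemma mul_normSq_le_energy (hds : ds.Admissible pl ker) (z : Fin 2 → L2 pl.ℓ) :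
    ds.C * rConst pl ds * (‖z 0‖ ^ 2 + ‖z 1‖ ^ 2) ≤ energy pl.ℓ (pl.weight ds.C ds.μ) z := by
  have hC := hds.C_pos.le
  refine le_energy_weight hC hds.μ_pos.le ?_ ?_ z
  · refine (mul_le_mul_of_nonneg_left (min_le_left _ _) hC).trans_eq ?_
    ring
  · refine (mul_le_mul_of_nonneg_left (min_le_right _ _) hC).trans_eq ?_
    ring

lemma κ₁_le (hds : ds.Admissible pl ker) : κ₁ pl ker ds ≤ ds.C *
    (Real.exp (-(ds.μ * pl.ℓ / pl.lam₁))
      - 4 * pl.ρ ^ 2 * pl.q ^ 2 * Real.exp (ds.μ * pl.ℓ / pl.lam₂)) := by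
  have l1 := pl.lam₁_pos
  have l2 := pl.lam₂_pos
  have l3 := pl.ℓ_pos
  have hpos : 0 < pl.ℓ / pl.lam₁ + pl.ℓ / pl.lam₂ := by positivity
  have hρq : 0 < 4 * pl.ρ ^ 2 * pl.q ^ 2 := by
    have := pl.ρ_ne
    have := pl.q_ne
    positivity
  have h1 : 0 < 1 - 4 * pl.ρ ^ 2 * pl.q ^ 2
      * Real.exp (ds.μ * (pl.ℓ / pl.lam₁ + pl.ℓ / pl.lam₂)) := by
    rw [← exp_μbar pl, sub_pos]
    exact mul_lt_mul_of_pos_left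
      (Real.exp_lt_exp.2 (mul_lt_mul_of_pos_right hds.μ_lt hpos)) hρq
  have h2 := hds.C_gt₁
  rw [div_lt_iff₀ h1] at h2
  have h3 : Real.exp (ds.μ * pl.ℓ / pl.lam₁) * Real.exp (-(ds.μ * pl.ℓ / pl.lam₁)) = 1 := by
    rw [← Real.exp_add, add_neg_cancel, Real.exp_zero]
  have h4 := mul_le_mul_of_nonneg_right h2.le (Real.exp_pos (-(ds.μ * pl.ℓ / pl.lam₁))).le
  rw [mul_assoc, h3, mul_one] at h4
  rw [← exp_split ds.μ]
  linarith

lemma IsLoop.lyapunov_sub_le (hker : ker.Solve pl) (hds : ds.Admissible pl ker)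
    (h : IsLoop X ds φu φv ini D) (hm : ∀ s, 0 ≤ s → D.m s < 0) (k : ℕ) {s t : ℝ}
    (hs : D.t k ≤ s) (hst : s ≤ t) (ht : t ≤ D.t (k + 1))
    (hi : IntervalIntegrable (fun r => -decayRate pl ker ds * D.lyapunov X ds r
      + errorGain X ds * D.e0 1 r ^ 2) volume (D.t k) (D.t (k + 1))) :
    D.lyapunov X ds t - D.lyapunov X ds s ≤ ∫ r in s..t, (-decayRate pl ker ds * D.lyapunov X ds r
      + errorGain X ds * D.e0 1 r ^ 2) := by
  have hT := h.isTargetOn hker hds k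
  have hC := hds.C_pos
  have hr := rConst_pos (pl := pl) (ds := ds)
  have hP := (hT.isPrimitive_energy ds.C ds.μ).add hT.le (h.isPrimitive_m hker hds k).neg
  have e : D.lyapunov X ds = fun x => energy pl.ℓ (pl.weight ds.C ds.μ)
      (fun i => D.target X i x) + -D.m x := funext fun x => sub_eq_add_neg _ _
  rw [← e] at hP
  refine hP.sub_le hi ?_ hs hst ht
  filter_upwards [hT.bc0, hT.bcL, ae_restrict_mem measurableSet_Ioc] with r h0 hL hr0
  have h4 := energyRate_weight_le (μ := ds.μ) (b := D.e0 1 r)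
    (d := D.control pl ker (D.t k) - X.ctl fun i => D.target X i r) hC.le hds.δ_pos X.pbar
    (fun i => D.target X i r) (z0 := fun i => D.w0 i r - D.e0 i r)
    (zL := fun i => D.targetL X i r) h0 hL
  have h5 := mul_le_mul_of_nonneg_right (κ₁_le hds) (sq_nonneg (D.targetL X 0 r))
  have h6 := mul_normSq_le_energy hds fun i => D.target X i r
  have hV := energy_weight_nonneg hC.le ds.μ fun i => D.target X i r
  have hmr := hm r (hT.nonneg.trans hr0.1.le)
  have h7 : κ₀ pl ker ds * (‖D.target X 0 r‖ ^ 2 + ‖D.target X 1 r‖ ^ 2)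
      ≤ κ₀ pl ker ds / (ds.C * rConst pl ds)
        * energy pl.ℓ (pl.weight ds.C ds.μ) fun i => D.target X i r := by
    refine le_trans (le_of_eq ?_) (mul_le_mul_of_nonneg_left h6
      (div_nonneg (κ₀_nonneg hds) (mul_pos hC hr).le))
    field_simp
  have h8 := mul_le_mul_of_nonneg_right (min_le_left (ds.μ - ds.δ
    - κ₀ pl ker ds / (ds.C * rConst pl ds)) ds.η) hV
  have h9 := mul_le_mul_of_nonneg_right (min_le_right (ds.μ - ds.δ
    - κ₀ pl ker ds / (ds.C * rConst pl ds)) ds.η) (neg_pos.2 hmr).le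
  rw [← decayRate] at h8 h9
  simp only [Loop.lyapunov, errorGain, θm]
  linarith

lemma sub_le_integral_of_times {f h : ℝ → ℝ} {t : ℕ → ℝ} {c : ℝ} (hc : 0 < c)
    (htc : ∀ k, t k + c ≤ t (k + 1)) (h0 : t 0 = 0)
    (hh : ∀ a b, 0 ≤ a → 0 ≤ b → IntervalIntegrable h volume a b)
    (hk : ∀ k x y, t k ≤ x → x ≤ y → y ≤ t (k + 1) → f y - f x ≤ ∫ r in x..y, h r) {x y : ℝ}
    (hx : 0 ≤ x) (hxy : x ≤ y) : f y - f x ≤ ∫ r in x..y, h r := by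
  have hnn := times_nonneg hc htc h0
  have hmono := times_mono hc htc
  have hsub : ∀ a b, 0 ≤ a → 0 ≤ b →
      ∫ r in a..b, h r = (∫ r in (0 : ℝ)..b, h r) - ∫ r in (0 : ℝ)..a, h r := fun a b ha hb =>
    (intervalIntegral.integral_interval_sub_left (hh 0 b le_rfl hb) (hh 0 a le_rfl ha)).symm
  have hanti : ∀ n, AntitoneOn (fun x => f x - ∫ r in (0 : ℝ)..x, h r) (Icc 0 (t n)) := fun n => by
    induction n with
    | zero =>
      rw [h0, Icc_self]
      exact antitoneOn_singleton _
    | succ n ih =>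
      have hn := (hmono n.lt_succ_self).le
      rw [← Icc_union_Icc_eq_Icc (hnn n) hn]
      refine ih.union_right (fun a ha b hb hab => ?_) (isGreatest_Icc (hnn n)) (isLeast_Icc hn)
      have h1 := hk n a b ha.1 hab hb.2
      rw [hsub a b ((hnn n).trans ha.1) ((hnn n).trans hb.1)] at h1
      beta_reduce
      linarith
  obtain ⟨n, hn⟩ := exists_lt_times hc htc h0 y
  have := hanti n ⟨hx, hxy.trans hn.le⟩ ⟨hx.trans hxy, hn.le⟩ hxy
  rw [hsub x y hx (hx.trans hxy)]
  beta_reduce at this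
  linarith

lemma IsLoop.continuousOn_lyapunov (hker : ker.Solve pl) (hds : ds.Admissible pl ker)
    (h : IsLoop X ds φu φv ini D) : ContinuousOn (D.lyapunov X ds) (Ici 0) :=
  (continuousOn_finsetSum _ fun i _ => ((mulH pl.ℓ (pl.weight ds.C ds.μ i)).continuous.comp_continuousOn
    ((h.isTargetOn hker hds 0).sol.cont i)).inner ((h.isTargetOn hker hds 0).sol.cont i)).sub h.m_cont

lemma IsLoop.lyapunov_le (hker : ker.Solve pl) (hds : ds.Admissible pl ker)
    (h : IsLoop X ds φu φv ini D) (hm : ∀ s, 0 ≤ s → D.m s < 0) {H c : ℝ} (hH : 0 ≤ H)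
    (h0 : ∀ r, H ≤ r → D.e0 1 r = 0) (hc : ∀ t, 0 ≤ t → ∫ r in (0 : ℝ)..t, D.e0 1 r ^ 2 ≤ c)
    {t : ℝ} (ht : 0 ≤ t) : D.lyapunov X ds t ≤ (D.lyapunov X ds 0 + errorGain X ds * c)
      * Real.exp (decayRate pl ker ds * H) * Real.exp (-decayRate pl ker ds * t) := by
  set ν := decayRate pl ker ds with hν
  have hνpos : 0 < ν := decayRate_pos hds
  have hcont := h.continuousOn_lyapunov hker hds
  have hg := errorGain_nonneg (X := X) hds
  have hnn : ∀ s, 0 ≤ s → 0 ≤ D.lyapunov X ds s := fun s hs => by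
    have := energy_weight_nonneg hds.C_pos.le ds.μ fun i => D.target X i s
    have := hm s hs
    rw [Loop.lyapunov]
    linarith
  have hb : ∀ a b, 0 ≤ a → 0 ≤ b →
      IntervalIntegrable (fun r => errorGain X ds * D.e0 1 r ^ 2) volume a b := fun a b ha hb =>
    ((h.err.trace0 1).sq_intervalIntegrable ha hb).const_mul _
  have hl : ∀ a b, 0 ≤ a → 0 ≤ b →
      IntervalIntegrable (fun r => -ν * D.lyapunov X ds r) volume a b := fun a b ha hb =>
    (ContinuousOn.intervalIntegrable_Ici hcont ha hb).const_mul _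
  have hi : ∀ a b, 0 ≤ a → 0 ≤ b → IntervalIntegrable (fun r => -ν * D.lyapunov X ds r
      + errorGain X ds * D.e0 1 r ^ 2) volume a b := fun a b ha hb' => (hl a b ha hb').add (hb a b ha hb')
  have htn := times_nonneg (τ_pos hds) h.τ_le h.t_zero
  have hsub : ∀ x y, 0 ≤ x → x ≤ y → D.lyapunov X ds y - D.lyapunov X ds x
      ≤ ∫ r in x..y, (-ν * D.lyapunov X ds r + errorGain X ds * D.e0 1 r ^ 2) := fun x y =>
    sub_le_integral_of_times (τ_pos hds) h.τ_le h.t_zero hi fun k a b ha hab hb =>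
      h.lyapunov_sub_le hker hds hm k ha hab hb (hi _ _ (htn k) (htn (k + 1)))
  have hshort : ∀ s, 0 ≤ s → D.lyapunov X ds s ≤ D.lyapunov X ds 0 + errorGain X ds * c :=
    fun s hs => by
      have h1 := hsub 0 s le_rfl hs
      rw [intervalIntegral.integral_add (hl 0 s le_rfl hs) (hb 0 s le_rfl hs),
        intervalIntegral.integral_const_mul, intervalIntegral.integral_const_mul] at h1
      have h2 := mul_le_mul_of_nonneg_left (hc s hs) hg
      have h3 := mul_nonneg hνpos.le (intervalIntegral.integral_nonneg (μ := volume) hs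
        fun r hr => hnn r hr.1)
      linarith
  have hexp : ∀ x : ℝ, Real.exp (ν * H) * Real.exp (-ν * x) = Real.exp (-ν * (x - H)) := fun x => by
    rw [← Real.exp_add]
    congr 1
    ring
  have hA : 0 ≤ D.lyapunov X ds 0 + errorGain X ds * c := (hnn 0 le_rfl).trans (hshort 0 le_rfl)
  rw [mul_assoc, hexp]
  rcases le_total t H with htH | htH
  · exact (hshort t ht).trans (le_mul_of_one_le_right hA (Real.one_le_exp (by nlinarith)))
  · refine (le_exp_of_sub_le_integral (c := -ν)
      (hcont.mono (Icc_subset_Ici_self.trans (Ici_subset_Ici.2 hH)))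
      (fun x y hx hxy hy => (hsub x y (hH.trans hx) hxy).trans_eq ?_) ⟨htH, le_rfl⟩).trans
      (mul_le_mul_of_nonneg_right (hshort H hH) (Real.exp_pos _).le)
    refine intervalIntegral.integral_congr fun r hr => ?_
    rw [uIcc_of_le hxy] at hr
    simp only [h0 r (hx.trans hr.1)]
    ring

lemma norm_add_sq_le_two {E : Type*} [SeminormedAddCommGroup E] (x y : E) :
    ‖x + y‖ ^ 2 ≤ 2 * ‖x‖ ^ 2 + 2 * ‖y‖ ^ 2 := by
  have h := pow_le_pow_left₀ (norm_nonneg _) (norm_add_le x y) 2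
  linarith [sq_nonneg (‖x‖ - ‖y‖)]

/-- Exponential decay, with constants that depend only on the plant, the kernels and the design. -/
lemma exists_decay (X : Extension pl ker) (hker : ker.Solve pl) (hds : ds.Admissible pl ker)
    {c : ℝ} (hc : 0 < c) : ∃ M, 0 < M ∧ ∀ (φu φv : ℝ) (ini : InitialData pl.ℓ) (D : Loop pl.ℓ),
      IsLoop X ds φu φv ini D → (∀ s, 0 ≤ s → D.m s < 0) →
      (∀ t, pl.ℓ / pl.lam₁ + pl.ℓ / pl.lam₂ ≤ t → (∀ i, D.e i t = 0) ∧ D.e0 1 t = 0) →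
      (∀ t i, ‖D.e i t‖ ^ 2 ≤ c * (‖ini.u - ini.uh‖ ^ 2 + ‖ini.v - ini.vh‖ ^ 2)) →
      (∀ t, 0 ≤ t → ∫ s in (0 : ℝ)..t, D.e0 1 s ^ 2
        ≤ c * (‖ini.u - ini.uh‖ ^ 2 + ‖ini.v - ini.vh‖ ^ 2)) →
      ∀ t, 0 ≤ t → ‖D.w 0 t‖ ^ 2 + ‖D.w 1 t‖ ^ 2 + ‖D.obs 0 t‖ ^ 2 + ‖D.obs 1 t‖ ^ 2
        ≤ M * (‖ini.u‖ ^ 2 + ‖ini.v‖ ^ 2 + ‖ini.uh‖ ^ 2 + ‖ini.vh‖ ^ 2 + |ini.m|)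
          * Real.exp (-decayRate pl ker ds * t) := by
  obtain ⟨cK, hcK, hK⟩ := exists_norm_transform_sq_le (ℓ := pl.ℓ) X.MK
  obtain ⟨cL, hcL, hL⟩ := exists_norm_transform_sq_le (ℓ := pl.ℓ) X.ML
  have hC := hds.C_pos
  have hr := rConst_pos (pl := pl) (ds := ds)
  have hν := decayRate_pos hds
  have hg := errorGain_nonneg (X := X) hds
  have l1 := pl.lam₁_pos
  have l2 := pl.lam₂_pos
  have l3 := pl.ℓ_pos
  set H := pl.ℓ / pl.lam₁ + pl.ℓ / pl.lam₂ with hH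
  have hHpos : 0 < H := by positivity
  set W := ‖mulH pl.ℓ (pl.weight ds.C ds.μ 0)‖ + ‖mulH pl.ℓ (pl.weight ds.C ds.μ 1)‖ with hW
  have hWnn : 0 ≤ W := by positivity
  set ν := decayRate pl ker ds
  set A := W * (2 * cK) + errorGain X ds * (2 * c) + 1 with hA
  have hApos : 0 < A := by positivity
  set B := 6 * cL / (ds.C * rConst pl ds) with hB
  have hBpos : 0 < B := by positivity
  refine ⟨(B * A + 8 * c) * Real.exp (ν * H), by positivity,
    fun φu φv ini D h hm hz hwc htc t ht => ?_⟩
  set S := ‖ini.u‖ ^ 2 + ‖ini.v‖ ^ 2 + ‖ini.uh‖ ^ 2 + ‖ini.vh‖ ^ 2 + |ini.m| with hS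
  have hE : ‖ini.u - ini.uh‖ ^ 2 + ‖ini.v - ini.vh‖ ^ 2 ≤ 2 * S := by
    have h1 := norm_add_sq_le_two ini.u (-ini.uh)
    have h2 := norm_add_sq_le_two ini.v (-ini.vh)
    rw [norm_neg, ← sub_eq_add_neg] at h1 h2
    have := abs_nonneg ini.m
    linarith
  have hSnn : 0 ≤ S := by positivity
  have ho : (fun i => D.obs i 0) = ![ini.uh, ini.vh] := by
    funext i
    rw [Loop.obs, h.plant.init, h.err_init]
    fin_cases i
    · exact sub_sub_cancel ini.u ini.uh
    · exact sub_sub_cancel ini.v ini.vh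
  have hX0 : D.lyapunov X ds 0 ≤ (W * (2 * cK) + 1) * S := by
    have h1 := energy_le (pl.weight ds.C ds.μ) fun i => D.target X i 0
    have h2 : ∀ i, ‖D.target X i 0‖ ^ 2 ≤ cK * (‖ini.uh‖ ^ 2 + ‖ini.vh‖ ^ 2) := fun i => by
      rw [Loop.target, ho]
      exact hK ![ini.uh, ini.vh] i
    have h3 := mul_le_mul_of_nonneg_left (add_le_add (h2 0) (h2 1)) hWnn
    have h4 : ‖ini.uh‖ ^ 2 + ‖ini.vh‖ ^ 2 ≤ S := by
      have := abs_nonneg ini.m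
      linarith [sq_nonneg ‖ini.u‖, sq_nonneg ‖ini.v‖]
    have h5 := mul_le_mul_of_nonneg_left h4 (by positivity : 0 ≤ W * (2 * cK))
    have h6 : -ini.m ≤ S := by
      have := neg_le_abs ini.m
      linarith [sq_nonneg ‖ini.u‖, sq_nonneg ‖ini.v‖, sq_nonneg ‖ini.uh‖, sq_nonneg ‖ini.vh‖]
    rw [Loop.lyapunov, h.m_init]
    linarith
  have hX := h.lyapunov_le hker hds hm hHpos.le (fun r hr => (hz r hr).2) htc ht
  have hXt : D.lyapunov X ds t ≤ A * S * (Real.exp (ν * H) * Real.exp (-ν * t)) := by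
    rw [mul_assoc] at hX
    refine hX.trans (mul_le_mul_of_nonneg_right ?_ (by positivity))
    have := mul_le_mul_of_nonneg_left (mul_le_mul_of_nonneg_left hE hc.le) hg
    rw [hA]
    linarith
  have hobs : ∀ i, ‖D.obs i t‖ ^ 2 ≤ cL / (ds.C * rConst pl ds) * D.lyapunov X ds t := fun i => by
    have h1 := hL (fun i => D.target X i t) i
    have h2 := transform_transform' pl.ℓ_pos (X.compKernel_K_L hker) fun j => D.obs j t
    have h3 : transform pl.ℓ X.ML (fun i => D.target X i t) i = D.obs i t := congrFun h2 i
    rw [h3] at h1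
    have h4 := mul_normSq_le_energy hds fun i => D.target X i t
    have h5 : ds.C * rConst pl ds * (‖D.target X 0 t‖ ^ 2 + ‖D.target X 1 t‖ ^ 2)
        ≤ D.lyapunov X ds t := by
      have := hm t ht
      rw [Loop.lyapunov]
      linarith
    have h6 := mul_le_mul_of_nonneg_left h5
      (by positivity : 0 ≤ cL / (ds.C * rConst pl ds))
    refine h1.trans (le_trans (le_of_eq ?_) h6)
    field_simp
  have herr : ∀ i, ‖D.e i t‖ ^ 2 ≤ 2 * c * S * (Real.exp (ν * H) * Real.exp (-ν * t)) := fun i => by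
    rcases le_total H t with h1 | h1
    · rw [(hz t h1).1 i, norm_zero, zero_pow two_ne_zero]
      positivity
    · refine (hwc t i).trans ((mul_le_mul_of_nonneg_left hE hc.le).trans ?_)
      have : 1 ≤ Real.exp (ν * H) * Real.exp (-ν * t) := by
        rw [← Real.exp_add]
        refine Real.one_le_exp ?_
        nlinarith
      have := le_mul_of_one_le_right (by positivity : 0 ≤ 2 * c * S) this
      linarith
  have hw : ∀ i, ‖D.w i t‖ ^ 2 ≤ 2 * ‖D.obs i t‖ ^ 2 + 2 * ‖D.e i t‖ ^ 2 := fun i => by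
    have := norm_add_sq_le_two (D.obs i t) (D.e i t)
    rwa [Loop.obs, sub_add_cancel] at this
  have hfin := mul_le_mul_of_nonneg_left hXt hBpos.le
  have hB' : B * D.lyapunov X ds t = 6 * (cL / (ds.C * rConst pl ds) * D.lyapunov X ds t) := by
    rw [hB]
    ring
  have := hobs 0
  have := hobs 1
  have := herr 0
  have := herr 1
  have := hw 0
  have := hw 1
  linarith

end Decay

end

end STC

theorem mainTheorem2 (pl : STC.Plant) (hρq : |pl.ρ * pl.q| ≤ 1 / 2)
    (ker : STC.Kernels) (hker : ker.Solve pl)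
    (ds : STC.Design) (hds : ds.Admissible pl ker) :
    ∃ ν : ℝ, 0 < ν ∧ ∃ M : ℝ, 0 < M ∧
      ∀ φu φv : ℝ, 0 < φu → 0 < φv →
      ∀ ini : STC.InitialData pl.ℓ, ini.m < 0 →
        (∀ᵐ x ∂volume.restrict (Ioo (0 : ℝ) pl.ℓ), (ini.u x - ini.uh x) ^ 2 ≤ φu) →
        (∀ᵐ x ∂volume.restrict (Ioo (0 : ℝ) pl.ℓ), (ini.v x - ini.vh x) ^ 2 ≤ φv) →
        ∃ S : STC.Signals pl.ℓ, STC.IsClosedLoop pl ker ds φu φv ini S ∧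
          (∀ S' : STC.Signals pl.ℓ, STC.IsClosedLoop pl ker ds φu φv ini S' →
            EqOn S'.u S.u (Ici 0) ∧ EqOn S'.v S.v (Ici 0) ∧
            EqOn S'.uh S.uh (Ici 0) ∧ EqOn S'.vh S.vh (Ici 0) ∧
            EqOn S'.m S.m (Ici 0) ∧ S'.t = S.t) ∧
          ∀ t : ℝ, 0 ≤ t →
            ‖S.u t‖ ^ 2 + ‖S.v t‖ ^ 2 + ‖S.uh t‖ ^ 2 + ‖S.vh t‖ ^ 2 ≤
              M * (‖ini.u‖ ^ 2 + ‖ini.v‖ ^ 2 + ‖ini.uh‖ ^ 2 + ‖ini.vh‖ ^ 2 + |ini.m|)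
                * Real.exp (-ν * t) := by
  obtain ⟨X⟩ := hker.exists_extension
  obtain ⟨c, hc, herr⟩ := STC.exists_isErrorSol X hker
  obtain ⟨M, hM, hdecay⟩ := STC.exists_decay X hker hds hc
  refine ⟨STC.decayRate pl ker ds, STC.decayRate_pos hds, M, hM,
    fun φu φv hφu hφv ini hm hu hv => ?_⟩
  obtain ⟨e, e0, eL, he, hce, hct⟩ := herr ![ini.u - ini.uh, ini.v - ini.vh]
  obtain ⟨D, hD, rfl, rfl⟩ := STC.exists_isLoop X hker hds φu φv he
  have hu' : ∀ᵐ x ∂volume.restrict (Ioo (0 : ℝ) pl.ℓ), (ini.u - ini.uh : STC.L2 pl.ℓ) x ^ 2 ≤ φu := by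
    filter_upwards [hu, Lp.coeFn_sub ini.u ini.uh] with x h1 h2
    rwa [h2]
  have hv' : ∀ᵐ x ∂volume.restrict (Ioo (0 : ℝ) pl.ℓ), (ini.v - ini.vh : STC.L2 pl.ℓ) x ^ 2 ≤ φv := by
    filter_upwards [hv, Lp.coeFn_sub ini.v ini.vh] with x h1 h2
    rwa [h2]
  have hneg : ∀ s, 0 ≤ s → D.m s < 0 := fun s hs =>
    hD.m_neg hker hds hm (fun r _ => he.sq_le_φ₀ hφu hφv hu' hv' r) hs
  refine ⟨D.signals, hD.isClosedLoop hds, fun S' hS' => ?_,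
    hdecay φu φv ini D hD hneg (fun t ht => ⟨he.eq_zero t ht, he.trace_eq_zero t ht⟩) hce hct⟩
  obtain ⟨D', hD', hw, ho, hm', ht⟩ := hS'.exists_isLoop X hds
  obtain ⟨h1, h2, h3, h4⟩ := hD'.unique hds hD
  rw [hw] at h1
  rw [ho] at h2
  rw [hm'] at h3
  rw [ht] at h4
  exact ⟨h1 0, h1 1, h2 0, h2 1, h3, h4⟩
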